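/- Let $d\ge 3$ and let $x\cdot y=x^0y^0-\mathbf x\cdot\mathbf y$, $x^2=x\cdot x$, on $\mathbb R^d$. Let $\mathcal S_n$ be the complex Schwartz functions on $\mathbb R^{dn}$ with $$\mathcal Ff(k_1,\dots,k_n)=(2\pi)^{-dn/2}\int e^{-i(x_1\cdot k_1+\cdots+x_n\cdot k_n)}f(x_1,\dots,x_n)\,dx ,$$ and put $(\bar{\mathcal F}T)(f)=T(\mathcal Ff)$ for $T\in\mathcal S_n'$. Let $\underline{\mathcal S}=\bigoplus_n\mathcal S_n$ and $\underline{\mathcal S}^{\rm ext}=\bigoplus_n\mathcal S(\mathbb R^{dn},(\mathbb C^3)^{\otimes n})$. An element $F$ of $\underline{\mathcal S}^{\rm ext\prime}$ is a family of components $F_n^{(a_1,\dots,a_n)}\in\mathcal S_n'$ with $a_l\in\{\mathrm{in},\mathrm{loc},\mathrm{out}\}$; maps are applied to it componentwise. *The functionals $\hat G$ and $\hat F^G$.* Let $m,m_0>0$ and let $\rho\ge 0$ be a locally integrable, polynomially bounded density on $(m_0,\infty)$. With $\omega_\mu=(|\mathbf k|^2+\mu^2)^{1/2}$ and $\omega=\omega_m$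 let $\int\delta^\pm_\mu(k)g(k)\,dk=\int g(\pm\omega_\mu,\mathbf k)\,\frac{d\mathbf k}{2\omega_\mu}$. Let $\hat\Delta_m(\mathrm{loc},k)=1/(k^2-m^2)$ (Cauchy principal value), $\hat\Delta_m(\mathrm{in},k)=-i\pi(\delta_m^+(k)-\delta_m^-(k))$ and $\hat\Delta_m(\mathrm{out},k)=i\pi(\delta_m^+(k)-\delta_m^-(k))$. Define $\hat F^G$ by $\hat F^G_0=0$, $\hat F^G_1=0$, $$\hat F_2^{G(\mathrm{loc},\mathrm{loc})}=\Big[\delta_m^-(k_1)+\int_{m_0}^\infty\delta_\mu^-(k_1)\rho(\mu)\,d\mu\Big]\delta(k_1+k_2),\qquad \hat F_2^{G(a_1,a_2)}=\delta_m^-(k_1)\delta(k_1+k_2)\ \text{ otherwise},$$ and for $n\ge3$ $$\hat F_n^{G(a_1,\dots,a_n)}=\Big\{\sum_{j=1}^n\prod_{l<j}\delta_m^-(k_l)\,\hat\Delta_m(a_j,k_j)\prod_{l>j}\delta_m^+(k_l)\Big\}\,\delta\Big(\sum_{l=1}^nk_l\Big).$$ Here the deltas at $k_l$, $l\ne j$,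 and $\delta(\sum_l k_l)$ are carried out, and then $\hat\Delta_m(a_j,k_j)$ is evaluated at $k_j=-\sum_{l\ne j}k_l$ as the limit $\varepsilon\downarrow 0$ of $1_{\{|k_j^2-m^2|>\varepsilon\}}/(k_j^2-m^2)$ for $a_j=\mathrm{loc}$, and of $\mp i\pi\,\mathrm{sign}(k_j^0)\,1_{\{|k_j^2-m^2|<\varepsilon\}}/(2\varepsilon)$ for $a_j=\mathrm{in}$ and $a_j=\mathrm{out}$ respectively. Let $\hat G_n=\hat F_n^{G(\mathrm{loc},\dots,\mathrm{loc})}$. *Transfer functions.* Let $M=(M_n)_{n\ge0}$ be a sequence of real polynomials $M_n$ on $\mathbb R^{dn}$, symmetric under permutations of the arguments $k_1,\dots,k_n$ and invariant under the full Lorentz group, with $M_2=1$, such that for some $L_{\max}$ the degree of every $M_n$ in each single argument $k_l$ is at most $L_{\max}$. Put $(M\cdot\hat G)_n=M_n\hat G_n$ and $(M\cdot\hat F^G)_n^{(a_1,\dots,a_n)}=M_n\hat F_n^{G(a_1,\dots,a_n)}$. *Form factor functional.* Let $\varphi\in C_0^\infty(\mathbb R,\mathbb R)$ have support in $(-\epsilon,\epsilon)$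 with $0<\epsilon<m^2$, and $\varphi=1$ on $(-\epsilon/2,\epsilon/2)$. Let $\chi^\pm(k)=\theta(\pm k^0)\varphi(k^2-m^2)$, $\chi_t(\mathrm{loc},k)=1$ and $$\chi_t(\mathrm{in},k)=\chi^+(k)e^{-i(k^0-\omega)t}+\chi^-(k)e^{-i(k^0+\omega)t},\qquad \chi_t(\mathrm{out},k)=\chi^+(k)e^{i(k^0-\omega)t}+\chi^-(k)e^{i(k^0+\omega)t}.$$ For $W\in\underline{\mathcal S}'$ let $W\circ\Omega_t\in\underline{\mathcal S}^{\rm ext\prime}$ have the components $f\mapsto W_n\big(\mathcal F^{-1}\big(\prod_l\chi_{t_n^l}(a_l,k_l)\,\mathcal Ff\big)\big)$. The form factor functional of $W$ is the limit of $W\circ\Omega_t$ in $\underline{\mathcal S}^{\rm ext\prime}$ as, for each $n$, the parameters $t_n^1,\dots,t_n^n$ tend to $+\infty$ one after the other, provided that this iterated limit exists in every order and does not depend on the order. *The topology $\gamma$.* On $\mathcal S_n$ (and, taking the maximum over components, on the $n$-th summand of $\underline{\mathcal S}^{\rm ext}$) let $$\|f\|_{K,L}=\sup_{x_1,\dots,x_n;\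 |\beta_1|,\dots,|\beta_n|\le K}\Big|\prod_{l=1}^n(1+|x_l|^2)^{L/2}D^{\beta_1\cdots\beta_n}f(x_1,\dots,x_n)\Big| .$$ Let $\gamma_{K,L}$ be the direct sum topology on $\underline{\mathcal S}^{\rm ext}$ of the summands normed by $\|\cdot\|_{K,L}$ (the strongest locally convex topology for which the inclusions of the summands are continuous), and let $\gamma$ be the weakest topology that is stronger than all $\gamma_{K,L}$, $K,L\in\mathbb N_0$. **Corollary.** The functionals $\hat G\in\underline{\mathcal S}'$ and $\hat F^G\in\underline{\mathcal S}^{\rm ext\prime}$ are well defined (the limits $\varepsilon\downarrow0$ exist for each $j$ and define tempered distributions). The truncated form factor functional $F^T$ of $W^T=\bar{\mathcal F}(M\cdot\hat G)$, that is, the form factor functional of $W^T$, exists for every such $\varphi$, and $F^T=\bar{\mathcal F}(M\cdot\hat F^G)$. It is invariant under the proper orthochronous Poincaré group and $\gamma$-continuous. -/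

import Mathlib

open MeasureTheory Filter Topology
open scoped SchwartzMap ContDiff DirectSum LineDeriv FourierTransform

noncomputable section

namespace FormFactor

/-! ### Minkowski space

Space-time has dimension `d = s + 1`; a point of it is a function on `Fin (s + 1)` whose
coordinate `0` is the time (energy) coordinate. -/

variable {s n : ℕ}

/-- The Minkowski product `x · y = x⁰ y⁰ - ∑ xⁱ yⁱ`. -/
def mink (x y : Fin (s + 1) → ℝ) : ℝ := x 0 * y 0 - ∑ i : Fin s, x i.succ * y i.succ

/-- The full Lorentz group: linear maps which preserve the Minkowski product. -/
def IsLorentz (Λ : (Fin (s + 1) → ℝ) ≃ₗ[ℝ] (Fin (s + 1) → ℝ)) : Prop :=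
  ∀ x y, mink (Λ x) (Λ y) = mink x y

/-- The proper orthochronous Lorentz group. -/
def IsProperOrthochronous (Λ : (Fin (s + 1) → ℝ) ≃ₗ[ℝ] (Fin (s + 1) → ℝ)) : Prop :=
  IsLorentz Λ ∧ LinearMap.det Λ.toLinearMap = 1 ∧ 0 < Λ (Pi.single 0 1) 0

/-- The space of `n`-tuples of space-time (or energy-momentum) vectors. -/
abbrev Cfg (s n : ℕ) := EuclideanSpace ℝ (Fin n × Fin (s + 1))

/-- The `l`-th vector of an `n`-tuple. -/
def slot (x : Cfg s n) (l : Fin n) : Fin (s + 1) → ℝ := fun μ => x (l, μ)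

/-- The `n`-tuple with given vectors. -/
def ofSlots (x : Fin n → Fin (s + 1) → ℝ) : Cfg s n := WithLp.toLp 2 fun q => x q.1 q.2

/-- A linear automorphism of space-time acting on all members of an `n`-tuple. -/
def diagEquiv (n : ℕ) (Λ : (Fin (s + 1) → ℝ) ≃ₗ[ℝ] (Fin (s + 1) → ℝ)) :
    Cfg s n ≃L[ℝ] Cfg s n :=
  LinearEquiv.toContinuousLinearEquiv
    { toFun := fun x => ofSlots fun l => Λ (slot x l)
      invFun := fun x => ofSlots fun l => Λ.symm (slot x l)
      map_add' := fun x y => by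
        ext q
        exact congrFun (map_add Λ (slot x q.1) (slot y q.1)) q.2
      map_smul' := fun c x => by
        ext q
        exact congrFun (map_smul Λ c (slot x q.1)) q.2
      left_inv := fun x => by
        ext q
        exact congrFun (Λ.symm_apply_apply (slot x q.1)) q.2
      right_inv := fun x => by
        ext q
        exact congrFun (Λ.apply_symm_apply (slot x q.1)) q.2 }

/-! ### Test functions, Poincaré group and Fourier transform -/

/-- The action `α f (x₁, …, xₙ) = f (Λ⁻¹ (x₁ - a), …, Λ⁻¹ (xₙ - a))` of a Poincaré
transformation. -/
def poincare (n : ℕ) (Λ : (Fin (s + 1) → ℝ) ≃ₗ[ℝ] (Fin (s + 1) → ℝ)) (a : Fin (s + 1) → ℝ) :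
    𝓢(Cfg s n, ℂ) →L[ℂ] 𝓢(Cfg s n, ℂ) :=
  SchwartzMap.compSubConstCLM ℂ (ofSlots fun _ => a) ∘L
    SchwartzMap.compCLMOfContinuousLinearEquiv ℂ (diagEquiv n Λ.symm)

theorem poincare_apply (Λ : (Fin (s + 1) → ℝ) ≃ₗ[ℝ] (Fin (s + 1) → ℝ)) (a : Fin (s + 1) → ℝ)
    (f : 𝓢(Cfg s n, ℂ)) (x : Cfg s n) :
    poincare n Λ a f x = f (ofSlots fun l => Λ.symm (slot x l - a)) := rfl

/-- The map `k ↦ (k⁰, -𝐤) / 2π` on a single vector. -/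
def dualScale : (Fin (s + 1) → ℝ) ≃ₗ[ℝ] (Fin (s + 1) → ℝ) where
  toFun k := fun μ => if μ = 0 then (2 * Real.pi)⁻¹ * k μ else -((2 * Real.pi)⁻¹ * k μ)
  invFun k := fun μ => if μ = 0 then 2 * Real.pi * k μ else -(2 * Real.pi * k μ)
  map_add' x y := by
    ext μ
    by_cases h : μ = 0 <;> simp [h] <;> ring
  map_smul' c x := by
    ext μ
    by_cases h : μ = 0 <;> simp [h] <;> ring
  left_inv x := by
    ext μ
    have hpi := Real.pi_ne_zero
    by_cases h : μ = 0 <;> simp [h] <;> field_simp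
  right_inv x := by
    ext μ
    have hpi := Real.pi_ne_zero
    by_cases h : μ = 0 <;> simp [h] <;> field_simp

/-- The Fourier transform
`(ℱ f)(k₁, …, kₙ) = (2π)^(-dn/2) ∫ exp (-i (x₁ · k₁ + ⋯ + xₙ · kₙ)) f (x₁, …, xₙ) dx`
with Minkowski products in the exponent; see `minkFourier_apply`. -/
def minkFourier (s n : ℕ) : 𝓢(Cfg s n, ℂ) →L[ℂ] 𝓢(Cfg s n, ℂ) :=
  (((2 * Real.pi) ^ (-(((s + 1) * n : ℕ) : ℝ) / 2) : ℝ) : ℂ) •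
    (SchwartzMap.compCLMOfContinuousLinearEquiv ℂ (diagEquiv n dualScale) ∘L
      FourierTransform.fourierCLM ℂ 𝓢(Cfg s n, ℂ))

/-- The inverse Fourier transform; see `minkFourierInv_minkFourier`. -/
def minkFourierInv (s n : ℕ) : 𝓢(Cfg s n, ℂ) →L[ℂ] 𝓢(Cfg s n, ℂ) :=
  (((2 * Real.pi) ^ ((((s + 1) * n : ℕ) : ℝ) / 2) : ℝ) : ℂ) •
    (FourierTransform.fourierInvCLM ℂ 𝓢(Cfg s n, ℂ) ∘L
      SchwartzMap.compCLMOfContinuousLinearEquiv ℂ (diagEquiv n dualScale).symm)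

theorem minkFourier_apply (f : 𝓢(Cfg s n, ℂ)) (k : Cfg s n) :
    minkFourier s n f k = (((2 * Real.pi) ^ (-(((s + 1) * n : ℕ) : ℝ) / 2) : ℝ) : ℂ) *
      ∫ x : Cfg s n,
        Complex.exp (-Complex.I * ((∑ l, mink (slot x l) (slot k l) : ℝ) : ℂ)) * f x := by
  have h1 : minkFourier s n f k = (((2 * Real.pi) ^ (-(((s + 1) * n : ℕ) : ℝ) / 2) : ℝ) : ℂ) *
      𝓕 (f : Cfg s n → ℂ) (diagEquiv n dualScale k) := rfl
  rw [h1, Real.fourier_eq']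
  congr 1
  refine integral_congr_ae (Eventually.of_forall fun x => ?_)
  simp only [smul_eq_mul]
  congr 2
  have h2 : -2 * Real.pi * inner ℝ x (diagEquiv n dualScale k) =
      -∑ l, mink (slot x l) (slot k l) := by
    have h3 : ∀ l μ, (diagEquiv n dualScale k) (l, μ) =
        if μ = 0 then (2 * Real.pi)⁻¹ * k (l, μ) else -((2 * Real.pi)⁻¹ * k (l, μ)) :=
      fun _ _ => rfl
    rw [PiLp.inner_apply, Fintype.sum_prod_type, Finset.mul_sum, ← Finset.sum_neg_distrib]
    refine Finset.sum_congr rfl fun l _ => ?_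
    rw [Fin.sum_univ_succ]
    simp only [h3, mink, slot, Fin.succ_ne_zero, if_true, if_false, RCLike.inner_apply,
      conj_trivial]
    rw [neg_sub, mul_add, Finset.mul_sum]
    have hpi := Real.pi_pos
    rw [sub_eq_add_neg, add_comm]
    congr 1
    · refine Finset.sum_congr rfl fun i _ => ?_
      field_simp
    · field_simp
  rw [h2]
  push_cast
  ring

theorem minkFourierInv_minkFourier (f : 𝓢(Cfg s n, ℂ)) :
    minkFourierInv s n (minkFourier s n f) = f := by
  have hc : (((2 * Real.pi) ^ ((((s + 1) * n : ℕ) : ℝ) / 2) : ℝ) : ℂ) *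
      (((2 * Real.pi) ^ (-(((s + 1) * n : ℕ) : ℝ) / 2) : ℝ) : ℂ) = 1 := by
    rw [← Complex.ofReal_mul, ← Real.rpow_add (by positivity)]
    simp [neg_div]
  have h : SchwartzMap.compCLMOfContinuousLinearEquiv ℂ (diagEquiv n dualScale).symm
      (SchwartzMap.compCLMOfContinuousLinearEquiv ℂ (diagEquiv n dualScale) (𝓕 f)) = 𝓕 f := by
    ext x
    simp
  simp only [minkFourierInv, minkFourier, smul_apply,
    ContinuousLinearMap.comp_apply, map_smul, FourierTransform.fourierCLM_apply]
  rw [h, smul_smul, mul_comm, hc, one_smul, FourierTransform.fourierInvCLM_apply,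
    FourierTransform.fourierInv_fourier_eq]

theorem minkFourier_minkFourierInv (f : 𝓢(Cfg s n, ℂ)) :
    minkFourier s n (minkFourierInv s n f) = f := by
  have hc : (((2 * Real.pi) ^ (-(((s + 1) * n : ℕ) : ℝ) / 2) : ℝ) : ℂ) *
      (((2 * Real.pi) ^ ((((s + 1) * n : ℕ) : ℝ) / 2) : ℝ) : ℂ) = 1 := by
    rw [← Complex.ofReal_mul, ← Real.rpow_add (by positivity)]
    simp [neg_div]
  simp only [minkFourierInv, minkFourier, smul_apply,
    ContinuousLinearMap.comp_apply, map_smul, FourierTransform.fourierCLM_apply,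
    FourierTransform.fourierInvCLM_apply, FourierTransform.fourier_fourierInv_eq]
  rw [smul_smul, mul_comm, hc, one_smul]
  ext x
  simp

/-! ### Functionals on the Borchers algebra and on its extension -/

/-- The three kinds of fields. -/
inductive Label
  | inn
  | loc
  | out
  deriving DecidableEq

instance : Fintype Label where
  elems := {.inn, .loc, .out}
  complete a := by cases a <;> simp

/-- An element of the dual of the Borchers algebra `⨁ₙ 𝒮ₙ`: an arbitrary sequence of tempered
distributions. -/
abbrev Functional (s : ℕ) := ∀ n : ℕ, 𝓢'(Cfg s n, ℂ)

/-- An element of the dual of the extended Borchers algebra, given by its components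
`Fₙ^(a₁, …, aₙ)`. -/
abbrev ExtFunctional (s : ℕ) := ∀ n : ℕ, (Fin n → Label) → 𝓢'(Cfg s n, ℂ)

/-- The extended Borchers algebra `⨁ₙ 𝒮ₙ(ℝ^d, ℂ³)`; a `ℂ³ ⊗ ⋯ ⊗ ℂ³`-valued Schwartz function
is given by its components. -/
abbrev ExtBorchers (s : ℕ) := ⨁ n : ℕ, ((Fin n → Label) → 𝓢(Cfg s n, ℂ))

/-- The linear functional `f ↦ ∑ₙ ∑ₐ Fₙ^a (fₙ^a)` on the extended Borchers algebra. -/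
def ExtFunctional.eval (F : ExtFunctional s) : ExtBorchers s →ₗ[ℂ] ℂ :=
  DirectSum.toModule ℂ ℕ ℂ fun n =>
    ∑ a : Fin n → Label, (F n a).toLinearMap ∘ₗ LinearMap.proj a

/-- The inverse Fourier transform of a tempered distribution, `(ℱ̄ T)(f) = T (ℱ f)`; this is the
action which is dual to the one on test functions, so that `T̂ (f̂) = T (f)`. -/
def invFourier (T : 𝓢'(Cfg s n, ℂ)) : 𝓢'(Cfg s n, ℂ) :=
  PointwiseConvergenceCLM.precomp ℂ (minkFourier s n) T

/-- Invariance under the proper orthochronous Poincaré group. -/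
def ExtFunctional.IsPoincareInvariant (F : ExtFunctional s) : Prop :=
  ∀ (Λ : (Fin (s + 1) → ℝ) ≃ₗ[ℝ] (Fin (s + 1) → ℝ)) (v : Fin (s + 1) → ℝ),
    IsProperOrthochronous Λ → ∀ (n : ℕ) (a : Fin n → Label) (f : 𝓢(Cfg s n, ℂ)),
      F n a (poincare n Λ v f) = F n a f

/-! ### The topology `γ` -/

/-- The weight `∏ₗ (1 + |xₗ|²)^(L/2)`. -/
def weight (L : ℕ) (x : Cfg s n) : ℝ :=
  ∏ l : Fin n, (1 + ∑ μ, x (l, μ) ^ 2) ^ ((L : ℝ) / 2)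

theorem weight_hasTemperateGrowth (L : ℕ) :
    (fun x : Cfg s n => (weight L x : ℂ)).HasTemperateGrowth := by
  have hprod : ∀ S : Finset (Fin n), (fun x : Cfg s n =>
      ((∏ l ∈ S, (1 + ∑ μ, x (l, μ) ^ 2) ^ ((L : ℝ) / 2) : ℝ) : ℂ)).HasTemperateGrowth := by
    intro S
    induction S using Finset.induction_on with
    | empty =>
      simp only [Finset.prod_empty, Complex.ofReal_one]
      exact Function.HasTemperateGrowth.const (E := Cfg s n) (1 : ℂ)
    | insert l S hl ih =>
      let P : Cfg s n →ₗ[ℝ] EuclideanSpace ℝ (Fin (s + 1)) :=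
        { toFun := fun x => WithLp.toLp 2 (slot x l)
          map_add' := fun _ _ => rfl
          map_smul' := fun _ _ => rfl }
      have h1 : (fun x : Cfg s n =>
          (((1 + ‖LinearMap.toContinuousLinearMap P x‖ ^ 2) ^ ((L : ℝ) / 2) : ℝ) :
            ℂ)).HasTemperateGrowth :=
        Function.Complex.hasTemperateGrowth_ofReal.comp
          ((Function.hasTemperateGrowth_one_add_norm_sq_rpow _ _).comp
            (LinearMap.toContinuousLinearMap P).hasTemperateGrowth)
      have h2 : (fun x : Cfg s n =>
          ((∏ l ∈ insert l S, (1 + ∑ μ, x (l, μ) ^ 2) ^ ((L : ℝ) / 2) : ℝ) : ℂ)) =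
          fun x : Cfg s n =>
            (((1 + ‖LinearMap.toContinuousLinearMap P x‖ ^ 2) ^ ((L : ℝ) / 2) : ℝ) : ℂ) *
            ((∏ l ∈ S, (1 + ∑ μ, x (l, μ) ^ 2) ^ ((L : ℝ) / 2) : ℝ) : ℂ) := by
        funext x
        rw [Finset.prod_insert hl, Complex.ofReal_mul]
        congr 3
        rw [EuclideanSpace.norm_sq_eq]
        refine congrArg (1 + ·) (Finset.sum_congr rfl fun μ _ => ?_)
        rw [Real.norm_eq_abs, sq_abs]
        rfl
      rw [h2]
      exact Function.HasTemperateGrowth.fun_mul h1 ih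
  exact hprod Finset.univ

/-- The seminorm `sup_x |∏ₗ (1 + |xₗ|²)^(L/2) ∂_{c 1} ⋯ ∂_{c r} f (x)|`; see
`derivSeminorm_apply`. -/
def derivSeminorm (s n L : ℕ) {r : ℕ} (c : Fin r → Fin n × Fin (s + 1)) :
    Seminorm ℂ 𝓢(Cfg s n, ℂ) :=
  (normSeminorm ℂ (BoundedContinuousFunction (Cfg s n) ℂ)).comp
    (SchwartzMap.toBoundedContinuousFunctionCLM ℂ (Cfg s n) ℂ ∘L
      SchwartzMap.smulLeftCLM ℂ (fun x : Cfg s n => (weight L x : ℂ)) ∘L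
      LineDeriv.iteratedLineDerivOpCLM ℂ 𝓢(Cfg s n, ℂ)
        fun i => EuclideanSpace.single (c i) (1 : ℝ)).toLinearMap

theorem derivSeminorm_apply (L : ℕ) {r : ℕ} (c : Fin r → Fin n × Fin (s + 1))
    (f : 𝓢(Cfg s n, ℂ)) :
    derivSeminorm s n L c f = ⨆ x : Cfg s n,
      ‖(weight L x : ℂ) * iteratedFDeriv ℝ r f x fun i => EuclideanSpace.single (c i) 1‖ := by
  simp only [derivSeminorm, Seminorm.comp_apply, coe_normSeminorm,
    BoundedContinuousFunction.norm_eq_iSup_norm]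
  refine iSup_congr fun x => ?_
  rw [← SchwartzMap.iteratedLineDerivOp_eq_iteratedFDeriv]
  simp [SchwartzMap.smulLeftCLM_apply_apply (weight_hasTemperateGrowth L)]

/-- The partial derivatives `D^(β₁ ⋯ βₙ)` with `|β₁|, …, |βₙ| ≤ K`, each given by the list of the
coordinates in which one differentiates. -/
def derivIndices (s n K : ℕ) : Finset (Σ r : Fin (n * K + 1), Fin r → Fin n × Fin (s + 1)) :=
  Finset.univ.filter fun c => ∀ l : Fin n, (Finset.univ.filter fun i => (c.2 i).1 = l).card ≤ K

/-- The Schwartz norm `‖f‖_{K,L}`: the supremum over all `x₁, …, xₙ` and over all multi-indices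
with `|β₁|, …, |βₙ| ≤ K` of `|∏ₗ (1 + |xₗ|²)^(L/2) D^(β₁ ⋯ βₙ) f (x₁, …, xₙ)|`. -/
def schwartzNorm (s n K L : ℕ) : Seminorm ℂ 𝓢(Cfg s n, ℂ) :=
  (derivIndices s n K).sup fun c => derivSeminorm s n L c.2

/-- The norm `‖·‖_{K,L}` of a vector-valued Schwartz function (the maximum over its
components). -/
def extSchwartzNorm (s n K L : ℕ) : Seminorm ℂ ((Fin n → Label) → 𝓢(Cfg s n, ℂ)) :=
  Finset.univ.sup fun a => (schwartzNorm s n K L).comp (LinearMap.proj a)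

/-- The topology that a seminorm induces. -/
@[reducible]
def seminormTopology {V : Type*} [AddCommGroup V] [Module ℂ V] (p : Seminorm ℂ V) :
    TopologicalSpace V :=
  p.toSeminormedAddCommGroup.toUniformSpace.toTopologicalSpace

/-- The direct sum topology `γ_{K,L}`: the strongest locally convex vector space topology on the
extended Borchers algebra for which the inclusions of the `n`-th summands, normed by
`‖·‖_{K,L}`, are continuous. -/
@[reducible]
def gammaKL (s K L : ℕ) : TopologicalSpace (ExtBorchers s) :=
  sInf {t | @IsTopologicalAddGroup (ExtBorchers s) t _ ∧
    @ContinuousSMul ℂ (ExtBorchers s) _ _ t ∧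
    @LocallyConvexSpace ℝ (ExtBorchers s) _ _ _ _ t ∧
    ∀ n : ℕ, @Continuous _ _ (seminormTopology (extSchwartzNorm s n K L)) t
      (DirectSum.lof ℂ ℕ (fun n => (Fin n → Label) → 𝓢(Cfg s n, ℂ)) n)}

/-- The topology `γ`: the weakest topology which is stronger than all `γ_{K,L}`. -/
@[reducible]
def gamma (s : ℕ) : TopologicalSpace (ExtBorchers s) := ⨅ (K : ℕ) (L : ℕ), gammaKL s K L

/-- Continuity of a functional with respect to `γ`. -/
def ExtFunctional.IsGammaContinuous (F : ExtFunctional s) : Prop :=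
  @Continuous _ _ (gamma s) _ F.eval

/-! ### Wave operators and the form factor functional -/

/-- The spatial part of a vector. -/
def spatial (k : Fin (s + 1) → ℝ) : EuclideanSpace ℝ (Fin s) := WithLp.toLp 2 fun i => k i.succ

/-- The energy `ω = (|𝐤|² + m²)^(1/2)`. -/
def omega (m : ℝ) (p : EuclideanSpace ℝ (Fin s)) : ℝ := √(‖p‖ ^ 2 + m ^ 2)

/-- A smooth cutoff around the mass shell: `φ ∈ C₀^∞(ℝ, ℝ)` with support in `(-ε, ε)`,
`0 < ε < m²`, and `φ = 1` on `(-ε/2, ε/2)`. -/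
def IsShellCutoff (m : ℝ) (φ : ℝ → ℝ) : Prop :=
  ContDiff ℝ ∞ φ ∧ ∃ ε : ℝ, 0 < ε ∧ ε < m ^ 2 ∧ tsupport φ ⊆ Set.Ioo (-ε) ε ∧
    ∀ x ∈ Set.Ioo (-ε / 2) (ε / 2), φ x = 1

/-- `χ⁺(k) = θ(k⁰) φ(k² - m²)` -/
def chiPlus (m : ℝ) (φ : ℝ → ℝ) (k : Fin (s + 1) → ℝ) : ℝ :=
  if 0 < k 0 then φ (mink k k - m ^ 2) else 0

/-- `χ⁻(k) = θ(-k⁰) φ(k² - m²)` -/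
def chiMinus (m : ℝ) (φ : ℝ → ℝ) (k : Fin (s + 1) → ℝ) : ℝ :=
  if k 0 < 0 then φ (mink k k - m ^ 2) else 0

/-- The multiplier `χ_t(a, k)`. -/
def chi (m : ℝ) (φ : ℝ → ℝ) (t : ℝ) : Label → (Fin (s + 1) → ℝ) → ℂ
  | .inn, k =>
      chiPlus m φ k * Complex.exp (-Complex.I * ((k 0 - omega m (spatial k)) * t : ℝ)) +
      chiMinus m φ k * Complex.exp (-Complex.I * ((k 0 + omega m (spatial k)) * t : ℝ))
  | .loc, _ => 1
  | .out, k =>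
      chiPlus m φ k * Complex.exp (Complex.I * ((k 0 - omega m (spatial k)) * t : ℝ)) +
      chiMinus m φ k * Complex.exp (Complex.I * ((k 0 + omega m (spatial k)) * t : ℝ))

theorem coord_hasTemperateGrowth (q : Fin n × Fin (s + 1)) :
    (fun k : Cfg s n => k q).HasTemperateGrowth :=
  (EuclideanSpace.proj (𝕜 := ℝ) q : Cfg s n →L[ℝ] ℝ).hasTemperateGrowth

theorem cexp_hasTemperateGrowth (c : ℝ) :
    (fun x : ℝ => Complex.exp (c * Complex.I * x)).HasTemperateGrowth := by
  have hd : ∀ r : ℕ, iteratedDeriv r (fun x : ℝ => Complex.exp (c * Complex.I * x)) =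
      fun x : ℝ => (c * Complex.I) ^ r * Complex.exp (c * Complex.I * x) := by
    intro r
    induction r with
    | zero => simp
    | succ r ih =>
      rw [iteratedDeriv_succ, ih]
      funext x
      have h1 : HasDerivAt (fun y : ℝ => c * Complex.I * (y : ℂ)) (c * Complex.I * 1) x :=
        (HasDerivAt.ofReal_comp (hasDerivAt_id x)).const_mul _
      rw [(h1.cexp.const_mul ((c * Complex.I) ^ r)).deriv]
      ring
  refine ⟨Complex.contDiff_exp.comp (contDiff_const.mul Complex.ofRealCLM.contDiff),
    fun r => ⟨0, |c| ^ r, fun x => ?_⟩⟩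
  rw [norm_iteratedFDeriv_eq_norm_iteratedDeriv, hd]
  have h : (c : ℂ) * Complex.I * x = ((c * x : ℝ) : ℂ) * Complex.I := by
    push_cast
    ring
  beta_reduce
  rw [h, norm_mul, Complex.norm_exp_ofReal_mul_I]
  simp

theorem sumSq_hasTemperateGrowth (l : Fin n) :
    (fun k : Cfg s n => ∑ i : Fin s, k (l, i.succ) * k (l, i.succ)).HasTemperateGrowth :=
  Function.HasTemperateGrowth.sum fun i _ =>
    Function.HasTemperateGrowth.fun_mul (coord_hasTemperateGrowth (l, i.succ))
      (coord_hasTemperateGrowth (l, i.succ))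

theorem omega_hasTemperateGrowth {m : ℝ} (hm : 0 < m) (l : Fin n) :
    (fun k : Cfg s n => omega m (spatial (slot k l))).HasTemperateGrowth := by
  let P : Cfg s n →ₗ[ℝ] EuclideanSpace ℝ (Fin s) :=
    { toFun := fun k => m⁻¹ • spatial (slot k l)
      map_add' := fun x y => by
        rw [← smul_add]
        rfl
      map_smul' := fun c x => by
        rw [RingHom.id_apply, smul_comm c]
        rfl }
  have h1 : (fun k : Cfg s n =>
      m * (1 + ‖LinearMap.toContinuousLinearMap P k‖ ^ 2) ^ (1 / 2 : ℝ)).HasTemperateGrowth :=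
    Function.HasTemperateGrowth.fun_mul (Function.HasTemperateGrowth.const m)
      ((Function.hasTemperateGrowth_one_add_norm_sq_rpow _ _).comp
        (LinearMap.toContinuousLinearMap P).hasTemperateGrowth)
  convert h1 using 2 with k
  have h2 : LinearMap.toContinuousLinearMap P k = m⁻¹ • spatial (slot k l) := rfl
  rw [h2, norm_smul, ← Real.sqrt_eq_rpow, omega, norm_inv, Real.norm_eq_abs, abs_of_pos hm]
  have h3 : ‖spatial (slot k l)‖ ^ 2 + m ^ 2 =
      m ^ 2 * (1 + (m⁻¹ * ‖spatial (slot k l)‖) ^ 2) := by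
    field_simp
    ring
  rw [h3, Real.sqrt_mul (sq_nonneg m), Real.sqrt_sq hm.le]

/-- The cutoffs `χ^±` are smooth: on the support of `φ (k² - m²)` the energy is bounded away from
`0`, so that the step function can be replaced by a smooth one. -/
theorem step_hasTemperateGrowth {m : ℝ} {φ : ℝ → ℝ} (hφ : IsShellCutoff m φ) (l : Fin n)
    {ς : ℝ} (hς : ς = 1 ∨ ς = -1) :
    (fun k : Cfg s n =>
      if 0 < ς * slot k l 0 then φ (mink (slot k l) (slot k l) - m ^ 2) else
        0).HasTemperateGrowth := by
  obtain ⟨hsm, ε, hε, hεm, hsupp, -⟩ := hφ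
  have hcpt : HasCompactSupport φ :=
    HasCompactSupport.of_support_subset_isCompact (isCompact_Icc (a := -ε) (b := ε))
      ((subset_tsupport φ).trans (hsupp.trans Set.Ioo_subset_Icc_self))
  have hφt : φ.HasTemperateGrowth := hcpt.hasTemperateGrowth hsm
  set c : ℝ := √(m ^ 2 - ε) with hc
  have hc0 : 0 < c := Real.sqrt_pos.2 (by linarith)
  have hcsq : c ^ 2 = m ^ 2 - ε := Real.sq_sqrt (by linarith)
  have hmink : (fun k : Cfg s n => mink (slot k l) (slot k l) - m ^ 2).HasTemperateGrowth :=
    ((Function.HasTemperateGrowth.fun_mul (coord_hasTemperateGrowth (l, 0))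
      (coord_hasTemperateGrowth (l, 0))).sub (sumSq_hasTemperateGrowth l)).sub
        (Function.HasTemperateGrowth.const _)
  have hstep : (fun x : ℝ => Real.smoothTransition x).HasTemperateGrowth := by
    have hd : (deriv Real.smoothTransition).HasTemperateGrowth := by
      refine HasCompactSupport.hasTemperateGrowth
        (HasCompactSupport.of_support_subset_isCompact (isCompact_Icc (a := 0) (b := 1)) ?_)
        (contDiff_infty_iff_deriv.1 Real.smoothTransition.contDiff).2
      intro x hx
      by_contra hx'
      refine hx ?_
      rw [Set.mem_Icc, not_and_or, not_le, not_le] at hx'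
      rcases hx' with h | h
      · have he : Real.smoothTransition =ᶠ[𝓝 x] fun _ => 0 :=
          (eventually_lt_nhds h).mono fun y hy => Real.smoothTransition.zero_of_nonpos hy.le
        rw [he.deriv_eq, deriv_const]
      · have he : Real.smoothTransition =ᶠ[𝓝 x] fun _ => 1 :=
          (eventually_gt_nhds h).mono fun y hy => Real.smoothTransition.one_of_one_le hy.le
        rw [he.deriv_eq, deriv_const]
    refine Function.HasTemperateGrowth.of_fderiv (k := 0) (C := 1) ?_
      (Real.smoothTransition.contDiff (n := 1)).differentiable_one fun x => ?_
    · have : fderiv ℝ Real.smoothTransition = fun x =>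
          (ContinuousLinearMap.toSpanSingletonCLE (𝕜 := ℝ) (E := ℝ))
            (deriv Real.smoothTransition x) := by
        funext x
        ext
        simp
      rw [this]
      exact (ContinuousLinearEquiv.hasTemperateGrowth _).comp hd
    · rw [Real.norm_eq_abs, abs_of_nonneg (Real.smoothTransition.nonneg x)]
      simpa using Real.smoothTransition.le_one x
  have hlin : (fun k : Cfg s n => (ς / c) * k (l, 0)).HasTemperateGrowth :=
    Function.HasTemperateGrowth.fun_mul (Function.HasTemperateGrowth.const _)
      (coord_hasTemperateGrowth (l, 0))
  have h1 := Function.HasTemperateGrowth.fun_mul (hstep.comp hlin) (hφt.comp hmink)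
  refine (congrArg Function.HasTemperateGrowth (funext fun k => ?_)).mpr h1
  simp only [Function.comp_def]
  have h0 : slot k l 0 = k (l, 0) := rfl
  rw [h0]
  by_cases hz : φ (mink (slot k l) (slot k l) - m ^ 2) = 0
  · simp [hz]
  have hmem := hsupp (subset_tsupport φ hz)
  have hsum : 0 ≤ ∑ i : Fin s, slot k l i.succ * slot k l i.succ :=
    Finset.sum_nonneg fun i _ => mul_self_nonneg _
  have hsq : c ^ 2 ≤ (ς * k (l, 0)) ^ 2 := by
    have h2 := hmem.1
    have h3 : ς ^ 2 = 1 := by rcases hς with h | h <;> simp [h]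
    simp only [mink, h0] at h2
    rw [mul_pow, h3, hcsq]
    nlinarith
  split_ifs with hpos
  · have h4 : c ≤ ς * k (l, 0) := abs_le_of_sq_le_sq' hsq hpos.le |>.2
    rw [Real.smoothTransition.one_of_one_le, one_mul]
    rw [div_mul_eq_mul_div, le_div_iff₀ hc0, one_mul]
    exact h4
  · rw [Real.smoothTransition.zero_of_nonpos, zero_mul]
    rw [div_mul_eq_mul_div]
    exact div_nonpos_of_nonpos_of_nonneg (not_lt.1 hpos) hc0.le

theorem chi_hasTemperateGrowth {m : ℝ} (hm : 0 < m) {φ : ℝ → ℝ} (hφ : IsShellCutoff m φ)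
    (t : ℝ) (a : Label) (l : Fin n) :
    (fun k : Cfg s n => chi m φ t a (slot k l)).HasTemperateGrowth := by
  have hp : (fun k : Cfg s n => (chiPlus m φ (slot k l) : ℂ)).HasTemperateGrowth := by
    have h := step_hasTemperateGrowth (s := s) hφ l (Or.inl rfl)
    simp only [one_mul] at h
    exact Function.Complex.hasTemperateGrowth_ofReal.comp h
  have hn : (fun k : Cfg s n => (chiMinus m φ (slot k l) : ℂ)).HasTemperateGrowth := by
    have h := step_hasTemperateGrowth (s := s) hφ l (Or.inr rfl)
    simp only [neg_one_mul, Left.neg_pos_iff] at h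
    exact Function.Complex.hasTemperateGrowth_ofReal.comp h
  have hk0 := coord_hasTemperateGrowth (s := s) (l, 0)
  have hom := omega_hasTemperateGrowth (s := s) hm l
  have he : ∀ (b : ℝ) {g : Cfg s n → ℝ}, g.HasTemperateGrowth →
      (fun k => Complex.exp (b * Complex.I * ((g k * t : ℝ) : ℂ))).HasTemperateGrowth :=
    fun b g hg => (cexp_hasTemperateGrowth b).comp
      (Function.HasTemperateGrowth.fun_mul hg (Function.HasTemperateGrowth.const t))
  cases a with
  | inn =>
    have h := (Function.HasTemperateGrowth.fun_mul hp (he (-1) (hk0.sub hom))).add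
      (Function.HasTemperateGrowth.fun_mul hn (he (-1) (hk0.add hom)))
    simp only [Complex.ofReal_neg, Complex.ofReal_one, neg_one_mul] at h
    exact h
  | loc => exact Function.HasTemperateGrowth.const _
  | out =>
    have h := (Function.HasTemperateGrowth.fun_mul hp (he 1 (hk0.sub hom))).add
      (Function.HasTemperateGrowth.fun_mul hn (he 1 (hk0.add hom)))
    simp only [Complex.ofReal_one, one_mul] at h
    exact h

/-- The component `(a₁, …, aₙ)` of `⨂ₗ Ω_{tₗ}`, followed by the projection `J`: the multiplier
`∏ₗ χ_{tₗ}(aₗ, kₗ)` in energy-momentum space. -/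
def waveOperator (m : ℝ) (φ : ℝ → ℝ) (a : Fin n → Label) (t : Fin n → ℝ) :
    𝓢(Cfg s n, ℂ) →L[ℂ] 𝓢(Cfg s n, ℂ) :=
  minkFourierInv s n ∘L
    SchwartzMap.smulLeftCLM ℂ (fun k : Cfg s n => ∏ l, chi m φ (t l) (a l) (slot k l)) ∘L
    minkFourier s n

/-- The defining property `ℱ Ω_t ℱ̄ = χ_t` of the wave operators. -/
theorem minkFourier_waveOperator {m : ℝ} (hm : 0 < m) {φ : ℝ → ℝ} (hφ : IsShellCutoff m φ)
    (a : Fin n → Label) (t : Fin n → ℝ) (f : 𝓢(Cfg s n, ℂ)) (k : Cfg s n) :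
    minkFourier s n (waveOperator m φ a t f) k =
      (∏ l, chi m φ (t l) (a l) (slot k l)) * minkFourier s n f k := by
  have hg : (fun k : Cfg s n => ∏ l, chi m φ (t l) (a l) (slot k l)).HasTemperateGrowth := by
    have hS : ∀ S : Finset (Fin n),
        (fun k : Cfg s n => ∏ l ∈ S, chi m φ (t l) (a l) (slot k l)).HasTemperateGrowth := by
      intro S
      induction S using Finset.induction_on with
      | empty => exact Function.HasTemperateGrowth.const _
      | insert l S hl ih =>
        simp only [Finset.prod_insert hl]
        exact Function.HasTemperateGrowth.fun_mul (chi_hasTemperateGrowth hm hφ (t l) (a l) l) ih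
    exact hS Finset.univ
  simp only [waveOperator, ContinuousLinearMap.comp_apply]
  rw [minkFourier_minkFourierInv, SchwartzMap.smulLeftCLM_apply_apply hg, smul_eq_mul]

/-- `HasIteratedLimit [i₁, …, iᵣ] Φ x`: first `t_{i₁} → +∞`, then `t_{i₂} → +∞` and so on, all
these limits of `Φ` exist, and the last one is (the constant) `x`. -/
def HasIteratedLimit {X : Type*} [TopologicalSpace X] :
    List (Fin n) → ((Fin n → ℝ) → X) → X → Prop
  | [], Φ, x => ∀ t, Φ t = x
  | i :: is, Φ, x => ∃ Ψ : (Fin n → ℝ) → X,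
      (∀ t, Tendsto (fun u => Φ (Function.update t i u)) atTop (𝓝 (Ψ t))) ∧
      HasIteratedLimit is Ψ x

/-- `F` is the form factor functional of `W`: the limit of `W ∘ Ω_t` as the time parameters of
each `n`-point component tend to `+∞` one after the other exists in every order `σ` and equals
`F`, whatever the order. -/
def IsFormFactor (m : ℝ) (φ : ℝ → ℝ) (W : Functional s) (F : ExtFunctional s) : Prop :=
  ∀ (n : ℕ) (a : Fin n → Label) (σ : Equiv.Perm (Fin n)),
    HasIteratedLimit (List.ofFn σ)
      (fun t => PointwiseConvergenceCLM.precomp ℂ (waveOperator m φ a t) (W n)) (F n a)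

/-! ### Transfer functions -/

/-- The polynomial function of `n` energy-momentum vectors. -/
def polyFun (P : MvPolynomial (Fin n × Fin (s + 1)) ℝ) (k : Cfg s n) : ℂ :=
  (MvPolynomial.eval (fun q => k q) P : ℝ)

theorem polyFun_hasTemperateGrowth (P : MvPolynomial (Fin n × Fin (s + 1)) ℝ) :
    (polyFun P).HasTemperateGrowth := by
  have h : (fun k : Cfg s n => MvPolynomial.eval (fun q => k q) P).HasTemperateGrowth := by
    induction P using MvPolynomial.induction_on with
    | C a =>
      simp only [MvPolynomial.eval_C]
      exact Function.HasTemperateGrowth.const (E := Cfg s n) a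
    | add p q hp hq =>
      simp only [map_add]
      exact hp.add hq
    | mul_X p q hp =>
      simp only [map_mul, MvPolynomial.eval_X]
      exact Function.HasTemperateGrowth.fun_mul hp (coord_hasTemperateGrowth q)
  exact Function.Complex.hasTemperateGrowth_ofReal.comp h

/-- The conditions on a sequence of real polynomial transfer functions. -/
structure IsTransferSequence (M : ∀ n : ℕ, MvPolynomial (Fin n × Fin (s + 1)) ℝ) : Prop where
  symmetric : ∀ (n : ℕ) (σ : Equiv.Perm (Fin n)) (k : Cfg s n),
    polyFun (M n) (ofSlots fun l => slot k (σ l)) = polyFun (M n) k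
  lorentz : ∀ (n : ℕ) (Λ : (Fin (s + 1) → ℝ) ≃ₗ[ℝ] (Fin (s + 1) → ℝ)), IsLorentz Λ →
    ∀ k : Cfg s n, polyFun (M n) (ofSlots fun l => Λ (slot k l)) = polyFun (M n) k
  two : M 2 = 1
  degree : ∃ Lmax : ℕ, ∀ (n : ℕ) (l : Fin n), ∀ e ∈ (M n).support, ∑ μ, e (l, μ) ≤ Lmax

/-- The dot product `(M · T)ₙ = Mₙ Tₙ` with a functional. -/
def dot (M : ∀ n : ℕ, MvPolynomial (Fin n × Fin (s + 1)) ℝ) (T : Functional s) : Functional s :=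
  fun n => TemperedDistribution.smulLeftCLM ℂ (polyFun (M n)) (T n)

/-- The dot product with a functional on the extended algebra, `(M · T)ₙ^a = Mₙ Tₙ^a`. -/
def dotExt (M : ∀ n : ℕ, MvPolynomial (Fin n × Fin (s + 1)) ℝ) (T : ExtFunctional s) :
    ExtFunctional s :=
  fun n a => TemperedDistribution.smulLeftCLM ℂ (polyFun (M n)) (T n a)

/-! ### The structure functional and its form factor functional -/

/-- The point `(±ω, 𝐩)` of the mass shell, `ς = ±1` being the sign of the energy. -/
def shellPoint (m ς : ℝ) (p : EuclideanSpace ℝ (Fin s)) : Fin (s + 1) → ℝ :=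
  Fin.cons (ς * omega m p) fun i => p i

/-- The distribution `δ⁻_μ(k₁) δ(k₁ + k₂)`, where `∫ δ^±_μ(k) g(k) dk = ∫ g(±ω, 𝐤) d𝐤 / 2ω`. -/
def twoPoint (μ : ℝ) (f : 𝓢(Cfg s 2, ℂ)) : ℂ :=
  ∫ p : EuclideanSpace ℝ (Fin s),
    f (ofSlots ![shellPoint μ (-1) p, -shellPoint μ (-1) p]) / (2 * omega μ p : ℝ)

/-- A nonnegative, locally integrable and polynomially bounded density on `(m₀, ∞)` (the growth
condition is understood in the integrated sense; a pointwise bound is a special case). -/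
def IsSpectralDensity (m₀ : ℝ) (ρ : ℝ → ℝ) : Prop :=
  (∀ μ, m₀ < μ → 0 ≤ ρ μ) ∧
    ∃ N : ℕ, IntegrableOn (fun μ => ρ μ * ((1 + |μ|) ^ N)⁻¹) (Set.Ioi m₀)

/-- The distribution `[δ⁻_m(k₁) + ∫_{m₀}^∞ δ⁻_μ(k₁) ρ(μ) dμ] δ(k₁ + k₂)`. -/
def fullTwoPoint (m m₀ : ℝ) (ρ : ℝ → ℝ) (f : 𝓢(Cfg s 2, ℂ)) : ℂ :=
  twoPoint m f + ∫ μ in Set.Ioi m₀, (ρ μ : ℂ) * twoPoint μ f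

/-- The approximations of
`Δ_m(in, k) = -iπ (δ⁺_m(k) - δ⁻_m(k))`, `Δ_m(loc, k) = 1/(k² - m²)` (Cauchy principal value) and
`Δ_m(out, k) = iπ (δ⁺_m(k) - δ⁻_m(k))` for a width `ε > 0` around the mass shell:
the principal value is the limit `ε → 0` of the integral over `|k² - m²| > ε`, and
`δ^±_m(k) = θ(±k⁰) δ(k² - m²)` is the limit of the averages over `|k² - m²| < ε`. -/
def propagatorApprox (m ε : ℝ) : Label → (Fin (s + 1) → ℝ) → ℂ
  | .inn, k => -Complex.I * Real.pi *
      ((if |mink k k - m ^ 2| < ε then Real.sign (k 0) / (2 * ε) else 0 : ℝ) : ℂ)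
  | .loc, k => ((if ε < |mink k k - m ^ 2| then (mink k k - m ^ 2)⁻¹ else 0 : ℝ) : ℂ)
  | .out, k => Complex.I * Real.pi *
      ((if |mink k k - m ^ 2| < ε then Real.sign (k 0) / (2 * ε) else 0 : ℝ) : ℂ)

/-- The `l`-th vector, `l ≠ j`, in the support of
`∏_{l<j} δ⁻_m(k_l) ∏_{l>j} δ⁺_m(k_l)` with the momenta `p`. -/
def onShell (m : ℝ) (j : Fin n) (p : {l : Fin n // l ≠ j} → EuclideanSpace ℝ (Fin s))
    (l : {l : Fin n // l ≠ j}) : Fin (s + 1) → ℝ :=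
  shellPoint m (if l.1 < j then -1 else 1) (p l)

/-- The remaining vector `k_j`, fixed by `k₁ + ⋯ + kₙ = 0`. -/
def recoil (m : ℝ) (j : Fin n) (p : {l : Fin n // l ≠ j} → EuclideanSpace ℝ (Fin s)) :
    Fin (s + 1) → ℝ :=
  -∑ l, onShell m j p l

/-- The corresponding `n`-tuple `(k₁, …, kₙ)`. -/
def onShellCfg (m : ℝ) (j : Fin n) (p : {l : Fin n // l ≠ j} → EuclideanSpace ℝ (Fin s)) :
    Cfg s n :=
  ofSlots fun l => if h : l = j then recoil m j p else onShell m j p ⟨l, h⟩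

/-- `T = ∏_{l<j} δ⁻_m(k_l) Δ_m(a, k_j) ∏_{l>j} δ⁺_m(k_l) δ(k₁ + ⋯ + kₙ)`: the deltas are carried
out, which leaves an integral over the momenta `𝐩_l`, `l ≠ j`, with the weight `∏ 1 / 2ω_l`, and
`Δ_m(a, k_j)` is the limit of its approximations. -/
def IsShellProduct (m : ℝ) (j : Fin n) (a : Label) (T : 𝓢'(Cfg s n, ℂ)) : Prop :=
  ∀ f : 𝓢(Cfg s n, ℂ), Tendsto
    (fun ε : ℝ => ∫ p : {l : Fin n // l ≠ j} → EuclideanSpace ℝ (Fin s),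
      propagatorApprox m ε a (recoil m j p) * f (onShellCfg m j p) *
        ∏ l, (((2 * omega m (p l))⁻¹ : ℝ) : ℂ))
    (𝓝[>] 0) (𝓝 (T f))

/-- `G` is the Fourier transform of the structure functional. -/
structure IsStructureFunctional (m m₀ : ℝ) (ρ : ℝ → ℝ) (G : Functional s) : Prop where
  zero : G 0 = 0
  one : G 1 = 0
  two : ∀ f, G 2 f = fullTwoPoint m m₀ ρ f
  three_le : ∀ n, 3 ≤ n → ∃ T : Fin n → 𝓢'(Cfg s n, ℂ),
    (∀ j, IsShellProduct m j .loc (T j)) ∧ G n = ∑ j, T j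

/-- `F` is the Fourier transform of the functional `F^G`. -/
structure IsStructureFormFactor (m m₀ : ℝ) (ρ : ℝ → ℝ) (F : ExtFunctional s) : Prop where
  zero : ∀ a, F 0 a = 0
  one : ∀ a, F 1 a = 0
  two_loc : ∀ a : Fin 2 → Label, (a 0 = .loc ∧ a 1 = .loc) →
    ∀ f, F 2 a f = fullTwoPoint m m₀ ρ f
  two_other : ∀ a : Fin 2 → Label, ¬(a 0 = .loc ∧ a 1 = .loc) → ∀ f, F 2 a f = twoPoint m f
  three_le : ∀ n, 3 ≤ n → ∀ a : Fin n → Label, ∃ T : Fin n → 𝓢'(Cfg s n, ℂ),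
    (∀ j, IsShellProduct m j (a j) (T j)) ∧ F n a = ∑ j, T j

end FormFactor

end

/-!
For `n ≥ 3` each summand of the functionals becomes, once the deltas are carried out, an integral
over the spatial momenta `𝐩_l` of the `n - 1` vectors on their mass shells, with the propagator
evaluated at the recoil vector `k_j = -∑ k_l`. The denominator is
`k_j² - m² = (k_j⁰ - ω)(k_j⁰ + ω)`, `ω` being the energy of a particle of mass `m` with the spatial
momentum of `k_j`. Where `k_j⁰ > 0`, only the first factor can vanish, and one of the vectors,
with momentum `p` say, has negative energy, so that `k_j⁰ - ω = ω(p) - ω(p + B) + b` with `B` the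
sum of the other momenta and `b` independent of `p`. On lines parallel to `B` this difference is
strictly monotone, by the convexity of the energy. It serves as a coordinate, in which the
integrand has a bounded, integrable and Lipschitz density (`isRegularDensity_energyGap`). For such
densities principal values and averages converge (`limits_of_isRegularDensity`), and
`exp (-i t w) / w` tends to `∓ i π δ(w)` as `t → ±∞` (`IsRegularDensity.tendsto_pv_phase`, a
consequence of the Riemann–Lebesgue lemma and of
`∫ exp (-|w|) (exp (i t w) - 1) / w dw = 2 i arctan t`). The bounds on a line are singular only
like `1 / ‖B‖`, which is integrable because space has at least two dimensions
(`integrable_lineWeight`); hence dominated convergence gives all limits for the full integrals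
(`exists_product_limits`, `exists_shell_limits`, `exists_shellIntegral_limits`). The region
`k_j⁰ < 0` is reduced to the other one by reflection, and away from the mass shell the propagator
is smooth. This yields the existence of the distributions (`exists_isShellProduct`) and the
transition from the principal value to the in- and outgoing propagators
(`IsShellProduct.tendsto_chi`).

On the mass shell the multiplier `χ_t` equals one. So each summand depends on the time of its
recoil vector only, and the limits may be taken one after the other in any order
(`hasIteratedLimit_of_family`, `hasIteratedLimit_shellProduct`). In the two-point functional the
masses `μ ≠ m` carry the factor `exp (± i (ω_μ - ω_m) t)` and vanish in the limit by the
Riemann–Lebesgue lemma (`tendsto_fullTwoPoint`).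

Translations act trivially because the momenta add up to zero
(`minkFourier_poincare_of_sum_eq_zero`). Lorentz invariance holds already for a fixed width `ε`;
it comes down to the invariance of `d𝐩 / 2ω`, which is, up to a constant, the image of the Lebesgue
measure on the layer `1 < k² < 4` of the forward cone under the projection along the rays
(`exists_lintegral_shellLayer`).

For the continuity in the topology `γ`, the order of the weights in the bounds must not depend on
`n`. The limits above are bounded by suprema of `f` and its first derivatives with product weights
`∏ (1 + |k_l|²)^L`, `L` independent of `n`. Since `1 + |k_l|²` corresponds to `1 - Δ_l` under the
Fourier transform, these suprema are bounded by norms `‖·‖_{K,L}` with fixed `K` and `L`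
(`exists_hasDecay_minkFourier`, `exists_hasDecay_transfer`), and a functional with such bounds is
continuous already for a single `γ_{K,L}` (`ExtFunctional.isGammaContinuous_of_bound`).
-/

noncomputable section

namespace FormFactor

/-! ### Principal values on the line -/

/-- The density, with respect to Lebesgue measure, of the image under a strictly increasing
function `H` (with derivative `H'`) of the measure with density `g`. It is extended by zero off
the range of `H`. -/
def pushDensity (H H' : ℝ → ℝ) (g : ℝ → ℂ) : ℝ → ℂ :=
  Function.extend H (fun x => g x / H' x) 0

section PushDensity

variable {H H' : ℝ → ℝ} {g : ℝ → ℂ}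

theorem strictMono_of_hasDerivAt_pos (hH : ∀ x, HasDerivAt H (H' x) x) (hpos : ∀ x, 0 < H' x) :
    StrictMono H :=
  strictMono_of_deriv_pos fun x => by rw [(hH x).deriv]; exact hpos x

theorem pushDensity_apply (hH : StrictMono H) (x : ℝ) :
    pushDensity H H' g (H x) = g x / H' x :=
  hH.injective.extend_apply _ _ x

theorem pushDensity_apply_of_notMem (w : ℝ) (hw : w ∉ Set.range H) :
    pushDensity H H' g w = 0 :=
  Function.extend_apply' _ _ _ (by simpa using hw)

/-- The change of variables `w = H x`. -/
theorem integral_mul_pushDensity (hH : ∀ x, HasDerivAt H (H' x) x) (hpos : ∀ x, 0 < H' x)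
    (F : ℝ → ℂ) : ∫ w, F w * pushDensity H H' g w = ∫ x, F (H x) * g x := by
  have hm := strictMono_of_hasDerivAt_pos hH hpos
  have h1 : ∫ w in Set.range H, F w * pushDensity H H' g w =
      ∫ w, F w * pushDensity H H' g w :=
    setIntegral_eq_integral_of_forall_compl_eq_zero fun w hw => by
      rw [pushDensity_apply_of_notMem w hw, mul_zero]
  rw [← h1, ← Set.image_univ, integral_image_eq_integral_abs_deriv_smul MeasurableSet.univ
    (fun x _ => (hH x).hasDerivWithinAt) hm.injective.injOn, setIntegral_univ]
  refine integral_congr_ae (Eventually.of_forall fun x => ?_)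
  have h2 : (H' x : ℂ) ≠ 0 := Complex.ofReal_ne_zero.2 (hpos x).ne'
  simp only [pushDensity_apply hm, abs_of_pos (hpos x), Complex.real_smul]
  field_simp

theorem integral_norm_pushDensity (hH : ∀ x, HasDerivAt H (H' x) x) (hpos : ∀ x, 0 < H' x) :
    ∫ w, ‖pushDensity H H' g w‖ = ∫ x, ‖g x‖ := by
  have hm := strictMono_of_hasDerivAt_pos hH hpos
  have h1 : ∫ w in Set.range H, ‖pushDensity H H' g w‖ = ∫ w, ‖pushDensity H H' g w‖ :=
    setIntegral_eq_integral_of_forall_compl_eq_zero fun w hw => by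
      rw [pushDensity_apply_of_notMem w hw, norm_zero]
  rw [← h1, ← Set.image_univ, integral_image_eq_integral_abs_deriv_smul MeasurableSet.univ
    (fun x _ => (hH x).hasDerivWithinAt) hm.injective.injOn, setIntegral_univ]
  refine integral_congr_ae (Eventually.of_forall fun x => ?_)
  have h2 := (hpos x).ne'
  simp only [pushDensity_apply hm, abs_of_pos (hpos x), smul_eq_mul, norm_div, Complex.norm_real,
    Real.norm_eq_abs]
  field_simp

theorem integrable_pushDensity (hH : ∀ x, HasDerivAt H (H' x) x) (hpos : ∀ x, 0 < H' x)
    (hg : Integrable g) : Integrable (pushDensity H H' g) := by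
  have hm := strictMono_of_hasDerivAt_pos hH hpos
  have h0 : IntegrableOn (pushDensity H H' g) (H '' Set.univ) := by
    rw [integrableOn_image_iff_integrableOn_abs_deriv_smul MeasurableSet.univ
      (fun x _ => (hH x).hasDerivWithinAt) hm.injective.injOn, integrableOn_univ]
    refine hg.congr (Eventually.of_forall fun x => ?_)
    have h2 : (H' x : ℂ) ≠ 0 := Complex.ofReal_ne_zero.2 (hpos x).ne'
    simp only [pushDensity_apply hm, abs_of_pos (hpos x), Complex.real_smul]
    field_simp
  rw [Set.image_univ] at h0
  exact (integrableOn_iff_integrable_of_support_subset fun w hw => by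
    by_contra h
    exact hw (pushDensity_apply_of_notMem w h)).1 h0

theorem norm_pushDensity_le (hH : StrictMono H) {A : ℝ} (hA : ∀ x, ‖g x / H' x‖ ≤ A) (w : ℝ) :
    ‖pushDensity H H' g w‖ ≤ A := by
  by_cases hw : w ∈ Set.range H
  · obtain ⟨x, rfl⟩ := hw
    rw [pushDensity_apply hH]
    exact hA x
  · rw [pushDensity_apply_of_notMem w hw, norm_zero]
    exact (norm_nonneg _).trans (hA 0)

/-- If `(g / H')' / H'` is bounded and `g / H'` tends to zero at infinity, then the density is
Lipschitz on the whole line, also across the ends of the range of `H`. -/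
theorem lipschitz_pushDensity (hH : ∀ x, HasDerivAt H (H' x) x) (hpos : ∀ x, 0 < H' x)
    {q' : ℝ → ℂ} {A : ℝ} (hq : ∀ x, HasDerivAt (fun x => g x / H' x) (q' x) x)
    (hq' : ∀ x, ‖q' x‖ ≤ A * H' x) (htop : Tendsto (fun x => g x / H' x) atTop (𝓝 0))
    (hbot : Tendsto (fun x => g x / H' x) atBot (𝓝 0)) (w w' : ℝ) :
    ‖pushDensity H H' g w - pushDensity H H' g w'‖ ≤ A * |w - w'| := by
  have hm := strictMono_of_hasDerivAt_pos hH hpos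
  have hcont : Continuous H := continuous_iff_continuousAt.2 fun x => (hH x).continuousAt
  have hA : 0 ≤ A := by
    have := (norm_nonneg _).trans (hq' 0)
    exact nonneg_of_mul_nonneg_left this (hpos 0)
  have key : ∀ x x', x ≤ x' → ‖g x / H' x - g x' / H' x'‖ ≤ A * (H x' - H x) := by
    intro x x' hx
    rw [norm_sub_rev]
    have := image_norm_le_of_norm_deriv_right_le_deriv_boundary (a := x) (b := x')
      (f := fun y => g y / H' y - g x / H' x) (f' := q') (B := fun y => A * (H y - H x))
      (B' := fun y => A * H' y)
      (fun y _ => ((hq y).sub_const _).continuousAt.continuousWithinAt)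
      (fun y _ => ((hq y).sub_const _).hasDerivWithinAt) (by simp)
      (fun y => ((hH y).sub_const _).const_mul A) (fun y _ => hq' y)
    exact this ⟨hx, le_rfl⟩
  have hoff : ∀ x v, v ∉ Set.range H → ‖g x / H' x‖ ≤ A * |H x - v| := by
    intro x v hv
    have hlt : ∀ y z, H y < v → H z < v := by
      intro y z hy
      by_contra! hz
      exact hv (isPreconnected_range hcont |>.Icc_subset ⟨y, rfl⟩ ⟨z, rfl⟩ ⟨hy.le, hz⟩)
    rcases lt_trichotomy (H x) v with h | h | h
    · have hl : Tendsto (fun y => ‖g x / H' x - g y / H' y‖) atTop (𝓝 ‖g x / H' x - 0‖) :=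
        (tendsto_const_nhds.sub htop).norm
      rw [sub_zero] at hl
      refine le_of_tendsto hl ((eventually_ge_atTop x).mono fun y hy => (key x y hy).trans ?_)
      rw [abs_sub_comm, abs_of_pos (sub_pos.2 h)]
      gcongr
      exact (hlt x y h).le
    · exact (hv ⟨x, h⟩).elim
    · have hl : Tendsto (fun y => ‖g y / H' y - g x / H' x‖) atBot (𝓝 ‖0 - g x / H' x‖) :=
        (hbot.sub tendsto_const_nhds).norm
      rw [zero_sub, norm_neg] at hl
      refine le_of_tendsto hl ((eventually_le_atBot x).mono fun y hy => (key y x hy).trans ?_)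
      rw [abs_of_pos (sub_pos.2 h)]
      gcongr
      by_contra! hy'
      exact lt_asymm h (hlt y x hy')
  by_cases hw : w ∈ Set.range H
  · obtain ⟨x, rfl⟩ := hw
    by_cases hw' : w' ∈ Set.range H
    · obtain ⟨x', rfl⟩ := hw'
      rw [pushDensity_apply hm, pushDensity_apply hm]
      rcases le_total x x' with h | h
      · rw [abs_sub_comm, abs_of_nonneg (sub_nonneg.2 (hm.monotone h))]
        exact key x x' h
      · rw [norm_sub_rev, abs_of_nonneg (sub_nonneg.2 (hm.monotone h))]
        exact key x' x h
    · rw [pushDensity_apply hm, pushDensity_apply_of_notMem w' hw', sub_zero]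
      exact hoff x w' hw'
  · by_cases hw' : w' ∈ Set.range H
    · obtain ⟨x', rfl⟩ := hw'
      rw [pushDensity_apply hm, pushDensity_apply_of_notMem w hw, zero_sub, norm_neg,
        abs_sub_comm]
      exact hoff x' w hw
    · rw [pushDensity_apply_of_notMem w hw, pushDensity_apply_of_notMem w' hw', sub_zero,
        norm_zero]
      positivity

end PushDensity

/-- A density on the line which is Lipschitz, bounded and integrable, with the common bound
`A`. -/
structure IsRegularDensity (A : ℝ) (ψ : ℝ → ℂ) : Prop where
  lip : ∀ w w', ‖ψ w - ψ w'‖ ≤ A * |w - w'|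
  bdd : ∀ w, ‖ψ w‖ ≤ A
  int : Integrable ψ
  l1 : ∫ w, ‖ψ w‖ ≤ A

/-- The regularized quotient `(ψ(w) - ψ(0) e^(-|w|)) / w`. The subtracted term is odd after
division by `w`, so that it does not contribute to principal values. -/
def pvQuotient (ψ : ℝ → ℂ) (w : ℝ) : ℂ := (ψ w - ψ 0 * Real.exp (-|w|)) / w

/-- The Cauchy principal value of `∫ ψ(w) / w dw`; see `tendsto_integral_truncated_inv_mul`. -/
def pv (ψ : ℝ → ℂ) : ℂ := ∫ w, pvQuotient ψ w

theorem integrable_exp_neg_abs : Integrable fun w : ℝ => Real.exp (-|w|) := by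
  rw [← integrableOn_univ, ← Set.Iic_union_Ioi (a := (0 : ℝ))]
  refine IntegrableOn.union ?_ ?_
  · exact (integrableOn_exp_Iic 0).congr_fun
      (fun w hw => by simp only [abs_of_nonpos (Set.mem_Iic.1 hw), neg_neg]) measurableSet_Iic
  · exact (integrableOn_exp_neg_Ioi 0).congr_fun
      (fun w hw => by simp only [abs_of_pos (Set.mem_Ioi.1 hw)]) measurableSet_Ioi

theorem integral_exp_neg_abs_mul_cexp (τ : ℝ) :
    ∫ w : ℝ, (Real.exp (-|w|) : ℂ) * Complex.exp (Complex.I * (τ * w : ℝ)) =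
      2 / (1 + τ ^ 2 : ℝ) := by
  have hint : Integrable fun w : ℝ =>
      (Real.exp (-|w|) : ℂ) * Complex.exp (Complex.I * (τ * w : ℝ)) := by
    refine integrable_exp_neg_abs.ofReal.mul_bdd (c := 1) ?_
      (Eventually.of_forall fun w => ?_)
    · exact Continuous.aestronglyMeasurable (by fun_prop)
    · rw [mul_comm, Complex.norm_exp_ofReal_mul_I]
  rw [← integral_add_compl (measurableSet_Iic (a := (0 : ℝ))) hint, Set.compl_Iic]
  have h1 : ∫ w in Set.Iic (0 : ℝ),
      (Real.exp (-|w|) : ℂ) * Complex.exp (Complex.I * (τ * w : ℝ)) = 1 / (1 + Complex.I * τ) := by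
    have h := integral_exp_mul_complex_Iic (a := 1 + Complex.I * τ) (by simp) 0
    simp only [Complex.ofReal_zero, mul_zero, Complex.exp_zero] at h
    rw [← h]
    refine setIntegral_congr_fun measurableSet_Iic fun w hw => ?_
    simp only [abs_of_nonpos (Set.mem_Iic.1 hw), Complex.ofReal_exp, ← Complex.exp_add]
    congr 1
    push_cast
    ring
  have h2 : ∫ w in Set.Ioi (0 : ℝ),
      (Real.exp (-|w|) : ℂ) * Complex.exp (Complex.I * (τ * w : ℝ)) = 1 / (1 - Complex.I * τ) := by
    have h := integral_exp_mul_complex_Ioi (a := -1 + Complex.I * τ) (by simp) 0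
    simp only [Complex.ofReal_zero, mul_zero, Complex.exp_zero] at h
    rw [show (1 : ℂ) / (1 - Complex.I * τ) = -1 / (-1 + Complex.I * τ) by
      rw [← neg_sub, div_neg, neg_div]; congr 2; ring, ← h]
    refine setIntegral_congr_fun measurableSet_Ioi fun w hw => ?_
    simp only [abs_of_pos (Set.mem_Ioi.1 hw), Complex.ofReal_exp, ← Complex.exp_add]
    congr 1
    push_cast
    ring
  rw [h1, h2]
  have hre : ∀ z : ℂ, z.re = 1 → z ≠ 0 := fun z hz h => by simp [h] at hz
  have ha : (1 + Complex.I * τ : ℂ) ≠ 0 := hre _ (by simp)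
  have hb : (1 - Complex.I * τ : ℂ) ≠ 0 := hre _ (by simp)
  have hc : ((1 + τ ^ 2 : ℝ) : ℂ) = (1 + Complex.I * τ) * (1 - Complex.I * τ) := by
    push_cast
    ring_nf
    rw [Complex.I_sq]
    ring
  rw [hc]
  field_simp
  ring

theorem integral_exp_neg_abs : ∫ w : ℝ, Real.exp (-|w|) = 2 := by
  have h := integral_exp_neg_abs_mul_cexp 0
  simp only [zero_mul, Complex.ofReal_zero, mul_zero, Complex.exp_zero, mul_one] at h
  have h1 : ∫ w : ℝ, ((Real.exp (-|w|) : ℝ) : ℂ) = ((∫ w : ℝ, Real.exp (-|w|) : ℝ) : ℂ) :=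
    integral_ofReal
  rw [h1] at h
  norm_num at h
  exact_mod_cast h

section RegularDensity

variable {A : ℝ} {ψ : ℝ → ℂ}

theorem IsRegularDensity.nonneg (h : IsRegularDensity A ψ) : 0 ≤ A :=
  (norm_nonneg _).trans (h.bdd 0)

theorem IsRegularDensity.continuous (h : IsRegularDensity A ψ) : Continuous ψ :=
  (LipschitzWith.of_dist_le_mul (K := ⟨A, h.nonneg⟩) fun w w' => by
    rw [dist_eq_norm, Real.dist_eq]; exact h.lip w w').continuous

theorem IsRegularDensity.norm_pvQuotient_le (h : IsRegularDensity A ψ) (w : ℝ) :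
    ‖pvQuotient ψ w‖ ≤ (Set.Icc (-1) 1).indicator (fun _ => 2 * A) w +
      (‖ψ w‖ + A * Real.exp (-|w|)) := by
  have hA := h.nonneg
  have he := Real.exp_pos (-|w|)
  rw [pvQuotient, norm_div, Complex.norm_real, Real.norm_eq_abs]
  by_cases hw : w ∈ Set.Icc (-1 : ℝ) 1
  · rw [Set.indicator_of_mem hw]
    refine le_add_of_le_of_nonneg ?_ (by positivity)
    refine div_le_of_le_mul₀ (abs_nonneg _) (by positivity) ?_
    have h1 : ψ w - ψ 0 * Real.exp (-|w|) = (ψ w - ψ 0) + ψ 0 * (1 - Real.exp (-|w|) : ℝ) := by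
      push_cast
      ring
    have h2 : |1 - Real.exp (-|w|)| ≤ |w| := by
      rw [abs_of_nonneg (by simp)]
      linarith [Real.add_one_le_exp (-|w|)]
    rw [h1]
    refine (norm_add_le _ _).trans ?_
    rw [norm_mul, Complex.norm_real, Real.norm_eq_abs]
    have h3 := h.lip w 0
    rw [sub_zero] at h3
    have h4 := mul_le_mul (h.bdd 0) h2 (abs_nonneg _) hA
    linarith
  · rw [Set.indicator_of_notMem hw, zero_add]
    have hw1 : 1 ≤ |w| := by
      by_contra! h1
      exact hw (Set.mem_Icc.2 (abs_le.1 h1.le))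
    refine (div_le_self (norm_nonneg _) hw1).trans ((norm_sub_le _ _).trans ?_)
    rw [norm_mul, Complex.norm_real, Real.norm_eq_abs, abs_of_pos he]
    gcongr
    exact h.bdd 0

theorem IsRegularDensity.measurable_pvQuotient (h : IsRegularDensity A ψ) :
    Measurable (pvQuotient ψ) := by
  have := h.continuous.measurable
  unfold pvQuotient
  fun_prop

theorem IsRegularDensity.integrable_bound (h : IsRegularDensity A ψ) :
    Integrable fun w => (Set.Icc (-1) 1).indicator (fun _ => 2 * A) w +
      (‖ψ w‖ + A * Real.exp (-|w|)) := by
  refine Integrable.add ?_ (h.int.norm.add (integrable_exp_neg_abs.const_mul A))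
  exact (integrable_indicator_iff measurableSet_Icc).2 (integrableOn_const (by simp))

theorem IsRegularDensity.integrable_pvQuotient (h : IsRegularDensity A ψ) :
    Integrable (pvQuotient ψ) :=
  h.integrable_bound.mono' h.measurable_pvQuotient.aestronglyMeasurable
    (Eventually.of_forall h.norm_pvQuotient_le)

theorem IsRegularDensity.integral_norm_pvQuotient_le (h : IsRegularDensity A ψ) :
    ∫ w, ‖pvQuotient ψ w‖ ≤ 7 * A := by
  refine (integral_mono h.integrable_pvQuotient.norm h.integrable_bound
    h.norm_pvQuotient_le).trans ?_
  have h1 : Integrable ((Set.Icc (-1 : ℝ) 1).indicator fun _ => 2 * A) :=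
    (integrable_indicator_iff measurableSet_Icc).2 (integrableOn_const (by simp))
  have h2 : ∫ w, (Set.Icc (-1 : ℝ) 1).indicator (fun _ => 2 * A) w = 4 * A := by
    rw [integral_indicator measurableSet_Icc]
    simp
    ring
  have h3 : ∫ w, (‖ψ w‖ + A * Real.exp (-|w|)) = (∫ w, ‖ψ w‖) + A * 2 := by
    rw [integral_add h.int.norm (integrable_exp_neg_abs.const_mul A), integral_const_mul,
      integral_exp_neg_abs]
  have h4 : ∫ w, ((Set.Icc (-1 : ℝ) 1).indicator (fun _ => 2 * A) w +
      (‖ψ w‖ + A * Real.exp (-|w|))) = _ :=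
    integral_add h1 (h.int.norm.add (integrable_exp_neg_abs.const_mul A))
  rw [h4]
  refine (add_le_add h2.le h3.le).trans ?_
  linarith [h.l1]

theorem integral_eq_zero_of_odd {F : ℝ → ℂ} (hF : ∀ w, F (-w) = -F w) : ∫ w, F w = 0 := by
  have h := integral_neg_eq_self F volume
  simp only [hF, integral_neg] at h
  exact self_eq_neg.1 h.symm

theorem IsRegularDensity.integral_truncated_inv_mul (h : IsRegularDensity A ψ) {δ : ℝ}
    (hδ : 0 < δ) : ∫ w : ℝ, (if δ < |w| then (w : ℂ)⁻¹ else 0) * ψ w =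
      ∫ w : ℝ, if δ < |w| then pvQuotient ψ w else 0 := by
  have hset : MeasurableSet {w : ℝ | δ < |w|} := measurableSet_lt measurable_const (by fun_prop)
  have hodd : ∫ w : ℝ, (if δ < |w| then (w : ℂ)⁻¹ * (ψ 0 * Real.exp (-|w|)) else 0) = 0 := by
    refine integral_eq_zero_of_odd fun w => ?_
    simp only [abs_neg]
    split_ifs
    · push_cast
      rw [inv_neg, neg_mul]
    · rw [neg_zero]
  have hi1 : Integrable fun w : ℝ => if δ < |w| then pvQuotient ψ w else 0 :=
    h.integrable_pvQuotient.indicator hset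
  have hi2 : Integrable fun w : ℝ =>
      if δ < |w| then (w : ℂ)⁻¹ * (ψ 0 * Real.exp (-|w|)) else 0 := by
    refine (integrable_exp_neg_abs.const_mul (δ⁻¹ * ‖ψ 0‖)).mono'
      (Measurable.aestronglyMeasurable ?_) (Eventually.of_forall fun w => ?_)
    · exact Measurable.ite hset (by fun_prop) measurable_const
    · split_ifs with hw
      · rw [norm_mul, norm_mul, norm_inv, Complex.norm_real, Complex.norm_real,
          Real.norm_eq_abs, Real.norm_eq_abs, abs_of_pos (Real.exp_pos _), mul_assoc]
        gcongr
      · rw [norm_zero]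
        positivity
  have hsum := integral_add hi1 hi2
  rw [hodd, add_zero] at hsum
  rw [← hsum]
  refine integral_congr_ae ?_
  filter_upwards with w
  split_ifs with hw
  · have hw0 : (w : ℂ) ≠ 0 := by
      rintro h0
      rw [Complex.ofReal_eq_zero] at h0
      rw [h0, abs_zero] at hw
      exact lt_asymm hw hδ
    rw [pvQuotient]
    field_simp
    ring
  · simp

theorem IsRegularDensity.norm_integral_truncated_inv_mul_le (h : IsRegularDensity A ψ) {δ : ℝ}
    (hδ : 0 < δ) : ‖∫ w : ℝ, (if δ < |w| then (w : ℂ)⁻¹ else 0) * ψ w‖ ≤ 7 * A := by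
  rw [h.integral_truncated_inv_mul hδ]
  refine (norm_integral_le_of_norm_le h.integrable_pvQuotient.norm
    (Eventually.of_forall fun w => ?_)).trans h.integral_norm_pvQuotient_le
  split_ifs
  · exact le_rfl
  · simp

theorem IsRegularDensity.tendsto_integral_truncated_inv_mul (h : IsRegularDensity A ψ) :
    Tendsto (fun δ : ℝ => ∫ w : ℝ, (if δ < |w| then (w : ℂ)⁻¹ else 0) * ψ w) (𝓝[>] 0)
      (𝓝 (pv ψ)) := by
  have h1 : Tendsto (fun δ : ℝ => ∫ w : ℝ, if δ < |w| then pvQuotient ψ w else 0) (𝓝[>] 0)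
      (𝓝 (pv ψ)) := by
    refine tendsto_integral_filter_of_dominated_convergence (fun w => ‖pvQuotient ψ w‖)
      (Eventually.of_forall fun δ => ?_) (Eventually.of_forall fun δ =>
        Eventually.of_forall fun w => ?_) h.integrable_pvQuotient.norm ?_
    · exact (Measurable.ite (measurableSet_lt measurable_const (by fun_prop))
        h.measurable_pvQuotient measurable_const).aestronglyMeasurable
    · split_ifs
      · exact le_rfl
      · simp
    · have h0 : ∀ᵐ w : ℝ, w ≠ 0 := by simp [ae_iff]
      filter_upwards [h0] with w hw
      refine tendsto_const_nhds.congr' ?_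
      filter_upwards [mem_nhdsWithin_of_mem_nhds (eventually_lt_nhds (abs_pos.2 hw))] with δ hδ
      rw [if_pos hδ]
  refine h1.congr' ?_
  filter_upwards [self_mem_nhdsWithin] with δ hδ
  exact (h.integral_truncated_inv_mul hδ).symm

end RegularDensity

/-! ### Oscillating principal values -/

theorem norm_cexp_I_mul_sub_one_le (x : ℝ) : ‖Complex.exp (Complex.I * x) - 1‖ ≤ |x| :=
  Real.norm_exp_I_mul_ofReal_sub_one_le

theorem integrable_exp_neg_abs_mul_quotient (τ : ℝ) : Integrable fun w : ℝ =>
    (Real.exp (-|w|) : ℂ) * ((Complex.exp (Complex.I * (τ * w : ℝ)) - 1) / w) := by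
  refine (integrable_exp_neg_abs.const_mul |τ|).mono' (Measurable.aestronglyMeasurable
    (by fun_prop)) (Eventually.of_forall fun w => ?_)
  rw [norm_mul, Complex.norm_real, Real.norm_eq_abs, abs_of_pos (Real.exp_pos _), mul_comm,
    norm_div, Complex.norm_real, Real.norm_eq_abs]
  gcongr
  refine div_le_of_le_mul₀ (abs_nonneg _) (abs_nonneg _) ?_
  rw [← abs_mul]
  exact norm_cexp_I_mul_sub_one_le _

/-- The model integral behind `exp (i τ w) / w → i π δ(w)`. -/
theorem integral_exp_neg_abs_mul_quotient (τ : ℝ) :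
    ∫ w : ℝ, (Real.exp (-|w|) : ℂ) * ((Complex.exp (Complex.I * (τ * w : ℝ)) - 1) / w) =
      2 * Complex.I * Real.arctan τ := by
  set J : ℝ → ℂ := fun τ => ∫ w : ℝ,
    (Real.exp (-|w|) : ℂ) * ((Complex.exp (Complex.I * (τ * w : ℝ)) - 1) / w) with hJ
  have hne : ∀ᵐ w : ℝ, w ≠ 0 := by simp [ae_iff]
  have hd : ∀ τ, HasDerivAt J (Complex.I * (2 / (1 + τ ^ 2 : ℝ))) τ := by
    intro τ
    have h := (hasDerivAt_integral_of_dominated_loc_of_deriv_le (𝕜 := ℝ) (μ := volume)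
      (s := Set.univ) (x₀ := τ)
      (F := fun (τ w : ℝ) =>
        (Real.exp (-|w|) : ℂ) * ((Complex.exp (Complex.I * (τ * w : ℝ)) - 1) / w))
      (F' := fun (τ w : ℝ) =>
        Complex.I * ((Real.exp (-|w|) : ℂ) * Complex.exp (Complex.I * (τ * w : ℝ))))
      (bound := fun w => Real.exp (-|w|)) Filter.univ_mem
      (Eventually.of_forall fun τ => Measurable.aestronglyMeasurable (by fun_prop))
      (integrable_exp_neg_abs_mul_quotient τ) (Measurable.aestronglyMeasurable (by fun_prop))
      ?_ integrable_exp_neg_abs ?_).2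
    · rw [integral_const_mul, integral_exp_neg_abs_mul_cexp] at h
      exact h
    · refine Eventually.of_forall fun w τ _ => ?_
      rw [norm_mul, norm_mul, Complex.norm_I, one_mul, mul_comm Complex.I,
        Complex.norm_exp_ofReal_mul_I, mul_one, Complex.norm_real, Real.norm_eq_abs,
        abs_of_pos (Real.exp_pos _)]
    · filter_upwards [hne] with w hw τ _
      have hw' : (w : ℂ) ≠ 0 := Complex.ofReal_ne_zero.2 hw
      have h1 : HasDerivAt (fun τ : ℝ => Complex.I * ((τ * w : ℝ) : ℂ)) (Complex.I * w) τ := by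
        have := ((hasDerivAt_id τ).mul_const w).ofReal_comp.const_mul Complex.I
        simpa using this
      have h2 := ((h1.cexp.sub_const 1).div_const (w : ℂ)).const_mul (Real.exp (-|w|) : ℂ)
      refine h2.congr_deriv ?_
      field_simp
  have ha : ∀ τ : ℝ, HasDerivAt (fun τ : ℝ => 2 * Complex.I * (Real.arctan τ : ℂ))
      (Complex.I * (2 / (1 + τ ^ 2 : ℝ))) τ := by
    intro τ
    refine ((Real.hasDerivAt_arctan τ).ofReal_comp.const_mul (2 * Complex.I)).congr_deriv ?_
    push_cast
    ring
  have hsub : ∀ τ, HasDerivAt (fun τ => J τ - 2 * Complex.I * (Real.arctan τ : ℂ)) 0 τ :=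
    fun τ => ((hd τ).sub (ha τ)).congr_deriv (sub_self _)
  have hconst := is_const_of_deriv_eq_zero (fun τ => (hsub τ).differentiableAt)
    (fun τ => (hsub τ).deriv) τ 0
  have h0 : J 0 = 0 := by simp [hJ]
  simp only [h0, Real.arctan_zero, Complex.ofReal_zero, mul_zero, sub_zero] at hconst
  exact sub_eq_zero.1 hconst

theorem tendsto_integral_mul_cexp {F : ℝ → ℂ} :
    Tendsto (fun τ : ℝ => ∫ w, F w * Complex.exp (Complex.I * (τ * w : ℝ))) (cocompact ℝ)
      (𝓝 0) := by
  have h := Real.tendsto_integral_exp_smul_cocompact F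
  have hc : Tendsto (fun τ : ℝ => -(2 * Real.pi)⁻¹ * τ) (cocompact ℝ) (cocompact ℝ) :=
    (Homeomorph.mulLeft₀ (-(2 * Real.pi)⁻¹)
      (neg_ne_zero.2 (inv_ne_zero Real.two_pi_pos.ne'))).isClosedEmbedding.tendsto_cocompact
  refine (h.comp hc).congr fun τ => integral_congr_ae (Eventually.of_forall fun w => ?_)
  simp only [Circle.smul_def, Real.fourierChar_apply, smul_eq_mul]
  rw [mul_comm]
  congr 2
  have hpi : (Real.pi : ℂ) ≠ 0 := Complex.ofReal_ne_zero.2 Real.pi_ne_zero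
  push_cast
  field_simp

section Phase

variable {A : ℝ} {ψ : ℝ → ℂ}

theorem IsRegularDensity.pv_phase (h : IsRegularDensity A ψ) (τ : ℝ) :
    pv (fun w => ψ w * Complex.exp (Complex.I * (τ * w : ℝ))) =
      (∫ w, pvQuotient ψ w * Complex.exp (Complex.I * (τ * w : ℝ))) +
        ψ 0 * (2 * Complex.I * Real.arctan τ) := by
  have h1 : Integrable fun w => pvQuotient ψ w * Complex.exp (Complex.I * (τ * w : ℝ)) := by
    refine h.integrable_pvQuotient.mul_bdd (c := 1)
      (Measurable.aestronglyMeasurable (by fun_prop)) (Eventually.of_forall fun w => ?_)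
    rw [mul_comm, Complex.norm_exp_ofReal_mul_I]
  have h2 := integral_add h1 ((integrable_exp_neg_abs_mul_quotient τ).const_mul (ψ 0))
  rw [integral_const_mul, integral_exp_neg_abs_mul_quotient] at h2
  rw [← h2, pv]
  refine integral_congr_ae (Eventually.of_forall fun w => ?_)
  simp only [pvQuotient, mul_zero, Complex.ofReal_zero, Complex.exp_zero, mul_one]
  ring

theorem IsRegularDensity.norm_pv_phase_le (h : IsRegularDensity A ψ) (τ : ℝ) :
    ‖pv (fun w => ψ w * Complex.exp (Complex.I * (τ * w : ℝ)))‖ ≤ 11 * A := by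
  have hA := h.nonneg
  rw [h.pv_phase]
  have h1 : ‖∫ w, pvQuotient ψ w * Complex.exp (Complex.I * (τ * w : ℝ))‖ ≤ 7 * A := by
    refine (norm_integral_le_integral_norm _).trans (le_trans (le_of_eq ?_)
      h.integral_norm_pvQuotient_le)
    refine integral_congr_ae (Eventually.of_forall fun w => ?_)
    simp only [norm_mul]
    rw [mul_comm Complex.I, Complex.norm_exp_ofReal_mul_I, mul_one]
  have h2 : |Real.arctan τ| ≤ 2 := by
    have := Real.arctan_lt_pi_div_two τ
    have := Real.neg_pi_div_two_lt_arctan τ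
    have := Real.pi_lt_four
    exact abs_le.2 ⟨by linarith, by linarith⟩
  have h3 : ‖ψ 0 * (2 * Complex.I * Real.arctan τ)‖ ≤ A * (2 * 2) := by
    simp only [norm_mul, Complex.norm_I, Complex.norm_real, Real.norm_eq_abs, Complex.norm_ofNat,
      mul_one]
    gcongr
    exact h.bdd 0
  linarith [norm_add_le (∫ w, pvQuotient ψ w * Complex.exp (Complex.I * (τ * w : ℝ)))
    (ψ 0 * (2 * Complex.I * Real.arctan τ))]

/-- Oscillating principal values: the regularized quotient is integrable, so that its contribution
vanishes by the Riemann–Lebesgue lemma, and the subtracted term contributes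
`2 i ψ(0) arctan τ`. For `τ → ± ∞` this is the statement `exp (i τ w) / w → ± i π δ(w)`. -/
theorem IsRegularDensity.tendsto_pv_phase (h : IsRegularDensity A ψ) {l : Filter ℝ}
    (hl : l ≤ cocompact ℝ) {y : ℝ} (hy : Tendsto Real.arctan l (𝓝 y)) :
    Tendsto (fun τ : ℝ => pv (fun w => ψ w * Complex.exp (Complex.I * (τ * w : ℝ)))) l
      (𝓝 (2 * Complex.I * y * ψ 0)) := by
  have h1 := (tendsto_integral_mul_cexp (F := pvQuotient ψ)).mono_left hl
  have h2 : Tendsto (fun τ => ψ 0 * (2 * Complex.I * (Real.arctan τ : ℂ))) l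
      (𝓝 (ψ 0 * (2 * Complex.I * y))) :=
    (((Complex.continuous_ofReal.tendsto y).comp hy).const_mul _).const_mul _
  have h3 := h1.add h2
  rw [zero_add, mul_comm (ψ 0)] at h3
  exact h3.congr fun τ => (h.pv_phase τ).symm

end Phase

/-! ### Truncation in a variable proportional to the coordinate -/

section Truncation

variable {A m : ℝ} {ψ ψ₁ : ℝ → ℂ} {c : ℝ → ℝ}

/-- The difference between the truncations `δ < |w| c(w)` and `δ / m < |w|`, in the rescaled
variable `η = w / δ`. -/
def truncationDefect (m : ℝ) (c : ℝ → ℝ) (ψ : ℝ → ℂ) (δ η : ℝ) : ℂ :=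
  (if 1 < |η| * c (δ * η) ∧ |η| ≤ m⁻¹ then (η : ℂ)⁻¹ else 0) * ψ (δ * η)

theorem norm_truncationDefect_le (h₁ : IsRegularDensity A ψ₁) (hm : 0 < m)
    (hψ : ∀ w, ψ₁ w = c w * ψ w) (hc : ∀ w, ψ w ≠ 0 → m ≤ c w) (δ η : ℝ) :
    ‖truncationDefect m c ψ δ η‖ ≤ (Set.Icc (-m⁻¹) m⁻¹).indicator (fun _ => A) η := by
  have hA := h₁.nonneg
  by_cases hη : |η| ≤ m⁻¹
  · rw [Set.indicator_of_mem (Set.mem_Icc.2 (abs_le.1 hη)), truncationDefect]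
    split_ifs with h
    · rw [norm_mul, norm_inv, Complex.norm_real, Real.norm_eq_abs]
      by_cases h0 : ψ (δ * η) = 0
      · rw [h0, norm_zero, mul_zero]
        exact hA
      · have hc0 : 0 < c (δ * η) := hm.trans_le (hc _ h0)
        have hη0 : 0 < |η| := pos_of_mul_pos_left (one_pos.trans h.1) hc0.le
        have h3 := h₁.bdd (δ * η)
        rw [hψ, norm_mul, Complex.norm_real, Real.norm_eq_abs, abs_of_pos hc0] at h3
        refine le_trans ?_ h3
        gcongr
        rw [inv_le_iff_one_le_mul₀ hη0, mul_comm]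
        exact h.1.le
    · rw [zero_mul, norm_zero]
      exact hA
  · rw [truncationDefect, if_neg fun h => hη h.2, zero_mul, norm_zero]
    exact Set.indicator_nonneg (fun _ _ => hA) _

theorem integrable_indicator_Icc (a b : ℝ) (A : ℝ) :
    Integrable ((Set.Icc a b).indicator fun _ => A) :=
  (integrable_indicator_iff measurableSet_Icc).2 (integrableOn_const (by simp))

theorem integral_indicator_Icc_inv (hm : 0 < m) :
    ∫ η, (Set.Icc (-m⁻¹) m⁻¹).indicator (fun _ => A) η = 2 * m⁻¹ * A := by
  rw [integral_indicator measurableSet_Icc]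
  have : 0 < m⁻¹ := inv_pos.2 hm
  rw [setIntegral_const, measureReal_def, Real.volume_Icc, smul_eq_mul,
    ENNReal.toReal_ofReal (by linarith)]
  ring

theorem measurable_truncationDefect (h : IsRegularDensity A ψ) (hcm : Measurable c) (δ : ℝ) :
    Measurable (truncationDefect m c ψ δ) := by
  have hψm := h.continuous.measurable
  have e1 : MeasurableSet {η : ℝ | 1 < |η| * c (δ * η)} :=
    measurableSet_lt measurable_const (by fun_prop)
  have e2 : MeasurableSet {η : ℝ | |η| ≤ m⁻¹} := measurableSet_le (by fun_prop) measurable_const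
  exact Measurable.mul (Measurable.ite (e1.inter e2) (by fun_prop) measurable_const)
    (by fun_prop)

theorem integral_truncationDefect (h : IsRegularDensity A ψ) (h₁ : IsRegularDensity A ψ₁)
    (hcm : Measurable c)
    (hm : 0 < m) (hψ : ∀ w, ψ₁ w = c w * ψ w) (hc : ∀ w, ψ w ≠ 0 → m ≤ c w) {δ : ℝ}
    (hδ : 0 < δ) :
    ∫ w : ℝ, (if δ < |w| * c w then (w : ℂ)⁻¹ else 0) * ψ w =
      (∫ w : ℝ, (if δ / m < |w| then (w : ℂ)⁻¹ else 0) * ψ w) +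
        ∫ η, truncationDefect m c ψ δ η := by
  have hψm := h.continuous.measurable
  have hδ0 : (δ : ℂ) ≠ 0 := Complex.ofReal_ne_zero.2 hδ.ne'
  have hresc : ∫ η, truncationDefect m c ψ δ η =
      ∫ w : ℝ, (if δ < |w| * c w ∧ |w| ≤ δ / m then (w : ℂ)⁻¹ else 0) * ψ w := by
    have h2 := Measure.integral_comp_mul_left
      (fun w : ℝ => (if δ < |w| * c w ∧ |w| ≤ δ / m then (w : ℂ)⁻¹ else 0) * ψ w) δ
    rw [abs_of_pos (inv_pos.2 hδ), Complex.real_smul, Complex.ofReal_inv,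
      eq_inv_mul_iff_mul_eq₀ hδ0, ← integral_const_mul] at h2
    rw [← h2]
    refine integral_congr_ae (Eventually.of_forall fun η => ?_)
    simp only [truncationDefect, abs_mul, abs_of_pos hδ]
    have e1 : δ < δ * |η| * c (δ * η) ↔ 1 < |η| * c (δ * η) := by
      rw [mul_assoc, lt_mul_iff_one_lt_right hδ]
    have e2 : δ * |η| ≤ δ / m ↔ |η| ≤ m⁻¹ := by
      rw [div_eq_mul_inv, mul_le_mul_iff_right₀ hδ]
    simp only [e1, e2]
    split_ifs
    · push_cast
      rw [mul_inv]
      field_simp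
    · ring
  have hi1 : Integrable fun w : ℝ => (if δ / m < |w| then (w : ℂ)⁻¹ else 0) * ψ w := by
    refine h.int.bdd_mul (c := (δ / m)⁻¹) (Measurable.aestronglyMeasurable ?_)
      (Eventually.of_forall fun w => ?_)
    · exact Measurable.ite (measurableSet_lt measurable_const (by fun_prop)) (by fun_prop)
        measurable_const
    · split_ifs with hw
      · rw [norm_inv, Complex.norm_real, Real.norm_eq_abs]
        gcongr
      · rw [norm_zero]
        positivity
  have hi2 : Integrable fun w : ℝ =>
      (if δ < |w| * c w ∧ |w| ≤ δ / m then (w : ℂ)⁻¹ else 0) * ψ w := by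
    refine (integrable_indicator_Icc (-(δ / m)) (δ / m) (A / δ)).mono'
      (Measurable.aestronglyMeasurable ?_) (Eventually.of_forall fun w => ?_)
    · have e1 : MeasurableSet {w : ℝ | δ < |w| * c w} :=
        measurableSet_lt measurable_const (by fun_prop)
      have e2 : MeasurableSet {w : ℝ | |w| ≤ δ / m} :=
        measurableSet_le (by fun_prop) measurable_const
      exact Measurable.mul (Measurable.ite (e1.inter e2) (by fun_prop) measurable_const)
        (by fun_prop)
    · have h3 := norm_truncationDefect_le h₁ hm hψ hc δ (w / δ)
      have e0 : δ * (w / δ) = w := by field_simp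
      have e1 : 1 < |w / δ| * c w ↔ δ < |w| * c w := by
        rw [abs_div, abs_of_pos hδ, div_mul_eq_mul_div, lt_div_iff₀ hδ, one_mul]
      have e2 : |w / δ| ≤ m⁻¹ ↔ |w| ≤ δ / m := by
        rw [abs_div, abs_of_pos hδ, div_le_iff₀ hδ, div_eq_inv_mul]
      have e3 : w / δ ∈ Set.Icc (-m⁻¹) m⁻¹ ↔ w ∈ Set.Icc (-(δ / m)) (δ / m) := by
        rw [Set.mem_Icc, Set.mem_Icc, ← abs_le, ← abs_le, e2]
      have hA := h.nonneg
      simp only [truncationDefect, e0, e1, e2] at h3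
      by_cases hw : w ∈ Set.Icc (-(δ / m)) (δ / m)
      · rw [Set.indicator_of_mem (e3.2 hw)] at h3
        rw [Set.indicator_of_mem hw, le_div_iff₀ hδ]
        refine le_trans (le_of_eq ?_) h3
        rw [norm_mul, norm_mul]
        split_ifs
        · push_cast
          rw [inv_div, norm_div, norm_inv, Complex.norm_real, Complex.norm_real,
            Real.norm_eq_abs δ, abs_of_pos hδ]
          ring
        · simp
      · rw [Set.indicator_of_notMem hw, if_neg fun hh => hw (Set.mem_Icc.2 (abs_le.1 hh.2))]
        simp
  rw [hresc, ← integral_add hi1 hi2]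
  refine integral_congr_ae (Eventually.of_forall fun w => ?_)
  beta_reduce
  by_cases h0 : ψ w = 0
  · simp [h0]
  have hcw := hc w h0
  rw [← add_mul]
  congr 1
  by_cases h3 : δ / m < |w|
  · have h4 : δ < |w| * c w := by
      rw [div_lt_iff₀ hm] at h3
      exact h3.trans_le (by gcongr)
    simp [h3, h4]
  · simp [h3, not_lt.1 h3]

theorem integral_truncationDefect_zero : ∫ η, truncationDefect m c ψ 0 η = 0 :=
  integral_eq_zero_of_odd fun η => by
    simp only [truncationDefect, abs_neg, zero_mul, Complex.ofReal_neg, inv_neg]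
    split_ifs <;> ring

theorem tendsto_integral_truncationDefect (h : IsRegularDensity A ψ)
    (h₁ : IsRegularDensity A ψ₁) (hcm : Measurable c) (hm : 0 < m)
    (hψ : ∀ w, ψ₁ w = c w * ψ w) (hc : ∀ w, ψ w ≠ 0 → m ≤ c w)
    (hc0 : ψ 0 ≠ 0 → ContinuousAt c 0) :
    Tendsto (fun δ => ∫ η, truncationDefect m c ψ δ η) (𝓝[>] 0) (𝓝 0) := by
  rw [← integral_truncationDefect_zero (m := m) (c := c) (ψ := ψ)]
  refine tendsto_integral_filter_of_dominated_convergence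
    ((Set.Icc (-m⁻¹) m⁻¹).indicator fun _ => A)
    (Eventually.of_forall fun δ => (measurable_truncationDefect h hcm δ).aestronglyMeasurable)
    (Eventually.of_forall fun δ => Eventually.of_forall fun η =>
      norm_truncationDefect_le h₁ hm hψ hc δ η) (integrable_indicator_Icc _ _ _) ?_
  have hscale : ∀ η : ℝ, Tendsto (fun δ : ℝ => δ * η) (𝓝[>] 0) (𝓝 0) := fun η => by
    have : Tendsto (fun δ : ℝ => δ * η) (𝓝 0) (𝓝 (0 * η)) := tendsto_id.mul_const η
    rw [zero_mul] at this
    exact this.mono_left nhdsWithin_le_nhds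
  have hlim : ∀ η : ℝ, Tendsto (fun δ : ℝ => ψ (δ * η)) (𝓝[>] 0) (𝓝 (ψ 0)) := fun η =>
    (h.continuous.tendsto 0).comp (hscale η)
  have hne : ∀ᵐ η : ℝ, η ≠ (c 0)⁻¹ ∧ η ≠ -(c 0)⁻¹ := by
    refine Filter.Eventually.and ?_ ?_ <;> simp [ae_iff]
  filter_upwards [hne] with η hη
  simp only [truncationDefect, zero_mul]
  by_cases hz : ψ 0 = 0
  · rw [hz, mul_zero]
    refine squeeze_zero_norm (a := fun δ => ‖(η : ℂ)⁻¹‖ * ‖ψ (δ * η)‖) (fun δ => ?_) ?_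
    · rw [norm_mul]
      gcongr
      split_ifs
      · exact le_rfl
      · simp
    · have := (hlim η).norm.const_mul ‖(η : ℂ)⁻¹‖
      rwa [hz, norm_zero, mul_zero] at this
  · refine Tendsto.mul ?_ (hlim η)
    have hpos : 0 < c 0 := hm.trans_le (hc 0 hz)
    have hcl : Tendsto (fun δ : ℝ => |η| * c (δ * η)) (𝓝[>] 0) (𝓝 (|η| * c 0)) :=
      (((hc0 hz).tendsto).comp (hscale η)).const_mul _
    have hne1 : |η| * c 0 ≠ 1 := by
      intro h1
      have h2 : |η| = (c 0)⁻¹ := eq_inv_of_mul_eq_one_left h1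
      rcases abs_choice η with h3 | h3
      · exact hη.1 (h3 ▸ h2)
      · exact hη.2 (by rw [← h2, h3, neg_neg])
    refine tendsto_const_nhds.congr' ?_
    rcases lt_or_gt_of_ne hne1 with h1 | h1
    · filter_upwards [hcl.eventually_lt_const h1] with δ hδ
      simp [h1.not_gt, hδ.not_gt]
    · filter_upwards [hcl.eventually_const_lt h1] with δ hδ
      simp [h1, hδ]

theorem norm_integral_truncation_le (h : IsRegularDensity A ψ) (h₁ : IsRegularDensity A ψ₁)
    (hcm : Measurable c) (hm : 0 < m) (hψ : ∀ w, ψ₁ w = c w * ψ w)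
    (hc : ∀ w, ψ w ≠ 0 → m ≤ c w) {δ : ℝ} (hδ : 0 < δ) :
    ‖∫ w : ℝ, (if δ < |w| * c w then (w : ℂ)⁻¹ else 0) * ψ w‖ ≤ (7 + 2 * m⁻¹) * A := by
  rw [integral_truncationDefect h h₁ hcm hm hψ hc hδ, add_mul]
  refine (norm_add_le _ _).trans (add_le_add
    (h.norm_integral_truncated_inv_mul_le (div_pos hδ hm)) ?_)
  rw [← integral_indicator_Icc_inv hm]
  exact norm_integral_le_of_norm_le (integrable_indicator_Icc _ _ _)
    (Eventually.of_forall fun η => norm_truncationDefect_le h₁ hm hψ hc δ η)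

/-- The principal value does not change if the truncation is done in the variable `w c(w)`: after
scaling `w = δ η`, the difference of the two truncated integrands tends to an odd function
of `η`. -/
theorem tendsto_integral_truncation (h : IsRegularDensity A ψ) (h₁ : IsRegularDensity A ψ₁)
    (hcm : Measurable c) (hm : 0 < m) (hψ : ∀ w, ψ₁ w = c w * ψ w)
    (hc : ∀ w, ψ w ≠ 0 → m ≤ c w) (hc0 : ψ 0 ≠ 0 → ContinuousAt c 0) :
    Tendsto (fun δ : ℝ => ∫ w : ℝ, (if δ < |w| * c w then (w : ℂ)⁻¹ else 0) * ψ w) (𝓝[>] 0)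
      (𝓝 (pv ψ)) := by
  have hdiv : Tendsto (fun δ : ℝ => δ / m) (𝓝[>] 0) (𝓝[>] 0) := by
    refine tendsto_nhdsWithin_iff.2 ⟨?_, ?_⟩
    · have : Tendsto (fun δ : ℝ => δ / m) (𝓝 0) (𝓝 (0 / m)) := tendsto_id.div_const m
      rw [zero_div] at this
      exact this.mono_left nhdsWithin_le_nhds
    · filter_upwards [self_mem_nhdsWithin] with δ hδ
      exact div_pos hδ hm
  have h2 := (h.tendsto_integral_truncated_inv_mul.comp hdiv).add
    (tendsto_integral_truncationDefect h h₁ hcm hm hψ hc hc0)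
  rw [add_zero] at h2
  refine h2.congr' ?_
  filter_upwards [self_mem_nhdsWithin] with δ hδ
  exact (integral_truncationDefect h h₁ hcm hm hψ hc hδ).symm

theorem integral_average {δ : ℝ} (hδ : 0 < δ) :
    ∫ w : ℝ, (if |w| * c w < δ then ((2 * δ : ℝ) : ℂ)⁻¹ else 0) * ψ₁ w =
      ∫ η : ℝ, (if |η| * c (δ * η) < 1 then (2 : ℂ)⁻¹ else 0) * ψ₁ (δ * η) := by
  have hδ0 : (δ : ℂ) ≠ 0 := Complex.ofReal_ne_zero.2 hδ.ne'
  have h2 := Measure.integral_comp_mul_left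
    (fun w : ℝ => (if |w| * c w < δ then ((2 * δ : ℝ) : ℂ)⁻¹ else 0) * ψ₁ w) δ
  rw [abs_of_pos (inv_pos.2 hδ), Complex.real_smul, Complex.ofReal_inv,
    eq_inv_mul_iff_mul_eq₀ hδ0, ← integral_const_mul] at h2
  rw [← h2]
  refine integral_congr_ae (Eventually.of_forall fun η => ?_)
  simp only [abs_mul, abs_of_pos hδ]
  have e1 : δ * |η| * c (δ * η) < δ ↔ |η| * c (δ * η) < 1 := by
    rw [mul_assoc, mul_lt_iff_lt_one_right hδ]
  simp only [e1]
  split_ifs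
  · push_cast
    field_simp
  · ring

theorem norm_average_le (h₁ : IsRegularDensity A ψ₁) (hm : 0 < m)
    (hψ : ∀ w, ψ₁ w = c w * ψ w) (hc : ∀ w, ψ w ≠ 0 → m ≤ c w) (δ η : ℝ) :
    ‖(if |η| * c (δ * η) < 1 then (2 : ℂ)⁻¹ else 0) * ψ₁ (δ * η)‖ ≤
      (Set.Icc (-m⁻¹) m⁻¹).indicator (fun _ => A) η := by
  have hA := h₁.nonneg
  have hnn : 0 ≤ (Set.Icc (-m⁻¹) m⁻¹).indicator (fun _ => A) η :=
    Set.indicator_nonneg (fun _ _ => hA) _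
  split_ifs with h1
  · by_cases h0 : ψ (δ * η) = 0
    · rw [hψ, h0, mul_zero, mul_zero, norm_zero]
      exact hnn
    · have hη : |η| ≤ m⁻¹ := by
        rw [← one_div, le_div_iff₀ hm]
        exact le_trans (by gcongr; exact hc _ h0) h1.le
      rw [Set.indicator_of_mem (Set.mem_Icc.2 (abs_le.1 hη)), norm_mul, norm_inv,
        Complex.norm_ofNat]
      linarith [h₁.bdd (δ * η), norm_nonneg (ψ₁ (δ * η))]
  · rwa [zero_mul, norm_zero]

theorem norm_integral_average_le (h₁ : IsRegularDensity A ψ₁) (hm : 0 < m)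
    (hψ : ∀ w, ψ₁ w = c w * ψ w) (hc : ∀ w, ψ w ≠ 0 → m ≤ c w) {δ : ℝ} (hδ : 0 < δ) :
    ‖∫ w : ℝ, (if |w| * c w < δ then ((2 * δ : ℝ) : ℂ)⁻¹ else 0) * ψ₁ w‖ ≤ 2 * m⁻¹ * A := by
  rw [integral_average hδ, ← integral_indicator_Icc_inv hm]
  exact norm_integral_le_of_norm_le (integrable_indicator_Icc _ _ _)
    (Eventually.of_forall fun η => norm_average_le h₁ hm hψ hc δ η)

/-- Averages over `|w c(w)| < δ` with density `ψ₁ = c ψ` converge to `ψ₁(0) / c(0) = ψ(0)`. -/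
theorem tendsto_integral_average (h₁ : IsRegularDensity A ψ₁)
    (hcm : Measurable c) (hm : 0 < m) (hψ : ∀ w, ψ₁ w = c w * ψ w)
    (hc : ∀ w, ψ w ≠ 0 → m ≤ c w) (hc0 : ψ 0 ≠ 0 → ContinuousAt c 0) :
    Tendsto (fun δ : ℝ => ∫ w : ℝ,
      (if |w| * c w < δ then ((2 * δ : ℝ) : ℂ)⁻¹ else 0) * ψ₁ w) (𝓝[>] 0) (𝓝 (ψ 0)) := by
  have hval : ∫ η : ℝ, (if |η| * c 0 < 1 then (2 : ℂ)⁻¹ else 0) * ψ₁ 0 = ψ 0 := by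
    by_cases hz : ψ 0 = 0
    · simp [hψ, hz]
    · have hpos : 0 < c 0 := hm.trans_le (hc 0 hz)
      have hset : ∀ η : ℝ, (if |η| * c 0 < 1 then (2 : ℂ)⁻¹ else 0) * ψ₁ 0 =
          (Set.Ioo (-(c 0)⁻¹) (c 0)⁻¹).indicator (fun _ => (2 : ℂ)⁻¹ * ψ₁ 0) η := by
        intro η
        rw [Set.indicator_apply]
        have : |η| * c 0 < 1 ↔ η ∈ Set.Ioo (-(c 0)⁻¹) (c 0)⁻¹ := by
          rw [Set.mem_Ioo, ← abs_lt, ← lt_div_iff₀ hpos, one_div]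
        simp only [this]
        split_ifs <;> simp
      simp only [hset]
      rw [integral_indicator measurableSet_Ioo, setIntegral_const, hψ]
      have h0 : (c 0 : ℂ) ≠ 0 := Complex.ofReal_ne_zero.2 hpos.ne'
      rw [measureReal_def, Real.volume_Ioo,
        ENNReal.toReal_ofReal (by linarith [inv_pos.2 hpos]), Complex.real_smul]
      push_cast
      field_simp
      ring
  have hscale : ∀ η : ℝ, Tendsto (fun δ : ℝ => δ * η) (𝓝[>] 0) (𝓝 0) := fun η => by
    have : Tendsto (fun δ : ℝ => δ * η) (𝓝 0) (𝓝 (0 * η)) := tendsto_id.mul_const η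
    rw [zero_mul] at this
    exact this.mono_left nhdsWithin_le_nhds
  have hlim : ∀ η : ℝ, Tendsto (fun δ : ℝ => ψ₁ (δ * η)) (𝓝[>] 0) (𝓝 (ψ₁ 0)) := fun η =>
    (h₁.continuous.tendsto 0).comp (hscale η)
  have hψm := h₁.continuous.measurable
  have hmain : Tendsto (fun δ : ℝ => ∫ η : ℝ,
      (if |η| * c (δ * η) < 1 then (2 : ℂ)⁻¹ else 0) * ψ₁ (δ * η)) (𝓝[>] 0) (𝓝 (ψ 0)) := by
    rw [← hval]
    refine tendsto_integral_filter_of_dominated_convergence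
      ((Set.Icc (-m⁻¹) m⁻¹).indicator fun _ => A)
      (Eventually.of_forall fun δ => Measurable.aestronglyMeasurable ?_)
      (Eventually.of_forall fun δ => Eventually.of_forall fun η =>
        norm_average_le h₁ hm hψ hc δ η) (integrable_indicator_Icc _ _ _) ?_
    · exact Measurable.mul (Measurable.ite (measurableSet_lt (by fun_prop) measurable_const)
        measurable_const measurable_const) (by fun_prop)
    have hne : ∀ᵐ η : ℝ, η ≠ (c 0)⁻¹ ∧ η ≠ -(c 0)⁻¹ := by
      refine Filter.Eventually.and ?_ ?_ <;> simp [ae_iff]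
    filter_upwards [hne] with η hη
    by_cases hz : ψ 0 = 0
    · have hz1 : ψ₁ 0 = 0 := by rw [hψ, hz, mul_zero]
      rw [hz1, mul_zero]
      refine squeeze_zero_norm (a := fun δ => 1 * ‖ψ₁ (δ * η)‖) (fun δ => ?_) ?_
      · rw [norm_mul]
        gcongr
        split_ifs <;> norm_num
      · have := (hlim η).norm.const_mul 1
        rwa [hz1, norm_zero, mul_zero] at this
    · refine Tendsto.mul ?_ (hlim η)
      have hpos : 0 < c 0 := hm.trans_le (hc 0 hz)
      have hcl : Tendsto (fun δ : ℝ => |η| * c (δ * η)) (𝓝[>] 0) (𝓝 (|η| * c 0)) :=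
        (((hc0 hz).tendsto).comp (hscale η)).const_mul _
      have hne1 : |η| * c 0 ≠ 1 := by
        intro h1
        have h2 : |η| = (c 0)⁻¹ := eq_inv_of_mul_eq_one_left h1
        rcases abs_choice η with h3 | h3
        · exact hη.1 (h3 ▸ h2)
        · exact hη.2 (by rw [← h2, h3, neg_neg])
      refine tendsto_const_nhds.congr' ?_
      rcases lt_or_gt_of_ne hne1 with h1 | h1
      · filter_upwards [hcl.eventually_lt_const h1] with δ hδ
        simp [h1, hδ]
      · filter_upwards [hcl.eventually_const_lt h1] with δ hδ
        simp [h1.not_gt, hδ.not_gt]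
  refine hmain.congr' ?_
  filter_upwards [self_mem_nhdsWithin] with δ hδ
  exact (integral_average hδ).symm

end Truncation

/-! ### The energy difference along a line -/

/-- The energy `(x² + a²)^(1/2)` as a function of one component `x` of the momentum. -/
def hyp (a x : ℝ) : ℝ := √(x ^ 2 + a ^ 2)

section Hyp

variable {a : ℝ}

theorem hyp_sq (a x : ℝ) : hyp a x ^ 2 = x ^ 2 + a ^ 2 := Real.sq_sqrt (by positivity)

theorem le_hyp (a x : ℝ) : a ≤ hyp a x := Real.le_sqrt_of_sq_le (by nlinarith [sq_nonneg x])

theorem abs_le_hyp (a x : ℝ) : |x| ≤ hyp a x :=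
  Real.abs_le_sqrt (by nlinarith [sq_nonneg a])

theorem hyp_pos (ha : 0 < a) (x : ℝ) : 0 < hyp a x := ha.trans_le (le_hyp a x)

theorem hasDerivAt_hyp (ha : 0 < a) (x : ℝ) : HasDerivAt (hyp a) (x / hyp a x) x := by
  have h1 : HasDerivAt (fun x : ℝ => x ^ 2 + a ^ 2) (2 * x) x := by
    simpa using (hasDerivAt_pow 2 x).add_const (a ^ 2)
  refine (h1.sqrt (by positivity)).congr_deriv ?_
  rw [← hyp, mul_div_mul_left _ _ two_ne_zero]

theorem hasDerivAt_velocity (ha : 0 < a) (x : ℝ) :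
    HasDerivAt (fun x => x / hyp a x) (a ^ 2 / hyp a x ^ 3) x := by
  have hp := hyp_pos ha x
  refine ((hasDerivAt_id x).div (hasDerivAt_hyp ha x) hp.ne').congr_deriv ?_
  have := hyp_sq a x
  simp only [id]
  field_simp
  linarith

theorem hasDerivAt_acceleration (ha : 0 < a) (x : ℝ) :
    HasDerivAt (fun x => a ^ 2 / hyp a x ^ 3) (-(3 * a ^ 2 * x) / hyp a x ^ 5) x := by
  have hp := hyp_pos ha x
  refine ((hasDerivAt_const x (a ^ 2)).div ((hasDerivAt_hyp ha x).pow 3)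
    (by simp only [Pi.pow_apply]; positivity)).congr_deriv ?_
  simp only [Pi.pow_apply]
  field_simp
  push_cast
  ring

theorem abs_velocity_le (ha : 0 < a) (x : ℝ) : |x / hyp a x| ≤ 1 := by
  rw [abs_div, abs_of_pos (hyp_pos ha x)]
  exact div_le_one_of_le₀ (abs_le_hyp a x) (hyp_pos ha x).le

theorem hyp_add_le (a x : ℝ) {t : ℝ} (ht : 0 ≤ t) : hyp a (x + t) ≤ hyp a x + t := by
  have h0 : 0 ≤ hyp a x := Real.sqrt_nonneg _
  refine Real.sqrt_le_iff.2 ⟨by positivity, ?_⟩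
  nlinarith [hyp_sq a x, (le_abs_self x).trans (abs_le_hyp a x)]

end Hyp

/-- The difference of two energies at momenta which differ by `r`, up to a shift `b` and the
factor `r`. -/
def energyGap (a b r x : ℝ) : ℝ := (hyp a (x + r) - hyp a x - b) / r

/-- The derivative of `energyGap`. -/
def energyGapDeriv (a r x : ℝ) : ℝ := ((x + r) / hyp a (x + r) - x / hyp a x) / r

section EnergyGap

variable {a b r m : ℝ}

theorem hasDerivAt_hyp_add (ha : 0 < a) (x : ℝ) :
    HasDerivAt (fun x => hyp a (x + r)) ((x + r) / hyp a (x + r)) x := by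
  simpa using (hasDerivAt_hyp ha (x + r)).comp_add_const x r

theorem hasDerivAt_energyGap (ha : 0 < a) (x : ℝ) :
    HasDerivAt (energyGap a b r) (energyGapDeriv a r x) x :=
  (((hasDerivAt_hyp_add ha x).sub (hasDerivAt_hyp ha x)).sub_const b).div_const r

theorem hasDerivAt_energyGapDeriv (ha : 0 < a) (x : ℝ) :
    HasDerivAt (energyGapDeriv a r)
      ((a ^ 2 / hyp a (x + r) ^ 3 - a ^ 2 / hyp a x ^ 3) / r) x := by
  have h : HasDerivAt (fun x => (x + r) / hyp a (x + r)) (a ^ 2 / hyp a (x + r) ^ 3) x := by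
    simpa using (hasDerivAt_velocity ha (x + r)).comp_add_const x r
  exact (h.sub (hasDerivAt_velocity ha x)).div_const r

/-- By convexity of the energy, the gap is increasing, with a quantitative bound. -/
theorem le_energyGapDeriv (ha : 0 < a) (hr : 0 < r) (x : ℝ) :
    a ^ 2 / (hyp a x + r) ^ 3 ≤ energyGapDeriv a r x := by
  obtain ⟨ξ, hξ, h⟩ := exists_hasDerivAt_eq_slope (fun x => x / hyp a x)
    (fun x => a ^ 2 / hyp a x ^ 3) (lt_add_of_pos_right x hr)
    (fun y _ => (hasDerivAt_velocity ha y).continuousAt.continuousWithinAt)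
    (fun y _ => hasDerivAt_velocity ha y)
  rw [add_sub_cancel_left] at h
  rw [energyGapDeriv, ← h]
  have h1 : hyp a ξ ≤ hyp a x + r := by
    have := hyp_add_le a x (sub_nonneg.2 hξ.1.le)
    rw [add_sub_cancel] at this
    linarith [hξ.2]
  have := hyp_pos ha ξ
  gcongr

theorem energyGapDeriv_pos (ha : 0 < a) (hr : 0 < r) (x : ℝ) : 0 < energyGapDeriv a r x := by
  have := hyp_pos ha x
  exact lt_of_lt_of_le (by positivity) (le_energyGapDeriv ha hr x)

theorem inv_energyGapDeriv_le (hm : 0 < m) (hma : m ≤ a) (hr : 0 < r) (x : ℝ) :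
    (energyGapDeriv a r x)⁻¹ ≤ (hyp a x * (1 + r / m)) ^ 3 / m ^ 2 := by
  have ha := hm.trans_le hma
  have hp := hyp_pos ha x
  have h1 : hyp a x + r ≤ hyp a x * (1 + r / m) := by
    have h2 : r = m * (r / m) := by field_simp
    nlinarith [hma.trans (le_hyp a x), div_pos hr hm]
  calc (energyGapDeriv a r x)⁻¹ ≤ (a ^ 2 / (hyp a x + r) ^ 3)⁻¹ :=
        inv_anti₀ (by positivity) (le_energyGapDeriv ha hr x)
    _ = (hyp a x + r) ^ 3 / a ^ 2 := inv_div _ _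
    _ ≤ _ := by gcongr

theorem abs_deriv_energyGapDeriv_le (hm : 0 < m) (hma : m ≤ a) (hr : 0 < r) (x : ℝ) :
    |(a ^ 2 / hyp a (x + r) ^ 3 - a ^ 2 / hyp a x ^ 3) / r| ≤ 3 / m ^ 2 := by
  have ha := hm.trans_le hma
  obtain ⟨ξ, -, h⟩ := exists_hasDerivAt_eq_slope (fun x => a ^ 2 / hyp a x ^ 3)
    (fun x => -(3 * a ^ 2 * x) / hyp a x ^ 5) (lt_add_of_pos_right x hr)
    (fun y _ => (hasDerivAt_acceleration ha y).continuousAt.continuousWithinAt)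
    (fun y _ => hasDerivAt_acceleration ha y)
  rw [add_sub_cancel_left] at h
  have hp := hyp_pos ha ξ
  rw [← h, abs_div, abs_neg, abs_mul, abs_of_pos (by positivity : 0 < 3 * a ^ 2),
    abs_of_pos (by positivity : 0 < hyp a ξ ^ 5)]
  rw [div_le_div_iff₀ (by positivity) (by positivity)]
  have h1 := abs_le_hyp a ξ
  have h2 := le_hyp a ξ
  calc 3 * a ^ 2 * |ξ| * m ^ 2 ≤ 3 * hyp a ξ ^ 2 * hyp a ξ * hyp a ξ ^ 2 := by
        gcongr
        exact hma.trans h2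
    _ = _ := by ring

theorem tendsto_zero_of_norm_le_inv_hyp {q : ℝ → ℂ} {C : ℝ}
    (hq : ∀ x, ‖q x‖ ≤ C * (hyp a x)⁻¹) {l : Filter ℝ} (hl : Tendsto (fun x : ℝ => |x|) l atTop) :
    Tendsto q l (𝓝 0) := by
  refine squeeze_zero_norm hq ?_
  have h1 : Tendsto (hyp a) l atTop := tendsto_atTop_mono (abs_le_hyp a) hl
  simpa using (tendsto_inv_atTop_zero.comp h1).const_mul C

theorem inv_sq_add_sq_le (hm : 0 < m) (hma : m ≤ a) (x : ℝ) :
    (x ^ 2 + a ^ 2)⁻¹ ≤ (1 + m⁻¹ ^ 2) * (1 + x ^ 2)⁻¹ := by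
  have ha := hm.trans_le hma
  rw [← div_eq_mul_inv, ← one_div, div_le_div_iff₀ (by positivity) (by positivity), one_mul]
  have h1 : 1 ≤ m⁻¹ ^ 2 * a ^ 2 := by
    rw [← mul_pow]
    exact one_le_pow₀ (by rw [inv_mul_eq_div, one_le_div hm]; exact hma)
  nlinarith [sq_nonneg x, sq_nonneg a, mul_nonneg (sq_nonneg m⁻¹) (sq_nonneg x)]

/-- The mass-dependent constant in the bounds of `isRegularDensity_energyGap`. -/
def lineConst (m : ℝ) : ℝ := 4 * m⁻¹ ^ 8 + m⁻¹ ^ 7 + m⁻¹ ^ 7 * ((1 + m⁻¹ ^ 2) * 4)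

theorem hyp_pow_inv_le (hm : 0 < m) (hma : m ≤ a) (x : ℝ) (i k : ℕ) :
    (hyp a x ^ (k + i))⁻¹ ≤ m⁻¹ ^ i * (a ^ k)⁻¹ := by
  have ha := hm.trans_le hma
  have h := le_hyp a x
  rw [pow_add, mul_inv, mul_comm, inv_pow]
  have := hyp_pos ha x
  have := hma.trans h
  gcongr

/-- Functions on the line which decay with their derivative have a regular density in the
variable `energyGap`, uniformly in the shift `b`. -/
theorem isRegularDensity_energyGap (hm : 0 < m) (hma : m ≤ a) (hr : 0 < r) {G G' : ℝ → ℂ}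
    {A : ℝ} {k : ℕ} (hG : ∀ x, HasDerivAt G (G' x) x)
    (hGA : ∀ x, ‖G x‖ ≤ A * (hyp a x ^ (k + 9))⁻¹)
    (hGA' : ∀ x, ‖G' x‖ ≤ A * (hyp a x ^ (k + 9))⁻¹) :
    IsRegularDensity (lineConst m * (A * (1 + r / m) ^ 9 * (a ^ k)⁻¹))
      (pushDensity (energyGap a b r) (energyGapDeriv a r) G) := by
  have ha := hm.trans_le hma
  have hd : ∀ x, HasDerivAt (energyGap a b r) (energyGapDeriv a r x) x :=
    hasDerivAt_energyGap ha
  have hpos := energyGapDeriv_pos ha hr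
  set ρ := 1 + r / m with hρ
  have hρ1 : 1 ≤ ρ := by
    rw [hρ]
    have := div_pos hr hm
    linarith
  have hA : 0 ≤ A := by
    have h0 := (norm_nonneg _).trans (hGA 0)
    have := hyp_pos ha 0
    exact nonneg_of_mul_nonneg_left h0 (by positivity)
  have hmi : 0 < m⁻¹ := inv_pos.2 hm
  have hZ : ∀ x, (energyGapDeriv a r x)⁻¹ ≤ hyp a x ^ 3 * ρ ^ 3 * m⁻¹ ^ 2 := fun x => by
    have := inv_energyGapDeriv_le hm hma hr x
    rwa [mul_pow, div_eq_mul_inv, ← inv_pow] at this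
  have hZ0 : ∀ x, 0 ≤ (energyGapDeriv a r x)⁻¹ := fun x => (inv_pos.2 (hpos x)).le
  have hq : ∀ x, ‖G x / energyGapDeriv a r x‖ ≤
      A * ρ ^ 3 * m⁻¹ ^ 2 * (hyp a x ^ (k + 6))⁻¹ := fun x => by
    have hp := hyp_pos ha x
    rw [div_eq_mul_inv, norm_mul, norm_inv, Complex.norm_real, Real.norm_eq_abs,
      abs_of_pos (hpos x)]
    refine (mul_le_mul (hGA x) (hZ x) (hZ0 x) (by positivity)).trans (le_of_eq ?_)
    rw [show k + 9 = (k + 6) + 3 by ring, pow_add]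
    field_simp
  have hlip : ∀ x, ‖(G' x * energyGapDeriv a r x - G x *
      (((a ^ 2 / hyp a (x + r) ^ 3 - a ^ 2 / hyp a x ^ 3) / r : ℝ) : ℂ)) /
        (energyGapDeriv a r x : ℂ) ^ 2‖ ≤
      lineConst m * (A * ρ ^ 9 * (a ^ k)⁻¹) * energyGapDeriv a r x := by
    intro x
    have hp := hyp_pos ha x
    have hH := hpos x
    set e := energyGapDeriv a r x with he
    set d := (a ^ 2 / hyp a (x + r) ^ 3 - a ^ 2 / hyp a x ^ 3) / r
    have hdle : |d| ≤ 3 / m ^ 2 := abs_deriv_energyGapDeriv_le hm hma hr x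
    have h1 : ‖G' x * e - G x * (d : ℂ)‖ ≤
        A * (hyp a x ^ (k + 9))⁻¹ * e + A * (hyp a x ^ (k + 9))⁻¹ * (3 / m ^ 2) := by
      refine (norm_sub_le _ _).trans (add_le_add ?_ ?_)
      · rw [norm_mul, Complex.norm_real, Real.norm_eq_abs, abs_of_pos hH]
        gcongr
        exact hGA' x
      · rw [norm_mul, Complex.norm_real, Real.norm_eq_abs]
        gcongr
        exact hGA x
    rw [norm_div, norm_pow, Complex.norm_real, Real.norm_eq_abs, abs_of_pos hH,
      div_le_iff₀ (by positivity)]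
    refine h1.trans ?_
    have hZx := hZ x
    rw [← he] at hZx
    have e1 : 1 ≤ hyp a x ^ 3 * ρ ^ 3 * m⁻¹ ^ 2 * e := by
      rwa [inv_le_iff_one_le_mul₀ hH] at hZx
    have h7 : (hyp a x ^ (k + 9))⁻¹ ≤
        (hyp a x ^ (k + 9))⁻¹ * (hyp a x ^ 3 * ρ ^ 3 * m⁻¹ ^ 2 * e) ^ 2 :=
      le_mul_of_one_le_right (by positivity) (one_le_pow₀ e1)
    have h8 : (hyp a x ^ (k + 9))⁻¹ ≤
        (hyp a x ^ (k + 9))⁻¹ * (hyp a x ^ 3 * ρ ^ 3 * m⁻¹ ^ 2 * e) ^ 3 :=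
      le_mul_of_one_le_right (by positivity) (one_le_pow₀ e1)
    have s1 : (hyp a x ^ (k + 9))⁻¹ * (hyp a x ^ 3 * ρ ^ 3 * m⁻¹ ^ 2 * e) ^ 2 =
        (hyp a x ^ (k + 3))⁻¹ * (ρ ^ 6 * m⁻¹ ^ 4 * e ^ 2) := by
      rw [show k + 9 = (k + 3) + 6 by ring, pow_add]
      field_simp
    have s2 : (hyp a x ^ (k + 9))⁻¹ * (hyp a x ^ 3 * ρ ^ 3 * m⁻¹ ^ 2 * e) ^ 3 =
        (hyp a x ^ k)⁻¹ * (ρ ^ 9 * m⁻¹ ^ 6 * e ^ 3) := by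
      rw [pow_add]
      field_simp
    have b1 : A * (hyp a x ^ (k + 9))⁻¹ * e ≤
        A * (m⁻¹ ^ 3 * (a ^ k)⁻¹ * (ρ ^ 9 * m⁻¹ ^ 4 * e ^ 2)) * e := by
      gcongr
      refine h7.trans (s1.le.trans ?_)
      gcongr
      · exact hyp_pow_inv_le hm hma x 3 k
      · norm_num
    have b2 : A * (hyp a x ^ (k + 9))⁻¹ * (3 / m ^ 2) ≤
        A * ((a ^ k)⁻¹ * (ρ ^ 9 * m⁻¹ ^ 6 * e ^ 3)) * (3 / m ^ 2) := by
      gcongr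
      refine h8.trans (s2.le.trans ?_)
      gcongr
      exact le_hyp a x
    refine (add_le_add b1 b2).trans ?_
    have hsum : A * (m⁻¹ ^ 3 * (a ^ k)⁻¹ * (ρ ^ 9 * m⁻¹ ^ 4 * e ^ 2)) * e +
        A * ((a ^ k)⁻¹ * (ρ ^ 9 * m⁻¹ ^ 6 * e ^ 3)) * (3 / m ^ 2) =
        (m⁻¹ ^ 7 + 3 * m⁻¹ ^ 8) * (A * ρ ^ 9 * (a ^ k)⁻¹) * e * e ^ 2 := by
      field_simp
    rw [hsum]
    gcongr
    rw [lineConst]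
    nlinarith [pow_pos hmi 8, pow_pos hmi 7, pow_pos hmi 2]
  have hC0 : 0 < lineConst m := by
    rw [lineConst]
    positivity
  have hbd : ∀ x, ‖G x / energyGapDeriv a r x‖ ≤ lineConst m * (A * ρ ^ 9 * (a ^ k)⁻¹) := by
    intro x
    refine (hq x).trans ?_
    have hp := hyp_pos ha x
    calc A * ρ ^ 3 * m⁻¹ ^ 2 * (hyp a x ^ (k + 6))⁻¹
        ≤ A * ρ ^ 9 * m⁻¹ ^ 2 * (m⁻¹ ^ 6 * (a ^ k)⁻¹) := by
          gcongr
          · norm_num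
          · exact hyp_pow_inv_le hm hma x 6 k
      _ = m⁻¹ ^ 8 * (A * ρ ^ 9 * (a ^ k)⁻¹) := by ring
      _ ≤ _ := by
        gcongr
        rw [lineConst]
        nlinarith [pow_pos hmi 8, pow_pos hmi 7, pow_pos hmi 2]
  have hqinv : ∀ x, ‖G x / energyGapDeriv a r x‖ ≤
      A * ρ ^ 3 * m⁻¹ ^ 2 * (m⁻¹ ^ (k + 5)) * (hyp a x)⁻¹ := by
    intro x
    refine (hq x).trans ?_
    have hp := hyp_pos ha x
    rw [mul_assoc _ (m⁻¹ ^ (k + 5)), show k + 6 = (k + 5) + 1 by ring,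
      pow_succ (hyp a x), mul_inv]
    gcongr
    rw [inv_pow]
    gcongr
    exact hma.trans (le_hyp a x)
  have hGle : ∀ x, ‖G x‖ ≤ A * (m⁻¹ ^ 7 * (a ^ k)⁻¹) * ((1 + m⁻¹ ^ 2) * (1 + x ^ 2)⁻¹) := by
    intro x
    refine (hGA x).trans ?_
    have hp := hyp_pos ha x
    rw [mul_assoc]
    gcongr
    rw [show k + 9 = (k + 7) + 2 by ring, pow_add, mul_inv, hyp_sq]
    gcongr
    · exact hyp_pow_inv_le hm hma x 7 k
    · exact inv_sq_add_sq_le hm hma x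
  have hint : Integrable fun x : ℝ =>
      A * (m⁻¹ ^ 7 * (a ^ k)⁻¹) * ((1 + m⁻¹ ^ 2) * (1 + x ^ 2)⁻¹) :=
    (integrable_inv_one_add_sq.const_mul _).const_mul _
  have hGint : Integrable G := hint.mono'
    (continuous_iff_continuousAt.2 fun x => (hG x).continuousAt).aestronglyMeasurable
    (Eventually.of_forall hGle)
  refine ⟨lipschitz_pushDensity hd hpos (fun x => ?_) hlip
    (tendsto_zero_of_norm_le_inv_hyp hqinv tendsto_abs_atTop_atTop)
    (tendsto_zero_of_norm_le_inv_hyp hqinv tendsto_abs_atBot_atTop),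
    norm_pushDensity_le (strictMono_of_hasDerivAt_pos hd hpos) hbd,
    integrable_pushDensity hd hpos hGint, ?_⟩
  · exact (hG x).div ((hasDerivAt_energyGapDeriv ha x).ofReal_comp)
      (Complex.ofReal_ne_zero.2 (hpos x).ne')
  · rw [integral_norm_pushDensity hd hpos]
    refine (integral_mono hGint.norm hint hGle).trans ?_
    rw [integral_const_mul, integral_const_mul, integral_univ_inv_one_add_sq]
    calc A * (m⁻¹ ^ 7 * (a ^ k)⁻¹) * ((1 + m⁻¹ ^ 2) * Real.pi)
        ≤ A * (m⁻¹ ^ 7 * (ρ ^ 9 * (a ^ k)⁻¹)) * ((1 + m⁻¹ ^ 2) * 4) := by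
          have h9 : 1 ≤ ρ ^ 9 := one_le_pow₀ hρ1
          gcongr
          · exact le_mul_of_one_le_left (by positivity) h9
          · exact Real.pi_lt_four.le
      _ = m⁻¹ ^ 7 * ((1 + m⁻¹ ^ 2) * 4) * (A * ρ ^ 9 * (a ^ k)⁻¹) := by ring
      _ ≤ _ := by
        gcongr
        rw [lineConst]
        nlinarith [pow_pos hmi 8, pow_pos hmi 7]

end EnergyGap

/-! ### Limits along a line -/

/-- The reciprocal, truncated at distance `ε` from zero. -/
def truncInv (ε v : ℝ) : ℂ := if ε < |v| then (v : ℂ)⁻¹ else 0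

/-- The normalized indicator function of an interval of half-width `ε`. -/
def boxDelta (ε v : ℝ) : ℂ := if |v| < ε then ((2 * ε : ℝ) : ℂ)⁻¹ else 0

theorem measurable_truncInv (ε : ℝ) : Measurable (truncInv ε) :=
  Measurable.ite (measurableSet_lt measurable_const (by fun_prop)) (by fun_prop) measurable_const

theorem measurable_boxDelta (ε : ℝ) : Measurable (boxDelta ε) :=
  Measurable.ite (measurableSet_lt (by fun_prop) measurable_const) measurable_const
    measurable_const

theorem norm_truncInv_le {ε : ℝ} (hε : 0 < ε) (v : ℝ) : ‖truncInv ε v‖ ≤ ε⁻¹ := by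
  rw [truncInv]
  split_ifs with h
  · rw [norm_inv, Complex.norm_real, Real.norm_eq_abs]
    gcongr
  · rw [norm_zero]
    positivity

theorem norm_boxDelta_le {ε : ℝ} (hε : 0 < ε) (v : ℝ) : ‖boxDelta ε v‖ ≤ ε⁻¹ := by
  rw [boxDelta]
  split_ifs with h
  · rw [norm_inv, Complex.norm_real, Real.norm_eq_abs, abs_of_pos (by positivity)]
    gcongr
    linarith
  · rw [norm_zero]
    positivity

theorem truncInv_neg_mul {r : ℝ} (hr : 0 < r) (ε v : ℝ) :
    truncInv ε (-(r * v)) = -(r : ℂ)⁻¹ * truncInv (ε / r) v := by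
  have e : ε < |-(r * v)| ↔ ε / r < |v| := by
    rw [abs_neg, abs_mul, abs_of_pos hr, div_lt_iff₀ hr, mul_comm]
  simp only [truncInv, e]
  split_ifs
  · push_cast
    rw [← neg_mul, mul_inv, inv_neg]
  · rw [mul_zero]

theorem boxDelta_neg_mul {r : ℝ} (hr : 0 < r) (ε v : ℝ) :
    boxDelta ε (-(r * v)) = (r : ℂ)⁻¹ * boxDelta (ε / r) v := by
  have e : |-(r * v)| < ε ↔ |v| < ε / r := by
    rw [abs_neg, abs_mul, abs_of_pos hr, lt_div_iff₀ hr, mul_comm]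
  have hr0 : (r : ℂ) ≠ 0 := Complex.ofReal_ne_zero.2 hr.ne'
  simp only [boxDelta, e]
  split_ifs
  · push_cast
    field_simp
  · rw [mul_zero]

theorem tendsto_div_const_nhdsGT {r : ℝ} (hr : 0 < r) :
    Tendsto (fun ε : ℝ => ε / r) (𝓝[>] 0) (𝓝[>] 0) := by
  refine tendsto_nhdsWithin_iff.2 ⟨?_, ?_⟩
  · have : Tendsto (fun ε : ℝ => ε / r) (𝓝 0) (𝓝 (0 / r)) := tendsto_id.div_const r
    rw [zero_div] at this
    exact this.mono_left nhdsWithin_le_nhds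
  · filter_upwards [self_mem_nhdsWithin] with ε hε
    exact div_pos hε hr

section Substitution

variable {H H' c : ℝ → ℝ} {g : ℝ → ℂ} {A m : ℝ}

/-- Limits of truncated integrals in a variable `H · c`, where `H` is a coordinate and `c` is
positive on the support of the integrand. -/
theorem limits_of_isRegularDensity (hH : ∀ x, HasDerivAt H (H' x) x) (hpos : ∀ x, 0 < H' x)
    (hcont : Continuous c) (hm : 0 < m) (hc : ∀ x, g x ≠ 0 → m ≤ c x)
    (h : IsRegularDensity A (pushDensity H H' fun x => g x / c x))
    (h₁ : IsRegularDensity A (pushDensity H H' g)) :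
    (∀ δ, 0 < δ → ‖∫ x, truncInv δ (H x * c x) * g x‖ ≤ (7 + 2 * m⁻¹) * A) ∧
    (∀ δ, 0 < δ → ‖∫ x, boxDelta δ (H x * c x) * g x‖ ≤ 2 * m⁻¹ * A) ∧
    Tendsto (fun δ => ∫ x, truncInv δ (H x * c x) * g x) (𝓝[>] 0)
      (𝓝 (pv (pushDensity H H' fun x => g x / c x))) ∧
    Tendsto (fun δ => ∫ x, boxDelta δ (H x * c x) * g x) (𝓝[>] 0)
      (𝓝 (pushDensity H H' (fun x => g x / c x) 0)) := by
  have hmono := strictMono_of_hasDerivAt_pos hH hpos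
  have hHc : Continuous H := continuous_iff_continuousAt.2 fun x => (hH x).continuousAt
  set cw : ℝ → ℝ := Function.extend H c fun _ => m with hcw
  have hcwH : ∀ x, cw (H x) = c x := fun x => hmono.injective.extend_apply _ _ x
  have hcwm : Measurable cw :=
    (hHc.measurableEmbedding hmono.injective).measurable_extend hcont.measurable
      measurable_const
  have hψ : ∀ w, pushDensity H H' g w = cw w * pushDensity H H' (fun x => g x / c x) w := by
    intro w
    by_cases hw : w ∈ Set.range H
    · obtain ⟨x, rfl⟩ := hw
      rw [hcwH, pushDensity_apply hmono, pushDensity_apply hmono]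
      by_cases hg : g x = 0
      · simp [hg]
      · have : (c x : ℂ) ≠ 0 := Complex.ofReal_ne_zero.2 (hm.trans_le (hc x hg)).ne'
        field_simp
    · rw [pushDensity_apply_of_notMem w hw, pushDensity_apply_of_notMem w hw, mul_zero]
  have hcle : ∀ w, pushDensity H H' (fun x => g x / c x) w ≠ 0 → m ≤ cw w := by
    intro w hw
    by_cases hr : w ∈ Set.range H
    · obtain ⟨x, rfl⟩ := hr
      rw [hcwH]
      refine hc x fun h0 => hw ?_
      rw [pushDensity_apply hmono, h0, zero_div, zero_div]
    · exact (hw (pushDensity_apply_of_notMem w hr)).elim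
  have hc0 : pushDensity H H' (fun x => g x / c x) 0 ≠ 0 → ContinuousAt cw 0 := by
    intro h0
    have hr : (0 : ℝ) ∈ Set.range H := by
      by_contra hr
      exact h0 (pushDensity_apply_of_notMem 0 hr)
    obtain ⟨x, hx⟩ := hr
    have hopen : map H (𝓝 x) = 𝓝 (H x) := by
      have hemb : IsOpenEmbedding H := by
        refine ⟨hmono.isEmbedding_of_ordConnected (isPreconnected_range hHc).ordConnected, ?_⟩
        · rw [isOpen_iff_mem_nhds]
          rintro _ ⟨y, rfl⟩
          have hsub : Set.Icc (H (y - 1)) (H (y + 1)) ⊆ Set.range H :=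
            (isPreconnected_range hHc).Icc_subset ⟨_, rfl⟩ ⟨_, rfl⟩
          exact mem_of_superset (Icc_mem_nhds (hmono (by linarith)) (hmono (by linarith))) hsub
      exact hemb.map_nhds_eq x
    rw [ContinuousAt, ← hx, ← hopen, tendsto_map'_iff, hcwH]
    exact (hcont.tendsto x).congr fun y => (hcwH y).symm
  have hpt : ∀ x, 0 < c x → |H x * c x| = |H x| * c x := fun x hx => by
    rw [abs_mul, abs_of_pos hx]
  have i1 : ∀ δ, 0 < δ → ∫ x, truncInv δ (H x * c x) * g x =
      ∫ w : ℝ, (if δ < |w| * cw w then (w : ℂ)⁻¹ else 0) *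
        pushDensity H H' (fun x => g x / c x) w := by
    intro δ hδ
    rw [integral_mul_pushDensity hH hpos fun w => if δ < |w| * cw w then (w : ℂ)⁻¹ else 0]
    refine integral_congr_ae (Eventually.of_forall fun x => ?_)
    by_cases hg : g x = 0
    · simp [hg]
    · have hcx := hm.trans_le (hc x hg)
      have : (c x : ℂ) ≠ 0 := Complex.ofReal_ne_zero.2 hcx.ne'
      simp only [truncInv, hpt x hcx, hcwH]
      split_ifs
      · push_cast
        rw [mul_inv]
        field_simp
      · simp
  have i2 : ∀ δ, 0 < δ → ∫ x, boxDelta δ (H x * c x) * g x =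
      ∫ w : ℝ, (if |w| * cw w < δ then ((2 * δ : ℝ) : ℂ)⁻¹ else 0) * pushDensity H H' g w := by
    intro δ hδ
    rw [integral_mul_pushDensity hH hpos
      fun w => if |w| * cw w < δ then ((2 * δ : ℝ) : ℂ)⁻¹ else 0]
    refine integral_congr_ae (Eventually.of_forall fun x => ?_)
    by_cases hg : g x = 0
    · simp [hg]
    · simp only [boxDelta, hpt x (hm.trans_le (hc x hg)), hcwH]
  refine ⟨fun δ hδ => ?_, fun δ hδ => ?_, ?_, ?_⟩
  · rw [i1 δ hδ]
    exact norm_integral_truncation_le h h₁ hcwm hm hψ hcle hδ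
  · rw [i2 δ hδ]
    exact norm_integral_average_le h₁ hm hψ hcle hδ
  · refine (tendsto_integral_truncation h h₁ hcwm hm hψ hcle hc0).congr' ?_
    filter_upwards [self_mem_nhdsWithin] with δ hδ
    exact (i1 δ hδ).symm
  · refine (tendsto_integral_average h₁ hcwm hm hψ hcle hc0).congr' ?_
    filter_upwards [self_mem_nhdsWithin] with δ hδ
    exact (i2 δ hδ).symm

end Substitution

/-- Energy of the recoiling vector minus its on-shell energy, along a line. -/
def lineGap (a b r x : ℝ) : ℝ := hyp a x + b - hyp a (x + r)

/-- Energy of the recoiling vector plus its on-shell energy, along a line. -/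
def lineSum (a b r x : ℝ) : ℝ := hyp a x + b + hyp a (x + r)

section Line

variable {a b r m : ℝ}

theorem continuous_hyp (a : ℝ) : Continuous (hyp a) := by
  unfold hyp
  fun_prop

theorem lineGap_eq (hr : 0 < r) (x : ℝ) : lineGap a b r x = -(r * energyGap a b r x) := by
  rw [lineGap, energyGap]
  field_simp
  ring

theorem lineGap_mul_lineSum_eq (hr : 0 < r) (x : ℝ) : lineGap a b r x * lineSum a b r x =
    -(r * (energyGap a b r x * lineSum a b r x)) := by
  rw [lineGap_eq hr]
  ring

/-- Division by the sum of the energies, which is positive on the support. -/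
theorem hasDerivAt_div_lineSum (hm : 0 < m) (hma : m ≤ a) {g g' : ℝ → ℂ} {A : ℝ} {k : ℕ}
    (hg : ∀ x, HasDerivAt g (g' x) x) (hgA : ∀ x, ‖g x‖ ≤ A * (hyp a x ^ k)⁻¹)
    (hgA' : ∀ x, ‖g' x‖ ≤ A * (hyp a x ^ k)⁻¹) {c₀ : ℝ} (hc₀ : 0 < c₀)
    (hsupp : ∀ x, g x ≠ 0 → c₀ ≤ hyp a x + b) :
    ∃ g₁' : ℝ → ℂ, (∀ x, HasDerivAt (fun x => g x / lineSum a b r x) (g₁' x) x) ∧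
      (∀ x, ‖g x / lineSum a b r x‖ ≤ (m⁻¹ + 2 * m⁻¹ ^ 2) * A * (hyp a x ^ k)⁻¹) ∧
      ∀ x, ‖g₁' x‖ ≤ (m⁻¹ + 2 * m⁻¹ ^ 2) * A * (hyp a x ^ k)⁻¹ := by
  have ha := hm.trans_le hma
  have hmi : 0 < m⁻¹ := inv_pos.2 hm
  have hA : 0 ≤ A := by
    have h0 := (norm_nonneg _).trans (hgA 0)
    have := hyp_pos ha 0
    exact nonneg_of_mul_nonneg_left h0 (by positivity)
  have hcm : ∀ x, 0 < hyp a x + b → m ≤ lineSum a b r x := fun x hx => by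
    rw [lineSum]
    linarith [le_hyp a (x + r)]
  set c' : ℝ → ℝ := fun x => x / hyp a x + (x + r) / hyp a (x + r) with hc'
  have hcd : ∀ x, HasDerivAt (lineSum a b r) (c' x) x := fun x =>
    ((hasDerivAt_hyp ha x).add_const b).add (hasDerivAt_hyp_add ha x)
  have hcle : ∀ x, |c' x| ≤ 2 := fun x =>
    (abs_add_le _ _).trans (by linarith [abs_velocity_le ha x, abs_velocity_le ha (x + r)])
  refine ⟨fun x => if 0 < hyp a x + b then
    (g' x * lineSum a b r x - g x * c' x) / (lineSum a b r x : ℂ) ^ 2 else 0,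
    fun x => ?_, fun x => ?_, fun x => ?_⟩
  · beta_reduce
    split_ifs with hx
    · exact (hg x).div (hcd x).ofReal_comp
        (Complex.ofReal_ne_zero.2 (hm.trans_le (hcm x hx)).ne')
    · have hev : ∀ᶠ y in 𝓝 x, hyp a y + b < c₀ :=
        (((continuous_hyp a).add continuous_const).tendsto x).eventually_lt_const
          (lt_of_le_of_lt (not_lt.1 hx) hc₀)
      refine (hasDerivAt_const x (0 : ℂ)).congr_of_eventuallyEq ?_
      filter_upwards [hev] with y hy
      have : g y = 0 := by
        by_contra h
        exact (hsupp y h).not_gt hy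
      rw [this, zero_div]
  · by_cases h0 : g x = 0
    · rw [h0, zero_div, norm_zero]
      have := hyp_pos ha x
      positivity
    · have hc := hcm x (hc₀.trans_le (hsupp x h0))
      rw [norm_div, Complex.norm_real, Real.norm_eq_abs, abs_of_pos (hm.trans_le hc),
        div_eq_inv_mul, mul_assoc]
      have h1 : (lineSum a b r x)⁻¹ ≤ m⁻¹ + 2 * m⁻¹ ^ 2 :=
        (inv_anti₀ hm hc).trans (by linarith [pow_pos hmi 2])
      exact mul_le_mul h1 (hgA x) (norm_nonneg _) (by positivity)
  · have hp := hyp_pos ha x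
    beta_reduce
    split_ifs with hx
    · have hc := hcm x hx
      have hcp := hm.trans_le hc
      have hcinv : (lineSum a b r x)⁻¹ ≤ m⁻¹ := inv_anti₀ hm hc
      have hc0 : (lineSum a b r x : ℂ) ≠ 0 := Complex.ofReal_ne_zero.2 hcp.ne'
      have e : (g' x * lineSum a b r x - g x * c' x) / (lineSum a b r x : ℂ) ^ 2 =
          ((lineSum a b r x)⁻¹ : ℝ) * g' x -
            (((lineSum a b r x)⁻¹ ^ 2 : ℝ) : ℂ) * (g x * c' x) := by
        push_cast
        field_simp
      rw [e]
      refine (norm_sub_le _ _).trans ?_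
      rw [norm_mul, norm_mul, norm_mul, Complex.norm_real, Complex.norm_real, Complex.norm_real,
        Real.norm_eq_abs, Real.norm_eq_abs, Real.norm_eq_abs, abs_of_pos (inv_pos.2 hcp),
        abs_of_pos (pow_pos (inv_pos.2 hcp) 2)]
      calc (lineSum a b r x)⁻¹ * ‖g' x‖ + (lineSum a b r x)⁻¹ ^ 2 * (‖g x‖ * |c' x|)
          ≤ m⁻¹ * (A * (hyp a x ^ k)⁻¹) + m⁻¹ ^ 2 * ((A * (hyp a x ^ k)⁻¹) * 2) := by
            gcongr
            · exact hgA' x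
            · exact hgA x
            · exact hcle x
        _ = _ := by ring
    · rw [norm_zero]
      positivity

/-- The constant in the estimates along a line. -/
def lineBound (m : ℝ) : ℝ :=
  (18 + 4 * m⁻¹) * ((1 + m⁻¹ + 2 * m⁻¹ ^ 2) * lineConst m)

/-- Along a line in momentum space, the truncated integrals of `1 / (h c)`, with or without an
oscillating factor `exp (-i t h)`, converge, and so do the averages which approximate
`δ (h c)`. Here `h` and `c` are difference and sum of the energies. All bounds are uniform in the
energy shift `b`, and the bound for the limits is uniform in `t`. -/
theorem exists_line_limits (hm : 0 < m) (hma : m ≤ a) (hr : 0 < r) {g g' : ℝ → ℂ}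
    {A : ℝ} {k : ℕ} (hg : ∀ x, HasDerivAt g (g' x) x)
    (hgA : ∀ x, ‖g x‖ ≤ A * (hyp a x ^ (k + 9))⁻¹)
    (hgA' : ∀ x, ‖g' x‖ ≤ A * (hyp a x ^ (k + 9))⁻¹) {c₀ : ℝ} (hc₀ : 0 < c₀)
    (hsupp : ∀ x, g x ≠ 0 → c₀ ≤ hyp a x + b) :
    ∃ (P : ℝ → ℂ) (S : ℂ),
      (∀ t ε : ℝ, 0 < ε → ‖∫ x, truncInv ε (lineGap a b r x * lineSum a b r x) *
        (g x * Complex.exp (-Complex.I * (t * lineGap a b r x : ℝ)))‖ ≤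
          (1 + 2 * |t|) * (lineBound m * (A * (1 + r / m) ^ 9 * (a ^ k)⁻¹) / r)) ∧
      (∀ ε : ℝ, 0 < ε → ‖∫ x, boxDelta ε (lineGap a b r x * lineSum a b r x) * g x‖ ≤
          lineBound m * (A * (1 + r / m) ^ 9 * (a ^ k)⁻¹) / r) ∧
      (∀ t : ℝ, Tendsto (fun ε => ∫ x, truncInv ε (lineGap a b r x * lineSum a b r x) *
        (g x * Complex.exp (-Complex.I * (t * lineGap a b r x : ℝ)))) (𝓝[>] 0) (𝓝 (P t))) ∧
      Tendsto (fun ε => ∫ x, boxDelta ε (lineGap a b r x * lineSum a b r x) * g x) (𝓝[>] 0)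
        (𝓝 S) ∧
      (∀ t, ‖P t‖ ≤ lineBound m * (A * (1 + r / m) ^ 9 * (a ^ k)⁻¹) / r) ∧
      Tendsto P atTop (𝓝 (-Complex.I * Real.pi * S)) ∧
      Tendsto P atBot (𝓝 (Complex.I * Real.pi * S)) := by
  have ha := hm.trans_le hma
  have hmi : 0 < m⁻¹ := inv_pos.2 hm
  have hA : 0 ≤ A := by
    have h0 := (norm_nonneg _).trans (hgA 0)
    have := hyp_pos ha 0
    exact nonneg_of_mul_nonneg_left h0 (by positivity)
  have hd : ∀ x, HasDerivAt (energyGap a b r) (energyGapDeriv a r x) x :=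
    hasDerivAt_energyGap ha
  have hpos := energyGapDeriv_pos ha hr
  have hmono := strictMono_of_hasDerivAt_pos hd hpos
  set D := A * (1 + r / m) ^ 9 * (a ^ k)⁻¹ with hD
  have hD0 : 0 ≤ D := by
    have := div_pos hr hm
    positivity
  set κ := 1 + m⁻¹ + 2 * m⁻¹ ^ 2 with hκ
  have hκ1 : 1 ≤ κ := by linarith [pow_pos hmi 2]
  have hL0 : 0 < lineConst m := by
    rw [lineConst]
    positivity
  set h : ℝ → ℝ := lineGap a b r with hh
  set c : ℝ → ℝ := lineSum a b r with hc
  have hcont : Continuous c := by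
    have := continuous_hyp a
    rw [hc]
    unfold lineSum
    fun_prop
  have hhd : ∀ x, HasDerivAt h (x / hyp a x - (x + r) / hyp a (x + r)) x := fun x =>
    ((hasDerivAt_hyp ha x).add_const b).sub (hasDerivAt_hyp_add ha x)
  -- the integrand with the oscillating factor obeys the same hypotheses
  set gt : ℝ → ℝ → ℂ := fun t x => g x * Complex.exp (-Complex.I * (t * h x : ℝ)) with hgt
  have hexp : ∀ y : ℝ, ‖Complex.exp (-Complex.I * y)‖ = 1 := fun y => by
    rw [neg_mul, mul_comm, ← neg_mul, ← Complex.ofReal_neg, Complex.norm_exp_ofReal_mul_I]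
  have hgtn : ∀ t x, ‖gt t x‖ = ‖g x‖ := fun t x => by
    simp only [hgt]
    rw [norm_mul, hexp, mul_one]
  have hgtd : ∀ t x, HasDerivAt (gt t)
      (g' x * Complex.exp (-Complex.I * (t * h x : ℝ)) + g x *
        (Complex.exp (-Complex.I * (t * h x : ℝ)) * (-Complex.I *
          ((t * (x / hyp a x - (x + r) / hyp a (x + r)) : ℝ) : ℂ)))) x := fun t x =>
    (hg x).mul (((hhd x).const_mul t).ofReal_comp.const_mul (-Complex.I)).cexp
  have hvel : ∀ x, |x / hyp a x - (x + r) / hyp a (x + r)| ≤ 2 := fun x =>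
    (abs_sub _ _).trans (by linarith [abs_velocity_le ha x, abs_velocity_le ha (x + r)])
  have hgtA : ∀ t x, ‖gt t x‖ ≤ (1 + 2 * |t|) * A * (hyp a x ^ (k + 9))⁻¹ := fun t x => by
    rw [hgtn, mul_assoc]
    exact (hgA x).trans (le_mul_of_one_le_left ((norm_nonneg _).trans (hgA x))
      (by linarith [abs_nonneg t]))
  have hgtA' : ∀ t x, ‖g' x * Complex.exp (-Complex.I * (t * h x : ℝ)) + g x *
        (Complex.exp (-Complex.I * (t * h x : ℝ)) * (-Complex.I *
          ((t * (x / hyp a x - (x + r) / hyp a (x + r)) : ℝ) : ℂ)))‖ ≤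
      (1 + 2 * |t|) * A * (hyp a x ^ (k + 9))⁻¹ := fun t x => by
    refine (norm_add_le _ _).trans ?_
    simp only [norm_mul, norm_neg, Complex.norm_I, hexp, one_mul, mul_one, Complex.norm_real,
      Real.norm_eq_abs]
    have hp := hyp_pos ha x
    calc ‖g' x‖ + ‖g x‖ * (|t| * |x / hyp a x - (x + r) / hyp a (x + r)|)
        ≤ A * (hyp a x ^ (k + 9))⁻¹ + A * (hyp a x ^ (k + 9))⁻¹ * (|t| * 2) := by
          gcongr
          · exact hgA' x
          · exact hgA x
          · exact hvel x
      _ = _ := by ring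
  have hsuppt : ∀ t x, gt t x ≠ 0 → c₀ ≤ hyp a x + b := fun t x hx =>
    hsupp x (left_ne_zero_of_mul hx)
  have hcm : ∀ t x, gt t x ≠ 0 → m ≤ c x := fun t x hx => by
    have := hsuppt t x hx
    simp only [hc, lineSum]
    linarith [le_hyp a (x + r)]
  have hreg : ∀ t, IsRegularDensity ((1 + 2 * |t|) * (κ * lineConst m * D))
      (pushDensity (energyGap a b r) (energyGapDeriv a r) fun x => gt t x / c x) := by
    intro t
    obtain ⟨g₁', h1, h2, h3⟩ := hasDerivAt_div_lineSum (r := r) (b := b) hm hma (hgtd t)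
      (hgtA t) (hgtA' t) hc₀ (hsuppt t)
    have h4 := isRegularDensity_energyGap (b := b) hm hma hr h1 h2 h3
    have hle : lineConst m * ((m⁻¹ + 2 * m⁻¹ ^ 2) * ((1 + 2 * |t|) * A) * (1 + r / m) ^ 9 *
        (a ^ k)⁻¹) ≤ (1 + 2 * |t|) * (κ * lineConst m * D) := by
      have : lineConst m * ((m⁻¹ + 2 * m⁻¹ ^ 2) * ((1 + 2 * |t|) * A) * (1 + r / m) ^ 9 *
        (a ^ k)⁻¹) = (1 + 2 * |t|) * ((m⁻¹ + 2 * m⁻¹ ^ 2) * lineConst m * D) := by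
          rw [hD]
          ring
      rw [this]
      gcongr
      rw [hκ]
      linarith
    exact ⟨fun w w' => (h4.lip w w').trans (by gcongr), fun w => (h4.bdd w).trans hle, h4.int,
      h4.l1.trans hle⟩
  have hreg₁ : ∀ t, IsRegularDensity ((1 + 2 * |t|) * (κ * lineConst m * D))
      (pushDensity (energyGap a b r) (energyGapDeriv a r) (gt t)) := by
    intro t
    have h4 := isRegularDensity_energyGap (b := b) hm hma hr (hgtd t) (hgtA t) (hgtA' t)
    have hle : lineConst m * ((1 + 2 * |t|) * A * (1 + r / m) ^ 9 *
        (a ^ k)⁻¹) ≤ (1 + 2 * |t|) * (κ * lineConst m * D) := by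
      have : lineConst m * ((1 + 2 * |t|) * A * (1 + r / m) ^ 9 *
        (a ^ k)⁻¹) = (1 + 2 * |t|) * (1 * lineConst m * D) := by
          rw [hD]
          ring
      rw [this]
      gcongr
    exact ⟨fun w w' => (h4.lip w w').trans (by gcongr), fun w => (h4.bdd w).trans hle, h4.int,
      h4.l1.trans hle⟩
  have hlim := fun t => limits_of_isRegularDensity hd hpos hcont hm (hcm t) (hreg t) (hreg₁ t)
  set ψ := pushDensity (energyGap a b r) (energyGapDeriv a r) fun x => gt 0 x / c x with hψ
  have hψt : ∀ t, (pushDensity (energyGap a b r) (energyGapDeriv a r) fun x => gt t x / c x) =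
      fun w => ψ w * Complex.exp (Complex.I * ((t * r) * w : ℝ)) := by
    intro t
    funext w
    by_cases hw : w ∈ Set.range (energyGap a b r)
    · obtain ⟨x, rfl⟩ := hw
      rw [hψ, pushDensity_apply hmono, pushDensity_apply hmono]
      have e : -Complex.I * (t * h x : ℝ) = Complex.I * ((t * r) * energyGap a b r x : ℝ) := by
        simp only [hh, lineGap_eq hr]
        push_cast
        ring
      simp only [hgt, e, zero_mul, Complex.ofReal_zero, mul_zero, Complex.exp_zero, mul_one]
      ring
    · rw [hψ, pushDensity_apply_of_notMem w hw, pushDensity_apply_of_notMem w hw, zero_mul]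
  have hreg0 : IsRegularDensity (κ * lineConst m * D) ψ := by
    have := hreg 0
    rwa [abs_zero, mul_zero, add_zero, one_mul] at this
  have hg0 : gt 0 = g := by
    funext x
    simp [hgt]
  have hr0 : (r : ℂ) ≠ 0 := Complex.ofReal_ne_zero.2 hr.ne'
  have itr : ∀ t ε, ∫ x, truncInv ε (h x * c x) * gt t x =
      -(r : ℂ)⁻¹ * ∫ x, truncInv (ε / r) (energyGap a b r x * c x) * gt t x := by
    intro t ε
    rw [← integral_const_mul]
    refine integral_congr_ae (Eventually.of_forall fun x => ?_)
    simp only [hh, hc, lineGap_mul_lineSum_eq hr, truncInv_neg_mul hr]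
    ring
  have ibd : ∀ ε, ∫ x, boxDelta ε (h x * c x) * g x =
      (r : ℂ)⁻¹ * ∫ x, boxDelta (ε / r) (energyGap a b r x * c x) * gt 0 x := by
    intro ε
    rw [← integral_const_mul, hg0]
    refine integral_congr_ae (Eventually.of_forall fun x => ?_)
    simp only [hh, hc, lineGap_mul_lineSum_eq hr, boxDelta_neg_mul hr]
    ring
  have hrn : ‖-(r : ℂ)⁻¹‖ = r⁻¹ := by
    rw [norm_neg, norm_inv, Complex.norm_real, Real.norm_eq_abs, abs_of_pos hr]
  have hrn' : ‖(r : ℂ)⁻¹‖ = r⁻¹ := by rw [← norm_neg, hrn]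
  have hLB : lineBound m = (18 + 4 * m⁻¹) * (κ * lineConst m) := rfl
  have hB0 : 0 ≤ κ * lineConst m * D := by positivity
  have hatop : Tendsto (fun t : ℝ => t * r) atTop atTop := tendsto_id.atTop_mul_const hr
  have habot : Tendsto (fun t : ℝ => t * r) atBot atBot := tendsto_id.atBot_mul_const hr
  refine ⟨fun t => -(r : ℂ)⁻¹ *
      pv (fun w => ψ w * Complex.exp (Complex.I * ((t * r) * w : ℝ))), (r : ℂ)⁻¹ * ψ 0,
    fun t ε hε => ?_, fun ε hε => ?_, fun t => ?_, ?_, fun t => ?_, ?_, ?_⟩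
  · rw [itr, norm_mul, hrn]
    calc r⁻¹ * _ ≤ r⁻¹ * ((7 + 2 * m⁻¹) * ((1 + 2 * |t|) * (κ * lineConst m * D))) := by
          gcongr
          exact (hlim t).1 _ (div_pos hε hr)
      _ ≤ r⁻¹ * ((18 + 4 * m⁻¹) * ((1 + 2 * |t|) * (κ * lineConst m * D))) := by
          gcongr <;> norm_num
      _ = _ := by
          rw [hLB]
          ring
  · rw [ibd, norm_mul, hrn']
    have h2 := (hlim 0).2.1 _ (div_pos hε hr)
    rw [abs_zero, mul_zero, add_zero, one_mul] at h2
    calc r⁻¹ * _ ≤ r⁻¹ * (2 * m⁻¹ * (κ * lineConst m * D)) := by gcongr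
      _ ≤ r⁻¹ * ((18 + 4 * m⁻¹) * (κ * lineConst m * D)) := by
          gcongr
          linarith
      _ = _ := by
          rw [hLB]
          ring
  · have h2 := ((hlim t).2.2.1.comp (tendsto_div_const_nhdsGT hr)).const_mul (-(r : ℂ)⁻¹)
    rw [hψt] at h2
    exact h2.congr fun ε => (itr t ε).symm
  · have h2 := ((hlim 0).2.2.2.comp (tendsto_div_const_nhdsGT hr)).const_mul ((r : ℂ)⁻¹)
    exact h2.congr fun ε => (ibd ε).symm
  · rw [norm_mul, hrn]
    calc r⁻¹ * _ ≤ r⁻¹ * (11 * (κ * lineConst m * D)) := by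
          gcongr
          exact hreg0.norm_pv_phase_le _
      _ ≤ r⁻¹ * ((18 + 4 * m⁻¹) * (κ * lineConst m * D)) := by
          gcongr
          linarith
      _ = _ := by
          rw [hLB]
          ring
  · have h2 := ((hreg0.tendsto_pv_phase atTop_le_cocompact
      (Real.tendsto_arctan_atTop.mono_right nhdsWithin_le_nhds)).comp hatop).const_mul
        (-(r : ℂ)⁻¹)
    have e : -(r : ℂ)⁻¹ * (2 * Complex.I * (Real.pi / 2 : ℝ) * ψ 0) =
        -Complex.I * Real.pi * ((r : ℂ)⁻¹ * ψ 0) := by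
      push_cast
      ring
    rw [e] at h2
    exact h2
  · have h2 := ((hreg0.tendsto_pv_phase atBot_le_cocompact
      (Real.tendsto_arctan_atBot.mono_right nhdsWithin_le_nhds)).comp habot).const_mul
        (-(r : ℂ)⁻¹)
    have e : -(r : ℂ)⁻¹ * (2 * Complex.I * (-(Real.pi / 2) : ℝ) * ψ 0) =
        Complex.I * Real.pi * ((r : ℂ)⁻¹ * ψ 0) := by
      push_cast
      ring
    rw [e] at h2
    exact h2

end Line

/-! ### Integration along lines whose direction depends on parameters -/

section Slab

variable {V Y : Type*} [NormedAddCommGroup V] [InnerProductSpace ℝ V] [FiniteDimensional ℝ V]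
  [MeasurableSpace V] [BorelSpace V] [MeasurableSpace Y] {ν : Measure Y} [SFinite ν]

theorem measurePreserving_shear {e : Y → V} (he : Measurable e) :
    MeasurePreserving (fun z : (Y × V) × ℝ => ((z.1.1, z.1.2 + z.2 • e z.1.1), z.2))
      ((ν.prod (volume : Measure V)).prod volume) ((ν.prod (volume : Measure V)).prod volume) := by
  have h1 : MeasurePreserving (fun z : (Y × ℝ) × V => (z.1, z.2 + z.1.2 • e z.1.1))
      ((ν.prod volume).prod (volume : Measure V)) ((ν.prod volume).prod (volume : Measure V)) :=
    (MeasurePreserving.id _).skew_product (g := fun (a : Y × ℝ) (p : V) => p + a.2 • e a.1)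
      (by unfold Function.uncurry; fun_prop) (Eventually.of_forall fun a => map_add_right_eq_self _ _)
  have hR : MeasurePreserving (fun z : (Y × V) × ℝ => ((z.1.1, z.2), z.1.2))
      ((ν.prod (volume : Measure V)).prod volume) ((ν.prod volume).prod (volume : Measure V)) :=
    ((measurePreserving_prodAssoc ν volume volume).symm.comp
      ((MeasurePreserving.id ν).prod Measure.measurePreserving_swap)).comp
        (measurePreserving_prodAssoc ν volume volume)
  have hR' : MeasurePreserving (fun z : (Y × ℝ) × V => ((z.1.1, z.2), z.1.2))
      ((ν.prod volume).prod (volume : Measure V)) ((ν.prod (volume : Measure V)).prod volume) :=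
    ((measurePreserving_prodAssoc ν volume volume).symm.comp
      ((MeasurePreserving.id ν).prod Measure.measurePreserving_swap)).comp
        (measurePreserving_prodAssoc ν volume volume)
  exact (hR'.comp h1).comp hR

/-- An integral over a family of Euclidean spaces is obtained by integrating first along the lines
in a unit direction `e`, which may depend on the parameter, and then over the slab
`0 ≤ ⟨p, e⟩ < 1`. -/
theorem integral_eq_integral_slab {e : Y → V} (he : Measurable e) (he1 : ∀ y, ‖e y‖ = 1)
    {F : Y × V → ℂ} (hF : Integrable F (ν.prod volume)) :
    ∫ z, F z ∂(ν.prod volume) = ∫ z : Y × V,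
      (if inner ℝ z.2 (e z.1) ∈ Set.Ico (0 : ℝ) 1 then ∫ x : ℝ, F (z.1, z.2 + x • e z.1) else 0)
        ∂(ν.prod volume) := by
  set G : (Y × V) × ℝ → ℂ := fun z =>
    (Set.Ico (0 : ℝ) 1).indicator (fun _ => F z.1) (inner ℝ z.1.2 (e z.1.1) - z.2) with hG
  have hset : ∀ i : ℝ, ∀ c : ℂ, (fun x : ℝ => (Set.Ico (0 : ℝ) 1).indicator (fun _ => c) (i - x)) =
      (Set.Ioc (i - 1) i).indicator fun _ => c := by
    intro i c
    funext x
    have : i - x ∈ Set.Ico (0 : ℝ) 1 ↔ x ∈ Set.Ioc (i - 1) i := by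
      rw [Set.mem_Ico, Set.mem_Ioc]
      constructor <;> rintro ⟨h1, h2⟩ <;> constructor <;> linarith
    simp only [Set.indicator_apply, this]
  have hmeas : AEStronglyMeasurable G ((ν.prod volume).prod volume) := by
    have h1 : AEStronglyMeasurable (fun z : (Y × V) × ℝ => F z.1) ((ν.prod volume).prod volume) :=
      hF.1.comp_fst
    have h2 : Measurable fun z : (Y × V) × ℝ => inner ℝ z.1.2 (e z.1.1) - z.2 := by fun_prop
    have h3 : G = ((fun z : (Y × V) × ℝ => inner ℝ z.1.2 (e z.1.1) - z.2) ⁻¹'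
        Set.Ico (0 : ℝ) 1).indicator fun z => F z.1 := by
      funext z
      simp only [hG]
      by_cases h : inner ℝ z.1.2 (e z.1.1) - z.2 ∈ Set.Ico (0 : ℝ) 1
      · rw [Set.indicator_of_mem h]
        exact (Set.indicator_of_mem (f := fun z : (Y × V) × ℝ => F z.1)
          (s := (fun z : (Y × V) × ℝ => inner ℝ z.1.2 (e z.1.1) - z.2) ⁻¹' Set.Ico 0 1) h).symm
      · rw [Set.indicator_of_notMem h]
        exact (Set.indicator_of_notMem (f := fun z : (Y × V) × ℝ => F z.1)
          (s := (fun z : (Y × V) × ℝ => inner ℝ z.1.2 (e z.1.1) - z.2) ⁻¹' Set.Ico 0 1) h).symm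
    rw [h3]
    exact h1.indicator (h2 measurableSet_Ico)
  have hGint : Integrable G ((ν.prod volume).prod volume) := by
    refine (integrable_prod_iff hmeas).2 ⟨Eventually.of_forall fun z => ?_, ?_⟩
    · simp only [hG, hset]
      exact (integrable_indicator_iff measurableSet_Ioc).2 (integrableOn_const (by simp))
    · refine hF.norm.congr (Eventually.of_forall fun z => ?_)
      have h1 : ∀ x, ‖G (z, x)‖ = (Set.Ioc (inner ℝ z.2 (e z.1) - 1) (inner ℝ z.2 (e z.1))).indicator
          (fun _ => ‖F z‖) x := fun x => by
        have := congrFun (hset (inner ℝ z.2 (e z.1)) (F z)) x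
        simp only [hG]
        rw [this, norm_indicator_eq_indicator_norm]
      simp only [h1]
      rw [integral_indicator measurableSet_Ioc]
      simp
  have hΘ := measurePreserving_shear (ν := ν) he
  have hl : ∫ z, G z ∂((ν.prod volume).prod volume) = ∫ z, F z ∂(ν.prod volume) := by
    rw [integral_prod _ hGint]
    refine integral_congr_ae (Eventually.of_forall fun z => ?_)
    simp only [hG, hset]
    rw [integral_indicator measurableSet_Ioc]
    simp
  have hcomp : ∫ z, G z ∂((ν.prod volume).prod volume) =
      ∫ z : (Y × V) × ℝ, G ((z.1.1, z.1.2 + z.2 • e z.1.1), z.2)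
        ∂((ν.prod volume).prod volume) := by
    conv_lhs => rw [← hΘ.map_eq]
    exact integral_map hΘ.measurable.aemeasurable (by rw [hΘ.map_eq]; exact hmeas)
  have hcint : Integrable (fun z : (Y × V) × ℝ => G ((z.1.1, z.1.2 + z.2 • e z.1.1), z.2))
      ((ν.prod volume).prod volume) := (hΘ.integrable_comp hmeas).2 hGint
  rw [← hl, hcomp, integral_prod _ hcint]
  refine integral_congr_ae (Eventually.of_forall fun z => ?_)
  have h1 : ∀ x : ℝ, G ((z.1, z.2 + x • e z.1), x) =
      if inner ℝ z.2 (e z.1) ∈ Set.Ico (0 : ℝ) 1 then F (z.1, z.2 + x • e z.1) else 0 := by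
    intro x
    have h2 : inner ℝ (z.2 + x • e z.1) (e z.1) - x = inner ℝ z.2 (e z.1) := by
      rw [inner_add_left, real_inner_smul_left, real_inner_self_eq_norm_sq, he1]
      ring
    simp only [hG, h2, Set.indicator_apply]
  simp only [h1]
  split_ifs
  · rfl
  · simp

end Slab

/-! ### The propagator of the recoiling vector as a function of one momentum -/

section Omega

variable {s : ℕ} {m : ℝ}

theorem le_omega (m : ℝ) (p : EuclideanSpace ℝ (Fin s)) : m ≤ omega m p :=
  Real.le_sqrt_of_sq_le (by nlinarith [sq_nonneg ‖p‖])

theorem omega_pos (hm : 0 < m) (p : EuclideanSpace ℝ (Fin s)) : 0 < omega m p :=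
  hm.trans_le (le_omega m p)

theorem norm_le_omega (m : ℝ) (p : EuclideanSpace ℝ (Fin s)) : ‖p‖ ≤ omega m p :=
  Real.le_sqrt_of_sq_le (by nlinarith [sq_nonneg m])

theorem omega_sq (m : ℝ) (p : EuclideanSpace ℝ (Fin s)) : omega m p ^ 2 = ‖p‖ ^ 2 + m ^ 2 :=
  Real.sq_sqrt (by positivity)

theorem continuous_omega (m : ℝ) : Continuous (omega (s := s) m) := by
  unfold omega
  fun_prop

theorem integrable_omega_pow_inv (hm : 0 < m) {k : ℕ} (hk : s < k) :
    Integrable fun p : EuclideanSpace ℝ (Fin s) => (omega m p ^ k)⁻¹ := by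
  have h := integrable_one_add_norm (E := EuclideanSpace ℝ (Fin s)) (μ := volume) (r := k)
    (by simpa using hk)
  refine (h.const_mul ((1 + m⁻¹) ^ k)).mono' ?_ (Eventually.of_forall fun p => ?_)
  · have := continuous_omega (s := s) m
    exact Measurable.aestronglyMeasurable (by fun_prop)
  · have hp := omega_pos hm p
    rw [Real.norm_eq_abs, abs_of_pos (by positivity), Real.rpow_neg (by positivity),
      Real.rpow_natCast, ← div_eq_mul_inv, ← one_div, div_le_div_iff₀ (by positivity)
      (by positivity), one_mul, ← mul_pow]
    gcongr
    have h1 : 1 ≤ m⁻¹ * omega m p := by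
      rw [inv_mul_eq_div, one_le_div hm]
      exact le_omega m p
    nlinarith [norm_le_omega m p]

theorem omega_add_smul {q e : EuclideanSpace ℝ (Fin s)} (he : ‖e‖ = 1)
    (hq : inner ℝ q e = 0) (x : ℝ) : omega m (q + x • e) = hyp (omega m q) x := by
  rw [omega, hyp, omega_sq, norm_add_sq_real, real_inner_smul_right, hq, norm_smul, he,
    Real.norm_eq_abs, mul_one, sq_abs]
  congr 1
  ring

end Omega

section Product

variable {s : ℕ} {m : ℝ} {Y : Type*} [MeasurableSpace Y]

/-- Energy of `q + R` with `q = (ω(p), p)`, minus the on-shell energy. -/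
def gapFn (m : ℝ) (b : Y → ℝ) (B : Y → EuclideanSpace ℝ (Fin s))
    (z : Y × EuclideanSpace ℝ (Fin s)) : ℝ :=
  omega m z.2 + b z.1 - omega m (z.2 + B z.1)

/-- Energy of `q + R` with `q = (ω(p), p)`, plus the on-shell energy. -/
def sumFn (m : ℝ) (b : Y → ℝ) (B : Y → EuclideanSpace ℝ (Fin s))
    (z : Y × EuclideanSpace ℝ (Fin s)) : ℝ :=
  omega m z.2 + b z.1 + omega m (z.2 + B z.1)

/-- The weight which controls the integral over one momentum; it is singular where the sum `B` of
the other momenta vanishes. -/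
def lineWeight (m : ℝ) (B : Y → EuclideanSpace ℝ (Fin s)) (W : Y → ℝ) (y : Y) : ℝ :=
  W y * (1 + ‖B y‖ / m) ^ 9 / ‖B y‖

/-- Limits of truncated integrals over the momentum `p` and the parameters `y`. -/
theorem exists_product_limits (hs : 0 < s) (hm : 0 < m) {ν : Measure Y} [SFinite ν]
    {b : Y → ℝ} (hb : Measurable b) {B : Y → EuclideanSpace ℝ (Fin s)} (hB : Measurable B)
    (hB0 : ∀ᵐ y ∂ν, B y ≠ 0) {W : Y → ℝ} (hW : Integrable W ν)
    (hWB : Integrable (lineWeight m B W) ν) {k : ℕ} (hk : s < k)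
    {g : Y × EuclideanSpace ℝ (Fin s) → ℂ} (hgm : Measurable g)
    (hgd : ∀ y, Differentiable ℝ fun p => g (y, p))
    (hgA : ∀ y p, ‖g (y, p)‖ ≤ W y * (omega m p ^ (k + 9))⁻¹)
    (hgA' : ∀ y p, ‖fderiv ℝ (fun p => g (y, p)) p‖ ≤ W y * (omega m p ^ (k + 9))⁻¹)
    {c₀ : ℝ} (hc₀ : 0 < c₀) (hsupp : ∀ y p, g (y, p) ≠ 0 → c₀ ≤ omega m p + b y) :
    ∃ (P : ℝ → ℂ) (S : ℂ),
      (∀ t : ℝ, Tendsto (fun ε => ∫ z, truncInv ε (gapFn m b B z * sumFn m b B z) *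
        (g z * Complex.exp (-Complex.I * (t * gapFn m b B z : ℝ))) ∂(ν.prod volume))
          (𝓝[>] 0) (𝓝 (P t))) ∧
      Tendsto (fun ε => ∫ z, boxDelta ε (gapFn m b B z * sumFn m b B z) * g z ∂(ν.prod volume))
        (𝓝[>] 0) (𝓝 S) ∧
      ‖P 0‖ ≤ lineBound m * (1 + m⁻¹) ^ k * ((∫ y, lineWeight m B W y ∂ν) *
        ∫ p : EuclideanSpace ℝ (Fin s), (omega m p ^ k)⁻¹) ∧
      ‖S‖ ≤ lineBound m * (1 + m⁻¹) ^ k * ((∫ y, lineWeight m B W y ∂ν) *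
        ∫ p : EuclideanSpace ℝ (Fin s), (omega m p ^ k)⁻¹) ∧
      Tendsto P atTop (𝓝 (-Complex.I * Real.pi * S)) ∧
      Tendsto P atBot (𝓝 (Complex.I * Real.pi * S)) := by
  have hmi : 0 < m⁻¹ := inv_pos.2 hm
  have hLB : 0 < lineBound m := by
    rw [lineBound, lineConst]
    positivity
  have hW0 : ∀ y, 0 ≤ W y := fun y => by
    have h := (norm_nonneg _).trans (hgA y 0)
    have := omega_pos hm (0 : EuclideanSpace ℝ (Fin s))
    exact nonneg_of_mul_nonneg_left h (by positivity)
  -- the unit direction of the lines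
  set e₀ : EuclideanSpace ℝ (Fin s) := EuclideanSpace.single ⟨0, hs⟩ 1 with he₀
  set e : Y → EuclideanSpace ℝ (Fin s) := fun y => if B y = 0 then e₀ else ‖B y‖⁻¹ • B y with he
  have hem : Measurable e :=
    Measurable.ite (hB (measurableSet_singleton 0)) measurable_const (by fun_prop)
  have he1 : ∀ y, ‖e y‖ = 1 := fun y => by
    simp only [he]
    split_ifs with h
    · simp [he₀]
    · rw [norm_smul, norm_inv, norm_norm, inv_mul_cancel₀ (norm_ne_zero_iff.2 h)]
  have hBe : ∀ y, B y ≠ 0 → B y = ‖B y‖ • e y := fun y hy => by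
    simp only [he, if_neg hy, smul_smul]
    rw [mul_inv_cancel₀ (norm_ne_zero_iff.2 hy), one_smul]
  have hom := continuous_omega (s := s) m
  have hgapm : Measurable (gapFn m b B) := by
    unfold gapFn
    fun_prop
  have hsumm : Measurable (sumFn m b B) := by
    unfold sumFn
    fun_prop
  -- the foot of the line on the hyperplane orthogonal to it
  set q : Y × EuclideanSpace ℝ (Fin s) → EuclideanSpace ℝ (Fin s) :=
    fun z => z.2 - (inner ℝ z.2 (e z.1)) • e z.1 with hq
  have hqe : ∀ z, inner ℝ (q z) (e z.1) = 0 := fun z => by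
    simp only [hq]
    rw [inner_sub_left, real_inner_smul_left, real_inner_self_eq_norm_sq, he1]
    ring
  have hhyp : ∀ z (x : ℝ), omega m (q z + x • e z.1) = hyp (omega m (q z)) x := fun z x =>
    omega_add_smul (he1 _) (hqe z) x
  have hgap : ∀ z (x : ℝ), B z.1 ≠ 0 → gapFn m b B (z.1, q z + x • e z.1) =
      lineGap (omega m (q z)) (b z.1) ‖B z.1‖ x := fun z x hz => by
    have h1 : q z + x • e z.1 + B z.1 = q z + (x + ‖B z.1‖) • e z.1 := by
      conv_lhs => rw [hBe _ hz]
      rw [add_smul, add_assoc]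
    simp only [gapFn, lineGap, h1, hhyp]
  have hsum : ∀ z (x : ℝ), B z.1 ≠ 0 → sumFn m b B (z.1, q z + x • e z.1) =
      lineSum (omega m (q z)) (b z.1) ‖B z.1‖ x := fun z x hz => by
    have h1 : q z + x • e z.1 + B z.1 = q z + (x + ‖B z.1‖) • e z.1 := by
      conv_lhs => rw [hBe _ hz]
      rw [add_smul, add_assoc]
    simp only [sumFn, lineSum, h1, hhyp]
  have hline := fun (z : Y × EuclideanSpace ℝ (Fin s)) (hz : B z.1 ≠ 0) =>
    exists_line_limits (b := b z.1) (A := W z.1) (k := k) hm (le_omega m (q z))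
      (norm_pos_iff.2 hz)
      (g := fun x => g (z.1, q z + x • e z.1))
      (g' := fun x => fderiv ℝ (fun p => g (z.1, p)) (q z + x • e z.1) (e z.1))
      (fun x => by
        have h1 : HasDerivAt (fun x : ℝ => q z + x • e z.1) (e z.1) x := by
          simpa using ((hasDerivAt_id x).smul_const (e z.1)).const_add (q z)
        exact ((hgd z.1 _).hasFDerivAt.comp_hasDerivAt x h1))
      (fun x => by
        rw [← hhyp]
        exact hgA _ _)
      (fun x => by
        rw [← hhyp]
        refine ((ContinuousLinearMap.le_opNorm _ _).trans_eq ?_).trans (hgA' _ _)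
        rw [he1, mul_one]) hc₀
      (fun x hx => by
        rw [← hhyp]
        exact hsupp _ _ hx)
  choose! P S hPS using hline
  set K : ℝ := lineBound m * (1 + m⁻¹) ^ k with hK
  set bd : Y × EuclideanSpace ℝ (Fin s) → ℝ := fun z =>
    K * (lineWeight m B W z.1 * (omega m z.2 ^ k)⁻¹) with hbd
  have hbdi : Integrable bd (ν.prod volume) :=
    (hWB.mul_prod (integrable_omega_pow_inv hm hk)).const_mul K
  have hbdint : ∫ z, bd z ∂(ν.prod volume) = K * ((∫ y, lineWeight m B W y ∂ν) *
      ∫ p : EuclideanSpace ℝ (Fin s), (omega m p ^ k)⁻¹) := by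
    rw [integral_const_mul]
    congr 1
    exact integral_prod_mul (μ := ν) (lineWeight m B W) fun p => (omega m p ^ k)⁻¹
  have hlw0 : ∀ y, 0 ≤ lineWeight m B W y := fun y => by
    have := hW0 y
    rw [lineWeight]
    positivity
  have hbd0 : ∀ z, 0 ≤ bd z := fun z => by
    have := hlw0 z.1
    have := omega_pos hm z.2
    simp only [hbd]
    positivity
  have hslab : ∀ z : Y × EuclideanSpace ℝ (Fin s), B z.1 ≠ 0 →
      inner ℝ z.2 (e z.1) ∈ Set.Ico (0 : ℝ) 1 →
      lineBound m * (W z.1 * (1 + ‖B z.1‖ / m) ^ 9 * (omega m (q z) ^ k)⁻¹) / ‖B z.1‖ ≤ bd z := by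
    intro z hz hi
    have hqpos := omega_pos hm (q z)
    have h1 : omega m z.2 ≤ omega m (q z) * (1 + m⁻¹) := by
      have e1 : z.2 = q z + (inner ℝ z.2 (e z.1)) • e z.1 := by
        simp only [hq]
        abel
      rw [e1, hhyp]
      have h2 := hyp_add_le (omega m (q z)) 0 hi.1
      have h3 : hyp (omega m (q z)) 0 = omega m (q z) := by
        rw [hyp]
        simp [Real.sqrt_sq hqpos.le]
      rw [zero_add, h3] at h2
      have h4 : 1 ≤ omega m (q z) * m⁻¹ := by
        rw [← div_eq_mul_inv, one_le_div hm]
        exact le_omega m _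
      have h5 := hi.2
      linarith
    have hzpos := omega_pos hm z.2
    have h6 : (omega m (q z) ^ k)⁻¹ ≤ (1 + m⁻¹) ^ k * (omega m z.2 ^ k)⁻¹ := by
      rw [← div_eq_mul_inv, ← one_div, div_le_div_iff₀ (by positivity) (by positivity), one_mul,
        ← mul_pow]
      gcongr
      linarith
    have hWz := hW0 z.1
    have e2 : bd z = lineBound m * (W z.1 * (1 + ‖B z.1‖ / m) ^ 9 *
        ((1 + m⁻¹) ^ k * (omega m z.2 ^ k)⁻¹)) / ‖B z.1‖ := by
      simp only [hbd, hK, lineWeight]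
      ring
    rw [e2]
    gcongr
  -- reduction of the integral to lines
  have hgi : Integrable g (ν.prod volume) := by
    refine (hW.mul_prod (integrable_omega_pow_inv (s := s) hm
      (show s < k + 9 by omega))).mono' hgm.aestronglyMeasurable
      (Eventually.of_forall fun z => hgA z.1 z.2)
  have hexp : ∀ y : ℝ, ‖Complex.exp (-Complex.I * y)‖ = 1 := fun y => by
    rw [neg_mul, mul_comm, ← neg_mul, ← Complex.ofReal_neg, Complex.norm_exp_ofReal_mul_I]
  set Φ : ℝ → ℝ → Y × EuclideanSpace ℝ (Fin s) → ℂ := fun t ε z =>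
    truncInv ε (gapFn m b B z * sumFn m b B z) *
        (g z * Complex.exp (-Complex.I * (t * gapFn m b B z : ℝ))) with hΦ
  set Δ : ℝ → Y × EuclideanSpace ℝ (Fin s) → ℂ := fun ε z =>
    boxDelta ε (gapFn m b B z * sumFn m b B z) * g z with hΔ
  have hΦm : ∀ t ε, Measurable (Φ t ε) := fun t ε =>
    ((measurable_truncInv ε).comp (hgapm.mul hsumm)).mul (by fun_prop)
  have hΔm : ∀ ε, Measurable (Δ ε) := fun ε =>
    ((measurable_boxDelta ε).comp (hgapm.mul hsumm)).mul hgm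
  have hΦi : ∀ t ε, 0 < ε → Integrable (Φ t ε) (ν.prod volume) := fun t ε hε => by
    refine Integrable.bdd_mul (c := ε⁻¹) ?_
      (((measurable_truncInv ε).comp (hgapm.mul hsumm)).aestronglyMeasurable)
      (Eventually.of_forall fun z => norm_truncInv_le hε _)
    refine hgi.mul_bdd (c := 1) (Measurable.aestronglyMeasurable (by fun_prop))
      (Eventually.of_forall fun z => ?_)
    rw [hexp]
  have hΔi : ∀ ε, 0 < ε → Integrable (Δ ε) (ν.prod volume) := fun ε hε =>
    hgi.bdd_mul (((measurable_boxDelta ε).comp (hgapm.mul hsumm)).aestronglyMeasurable)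
      (Eventually.of_forall fun z => norm_boxDelta_le hε _)
  have hfoot : ∀ (F : Y × EuclideanSpace ℝ (Fin s) → ℂ) z,
      ∫ x : ℝ, F (z.1, z.2 + x • e z.1) = ∫ x : ℝ, F (z.1, q z + x • e z.1) := fun F z => by
    rw [← integral_add_right_eq_self (fun x : ℝ => F (z.1, q z + x • e z.1))
      (inner ℝ z.2 (e z.1))]
    refine integral_congr_ae (Eventually.of_forall fun x => ?_)
    simp only [hq, add_smul]
    congr 2
    abel
  set J : (Y × EuclideanSpace ℝ (Fin s) → ℂ) → Y × EuclideanSpace ℝ (Fin s) → ℂ := fun F z =>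
    if inner ℝ z.2 (e z.1) ∈ Set.Ico (0 : ℝ) 1 then ∫ x : ℝ, F (z.1, z.2 + x • e z.1) else 0
    with hJ
  have hJm : ∀ F, Measurable F → AEStronglyMeasurable (J F) (ν.prod volume) := fun F hF => by
    have h1 : StronglyMeasurable fun z : Y × EuclideanSpace ℝ (Fin s) =>
        ∫ x : ℝ, F (z.1, z.2 + x • e z.1) := by
      refine StronglyMeasurable.integral_prod_right
        (f := fun (z : Y × EuclideanSpace ℝ (Fin s)) (x : ℝ) => F (z.1, z.2 + x • e z.1)) ?_
      refine Measurable.stronglyMeasurable ?_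
      unfold Function.uncurry
      fun_prop
    have h2 : Measurable fun z : Y × EuclideanSpace ℝ (Fin s) => inner ℝ z.2 (e z.1) := by
      fun_prop
    exact (Measurable.ite (h2 measurableSet_Ico) h1.measurable
      measurable_const).aestronglyMeasurable
  have hJint : ∀ F, Integrable F (ν.prod volume) →
      ∫ z, F z ∂(ν.prod volume) = ∫ z, J F z ∂(ν.prod volume) := fun F hF =>
    integral_eq_integral_slab hem he1 hF
  have hΦline : ∀ t ε z, B z.1 ≠ 0 → (∫ x : ℝ, Φ t ε (z.1, z.2 + x • e z.1)) =
      ∫ x, truncInv ε (lineGap (omega m (q z)) (b z.1) ‖B z.1‖ x *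
        lineSum (omega m (q z)) (b z.1) ‖B z.1‖ x) * (g (z.1, q z + x • e z.1) *
          Complex.exp (-Complex.I * (t * lineGap (omega m (q z)) (b z.1) ‖B z.1‖ x : ℝ))) :=
    fun t ε z hz => by
      rw [hfoot]
      simp only [hΦ, hgap _ _ hz, hsum _ _ hz]
  have hΔline : ∀ ε z, B z.1 ≠ 0 → (∫ x : ℝ, Δ ε (z.1, z.2 + x • e z.1)) =
      ∫ x, boxDelta ε (lineGap (omega m (q z)) (b z.1) ‖B z.1‖ x *
        lineSum (omega m (q z)) (b z.1) ‖B z.1‖ x) * g (z.1, q z + x • e z.1) :=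
    fun ε z hz => by
      rw [hfoot]
      simp only [hΔ, hgap _ _ hz, hsum _ _ hz]
  have hB0' : ∀ᵐ z : Y × EuclideanSpace ℝ (Fin s) ∂(ν.prod volume), B z.1 ≠ 0 :=
    Measure.quasiMeasurePreserving_fst.ae hB0
  set Pz : ℝ → Y × EuclideanSpace ℝ (Fin s) → ℂ := fun t z =>
    if inner ℝ z.2 (e z.1) ∈ Set.Ico (0 : ℝ) 1 then P z t else 0 with hPz
  set Sz : Y × EuclideanSpace ℝ (Fin s) → ℂ := fun z =>
    if inner ℝ z.2 (e z.1) ∈ Set.Ico (0 : ℝ) 1 then S z else 0 with hSz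
  have hPlim : ∀ t, ∀ᵐ z ∂(ν.prod volume),
      Tendsto (fun ε => J (Φ t ε) z) (𝓝[>] 0) (𝓝 (Pz t z)) := fun t => by
    filter_upwards [hB0'] with z hz
    simp only [hJ, hPz]
    split_ifs with hi
    · exact ((hPS z hz).2.2.1 t).congr fun ε => (hΦline t ε z hz).symm
    · exact tendsto_const_nhds
  have hSlim : ∀ᵐ z ∂(ν.prod volume),
      Tendsto (fun ε => J (Δ ε) z) (𝓝[>] 0) (𝓝 (Sz z)) := by
    filter_upwards [hB0'] with z hz
    simp only [hJ, hSz]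
    split_ifs with hi
    · exact (hPS z hz).2.2.2.1.congr fun ε => (hΔline ε z hz).symm
    · exact tendsto_const_nhds
  have hPzb : ∀ t, ∀ᵐ z ∂(ν.prod volume), ‖Pz t z‖ ≤ bd z := fun t => by
    filter_upwards [hB0'] with z hz
    simp only [hPz]
    split_ifs with hi
    · exact ((hPS z hz).2.2.2.2.1 t).trans (hslab z hz hi)
    · rw [norm_zero]
      exact hbd0 z
  have hpos : ∀ᶠ ε : ℝ in 𝓝[>] 0, 0 < ε := self_mem_nhdsWithin
  have hΔb : ∀ ε : ℝ, 0 < ε → ∀ᵐ z ∂(ν.prod volume), ‖J (Δ ε) z‖ ≤ bd z := fun ε hε => by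
    filter_upwards [hB0'] with z hz
    simp only [hJ]
    split_ifs with hi
    · rw [hΔline ε z hz]
      exact ((hPS z hz).2.1 ε hε).trans (hslab z hz hi)
    · rw [norm_zero]
      exact hbd0 z
  have hT1 : ∀ t : ℝ, Tendsto (fun ε => ∫ z, Φ t ε z ∂(ν.prod volume))
      (𝓝[>] 0) (𝓝 (∫ z, Pz t z ∂(ν.prod volume))) := fun t => by
    have h1 := tendsto_integral_filter_of_dominated_convergence (μ := ν.prod volume)
      (l := 𝓝[>] (0 : ℝ)) (F := fun ε => J (Φ t ε)) (f := Pz t)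
      (fun z => (1 + 2 * |t|) * bd z) (Eventually.of_forall fun ε => hJm _ (hΦm t ε))
      (by
        filter_upwards [hpos] with ε hε
        filter_upwards [hB0'] with z hz
        simp only [hJ]
        split_ifs with hi
        · rw [hΦline t ε z hz]
          exact ((hPS z hz).1 t ε hε).trans (mul_le_mul_of_nonneg_left (hslab z hz hi)
            (by positivity))
        · rw [norm_zero]
          exact mul_nonneg (by positivity) (hbd0 z))
      (hbdi.const_mul _) (hPlim t)
    refine h1.congr' ?_
    filter_upwards [hpos] with ε hε
    exact (hJint _ (hΦi t ε hε)).symm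
  have hT2 : Tendsto (fun ε => ∫ z, Δ ε z ∂(ν.prod volume))
      (𝓝[>] 0) (𝓝 (∫ z, Sz z ∂(ν.prod volume))) := by
    have h1 := tendsto_integral_filter_of_dominated_convergence (μ := ν.prod volume)
      (l := 𝓝[>] (0 : ℝ)) (F := fun ε => J (Δ ε)) (f := Sz)
      bd (Eventually.of_forall fun ε => hJm _ (hΔm ε))
      (by
        filter_upwards [hpos] with ε hε
        exact hΔb ε hε)
      hbdi hSlim
    refine h1.congr' ?_
    filter_upwards [hpos] with ε hε
    exact (hJint _ (hΔi ε hε)).symm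
  have hPzm : ∀ t, AEStronglyMeasurable (Pz t) (ν.prod volume) := fun t =>
    aestronglyMeasurable_of_tendsto_ae (𝓝[>] (0 : ℝ)) (fun ε => hJm _ (hΦm t ε)) (hPlim t)
  have hT3 : ∀ (l : Filter ℝ) [l.IsCountablyGenerated] (c : ℂ),
      (∀ z, B z.1 ≠ 0 → Tendsto (P z) l (𝓝 (c * S z))) →
      Tendsto (fun t => ∫ z, Pz t z ∂(ν.prod volume)) l
        (𝓝 (c * ∫ z, Sz z ∂(ν.prod volume))) := by
    intro l _ c hl
    rw [← integral_const_mul]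
    refine tendsto_integral_filter_of_dominated_convergence bd (Eventually.of_forall hPzm)
      (Eventually.of_forall hPzb) hbdi ?_
    filter_upwards [hB0'] with z hz
    simp only [hPz, hSz]
    split_ifs with hi
    · exact hl z hz
    · rw [mul_zero]
      exact tendsto_const_nhds
  refine ⟨fun t => ∫ z, Pz t z ∂(ν.prod volume), ∫ z, Sz z ∂(ν.prod volume), hT1, hT2, ?_, ?_,
    hT3 _ _ fun z hz => (hPS z hz).2.2.2.2.2.1, hT3 _ _ fun z hz => (hPS z hz).2.2.2.2.2.2⟩
  · rw [← hbdint]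
    exact norm_integral_le_of_norm_le hbdi (hPzb 0)
  · rw [← hbdint]
    refine le_of_tendsto hT2.norm ?_
    filter_upwards [hpos] with ε hε
    rw [hJint _ (hΔi ε hε)]
    exact norm_integral_le_of_norm_le hbdi (hΔb ε hε)

end Product

/-! ### Splitting off one momentum -/

section Split

variable {s : ℕ} {m : ℝ} {ι : Type*}

/-- The family of momenta with `p` in position `l` and `y` elsewhere. -/
def insertAt [DecidableEq ι] (l : ι) (z : ({i // i ≠ l} → EuclideanSpace ℝ (Fin s)) × EuclideanSpace ℝ (Fin s)) :
    ι → EuclideanSpace ℝ (Fin s) :=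
  fun i => if h : i ≠ l then z.1 ⟨i, h⟩ else z.2

theorem insertAt_self [DecidableEq ι] (l : ι)
    (z : ({i // i ≠ l} → EuclideanSpace ℝ (Fin s)) × EuclideanSpace ℝ (Fin s)) :
    insertAt l z l = z.2 := by simp [insertAt]

theorem insertAt_ne [DecidableEq ι] (l : ι) (i : {i // i ≠ l})
    (z : ({i // i ≠ l} → EuclideanSpace ℝ (Fin s)) × EuclideanSpace ℝ (Fin s)) :
    insertAt l z i = z.1 i := by simp [insertAt, i.2]

theorem insertAt_eq_update [DecidableEq ι] (l : ι) (y : {i // i ≠ l} → EuclideanSpace ℝ (Fin s))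
    (p : EuclideanSpace ℝ (Fin s)) :
    insertAt l (y, p) = Function.update (insertAt l (y, 0)) l p := by
  funext i
  by_cases h : i = l
  · subst h
    simp [insertAt]
  · simp [insertAt, h]

variable [Fintype ι] [DecidableEq ι]

theorem measurePreserving_insertAt (l : ι) : MeasurePreserving (insertAt (s := s) l)
    ((volume : Measure ({i // i ≠ l} → EuclideanSpace ℝ (Fin s))).prod volume) volume ∧
    MeasurableEmbedding (insertAt (s := s) l) := by
  let _ : Unique {i // ¬i ≠ l} := ⟨⟨⟨l, by simp⟩⟩, fun i => Subtype.ext (not_not.1 i.2)⟩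
  let e := ((MeasurableEquiv.refl ({i // i ≠ l} → EuclideanSpace ℝ (Fin s))).prodCongr
    (MeasurableEquiv.funUnique {i // ¬i ≠ l} (EuclideanSpace ℝ (Fin s))).symm).trans
    (MeasurableEquiv.piEquivPiSubtypeProd (fun _ : ι => EuclideanSpace ℝ (Fin s)) (· ≠ l)).symm
  have he : (e : _ → _) = insertAt l := by
    funext z i
    rfl
  have hu : MeasurePreserving
      (MeasurableEquiv.funUnique {i // ¬i ≠ l} (EuclideanSpace ℝ (Fin s))).symm := by
    exact (volume_preserving_piUnique fun _ : {i // ¬i ≠ l} => EuclideanSpace ℝ (Fin s)).symm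
  have hmp : MeasurePreserving e
      ((volume : Measure ({i // i ≠ l} → EuclideanSpace ℝ (Fin s))).prod volume) volume :=
    (volume_preserving_piEquivPiSubtypeProd
      (fun _ : ι => EuclideanSpace ℝ (Fin s)) (· ≠ l)).symm.comp
      ((MeasurePreserving.id volume).prod
        hu)
  rw [← he]
  exact ⟨hmp, e.measurableEmbedding⟩

theorem integral_insertAt (l : ι) (F : (ι → EuclideanSpace ℝ (Fin s)) → ℂ) :
    ∫ p, F p = ∫ z, F (insertAt l z)
      ∂((volume : Measure ({i // i ≠ l} → EuclideanSpace ℝ (Fin s))).prod volume) :=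
  ((measurePreserving_insertAt l).1.integral_comp (measurePreserving_insertAt l).2 F).symm

theorem integrable_insertAt_iff (l : ι) {F : (ι → EuclideanSpace ℝ (Fin s)) → ℝ} :
    Integrable (fun z => F (insertAt l z))
      ((volume : Measure ({i // i ≠ l} → EuclideanSpace ℝ (Fin s))).prod volume) ↔
    Integrable F :=
  (measurePreserving_insertAt l).1.integrable_comp_emb (measurePreserving_insertAt l).2

theorem prod_insertAt {M : Type*} [CommMonoid M] (l : ι) (f : ι → EuclideanSpace ℝ (Fin s) → M)
    (z : ({i // i ≠ l} → EuclideanSpace ℝ (Fin s)) × EuclideanSpace ℝ (Fin s)) :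
    ∏ i, f i (insertAt l z i) = (∏ i : {i // i ≠ l}, f i (z.1 i)) * f l z.2 := by
  rw [← Fintype.prod_subtype_mul_prod_subtype (fun i => i ≠ l)]
  congr 1
  · exact Fintype.prod_congr _ _ fun i => by rw [insertAt_ne]
  · let _ : Unique {i // ¬i ≠ l} := ⟨⟨⟨l, by simp⟩⟩, fun i => Subtype.ext (not_not.1 i.2)⟩
    rw [Fintype.prod_unique]
    change f l (insertAt l z l) = _
    rw [insertAt_self]

theorem sum_insertAt {M : Type*} [AddCommMonoid M] (l : ι)
    (f : ι → EuclideanSpace ℝ (Fin s) → M)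
    (z : ({i // i ≠ l} → EuclideanSpace ℝ (Fin s)) × EuclideanSpace ℝ (Fin s)) :
    ∑ i, f i (insertAt l z i) = (∑ i : {i // i ≠ l}, f i (z.1 i)) + f l z.2 :=
  prod_insertAt (M := Multiplicative M) l f z

end Split

/-! ### Integrability of the singular weight -/

section Weight

variable {s : ℕ} {m : ℝ}

theorem integrableOn_inv_norm (hs : 2 ≤ s) :
    IntegrableOn (fun q : EuclideanSpace ℝ (Fin s) => ‖q‖⁻¹) (Metric.ball 0 1) := by
  have : Nonempty (Fin s) := ⟨⟨0, by omega⟩⟩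
  rw [integrableOn_fun_norm_addHaar volume (f := fun y => y⁻¹)]
  have h : IntegrableOn (fun _ : ℝ => (1 : ℝ)) (Set.Ioo 0 1) := integrableOn_const (by simp)
  refine Integrable.mono' h ?_ ?_
  · exact Measurable.aestronglyMeasurable (by fun_prop)
  · refine (ae_restrict_iff' measurableSet_Ioo).2 (Eventually.of_forall fun y hy => ?_)
    rw [finrank_euclideanSpace_fin, smul_eq_mul, norm_mul, norm_pow, norm_inv, Real.norm_eq_abs,
      abs_of_pos hy.1, ← div_eq_mul_inv]
    refine div_le_one_of_le₀ ?_ hy.1.le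
    exact pow_le_of_le_one hy.1.le hy.2.le (by omega)

theorem omega_pow_inv_div_norm_le (hm : 0 < m) (k : ℕ) (b p : EuclideanSpace ℝ (Fin s)) :
    (omega m p ^ k)⁻¹ * ‖p + b‖⁻¹ ≤ (m ^ k)⁻¹ *
      (Metric.ball (0 : EuclideanSpace ℝ (Fin s)) 1).indicator (fun q => ‖q‖⁻¹) (p + b) +
        (omega m p ^ k)⁻¹ := by
  have hp := omega_pos hm p
  by_cases h : ‖p + b‖ < 1
  · rw [Set.indicator_of_mem (by simpa using h)]
    refine le_add_of_le_of_nonneg ?_ (by positivity)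
    gcongr
    exact le_omega m p
  · have h2 : ‖p + b‖⁻¹ ≤ 1 := inv_le_one_of_one_le₀ (not_lt.1 h)
    refine le_add_of_nonneg_of_le ?_ (mul_le_of_le_one_right (by positivity) h2)
    exact mul_nonneg (by positivity) (Set.indicator_nonneg (fun q _ => by positivity) _)

theorem integrable_indicator_inv_norm_add (hs : 2 ≤ s) (b : EuclideanSpace ℝ (Fin s)) :
    Integrable fun p => (Metric.ball (0 : EuclideanSpace ℝ (Fin s)) 1).indicator
      (fun q => ‖q‖⁻¹) (p + b) :=
  ((integrable_indicator_iff measurableSet_ball).2 (integrableOn_inv_norm hs)).comp_add_right b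

theorem integrable_omega_pow_inv_div_norm (hs : 2 ≤ s) (hm : 0 < m) {k : ℕ} (hk : s < k)
    (b : EuclideanSpace ℝ (Fin s)) :
    Integrable fun p => (omega m p ^ k)⁻¹ * ‖p + b‖⁻¹ := by
  refine (((integrable_indicator_inv_norm_add hs b).const_mul (m ^ k)⁻¹).add
    (integrable_omega_pow_inv hm hk)).mono' ?_ (Eventually.of_forall fun p => ?_)
  · have := continuous_omega (s := s) m
    exact Measurable.aestronglyMeasurable (by fun_prop)
  · have hp := omega_pos hm p
    rw [Real.norm_eq_abs, abs_of_nonneg (by positivity)]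
    exact omega_pow_inv_div_norm_le hm k b p

theorem integral_omega_pow_inv_div_norm_le (hs : 2 ≤ s) (hm : 0 < m) {k : ℕ} (hk : s < k)
    (b : EuclideanSpace ℝ (Fin s)) :
    ∫ p, (omega m p ^ k)⁻¹ * ‖p + b‖⁻¹ ≤ (m ^ k)⁻¹ *
      (∫ q in Metric.ball (0 : EuclideanSpace ℝ (Fin s)) 1, ‖q‖⁻¹) +
        ∫ p : EuclideanSpace ℝ (Fin s), (omega m p ^ k)⁻¹ := by
  refine (integral_mono (integrable_omega_pow_inv_div_norm hs hm hk b)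
    (((integrable_indicator_inv_norm_add hs b).const_mul (m ^ k)⁻¹).add
    (integrable_omega_pow_inv hm hk)) (omega_pow_inv_div_norm_le hm k b)).trans (le_of_eq ?_)
  have h1 := integral_add ((integrable_indicator_inv_norm_add hs b).const_mul (m ^ k)⁻¹)
    (integrable_omega_pow_inv hm hk)
  refine h1.trans ?_
  rw [integral_const_mul, integral_add_right_eq_self
    (fun q => (Metric.ball (0 : EuclideanSpace ℝ (Fin s)) 1).indicator (fun q => ‖q‖⁻¹) q) b,
    integral_indicator measurableSet_ball]

variable {κ : Type*} [Fintype κ]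

theorem integrable_prod_omega_pow_inv (hm : 0 < m) {k : ℕ} (hk : s < k) :
    Integrable fun y : κ → EuclideanSpace ℝ (Fin s) => ∏ i, (omega m (y i) ^ k)⁻¹ :=
  Integrable.fintype_prod (f := fun _ p => (omega m p ^ k)⁻¹)
    fun _ => integrable_omega_pow_inv hm hk

theorem integrable_prod_omega_pow_inv_div_norm [DecidableEq κ] (hs : 2 ≤ s) (hm : 0 < m)
    {k : ℕ} (hk : s < k) (i₀ : κ) :
    Integrable fun y : κ → EuclideanSpace ℝ (Fin s) =>
      (∏ i, (omega m (y i) ^ k)⁻¹) * ‖∑ i, y i‖⁻¹ := by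
  have hom := continuous_omega (s := s) m
  rw [← integrable_insertAt_iff i₀]
  have e : ∀ z : ({i // i ≠ i₀} → EuclideanSpace ℝ (Fin s)) × EuclideanSpace ℝ (Fin s),
      (∏ i, (omega m (insertAt i₀ z i) ^ k)⁻¹) * ‖∑ i, insertAt i₀ z i‖⁻¹ =
      (∏ i : {i // i ≠ i₀}, (omega m (z.1 i) ^ k)⁻¹) *
        ((omega m z.2 ^ k)⁻¹ * ‖z.2 + ∑ i, z.1 i‖⁻¹) := fun z => by
    rw [prod_insertAt i₀ (fun _ p => (omega m p ^ k)⁻¹), sum_insertAt i₀ (fun _ p => p),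
      mul_assoc, add_comm z.2]
  simp only [e]
  refine (integrable_prod_iff (Measurable.aestronglyMeasurable (by fun_prop))).2
    ⟨Eventually.of_forall fun y => ?_, ?_⟩
  · have h := (integrable_omega_pow_inv_div_norm hs hm hk (∑ i, y i)).const_mul
        (∏ i, (omega m (y i) ^ k)⁻¹)
    exact h
  set C := (m ^ k)⁻¹ * (∫ q in Metric.ball (0 : EuclideanSpace ℝ (Fin s)) 1, ‖q‖⁻¹) +
        ∫ p : EuclideanSpace ℝ (Fin s), (omega m p ^ k)⁻¹
  refine ((integrable_prod_omega_pow_inv (κ := {i // i ≠ i₀}) hm hk).mul_const C).mono' ?_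
    (Eventually.of_forall fun y => ?_)
  · refine (StronglyMeasurable.integral_prod_right
      (f := fun (y : {i // i ≠ i₀} → EuclideanSpace ℝ (Fin s)) (p : EuclideanSpace ℝ (Fin s)) =>
        ‖(∏ i : {i // i ≠ i₀}, (omega m (y i) ^ k)⁻¹) *
        ((omega m p ^ k)⁻¹ * ‖p + ∑ i, y i‖⁻¹)‖) ?_).aestronglyMeasurable
    refine Measurable.stronglyMeasurable ?_
    unfold Function.uncurry
    fun_prop
  · have h0 : ∀ i : {i // i ≠ i₀}, 0 ≤ (omega m (y i) ^ k)⁻¹ := fun i => by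
      have := omega_pos hm (y i)
      positivity
    have hP : 0 ≤ ∏ i : {i // i ≠ i₀}, (omega m (y i) ^ k)⁻¹ :=
      Finset.prod_nonneg fun i _ => h0 i
    rw [Real.norm_eq_abs, abs_of_nonneg (integral_nonneg fun p => norm_nonneg _)]
    have h1 : ∀ p : EuclideanSpace ℝ (Fin s), ‖(∏ i : {i // i ≠ i₀}, (omega m (y i) ^ k)⁻¹) *
        ((omega m p ^ k)⁻¹ * ‖p + ∑ i, y i‖⁻¹)‖ = (∏ i : {i // i ≠ i₀}, (omega m (y i) ^ k)⁻¹) *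
        ((omega m p ^ k)⁻¹ * ‖p + ∑ i, y i‖⁻¹) := fun p => by
      have hq : 0 ≤ (omega m p ^ k)⁻¹ := by
        have := omega_pos hm p
        positivity
      exact Real.norm_of_nonneg (mul_nonneg hP (mul_nonneg hq (inv_nonneg.2 (norm_nonneg _))))
    simp only [h1]
    rw [integral_const_mul]
    refine mul_le_mul_of_nonneg_left ?_ hP
    exact integral_omega_pow_inv_div_norm_le hs hm hk _

theorem one_add_norm_sum_div_le (hm : 0 < m) (y : κ → EuclideanSpace ℝ (Fin s)) :
    1 + ‖∑ i, y i‖ / m ≤ ∏ i, (2 * m⁻¹ * omega m (y i)) := by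
  have h1 : 1 + ‖∑ i, y i‖ / m ≤ 1 + ∑ i, ‖y i‖ / m := by
    rw [← Finset.sum_div]
    gcongr
    exact norm_sum_le _ _
  have h2 : ∀ S : Finset κ, 1 + ∑ i ∈ S, ‖y i‖ / m ≤ ∏ i ∈ S, (1 + ‖y i‖ / m) := fun S => by
    classical
    induction S using Finset.induction_on with
    | empty => simp
    | insert i S hi ih =>
      rw [Finset.sum_insert hi, Finset.prod_insert hi]
      have h3 : 0 ≤ ‖y i‖ / m := by positivity
      have h4 : 0 ≤ ∑ j ∈ S, ‖y j‖ / m := Finset.sum_nonneg fun j _ => by positivity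
      nlinarith
  refine h1.trans ((h2 Finset.univ).trans (Finset.prod_le_prod (fun i _ => by positivity)
    fun i _ => ?_))
  have h5 : 1 ≤ m⁻¹ * omega m (y i) := by
    rw [inv_mul_eq_div, one_le_div hm]
    exact le_omega m _
  have h6 : ‖y i‖ / m ≤ m⁻¹ * omega m (y i) := by
    rw [div_eq_inv_mul]
    gcongr
    exact norm_le_omega m _
  linarith

/-- The weight is singular like `1 / ‖B‖` at the zeros of the sum `B` of the momenta. This is
integrable for `2 ≤ s`. -/
theorem integrable_lineWeight [DecidableEq κ] (hs : 2 ≤ s) (hm : 0 < m) (i₀ : κ) :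
    Integrable (lineWeight m (fun y : κ → EuclideanSpace ℝ (Fin s) => ∑ i, y i)
      fun y => ∏ i, (omega m (y i) ^ (s + 1 + 9))⁻¹) := by
  have hom := continuous_omega (s := s) m
  refine ((integrable_prod_omega_pow_inv_div_norm hs hm (Nat.lt_succ_self s) i₀).const_mul
    ((2 * m⁻¹) ^ (9 * Fintype.card κ))).mono' ?_ (Eventually.of_forall fun y => ?_)
  · unfold lineWeight
    exact Measurable.aestronglyMeasurable (by fun_prop)
  · have hp : ∀ i, 0 < omega m (y i) := fun i => omega_pos hm _
    have h0 : 0 ≤ ∏ i, (omega m (y i) ^ (s + 1 + 9))⁻¹ :=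
      Finset.prod_nonneg fun i _ => by have := hp i; positivity
    rw [lineWeight, Real.norm_eq_abs, abs_of_nonneg (by positivity), div_eq_mul_inv, ← mul_assoc]
    refine mul_le_mul_of_nonneg_right ?_ (by positivity)
    calc (∏ i, (omega m (y i) ^ (s + 1 + 9))⁻¹) * (1 + ‖∑ i, y i‖ / m) ^ 9
        ≤ (∏ i, (omega m (y i) ^ (s + 1 + 9))⁻¹) * (∏ i, (2 * m⁻¹ * omega m (y i))) ^ 9 := by
          gcongr
          exact one_add_norm_sum_div_le hm y
      _ = (2 * m⁻¹) ^ (9 * Fintype.card κ) * ∏ i, (omega m (y i) ^ (s + 1))⁻¹ := by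
          rw [← Finset.prod_pow, ← Finset.prod_mul_distrib, pow_mul, ← Finset.card_univ,
            ← Finset.prod_const, ← Finset.prod_mul_distrib]
          refine Finset.prod_congr rfl fun i _ => ?_
          have := hp i
          rw [mul_pow, pow_add]
          field_simp

theorem ae_sum_ne_zero [Nonempty κ] (hs : 0 < s) :
    ∀ᵐ y : κ → EuclideanSpace ℝ (Fin s), ∑ i, y i ≠ 0 := by
  classical
  let S : (κ → EuclideanSpace ℝ (Fin s)) →ₗ[ℝ] EuclideanSpace ℝ (Fin s) :=
    ∑ i, LinearMap.proj i
  have hS : ∀ y, S y = ∑ i, y i := fun y => by simp [S]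
  have hker : LinearMap.ker S ≠ ⊤ := by
    intro h
    obtain ⟨i₀⟩ := ‹Nonempty κ›
    have h1 : Pi.single i₀ (EuclideanSpace.single (⟨0, hs⟩ : Fin s) (1 : ℝ)) ∈
        LinearMap.ker S := by
      rw [h]
      trivial
    rw [LinearMap.mem_ker, hS, Finset.sum_pi_single'] at h1
    have h2 := congrArg norm h1
    simp at h2
  have h0 := Measure.addHaar_submodule volume (LinearMap.ker S) hker
  rw [ae_iff]
  convert h0 using 2
  ext y
  simp [hS]

end Weight

/-! ### Products of mass shells -/

section Shell

variable {s : ℕ} {m : ℝ} {ι : Type*} [Fintype ι]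

/-- Minus the sum of the vectors `(σ_l ω(𝐩_l), 𝐩_l)`. -/
def shellRecoil (m : ℝ) (σ : ι → ℝ) (p : ι → EuclideanSpace ℝ (Fin s)) : Fin (s + 1) → ℝ :=
  -∑ l, shellPoint m (σ l) (p l)

theorem shellRecoil_zero (σ : ι → ℝ) (p : ι → EuclideanSpace ℝ (Fin s)) :
    shellRecoil m σ p 0 = -∑ l, σ l * omega m (p l) := by
  simp [shellRecoil, shellPoint]

theorem spatial_shellRecoil (σ : ι → ℝ) (p : ι → EuclideanSpace ℝ (Fin s)) :
    spatial (shellRecoil m σ p) = -∑ l, p l := by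
  ext i
  simp [shellRecoil, shellPoint, spatial]

theorem shellRecoil_neg (σ : ι → ℝ) (p : ι → EuclideanSpace ℝ (Fin s)) :
    shellRecoil m (-σ) (-p) = -shellRecoil m σ p := by
  ext μ
  refine Fin.cases ?_ (fun i => ?_) μ
  · rw [Pi.neg_apply, shellRecoil_zero, shellRecoil_zero]
    simp [omega]
  · simp [shellRecoil, shellPoint]

theorem omega_neg (p : EuclideanSpace ℝ (Fin s)) : omega m (-p) = omega m p := by
  simp [omega]

theorem mink_self_sub (k : Fin (s + 1) → ℝ) :
    mink k k - m ^ 2 = (k 0 - omega m (spatial k)) * (k 0 + omega m (spatial k)) := by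
  have h1 : omega m (spatial k) ^ 2 = ‖spatial k‖ ^ 2 + m ^ 2 := omega_sq m _
  have h2 : ‖spatial k‖ ^ 2 = ∑ i : Fin s, k i.succ * k i.succ := by
    rw [EuclideanSpace.norm_sq_eq]
    refine Finset.sum_congr rfl fun i _ => ?_
    rw [Real.norm_eq_abs, sq_abs, sq]
    rfl
  rw [mink, ← h2]
  linear_combination h1

/-- The density `∏ 1 / 2ω_l` of the invariant measure on a product of mass shells. -/
def shellDensity (m : ℝ) (p : ι → EuclideanSpace ℝ (Fin s)) : ℂ :=
  ∏ l, (((2 * omega m (p l))⁻¹ : ℝ) : ℂ)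

/-- The decay in all momenta that is required of integrands on a product of mass shells: `s + 1`
powers of each energy for integrability, and nine more because the Lipschitz bound of the densities in the energy gap
contains the third power of the inverse slope of the gap, which grows like `ω³`. -/
def shellDecay (m : ℝ) (p : ι → EuclideanSpace ℝ (Fin s)) : ℝ :=
  ∏ l, (omega m (p l) ^ (s + 1 + 9))⁻¹

theorem shellDecay_neg (p : ι → EuclideanSpace ℝ (Fin s)) :
    shellDecay m (-p) = shellDecay m p := by
  simp [shellDecay, omega_neg]

theorem shellDensity_neg (p : ι → EuclideanSpace ℝ (Fin s)) :
    shellDensity m (-p) = shellDensity m p := by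
  simp [shellDensity, omega_neg]

theorem integral_comp_neg_pi (F : (ι → EuclideanSpace ℝ (Fin s)) → ℂ) :
    ∫ p, F (-p) = ∫ p, F p := by
  have : (volume : Measure (ι → EuclideanSpace ℝ (Fin s))).IsNegInvariant :=
    Measure.pi.isNegInvariant fun _ => volume
  exact integral_neg_eq_self F _

variable [DecidableEq ι]

theorem norm_fderiv_comp_insertAt_le (l : ι) {F : (ι → EuclideanSpace ℝ (Fin s)) → ℂ}
    (hF : Differentiable ℝ F) (y : {i // i ≠ l} → EuclideanSpace ℝ (Fin s))
    (p : EuclideanSpace ℝ (Fin s)) :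
    DifferentiableAt ℝ (fun p => F (insertAt l (y, p))) p ∧
    ‖fderiv ℝ (fun p => F (insertAt l (y, p))) p‖ ≤ ‖fderiv ℝ F (insertAt l (y, p))‖ := by
  have e : (fun p => F (insertAt l (y, p))) =
      F ∘ Function.update (insertAt l (y, 0)) l := by
    funext p
    rw [insertAt_eq_update]
    rfl
  have h := (hF (insertAt l (y, p))).hasFDerivAt
  rw [insertAt_eq_update] at h
  have h2 := h.comp p (hasFDerivAt_update (𝕜 := ℝ) (insertAt l (y, 0)) p)
  rw [e, insertAt_eq_update l y p]
  refine ⟨h2.differentiableAt, ?_⟩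
  rw [h2.fderiv]
  refine (ContinuousLinearMap.opNorm_comp_le _ _).trans
    (mul_le_of_le_one_right (norm_nonneg _) ?_)
  refine ContinuousLinearMap.opNorm_le_bound _ zero_le_one fun v => ?_
  rw [one_mul, pi_norm_le_iff_of_nonneg (norm_nonneg _)]
  intro i
  by_cases hi : i = l
  · subst hi
    simp
  · simp [hi]

theorem hasFDerivAt_inv_two_omega (hm : 0 < m) (p : EuclideanSpace ℝ (Fin s)) :
    DifferentiableAt ℝ (fun p : EuclideanSpace ℝ (Fin s) => (((2 * omega m p)⁻¹ : ℝ) : ℂ)) p ∧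
    ‖fderiv ℝ (fun p : EuclideanSpace ℝ (Fin s) => (((2 * omega m p)⁻¹ : ℝ) : ℂ)) p‖ ≤
      (2 * m ^ 2)⁻¹ := by
  have hp := omega_pos hm p
  have h0 : ‖p‖ ^ 2 + m ^ 2 ≠ 0 := by positivity
  have h1 : HasFDerivAt (fun p : EuclideanSpace ℝ (Fin s) => omega m p)
      ((1 / (2 * √(‖p‖ ^ 2 + m ^ 2))) • (2 • innerSL ℝ p)) p :=
    ((hasStrictFDerivAt_norm_sq p).hasFDerivAt.add_const (m ^ 2)).sqrt h0
  have h2 : HasFDerivAt (fun p : EuclideanSpace ℝ (Fin s) => (((2 * omega m p)⁻¹ : ℝ) : ℂ)) _ p :=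
    Complex.ofRealCLM.hasFDerivAt.comp p
      ((hasDerivAt_inv (by positivity : 2 * omega m p ≠ 0)).comp_hasFDerivAt p (h1.const_mul 2))
  refine ⟨h2.differentiableAt, ?_⟩
  rw [h2.fderiv]
  refine ContinuousLinearMap.opNorm_le_bound _ (by positivity) fun v => ?_
  have h3 : |inner ℝ p v| ≤ omega m p * ‖v‖ :=
    (abs_real_inner_le_norm p v).trans (by gcongr; exact norm_le_omega m p)
  have h4 : √(‖p‖ ^ 2 + m ^ 2) = omega m p := rfl
  have h5 : m ^ 2 ≤ omega m p ^ 2 := by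
    gcongr
    exact le_omega m p
  simp only [ContinuousLinearMap.comp_apply, smul_apply, innerSL_apply_apply, smul_eq_mul, h4,
    Complex.ofRealCLM_apply, Complex.norm_real, nsmul_eq_mul, Real.norm_eq_abs, abs_mul, abs_neg,
    abs_inv, abs_div, abs_one, abs_of_pos hp, abs_pow, Nat.cast_ofNat, Nat.abs_ofNat]
  calc ((2 * omega m p) ^ 2)⁻¹ * (2 * (1 / (2 * omega m p) * (2 * |inner ℝ p v|)))
      ≤ ((2 * omega m p) ^ 2)⁻¹ * (2 * (1 / (2 * omega m p) * (2 * (omega m p * ‖v‖)))) := by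
        gcongr
    _ = (2 * omega m p ^ 2)⁻¹ * ‖v‖ := by
        field_simp
    _ ≤ _ := by gcongr

set_option maxHeartbeats 400000 in
/-- Limits of truncated integrals of a function with support in the region of positive energy of
the recoil vector. -/
theorem exists_shell_limits_pos (hs : 2 ≤ s) (hm : 0 < m) [Nontrivial ι] {σ : ι → ℝ}
    (hσ : ∀ l, σ l = 1 ∨ σ l = -1) :
    ∃ C : ℝ, 0 ≤ C ∧ ∀ (F : (ι → EuclideanSpace ℝ (Fin s)) → ℂ) (A c₀ : ℝ), Differentiable ℝ F →
      (∀ p, ‖F p‖ ≤ A * shellDecay m p) → (∀ p, ‖fderiv ℝ F p‖ ≤ A * shellDecay m p) →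
      0 < c₀ → (∀ p, F p ≠ 0 → c₀ ≤ shellRecoil m σ p 0) →
      ∃ (P : ℝ → ℂ) (S : ℂ),
        (∀ t : ℝ, Tendsto (fun ε => ∫ p,
          truncInv ε (mink (shellRecoil m σ p) (shellRecoil m σ p) - m ^ 2) *
          (F p * Complex.exp (-Complex.I *
            (t * (shellRecoil m σ p 0 - omega m (spatial (shellRecoil m σ p))) : ℝ))) *
            shellDensity m p) (𝓝[>] 0) (𝓝 (P t))) ∧
        Tendsto (fun ε => ∫ p,
          boxDelta ε (mink (shellRecoil m σ p) (shellRecoil m σ p) - m ^ 2) * F p *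
            shellDensity m p) (𝓝[>] 0) (𝓝 S) ∧
        ‖P 0‖ ≤ C * A ∧ ‖S‖ ≤ C * A ∧
        Tendsto P atTop (𝓝 (-Complex.I * Real.pi * S)) ∧
        Tendsto P atBot (𝓝 (Complex.I * Real.pi * S)) := by
  by_cases hex : ∃ l, σ l = -1
  swap
  · -- all energies are positive, hence the recoil energy is negative
    refine ⟨0, le_rfl, fun F A c₀ _ _ _ hc₀ hsupp => ⟨fun _ => 0, 0, ?_⟩⟩
    have hF : F = 0 := by
      funext p
      by_contra hne
      have h1 := hc₀.trans_le (hsupp p hne)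
      rw [shellRecoil_zero] at h1
      have h2 : 0 ≤ ∑ l, σ l * omega m (p l) := Finset.sum_nonneg fun l _ => by
        rcases hσ l with h | h
        · rw [h, one_mul]
          exact (omega_pos hm _).le
        · exact (hex ⟨l, h⟩).elim
      linarith
    subst hF
    simp
  -- the vector `l` has negative energy, hence contributes `+ω` to the energy of the recoil vector,
  -- whose gap to the mass shell is then a difference of two energies as a function of `p l`
  obtain ⟨l, hl⟩ := hex
  obtain ⟨i₁, hi₁⟩ := exists_ne l
  let i₀ : {i // i ≠ l} := ⟨i₁, hi₁⟩
  have : Nonempty {i // i ≠ l} := ⟨i₀⟩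
  have hom := continuous_omega (s := s) m
  let B : ({i // i ≠ l} → EuclideanSpace ℝ (Fin s)) → EuclideanSpace ℝ (Fin s) := fun y => ∑ i, y i
  let b : ({i // i ≠ l} → EuclideanSpace ℝ (Fin s)) → ℝ := fun y =>
    -∑ i : {i // i ≠ l}, σ i * omega m (y i)
  let W₀ : ({i // i ≠ l} → EuclideanSpace ℝ (Fin s)) → ℝ := fun y =>
    ∏ i, (omega m (y i) ^ (s + 1 + 9))⁻¹
  set N := Fintype.card {i // i ≠ l} with hN
  set D : ℝ := ((2 * m)⁻¹) ^ N * ((2 * m)⁻¹ + (2 * m ^ 2)⁻¹) with hD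
  have hD0 : 0 < D := by positivity
  have hW₀ : Integrable W₀ := integrable_prod_omega_pow_inv hm (by omega)
  have hWB₀ : Integrable (lineWeight m B W₀) := integrable_lineWeight hs hm i₀
  have hW₀0 : ∀ y, 0 ≤ W₀ y := fun y => Finset.prod_nonneg fun i _ => by
    have := omega_pos hm (y i)
    positivity
  set J := ∫ y, lineWeight m B W₀ y with hJ
  have hJ0 : 0 ≤ J := integral_nonneg fun y => by
    have := hW₀0 y
    simp only [lineWeight, Pi.zero_apply]
    positivity
  set J' := ∫ p : EuclideanSpace ℝ (Fin s), (omega m p ^ (s + 1))⁻¹ with hJ'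
  have hJ'0 : 0 ≤ J' := integral_nonneg fun p => by
    have := omega_pos hm p
    simp only [Pi.zero_apply]
    positivity
  have hLB : 0 < lineBound m := by
    rw [lineBound, lineConst]
    positivity
  refine ⟨lineBound m * (1 + m⁻¹) ^ (s + 1) * (D * J * J'), by positivity,
    fun F A c₀ hFd hFA hFA' hc₀ hsupp => ?_⟩
  -- one factor of the density depends on the momentum that is singled out
  let d : ({i // i ≠ l} → EuclideanSpace ℝ (Fin s)) → ℂ := fun y =>
    ∏ i, (((2 * omega m (y i))⁻¹ : ℝ) : ℂ)
  let w : EuclideanSpace ℝ (Fin s) → ℂ := fun p => (((2 * omega m p)⁻¹ : ℝ) : ℂ)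
  let g : ({i // i ≠ l} → EuclideanSpace ℝ (Fin s)) × EuclideanSpace ℝ (Fin s) → ℂ :=
    fun z => F (insertAt l z) * (d z.1 * w z.2)
  have hw : ∀ p, ‖w p‖ ≤ (2 * m)⁻¹ := fun p => by
    have := omega_pos hm p
    simp only [w]
    rw [Complex.norm_real, Real.norm_of_nonneg (by positivity)]
    gcongr
    exact le_omega m p
  have hd : ∀ y, ‖d y‖ ≤ ((2 * m)⁻¹) ^ N := fun y => by
    simp only [d]
    rw [norm_prod, hN, ← Finset.card_univ, ← Finset.prod_const]
    exact Finset.prod_le_prod (fun i _ => norm_nonneg _) fun i _ => hw _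
  have hdec : ∀ y p, shellDecay m (insertAt l (y, p)) =
      W₀ y * (omega m p ^ (s + 1 + 9))⁻¹ := fun y p =>
    prod_insertAt l (fun _ p => (omega m p ^ (s + 1 + 9))⁻¹) (y, p)
  have hdec0 : ∀ y (p : EuclideanSpace ℝ (Fin s)), 0 ≤ W₀ y * (omega m p ^ (s + 1 + 9))⁻¹ := fun y p => by
    have h : 0 ≤ (omega m p ^ (s + 1 + 9))⁻¹ := by
      have := omega_pos hm p
      positivity
    exact mul_nonneg (hW₀0 y) h
  have hgm : Measurable g := by
    have h1 : Measurable fun z => F (insertAt l z) :=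
      hFd.continuous.measurable.comp (measurePreserving_insertAt (s := s) l).1.measurable
    have h2 : Measurable fun z :
        ({i // i ≠ l} → EuclideanSpace ℝ (Fin s)) × EuclideanSpace ℝ (Fin s) => d z.1 * w z.2 := by
      simp only [d, w]
      fun_prop
    exact h1.mul h2
  have hgd' : ∀ y p, HasFDerivAt (fun p => g (y, p))
      (F (insertAt l (y, p)) • (d y • fderiv ℝ w p) +
        (d y * w p) • fderiv ℝ (fun p => F (insertAt l (y, p))) p) p := fun y p =>
    (norm_fderiv_comp_insertAt_le l hFd y p).1.hasFDerivAt.mul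
      ((hasFDerivAt_inv_two_omega hm p).1.hasFDerivAt.const_mul (d y))
  have hA0 : 0 ≤ A := by
    have h := (norm_nonneg _).trans (hFA 0)
    refine nonneg_of_mul_nonneg_left h (Finset.prod_pos fun i _ => ?_)
    have := omega_pos hm ((0 : ι → EuclideanSpace ℝ (Fin s)) i)
    positivity
  have hgA : ∀ y p, ‖g (y, p)‖ ≤ (A * D * W₀ y) * (omega m p ^ (s + 1 + 9))⁻¹ := fun y p => by
    have h1 := hFA (insertAt l (y, p))
    rw [hdec] at h1
    calc ‖g (y, p)‖ = ‖F (insertAt l (y, p))‖ * (‖d y‖ * ‖w p‖) := by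
          simp only [g, norm_mul]
      _ ≤ (A * (W₀ y * (omega m p ^ (s + 1 + 9))⁻¹)) * (((2 * m)⁻¹) ^ N * (2 * m)⁻¹) := by
          gcongr
          exacts [mul_nonneg hA0 (hdec0 y p), hd y, hw p]
      _ ≤ (A * (W₀ y * (omega m p ^ (s + 1 + 9))⁻¹)) * D := by
          refine mul_le_mul_of_nonneg_left ?_ (mul_nonneg hA0 (hdec0 y p))
          rw [hD]
          gcongr
          exact le_add_of_nonneg_right (by positivity)
      _ = _ := by ring
  have hgA' : ∀ y p, ‖fderiv ℝ (fun p => g (y, p)) p‖ ≤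
      (A * D * W₀ y) * (omega m p ^ (s + 1 + 9))⁻¹ := fun y p => by
    have h1 := hFA (insertAt l (y, p))
    have h2 := (norm_fderiv_comp_insertAt_le l hFd y p).2.trans (hFA' (insertAt l (y, p)))
    rw [hdec] at h1 h2
    rw [(hgd' y p).fderiv]
    refine (norm_add_le _ _).trans ?_
    rw [norm_smul, norm_smul, norm_smul, norm_mul]
    have h3 := (hasFDerivAt_inv_two_omega hm p).2
    calc _ ≤ (A * (W₀ y * (omega m p ^ (s + 1 + 9))⁻¹)) * (((2 * m)⁻¹) ^ N * (2 * m ^ 2)⁻¹) +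
          (((2 * m)⁻¹) ^ N * (2 * m)⁻¹) * (A * (W₀ y * (omega m p ^ (s + 1 + 9))⁻¹)) := by
          gcongr
          exacts [mul_nonneg hA0 (hdec0 y p), hd y, hd y, hw p]
      _ = _ := by
          rw [hD]
          ring
  -- the recoil vector in the new variables
  have hk0 : ∀ z, shellRecoil m σ (insertAt l z) 0 = omega m z.2 + b z.1 := fun z => by
    rw [shellRecoil_zero, sum_insertAt l (fun i p => σ i * omega m p), hl]
    simp only [b]
    ring
  have hks : ∀ z, omega m (spatial (shellRecoil m σ (insertAt l z))) = omega m (z.2 + B z.1) :=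
    fun z => by
    rw [spatial_shellRecoil, sum_insertAt l (fun _ p => p), omega_neg, add_comm]
  have hgap : ∀ z, shellRecoil m σ (insertAt l z) 0 -
      omega m (spatial (shellRecoil m σ (insertAt l z))) = gapFn m b B z := fun z => by
    rw [hk0, hks, gapFn]
  have hmink : ∀ z, mink (shellRecoil m σ (insertAt l z)) (shellRecoil m σ (insertAt l z)) -
      m ^ 2 = gapFn m b B z * sumFn m b B z := fun z => by
    rw [mink_self_sub, hk0, hks, gapFn, sumFn]
  have hdens : ∀ z, shellDensity m (insertAt l z) = d z.1 * w z.2 := fun z =>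
    prod_insertAt l (fun _ p => (((2 * omega m p)⁻¹ : ℝ) : ℂ)) z
  have hlw : lineWeight m B (fun y => A * D * W₀ y) = fun y => (A * D) * lineWeight m B W₀ y := by
    funext y
    simp only [lineWeight]
    ring
  obtain ⟨P, S, hP, hS, hP0, hSn, hT, hT'⟩ := exists_product_limits (s := s) (ν := volume)
    (by omega) hm (b := b) (by fun_prop) (B := B) (by fun_prop) (ae_sum_ne_zero (by omega))
    (W := fun y => A * D * W₀ y) (hW₀.const_mul _) (by rw [hlw]; exact hWB₀.const_mul _)
    (k := s + 1) (by omega) hgm (fun y p => (hgd' y p).differentiableAt) hgA hgA' hc₀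
    (fun y p hg => by
      have h := hsupp (insertAt l (y, p)) (left_ne_zero_of_mul hg)
      rwa [hk0] at h)
  rw [hlw, integral_const_mul, ← hJ, ← hJ'] at hP0 hSn
  refine ⟨P, S, fun t => ?_, ?_, hP0.trans (le_of_eq (by ring)),
    hSn.trans (le_of_eq (by ring)), hT, hT'⟩
  · refine (hP t).congr fun ε => ?_
    rw [integral_insertAt l]
    refine integral_congr_ae (Eventually.of_forall fun z => ?_)
    simp only [hmink, hgap, hdens, g]
    ring
  · refine hS.congr fun ε => ?_
    rw [integral_insertAt l]
    refine integral_congr_ae (Eventually.of_forall fun z => ?_)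
    simp only [hmink, hdens, g]
    ring

/-- Limits of truncated integrals of a function with support in the region where the recoil
vector has energy of sign `ς`. -/
theorem exists_shell_limits (hs : 2 ≤ s) (hm : 0 < m) [Nontrivial ι] {σ : ι → ℝ}
    (hσ : ∀ l, σ l = 1 ∨ σ l = -1) {ς : ℝ} (hς : ς = 1 ∨ ς = -1) :
    ∃ C : ℝ, 0 ≤ C ∧ ∀ (F : (ι → EuclideanSpace ℝ (Fin s)) → ℂ) (A c₀ : ℝ), Differentiable ℝ F →
      (∀ p, ‖F p‖ ≤ A * shellDecay m p) → (∀ p, ‖fderiv ℝ F p‖ ≤ A * shellDecay m p) →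
      0 < c₀ → (∀ p, F p ≠ 0 → c₀ ≤ ς * shellRecoil m σ p 0) →
      ∃ (P : ℝ → ℂ) (S : ℂ),
        (∀ t : ℝ, Tendsto (fun ε => ∫ p,
          truncInv ε (mink (shellRecoil m σ p) (shellRecoil m σ p) - m ^ 2) *
          (F p * Complex.exp (-Complex.I *
            (t * (ς * shellRecoil m σ p 0 - omega m (spatial (shellRecoil m σ p))) : ℝ))) *
            shellDensity m p) (𝓝[>] 0) (𝓝 (P t))) ∧
        Tendsto (fun ε => ∫ p,
          boxDelta ε (mink (shellRecoil m σ p) (shellRecoil m σ p) - m ^ 2) * F p *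
            shellDensity m p) (𝓝[>] 0) (𝓝 S) ∧
        ‖P 0‖ ≤ C * A ∧ ‖S‖ ≤ C * A ∧
        Tendsto P atTop (𝓝 (-Complex.I * Real.pi * S)) ∧
        Tendsto P atBot (𝓝 (Complex.I * Real.pi * S)) := by
  rcases hς with rfl | rfl
  · simp only [one_mul]
    exact exists_shell_limits_pos hs hm hσ
  -- reflect all vectors
  obtain ⟨C, hC, h⟩ := exists_shell_limits_pos (ι := ι) hs hm (σ := -σ) fun l => by
    rcases hσ l with h | h <;> simp [h]
  have hr : ∀ p : ι → EuclideanSpace ℝ (Fin s), shellRecoil m (-σ) p = -shellRecoil m σ (-p) := fun p => by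
    rw [← shellRecoil_neg, neg_neg]
  have hsp : ∀ k : Fin (s + 1) → ℝ, spatial (-k) = -spatial k := fun k => rfl
  have hmn : ∀ k : Fin (s + 1) → ℝ, mink (-k) (-k) = mink k k := fun k => by simp [mink]
  refine ⟨C, hC, fun F A c₀ hFd hFA hFA' hc₀ hsupp => ?_⟩
  obtain ⟨P, S, hP, hS, hrest⟩ := h (fun p => F (-p)) A c₀ (hFd.comp differentiable_id.neg)
    (fun p => by rw [← shellDecay_neg]; exact hFA _)
    (fun p => by
      have h1 := (hFd (-p)).hasFDerivAt.comp p (hasFDerivAt_id p).neg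
      have h2 : fderiv ℝ (fun p => F (-p)) p = _ := h1.fderiv
      rw [h2, ← shellDecay_neg]
      refine le_trans ?_ (hFA' (-p))
      rw [ContinuousLinearMap.comp_neg, norm_neg, ContinuousLinearMap.comp_id])
    hc₀ (fun p hp => by
      have h1 := hsupp (-p) hp
      rw [hr, Pi.neg_apply]
      linarith)
  refine ⟨P, S, fun t => (hP t).congr fun ε => ?_, hS.congr fun ε => ?_, hrest⟩
  · rw [← integral_comp_neg_pi]
    refine integral_congr_ae (Eventually.of_forall fun p => ?_)
    simp only [hr, neg_neg, hsp, hmn, omega_neg, Pi.neg_apply, shellDensity_neg, neg_mul, one_mul]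
  · rw [← integral_comp_neg_pi]
    refine integral_congr_ae (Eventually.of_forall fun p => ?_)
    simp only [hr, neg_neg, hmn, shellDensity_neg]

end Shell

/-! ### Weighted bounds of test functions -/

section Decay

variable {s n : ℕ} {m : ℝ}

theorem one_le_weight (L : ℕ) (x : Cfg s n) : 1 ≤ weight L x :=
  Finset.one_le_prod fun l _ => Real.one_le_rpow
    (le_add_of_nonneg_right (Finset.sum_nonneg fun _ _ => sq_nonneg _)) (by positivity)

theorem weight_pos (L : ℕ) (x : Cfg s n) : 0 < weight L x := one_pos.trans_le (one_le_weight L x)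

theorem weight_add (L K : ℕ) (x : Cfg s n) : weight (L + K) x = weight L x * weight K x := by
  rw [weight, weight, weight, ← Finset.prod_mul_distrib]
  refine Finset.prod_congr rfl fun l _ => ?_
  rw [← Real.rpow_add (add_pos_of_pos_of_nonneg one_pos
    (Finset.sum_nonneg fun _ _ => sq_nonneg _))]
  congr 1
  push_cast
  ring

theorem weight_mono {L K : ℕ} (h : L ≤ K) (x : Cfg s n) : weight L x ≤ weight K x := by
  obtain ⟨k, rfl⟩ := Nat.exists_eq_add_of_le h
  rw [weight_add]
  exact le_mul_of_one_le_right (weight_pos L x).le (one_le_weight k x)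

/-- A factor of the weight is bounded by the weight. -/
theorem rpow_le_weight (L : ℕ) (x : Cfg s n) (l : Fin n) :
    (1 + ∑ μ, x (l, μ) ^ 2) ^ ((L : ℝ) / 2) ≤ weight L x := by
  have h := Finset.prod_le_prod_of_subset_of_one_le
    (f := fun l => (1 + ∑ μ, x (l, μ) ^ 2) ^ ((L : ℝ) / 2)) (Finset.subset_univ {l})
    (fun l _ => by positivity) (fun l _ _ => Real.one_le_rpow
      (le_add_of_nonneg_right (Finset.sum_nonneg fun _ _ => sq_nonneg _)) (by positivity))
  rwa [Finset.prod_singleton] at h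

/-- A function and its derivative decay at least like the inverse of the weight of order `L`. -/
structure HasDecay (L : ℕ) (A : ℝ) (f : Cfg s n → ℂ) : Prop where
  differentiable : Differentiable ℝ f
  le : ∀ k, weight L k * ‖f k‖ ≤ A
  fderiv_le : ∀ k, weight L k * ‖fderiv ℝ f k‖ ≤ A

theorem HasDecay.nonneg {L : ℕ} {A : ℝ} {f : Cfg s n → ℂ} (h : HasDecay L A f) : 0 ≤ A :=
  (mul_nonneg (weight_pos L 0).le (norm_nonneg _)).trans (h.le 0)

theorem HasDecay.mono {L K : ℕ} (hLK : L ≤ K) {A : ℝ} {f : Cfg s n → ℂ} (h : HasDecay K A f) :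
    HasDecay L A f :=
  ⟨h.differentiable,
    fun k => (mul_le_mul_of_nonneg_right (weight_mono hLK k) (norm_nonneg _)).trans (h.le k),
    fun k => (mul_le_mul_of_nonneg_right (weight_mono hLK k) (norm_nonneg _)).trans
      (h.fderiv_le k)⟩

theorem HasDecay.mul {L N : ℕ} {A C : ℝ} {f g : Cfg s n → ℂ} (hf : HasDecay (L + N) A f)
    (hgd : Differentiable ℝ g) (hg : ∀ k, ‖g k‖ ≤ C * weight N k)
    (hg' : ∀ k, ‖fderiv ℝ g k‖ ≤ C * weight N k) : HasDecay L (2 * C * A) fun k => g k * f k := by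
  have hC : 0 ≤ C := nonneg_of_mul_nonneg_left ((norm_nonneg _).trans (hg 0)) (weight_pos N 0)
  have h0 : ∀ k, weight L k * (C * weight N k * ‖f k‖) ≤ C * A := fun k => by
    have := mul_le_mul_of_nonneg_left (hf.le k) hC
    rw [weight_add] at this
    linarith
  have h1 : ∀ k, weight L k * (C * weight N k * ‖fderiv ℝ f k‖) ≤ C * A := fun k => by
    have := mul_le_mul_of_nonneg_left (hf.fderiv_le k) hC
    rw [weight_add] at this
    linarith
  have hCA := mul_nonneg hC hf.nonneg
  refine ⟨hgd.mul hf.differentiable, fun k => ?_, fun k => ?_⟩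
  · have hw := weight_pos L k
    rw [norm_mul]
    calc weight L k * (‖g k‖ * ‖f k‖) ≤ weight L k * (C * weight N k * ‖f k‖) := by
          gcongr
          exact hg k
      _ ≤ C * A := h0 k
      _ ≤ _ := by linarith
  · have hw := weight_pos L k
    have hw' := weight_pos N k
    have e : fderiv ℝ (fun k => g k * f k) k = g k • fderiv ℝ f k + f k • fderiv ℝ g k :=
      ((hgd k).hasFDerivAt.mul (hf.differentiable k).hasFDerivAt).fderiv
    rw [e]
    calc _ ≤ weight L k * (‖g k‖ * ‖fderiv ℝ f k‖ + ‖f k‖ * ‖fderiv ℝ g k‖) := by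
          gcongr
          refine (norm_add_le _ _).trans ?_
          rw [norm_smul, norm_smul]
      _ ≤ weight L k * (C * weight N k * ‖fderiv ℝ f k‖ + ‖f k‖ * (C * weight N k)) := by
          gcongr
          exacts [hg k, hg' k]
      _ = weight L k * (C * weight N k * ‖fderiv ℝ f k‖) +
          weight L k * (C * weight N k * ‖f k‖) := by ring
      _ ≤ C * A + C * A := add_le_add (h1 k) (h0 k)
      _ = _ := by ring

theorem HasDecay.sub {L : ℕ} {A B : ℝ} {f g : Cfg s n → ℂ} (hf : HasDecay L A f)
    (hg : HasDecay L B g) : HasDecay L (A + B) fun k => f k - g k := by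
  refine ⟨hf.differentiable.sub hg.differentiable, fun k => ?_, fun k => ?_⟩
  · refine (mul_le_mul_of_nonneg_left (norm_sub_le _ _) (weight_pos L k).le).trans ?_
    linarith [hf.le k, hg.le k]
  · have e : fderiv ℝ (fun k => f k - g k) k = fderiv ℝ f k - fderiv ℝ g k :=
      ((hf.differentiable k).hasFDerivAt.sub (hg.differentiable k).hasFDerivAt).fderiv
    rw [e]
    refine (mul_le_mul_of_nonneg_left (norm_sub_le _ _) (weight_pos L k).le).trans ?_
    linarith [hf.fderiv_le k, hg.fderiv_le k]

/-- The `l`-th vector of an `n`-tuple, as a tuple of length one. -/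
def slotProj (s n : ℕ) (l : Fin n) : Cfg s n →L[ℝ] Cfg s 1 :=
  LinearMap.toContinuousLinearMap
    { toFun := fun k => ofSlots fun _ => slot k l
      map_add' := fun _ _ => rfl
      map_smul' := fun _ _ => rfl }

theorem norm_slotProj_apply_sq (l : Fin n) (k : Cfg s n) :
    ‖slotProj s n l k‖ ^ 2 = ∑ μ, k (l, μ) ^ 2 := by
  rw [EuclideanSpace.norm_sq_eq, Fintype.sum_prod_type]
  simp [slotProj, ofSlots, slot]

theorem norm_slotProj_le (l : Fin n) : ‖slotProj s n l‖ ≤ 1 := by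
  refine ContinuousLinearMap.opNorm_le_bound _ zero_le_one fun k => ?_
  rw [one_mul]
  refine le_of_sq_le_sq ?_ (norm_nonneg _)
  rw [norm_slotProj_apply_sq, EuclideanSpace.norm_sq_eq, Fintype.sum_prod_type]
  simp only [Real.norm_eq_abs, sq_abs]
  exact Finset.single_le_sum (f := fun l => ∑ μ, k (l, μ) ^ 2)
    (fun l _ => Finset.sum_nonneg fun _ _ => sq_nonneg _) (Finset.mem_univ l)

theorem one_add_norm_slotProj_pow_le (N : ℕ) (l : Fin n) (k : Cfg s n) :
    (1 + ‖slotProj s n l k‖) ^ N ≤ 2 ^ N * weight N k := by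
  have h0 : 0 ≤ ∑ μ, k (l, μ) ^ 2 := Finset.sum_nonneg fun _ _ => sq_nonneg _
  refine le_trans ?_ (mul_le_mul_of_nonneg_left (rpow_le_weight N k l) (by positivity))
  rw [← norm_slotProj_apply_sq] at h0 ⊢
  set r := ‖slotProj s n l k‖
  have hr : 0 ≤ r := norm_nonneg _
  have h1 : (1 + r ^ 2) ^ ((N : ℝ) / 2) = √(1 + r ^ 2) ^ N := by
    rw [Real.sqrt_eq_rpow, ← Real.rpow_natCast _ N, ← Real.rpow_mul (by positivity)]
    congr 1
    ring
  rw [h1, ← mul_pow]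
  refine pow_le_pow_left₀ (by positivity) ?_ N
  have h2 : 1 ≤ √(1 + r ^ 2) := Real.one_le_sqrt.2 (by linarith)
  have h3 : r ≤ √(1 + r ^ 2) := Real.le_sqrt_of_sq_le (by linarith)
  linarith

/-- A function of temperate growth of one energy-momentum vector is bounded, with its derivative,
by a weight whose order does not depend on the number of vectors. -/
theorem exists_weight_bound {g : Cfg s 1 → ℂ} (hg : g.HasTemperateGrowth) :
    ∃ (N : ℕ) (C : ℝ), ∀ (n : ℕ) (l : Fin n) (k : Cfg s n),
      DifferentiableAt ℝ (fun k => g (slotProj s n l k)) k ∧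
      ‖g (slotProj s n l k)‖ ≤ C * weight N k ∧
      ‖fderiv ℝ (fun k => g (slotProj s n l k)) k‖ ≤ C * weight N k := by
  obtain ⟨N, C, hC, hN⟩ := hg.norm_iteratedFDeriv_le_uniform 1
  have hd : Differentiable ℝ g := hg.1.differentiable (by simp)
  refine ⟨N, C * 2 ^ N, fun n l k => ?_⟩
  have hb : C * (1 + ‖slotProj s n l k‖) ^ N ≤ C * 2 ^ N * weight N k := by
    rw [mul_assoc]
    exact mul_le_mul_of_nonneg_left (one_add_norm_slotProj_pow_le N l k) hC
  have h0 := hN 0 (by norm_num) (slotProj s n l k)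
  have h1 := hN 1 le_rfl (slotProj s n l k)
  rw [norm_iteratedFDeriv_zero] at h0
  rw [norm_iteratedFDeriv_one] at h1
  have h2 := (hd (slotProj s n l k)).hasFDerivAt.comp k (slotProj s n l).hasFDerivAt
  have h3 : fderiv ℝ (fun k => g (slotProj s n l k)) k = _ := h2.fderiv
  refine ⟨h2.differentiableAt, h0.trans hb, ?_⟩
  rw [h3]
  refine (ContinuousLinearMap.opNorm_comp_le _ _).trans (le_trans ?_ (h1.trans hb))
  exact mul_le_of_le_one_right (norm_nonneg _) (norm_slotProj_le l)

end Decay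

/-! ### Test functions on a product of mass shells -/

section OnShell

variable {s n : ℕ} {m : ℝ}

theorem hasFDerivAt_omega (hm : 0 < m) (p : EuclideanSpace ℝ (Fin s)) :
    DifferentiableAt ℝ (omega m) p ∧ ‖fderiv ℝ (omega m) p‖ ≤ 1 := by
  have hp := omega_pos hm p
  have h0 : ‖p‖ ^ 2 + m ^ 2 ≠ 0 := by positivity
  have h1 : HasFDerivAt (omega m)
      ((1 / (2 * √(‖p‖ ^ 2 + m ^ 2))) • (2 • innerSL ℝ p)) p :=
    ((hasStrictFDerivAt_norm_sq p).hasFDerivAt.add_const (m ^ 2)).sqrt h0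
  refine ⟨h1.differentiableAt, ?_⟩
  rw [h1.fderiv]
  refine ContinuousLinearMap.opNorm_le_bound _ zero_le_one fun v => ?_
  have h3 : |inner ℝ p v| ≤ omega m p * ‖v‖ :=
    (abs_real_inner_le_norm p v).trans (by gcongr; exact norm_le_omega m p)
  have h4 : √(‖p‖ ^ 2 + m ^ 2) = omega m p := rfl
  simp only [smul_apply, innerSL_apply_apply, smul_eq_mul, h4, nsmul_eq_mul, Real.norm_eq_abs,
    abs_mul, abs_div, abs_one, abs_of_pos hp, Nat.cast_ofNat, Nat.abs_ofNat]
  calc 1 / (2 * omega m p) * (2 * |inner ℝ p v|)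
      ≤ 1 / (2 * omega m p) * (2 * (omega m p * ‖v‖)) := by gcongr
    _ = 1 * ‖v‖ := by field_simp

/-- The sign of the energy of the `l`-th vector, `l ≠ j`. -/
def shellSign (j : Fin n) (l : {l : Fin n // l ≠ j}) : ℝ := if l.1 < j then -1 else 1

theorem shellSign_eq (j : Fin n) (l : {l : Fin n // l ≠ j}) :
    shellSign j l = 1 ∨ shellSign j l = -1 := by
  unfold shellSign
  split_ifs <;> simp

theorem recoil_eq (j : Fin n) (p : {l : Fin n // l ≠ j} → EuclideanSpace ℝ (Fin s)) :
    recoil m j p = shellRecoil m (shellSign j) p := rfl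

theorem slot_onShellCfg_self (j : Fin n) (p : {l : Fin n // l ≠ j} → EuclideanSpace ℝ (Fin s)) :
    slot (onShellCfg m j p) j = recoil m j p := by
  funext μ
  simp [slot, onShellCfg, ofSlots]

theorem slot_onShellCfg_ne (j : Fin n) (p : {l : Fin n // l ≠ j} → EuclideanSpace ℝ (Fin s))
    (l : {l : Fin n // l ≠ j}) : slot (onShellCfg m j p) l = onShell m j p l := by
  funext μ
  simp [slot, onShellCfg, ofSlots, l.2]

/-- The configuration on the mass shells as a linear function of momenta and energies. -/
def shellCfgMap (s : ℕ) (j : Fin n) :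
    (({l : Fin n // l ≠ j} → EuclideanSpace ℝ (Fin s)) × ({l : Fin n // l ≠ j} → ℝ)) →L[ℝ]
      Cfg s n :=
  LinearMap.toContinuousLinearMap
    { toFun := fun z => ofSlots fun l => if h : l = j then
          -∑ l, Fin.cons (shellSign j l * z.2 l) fun i => z.1 l i else
          Fin.cons (shellSign j ⟨l, h⟩ * z.2 ⟨l, h⟩) fun i => z.1 ⟨l, h⟩ i
      map_add' := fun x y => by
        ext ⟨l, μ⟩
        by_cases h : l = j
        · refine Fin.cases ?_ (fun i => ?_) μ
          · simp [ofSlots, h, mul_add, Finset.sum_add_distrib]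
            exact add_comm _ _
          · simp [ofSlots, h, Finset.sum_add_distrib]
            exact add_comm _ _
        · refine Fin.cases ?_ (fun i => ?_) μ
          · simp [ofSlots, h, mul_add]
          · simp [ofSlots, h]
      map_smul' := fun c x => by
        ext ⟨l, μ⟩
        by_cases h : l = j
        · refine Fin.cases ?_ (fun i => ?_) μ
          · simp [ofSlots, h, Finset.mul_sum, mul_left_comm]
          · simp [ofSlots, h, Finset.mul_sum]
        · refine Fin.cases ?_ (fun i => ?_) μ
          · simp [ofSlots, h, mul_left_comm]
          · simp [ofSlots, h] }

theorem norm_fderiv_onShellCfg_le (hm : 0 < m) (j : Fin n)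
    (p : {l : Fin n // l ≠ j} → EuclideanSpace ℝ (Fin s)) :
    DifferentiableAt ℝ (onShellCfg m j) p ∧
      ‖fderiv ℝ (onShellCfg m j) p‖ ≤ ‖shellCfgMap s j‖ := by
  have h1 : HasFDerivAt (fun (p : {l : Fin n // l ≠ j} → EuclideanSpace ℝ (Fin s)) l =>
      omega m (p l)) (ContinuousLinearMap.pi fun l => (fderiv ℝ (omega m) (p l)).comp
        (ContinuousLinearMap.proj l)) p :=
    hasFDerivAt_pi.2 fun l => by
      have h := (hasFDerivAt_omega hm (p l)).1.hasFDerivAt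
      have h' := (ContinuousLinearMap.proj (R := ℝ)
        (φ := fun _ : {l : Fin n // l ≠ j} => EuclideanSpace ℝ (Fin s)) l).hasFDerivAt (x := p)
      exact HasFDerivAt.comp p h h'
  have h2 : HasFDerivAt (onShellCfg m j) _ p :=
    (shellCfgMap s j).hasFDerivAt.comp p ((hasFDerivAt_id p).prodMk h1)
  refine ⟨h2.differentiableAt, ?_⟩
  rw [h2.fderiv]
  refine (ContinuousLinearMap.opNorm_comp_le _ _).trans
    (mul_le_of_le_one_right (norm_nonneg _) ?_)
  refine ContinuousLinearMap.opNorm_le_bound _ zero_le_one fun v => ?_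
  rw [one_mul, Prod.norm_def]
  refine max_le le_rfl ((pi_norm_le_iff_of_nonneg (norm_nonneg _)).2 fun l => ?_)
  calc ‖fderiv ℝ (omega m) (p l) (v l)‖ ≤ ‖fderiv ℝ (omega m) (p l)‖ * ‖v l‖ :=
        ContinuousLinearMap.le_opNorm _ _
    _ ≤ 1 * ‖v‖ := by
        gcongr
        · exact (hasFDerivAt_omega hm (p l)).2
        · exact norm_le_pi_norm v l
    _ = ‖v‖ := one_mul _

theorem sum_sq_onShell (j : Fin n) (p : {l : Fin n // l ≠ j} → EuclideanSpace ℝ (Fin s))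
    (l : {l : Fin n // l ≠ j}) :
    ∑ μ, onShellCfg m j p (l, μ) ^ 2 = omega m (p l) ^ 2 + ‖p l‖ ^ 2 := by
  have h : ∀ μ, onShellCfg m j p (l, μ) = onShell m j p l μ := fun μ =>
    congrFun (slot_onShellCfg_ne j p l) μ
  simp only [h]
  rw [Fin.sum_univ_succ, EuclideanSpace.norm_sq_eq]
  congr 1
  · simp only [onShell, shellPoint, Fin.cons_zero, mul_pow]
    split_ifs <;> norm_num
  · simp [onShell, shellPoint]

theorem prod_omega_pow_le_weight (L : ℕ) (j : Fin n)
    (p : {l : Fin n // l ≠ j} → EuclideanSpace ℝ (Fin s)) :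
    ∏ l, omega m (p l) ^ L ≤ weight L (onShellCfg m j p) := by
  rw [weight, ← Fintype.prod_subtype_mul_prod_subtype (fun l => l ≠ j)]
  have h0 : ∀ l, 0 ≤ ∑ μ, onShellCfg m j p (l, μ) ^ 2 := fun l =>
    Finset.sum_nonneg fun _ _ => sq_nonneg _
  have h1 : ∀ l : {l : Fin n // l ≠ j}, omega m (p l) ^ L ≤
      (1 + ∑ μ, onShellCfg m j p (l, μ) ^ 2) ^ ((L : ℝ) / 2) := fun l => by
    have hw : 0 ≤ omega m (p l) := Real.sqrt_nonneg _
    rw [sum_sq_onShell]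
    calc omega m (p l) ^ L = (omega m (p l) ^ 2) ^ ((L : ℝ) / 2) := by
          rw [← Real.rpow_natCast, ← Real.rpow_natCast, ← Real.rpow_mul hw]
          congr 1
          push_cast
          ring
      _ ≤ _ := by
          refine Real.rpow_le_rpow (by positivity) ?_ (by positivity)
          nlinarith [sq_nonneg ‖p l‖]
  refine (Finset.prod_le_prod (fun l _ => pow_nonneg (Real.sqrt_nonneg _) L)
    fun l _ => h1 l).trans (le_mul_of_one_le_right
      (Finset.prod_nonneg fun l _ => Real.rpow_nonneg (by linarith [h0 l]) _)
      (Finset.one_le_prod fun l _ => Real.one_le_rpow (by linarith [h0 l]) (by positivity)))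

/-- A weighted bound of a test function bounds its restriction to the product of mass shells. -/
theorem HasDecay.onShell_bound (hm : 0 < m) {A : ℝ} {f : Cfg s n → ℂ} (hf : HasDecay (s + 1 + 9) A f)
    (j : Fin n) :
    Differentiable ℝ (fun p => f (onShellCfg m j p)) ∧
    (∀ p, ‖f (onShellCfg m j p)‖ ≤ (1 + ‖shellCfgMap s j‖) * A * shellDecay m p) ∧
    ∀ p, ‖fderiv ℝ (fun p => f (onShellCfg m j p)) p‖ ≤
      (1 + ‖shellCfgMap s j‖) * A * shellDecay m p := by
  have hd : ∀ p : {l : Fin n // l ≠ j} → EuclideanSpace ℝ (Fin s), 0 < shellDecay m p := fun p =>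
    Finset.prod_pos fun l _ => by
      have := omega_pos hm (p l)
      positivity
  have key : ∀ (x : ℝ) (p : {l : Fin n // l ≠ j} → EuclideanSpace ℝ (Fin s)), 0 ≤ x →
      weight (s + 1 + 9) (onShellCfg m j p) * x ≤ A → x ≤ A * shellDecay m p := fun x p hx h => by
    have h1 := (mul_le_mul_of_nonneg_right (prod_omega_pow_le_weight (m := m) (s + 1 + 9) j p)
      hx).trans h
    have h2 : (∏ l, omega m (p l) ^ (s + 1 + 9)) * shellDecay m p = 1 := by
      rw [shellDecay, ← Finset.prod_mul_distrib]
      refine Finset.prod_eq_one fun l _ => mul_inv_cancel₀ ?_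
      have := omega_pos hm (p l)
      positivity
    have h3 := mul_le_mul_of_nonneg_right h1 (hd p).le
    rwa [mul_right_comm, h2, one_mul] at h3
  have hC := norm_nonneg (shellCfgMap s j)
  have hA := hf.nonneg
  have hc : ∀ p, HasFDerivAt (fun p => f (onShellCfg m j p))
      ((fderiv ℝ f (onShellCfg m j p)).comp (fderiv ℝ (onShellCfg m j) p)) p := fun p =>
    (hf.differentiable _).hasFDerivAt.comp p (norm_fderiv_onShellCfg_le hm j p).1.hasFDerivAt
  refine ⟨fun p => (hc p).differentiableAt, fun p => ?_, fun p => ?_⟩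
  · refine (key _ p (norm_nonneg _) (hf.le _)).trans
      (mul_le_mul_of_nonneg_right ?_ (hd p).le)
    nlinarith
  · rw [(hc p).fderiv]
    calc _ ≤ ‖fderiv ℝ f (onShellCfg m j p)‖ * ‖fderiv ℝ (onShellCfg m j) p‖ :=
          ContinuousLinearMap.opNorm_comp_le _ _
      _ ≤ (A * shellDecay m p) * ‖shellCfgMap s j‖ := by
          have := hd p
          gcongr
          · exact key _ p (norm_nonneg _) (hf.fderiv_le _)
          · exact (norm_fderiv_onShellCfg_le hm j p).2
      _ = ‖shellCfgMap s j‖ * A * shellDecay m p := by ring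
      _ ≤ _ := mul_le_mul_of_nonneg_right (by nlinarith) (hd p).le

end OnShell

/-! ### Products of mass shells with one propagator -/

section ShellProduct

variable {s n : ℕ} {m : ℝ} {φ : ℝ → ℝ}

/-- The cutoff around the shell of energies of sign `ς`. -/
def chiSign (m : ℝ) (φ : ℝ → ℝ) (ς : ℝ) (k : Fin (s + 1) → ℝ) : ℝ :=
  if 0 < ς * k 0 then φ (mink k k - m ^ 2) else 0

theorem chiPlus_eq (k : Fin (s + 1) → ℝ) : chiPlus m φ k = chiSign m φ 1 k := by
  simp [chiPlus, chiSign]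

theorem chiMinus_eq (k : Fin (s + 1) → ℝ) : chiMinus m φ k = chiSign m φ (-1) k := by
  simp [chiMinus, chiSign]

theorem exists_chiSign_decay (s : ℕ) (hφ : IsShellCutoff m φ) {ς : ℝ} (hς : ς = 1 ∨ ς = -1) :
    ∃ (N : ℕ) (C : ℝ), ∀ (n : ℕ) (j : Fin n) (L : ℕ) (A : ℝ) (f : Cfg s n → ℂ),
      HasDecay (L + N) A f →
      HasDecay L (2 * C * A) fun k => (chiSign m φ ς (slot k j) : ℂ) * f k := by
  have h := Function.Complex.hasTemperateGrowth_ofReal.comp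
    (step_hasTemperateGrowth (s := s) hφ (0 : Fin 1) hς)
  obtain ⟨N, C, hNC⟩ := exists_weight_bound h
  exact ⟨N, C, fun n j L A f hf => hf.mul (fun k => (hNC n j k).1) (fun k => (hNC n j k).2.1)
    fun k => (hNC n j k).2.2⟩

/-- On the support of the cutoff, the energy is bounded away from zero. -/
theorem exists_le_of_chiSign_ne_zero (s : ℕ) (hφ : IsShellCutoff m φ) {ς : ℝ}
    (hς : ς = 1 ∨ ς = -1) :
    ∃ c₀ > 0, ∀ k : Fin (s + 1) → ℝ, chiSign m φ ς k ≠ 0 → c₀ ≤ ς * k 0 := by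
  obtain ⟨-, ε, hε, hεm, hsupp, -⟩ := hφ
  refine ⟨√(m ^ 2 - ε), Real.sqrt_pos.2 (by linarith), fun k hk => ?_⟩
  unfold chiSign at hk
  split_ifs at hk with h0
  · have h1 := (hsupp (subset_tsupport φ hk)).1
    refine Real.sqrt_le_iff.2 ⟨h0.le, ?_⟩
    have h2 : ς ^ 2 = 1 := by rcases hς with h | h <;> simp [h]
    have h3 : 0 ≤ ∑ i : Fin s, k i.succ * k i.succ :=
      Finset.sum_nonneg fun i _ => mul_self_nonneg _
    rw [mul_pow, h2]
    simp only [mink] at h1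
    nlinarith
  · exact (hk rfl).elim

/-- Near the mass shell, the cutoffs for the two signs of the energy add up to one. -/
theorem exists_chiSign_add (s : ℕ) (hφ : IsShellCutoff m φ) :
    ∃ ε₀ > 0, ∀ k : Fin (s + 1) → ℝ, |mink k k - m ^ 2| < ε₀ →
      chiSign m φ 1 k + chiSign m φ (-1) k = 1 := by
  obtain ⟨-, ε, hε, hεm, -, h1⟩ := hφ
  refine ⟨ε / 2, by positivity, fun k hk => ?_⟩
  rw [abs_lt] at hk
  have h2 : φ (mink k k - m ^ 2) = 1 := h1 _ ⟨by linarith [hk.1], hk.2⟩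
  have h3 : 0 ≤ ∑ i : Fin s, k i.succ * k i.succ :=
    Finset.sum_nonneg fun i _ => mul_self_nonneg _
  have h4 : k 0 ≠ 0 := by
    intro h
    have := hk.1
    simp only [mink, h] at this
    nlinarith
  unfold chiSign
  rw [h2]
  rcases lt_or_gt_of_ne h4 with h | h
  · rw [if_neg (by linarith), if_pos (by linarith), zero_add]
  · rw [if_pos (by linarith), if_neg (by linarith), add_zero]

theorem continuous_recoil (j : Fin n) : Continuous (recoil (s := s) m j) := by
  have hom := continuous_omega (s := s) m
  refine continuous_pi fun μ => ?_
  refine Fin.cases ?_ (fun i => ?_) μ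
  · have e : (fun p => recoil (s := s) m j p 0) =
        fun p => -∑ l, shellSign j l * omega m (p l) := by
      funext p
      rw [recoil_eq, shellRecoil_zero]
    rw [e]
    fun_prop
  · have e : (fun p => recoil (s := s) m j p i.succ) = fun p => -∑ l, p l i := by
      funext p
      simp [recoil, onShell, shellPoint]
    rw [e]
    fun_prop

theorem continuous_spatial : Continuous (spatial (s := s)) := by
  unfold spatial
  fun_prop

theorem continuous_mink_self : Continuous fun k : Fin (s + 1) → ℝ => mink k k := by
  unfold mink
  fun_prop

variable {ι : Type*} [Fintype ι]

theorem norm_shellDensity_le (hm : 0 < m) (p : ι → EuclideanSpace ℝ (Fin s)) :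
    ‖shellDensity m p‖ ≤ (2 * m)⁻¹ ^ Fintype.card ι := by
  rw [shellDensity, norm_prod, ← Finset.card_univ, ← Finset.prod_const]
  refine Finset.prod_le_prod (fun i _ => norm_nonneg _) fun i _ => ?_
  have := omega_pos hm (p i)
  rw [Complex.norm_real, Real.norm_of_nonneg (by positivity)]
  gcongr
  exact le_omega m _

theorem integrable_shellDecay (hm : 0 < m) :
    Integrable (shellDecay (s := s) (ι := ι) m) :=
  integrable_prod_omega_pow_inv hm (by omega)

theorem integrable_shell (hm : 0 < m) {K G : (ι → EuclideanSpace ℝ (Fin s)) → ℂ}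
    (hK : AEStronglyMeasurable K) {B A : ℝ} (hB : ∀ p, ‖K p‖ ≤ B) (hG : Continuous G)
    (hA : ∀ p, ‖G p‖ ≤ A * shellDecay m p) :
    Integrable (fun p => K p * G p * shellDensity m p) ∧
    ‖∫ p, K p * G p * shellDensity m p‖ ≤ B * (2 * m)⁻¹ ^ Fintype.card ι *
      (∫ p : ι → EuclideanSpace ℝ (Fin s), shellDecay m p) * A := by
  have hom := continuous_omega (s := s) m
  have hB0 : 0 ≤ B := (norm_nonneg _).trans (hB 0)
  have hb : ∀ p, ‖K p * G p * shellDensity m p‖ ≤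
      B * (2 * m)⁻¹ ^ Fintype.card ι * A * shellDecay m p := fun p => by
    rw [norm_mul, norm_mul]
    have h0 := (norm_nonneg _).trans (hA p)
    calc _ ≤ B * (A * shellDecay m p) * (2 * m)⁻¹ ^ Fintype.card ι := by
          gcongr
          exacts [hB p, hA p, norm_shellDensity_le hm p]
      _ = _ := by ring
  have hi := (integrable_shellDecay (s := s) (ι := ι) hm).const_mul
    (B * (2 * m)⁻¹ ^ Fintype.card ι * A)
  have hsm : AEStronglyMeasurable fun p : ι → EuclideanSpace ℝ (Fin s) => shellDensity m p := by
    refine Measurable.aestronglyMeasurable ?_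
    unfold shellDensity
    fun_prop
  refine ⟨hi.mono' ((hK.mul hG.aestronglyMeasurable).mul hsm) (Eventually.of_forall hb),
    (norm_integral_le_of_norm_le hi (Eventually.of_forall hb)).trans (le_of_eq ?_)⟩
  rw [integral_const_mul]
  ring

end ShellProduct

section ShellProductLimits

variable {s n : ℕ} {m : ℝ} {φ : ℝ → ℝ}

theorem propagatorApprox_loc (ε : ℝ) (k : Fin (s + 1) → ℝ) :
    propagatorApprox m ε .loc k = truncInv ε (mink k k - m ^ 2) := by
  simp only [propagatorApprox, truncInv]
  split_ifs <;> simp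

theorem propagatorApprox_inn (ε : ℝ) (k : Fin (s + 1) → ℝ) :
    propagatorApprox m ε .inn k =
      -Complex.I * Real.pi * ((Real.sign (k 0) : ℂ) * boxDelta ε (mink k k - m ^ 2)) := by
  simp only [propagatorApprox, boxDelta]
  split_ifs <;> simp [div_eq_mul_inv]

theorem propagatorApprox_out (ε : ℝ) (k : Fin (s + 1) → ℝ) :
    propagatorApprox m ε .out k =
      Complex.I * Real.pi * ((Real.sign (k 0) : ℂ) * boxDelta ε (mink k k - m ^ 2)) := by
  simp only [propagatorApprox, boxDelta]
  split_ifs <;> simp [div_eq_mul_inv]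

/-- The integral over the mass shells, with one propagator, which occurs in `IsShellProduct`. -/
def shellIntegral (m : ℝ) (j : Fin n) (a : Label) (f : Cfg s n → ℂ) (ε : ℝ) : ℂ :=
  ∫ p : {l : Fin n // l ≠ j} → EuclideanSpace ℝ (Fin s),
    propagatorApprox m ε a (recoil m j p) * f (onShellCfg m j p) * shellDensity m p

set_option maxHeartbeats 1000000 in
/-- The limits `ε → 0` of products of mass shells with one propagator exist, and those with the
principal value turn into those with the in- and outgoing propagators for large times. The order
of the weight in the bounds does not depend on the number of arguments. -/
theorem exists_shellIntegral_limits (hs : 2 ≤ s) (hm : 0 < m) (hφ : IsShellCutoff m φ) :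
    ∃ L : ℕ, ∀ (n : ℕ) (_ : 3 ≤ n) (j : Fin n), ∃ C : ℝ, ∀ (f : Cfg s n → ℂ) (A : ℝ),
      HasDecay L A f → ∃ (V : Label → ℂ) (P : Label → ℝ → ℂ),
        (∀ a, Tendsto (shellIntegral m j a f) (𝓝[>] 0) (𝓝 (V a))) ∧
        (∀ a, ‖V a‖ ≤ C * A) ∧
        (∀ a t, Tendsto (shellIntegral m j .loc fun k => chi m φ t a (slot k j) * f k)
          (𝓝[>] 0) (𝓝 (P a t))) ∧
        ∀ a, Tendsto (P a) atTop (𝓝 (V a)) := by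
  obtain ⟨N₁, C₁, hχ₁⟩ := exists_chiSign_decay s hφ (Or.inl rfl : (1 : ℝ) = 1 ∨ (1 : ℝ) = -1)
  obtain ⟨N₂, C₂, hχ₂⟩ := exists_chiSign_decay s hφ (Or.inr rfl : (-1 : ℝ) = 1 ∨ (-1 : ℝ) = -1)
  obtain ⟨c₁, hc₁, hsupp₁⟩ := exists_le_of_chiSign_ne_zero s hφ
    (Or.inl rfl : (1 : ℝ) = 1 ∨ (1 : ℝ) = -1)
  obtain ⟨c₂, hc₂, hsupp₂⟩ := exists_le_of_chiSign_ne_zero s hφ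
    (Or.inr rfl : (-1 : ℝ) = 1 ∨ (-1 : ℝ) = -1)
  obtain ⟨ε₀, hε₀, hadd⟩ := exists_chiSign_add s hφ
  refine ⟨s + 1 + 9 + (N₁ + N₂), fun n hn j => ?_⟩
  have : Nontrivial {l : Fin n // l ≠ j} := by
    rw [← Fintype.one_lt_card_iff_nontrivial, Fintype.card_subtype_compl]
    simp
    omega
  obtain ⟨D₁, hD₁, hlim₁⟩ := exists_shell_limits hs hm (shellSign_eq j)
    (Or.inl rfl : (1 : ℝ) = 1 ∨ (1 : ℝ) = -1)
  obtain ⟨D₂, hD₂, hlim₂⟩ := exists_shell_limits hs hm (shellSign_eq j)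
    (Or.inr rfl : (-1 : ℝ) = 1 ∨ (-1 : ℝ) = -1)
  set τ := 1 + ‖shellCfgMap s j‖ with hτ
  set E := ε₀⁻¹ * (2 * m)⁻¹ ^ Fintype.card {l : Fin n // l ≠ j} *
    ∫ p : {l : Fin n // l ≠ j} → EuclideanSpace ℝ (Fin s), shellDecay m p with hE
  refine ⟨Real.pi * (D₁ * (τ * (2 * C₁)) + D₂ * (τ * (2 * C₂))) +
    (D₁ * (τ * (2 * C₁)) + D₂ * (τ * (2 * C₂)) + E * (τ * (1 + 2 * C₁ + 2 * C₂))),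
    fun f A hf => ?_⟩
  -- the parts of positive and of negative recoil energy, and the part off the mass shell
  have hf₁ : HasDecay (s + 1 + 9) (2 * C₁ * A) _ := hχ₁ n j _ A f (hf.mono (by omega))
  have hf₂ : HasDecay (s + 1 + 9) (2 * C₂ * A) _ := hχ₂ n j _ A f (hf.mono (by omega))
  have hf₀ : HasDecay (s + 1 + 9) (A + 2 * C₁ * A + 2 * C₂ * A) _ :=
    ((hf.mono (by omega : s + 1 + 9 ≤ _)).sub hf₁).sub hf₂
  obtain ⟨hd₁, hb₁, hb₁'⟩ := hf₁.onShell_bound hm j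
  obtain ⟨hd₂, hb₂, hb₂'⟩ := hf₂.onShell_bound hm j
  obtain ⟨hd₀, hb₀, -⟩ := hf₀.onShell_bound hm j
  simp only [slot_onShellCfg_self] at hd₁ hb₁ hb₁' hd₂ hb₂ hb₂' hd₀ hb₀
  set F₁ : ({l : Fin n // l ≠ j} → EuclideanSpace ℝ (Fin s)) → ℂ := fun p =>
    (chiSign m φ 1 (recoil m j p) : ℂ) * f (onShellCfg m j p) with hF₁
  set F₂ : ({l : Fin n // l ≠ j} → EuclideanSpace ℝ (Fin s)) → ℂ := fun p =>
    (chiSign m φ (-1) (recoil m j p) : ℂ) * f (onShellCfg m j p) with hF₂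
  set F₀ : ({l : Fin n // l ≠ j} → EuclideanSpace ℝ (Fin s)) → ℂ := fun p =>
    f (onShellCfg m j p) - (chiSign m φ 1 (recoil m j p) : ℂ) * f (onShellCfg m j p) -
      (chiSign m φ (-1) (recoil m j p) : ℂ) * f (onShellCfg m j p) with hF₀
  have hFs₁ : ∀ p, F₁ p ≠ 0 → c₁ ≤ 1 * recoil m j p 0 := fun p hp =>
    hsupp₁ _ fun h => hp (by simp [hF₁, h])
  have hFs₂ : ∀ p, F₂ p ≠ 0 → c₂ ≤ -1 * recoil m j p 0 := fun p hp =>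
    hsupp₂ _ fun h => hp (by simp [hF₂, h])
  have hFs₀ : ∀ p, F₀ p ≠ 0 → ε₀ ≤ |mink (recoil m j p) (recoil m j p) - m ^ 2| := fun p hp => by
    by_contra hlt
    have h1 := hadd _ (not_le.1 hlt)
    have h2 : ((chiSign m φ 1 (recoil m j p) : ℝ) : ℂ) + (chiSign m φ (-1) (recoil m j p) : ℂ) =
        1 := by
      rw [← Complex.ofReal_add, h1, Complex.ofReal_one]
    refine hp ?_
    simp only [hF₀]
    linear_combination (-f (onShellCfg m j p)) * h2
  obtain ⟨P₁, S₁, hP₁, hS₁, hP₁0, hS₁n, hT₁, hB₁⟩ :=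
    hlim₁ F₁ _ c₁ hd₁ hb₁ hb₁' hc₁ hFs₁
  obtain ⟨P₂, S₂, hP₂, hS₂, hP₂0, hS₂n, hT₂, hB₂⟩ :=
    hlim₂ F₂ _ c₂ hd₂ hb₂ hb₂' hc₂ hFs₂
  simp only [← recoil_eq] at hP₁ hS₁ hP₂ hS₂
  have hu : Measurable fun p : {l : Fin n // l ≠ j} → EuclideanSpace ℝ (Fin s) =>
      mink (recoil m j p) (recoil m j p) - m ^ 2 :=
    ((continuous_mink_self.comp (continuous_recoil j)).sub continuous_const).measurable
  have hk0 : Measurable fun p : {l : Fin n // l ≠ j} → EuclideanSpace ℝ (Fin s) =>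
      recoil m j p 0 := ((continuous_apply 0).comp (continuous_recoil j)).measurable
  have hkω : Measurable fun p : {l : Fin n // l ≠ j} → EuclideanSpace ℝ (Fin s) =>
      omega m (spatial (recoil m j p)) :=
    ((continuous_omega m).comp (continuous_spatial.comp (continuous_recoil j))).measurable
  have hexp : ∀ x : ℝ, ‖Complex.exp (-Complex.I * (x : ℂ))‖ = 1 := fun x => by
    rw [show -Complex.I * (x : ℂ) = ((-x : ℝ) : ℂ) * Complex.I by push_cast; ring,
      Complex.norm_exp_ofReal_mul_I]
  -- the part off the mass shell
  set R : ℂ := ∫ p, truncInv (ε₀ / 2) (mink (recoil m j p) (recoil m j p) - m ^ 2) * F₀ p *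
    shellDensity m p with hR
  have hRε : ∀ ε ∈ Set.Ioo 0 ε₀, ∀ p, truncInv ε (mink (recoil m j p) (recoil m j p) - m ^ 2) *
      F₀ p = truncInv (ε₀ / 2) (mink (recoil m j p) (recoil m j p) - m ^ 2) * F₀ p := by
    intro ε hε p
    by_cases h : F₀ p = 0
    · rw [h, mul_zero, mul_zero]
    · have h1 := hFs₀ p h
      rw [truncInv, truncInv, if_pos (hε.2.trans_le h1), if_pos (by linarith)]
  have hRn : ‖R‖ ≤ E * (τ * (A + 2 * C₁ * A + 2 * C₂ * A)) := by
    let K : ({l : Fin n // l ≠ j} → EuclideanSpace ℝ (Fin s)) → ℂ := fun p =>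
      if ε₀ ≤ |mink (recoil m j p) (recoil m j p) - m ^ 2| then
        truncInv (ε₀ / 2) (mink (recoil m j p) (recoil m j p) - m ^ 2) else 0
    have hKm : Measurable K := Measurable.ite (measurableSet_le measurable_const (by fun_prop))
      ((measurable_truncInv _).comp hu) measurable_const
    have hK : ∀ p, ‖K p‖ ≤ ε₀⁻¹ := fun p => by
      simp only [K]
      split_ifs with h
      · rw [truncInv, if_pos (by linarith), norm_inv, Complex.norm_real, Real.norm_eq_abs]
        gcongr
      · rw [norm_zero]
        positivity
    have h1 := (integrable_shell hm hKm.aestronglyMeasurable hK hd₀.continuous hb₀).2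
    refine le_trans (le_of_eq ?_) h1
    rw [hR]
    congr 1
    refine integral_congr_ae (Eventually.of_forall fun p => ?_)
    simp only [K]
    by_cases h : F₀ p = 0
    · simp [h]
    · rw [if_pos (hFs₀ p h)]
  have hI : ∀ ε > 0, ∀ (e : ({l : Fin n // l ≠ j} → EuclideanSpace ℝ (Fin s)) → ℂ),
      Measurable e → (∀ p, ‖e p‖ ≤ 1) →
      ∀ (G : ({l : Fin n // l ≠ j} → EuclideanSpace ℝ (Fin s)) → ℂ) (B : ℝ), Continuous G →
      (∀ p, ‖G p‖ ≤ B * shellDecay m p) →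
      Integrable (fun p => truncInv ε (mink (recoil m j p) (recoil m j p) - m ^ 2) *
        (G p * e p) * shellDensity m p) ∧
      Integrable (fun p => boxDelta ε (mink (recoil m j p) (recoil m j p) - m ^ 2) *
        G p * shellDensity m p) := by
    intro ε hε e he he1 G B hG hGB
    have h1 := (integrable_shell hm (((measurable_truncInv ε).comp hu).mul he).aestronglyMeasurable
      (B := ε⁻¹) (fun p => by
        rw [Pi.mul_apply, norm_mul]
        exact (mul_le_of_le_one_right (norm_nonneg _) (he1 p)).trans (norm_truncInv_le hε _))
      hG hGB).1
    have h2 := (integrable_shell hm ((measurable_boxDelta ε).comp hu).aestronglyMeasurable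
      (B := ε⁻¹) (fun p => norm_boxDelta_le hε _) hG hGB).1
    refine ⟨h1.congr (Eventually.of_forall fun p => ?_), h2⟩
    simp only [Pi.mul_apply, Function.comp_apply]
    ring
  have hev : ∀ᶠ ε : ℝ in 𝓝[>] 0, ε ∈ Set.Ioo 0 ε₀ := Ioo_mem_nhdsGT hε₀
  set e : ℝ → ℝ → ({l : Fin n // l ≠ j} → EuclideanSpace ℝ (Fin s)) → ℂ := fun ς t p =>
    Complex.exp (-Complex.I * (t * (ς * recoil m j p 0 - omega m (spatial (recoil m j p))) : ℝ))
    with he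
  have hem : ∀ ς t, Measurable (e ς t) := fun ς t => by
    simp only [he]
    fun_prop
  have he1 : ∀ ς t p, ‖e ς t p‖ ≤ 1 := fun ς t p => (hexp _).le
  have hphase : ∀ t₁ t₂, Tendsto (fun ε => ∫ p,
      truncInv ε (mink (recoil m j p) (recoil m j p) - m ^ 2) *
        (F₁ p * e 1 t₁ p + F₂ p * e (-1) t₂ p) * shellDensity m p) (𝓝[>] 0)
      (𝓝 (P₁ t₁ + P₂ t₂)) := fun t₁ t₂ => by
    refine ((hP₁ t₁).add (hP₂ t₂)).congr' (hev.mono fun ε hε => ?_)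
    have h := integral_add (hI ε hε.1 _ (hem 1 t₁) (he1 _ _) F₁ _ hd₁.continuous hb₁).1
      (hI ε hε.1 _ (hem (-1) t₂) (he1 _ _) F₂ _ hd₂.continuous hb₂).1
    refine h.symm.trans (integral_congr_ae (Eventually.of_forall fun p => ?_))
    simp only
    ring
  have hloc : Tendsto (shellIntegral m j .loc f) (𝓝[>] 0) (𝓝 (P₁ 0 + P₂ 0 + R)) := by
    refine ((hphase 0 0).add_const R).congr' (hev.mono fun ε hε => ?_)
    have h := integral_add
      ((hI ε hε.1 _ (hem 1 0) (he1 _ _) F₁ _ hd₁.continuous hb₁).1.add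
        (hI ε hε.1 _ (hem (-1) 0) (he1 _ _) F₂ _ hd₂.continuous hb₂).1)
      (hI ε hε.1 _ (hem 1 0) (he1 _ _) F₀ _ hd₀.continuous hb₀).1
    have hR' : R = ∫ p, truncInv ε (mink (recoil m j p) (recoil m j p) - m ^ 2) *
        (F₀ p * e 1 0 p) * shellDensity m p := by
      rw [hR]
      refine integral_congr_ae (Eventually.of_forall fun p => ?_)
      simp only [he, zero_mul, Complex.ofReal_zero, mul_zero, Complex.exp_zero, mul_one]
      rw [hRε ε hε p]
    rw [hR']
    refine Eq.trans ?_ (h.symm.trans ?_)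
    · congr 1
      refine integral_congr_ae (Eventually.of_forall fun p => ?_)
      simp only [Pi.add_apply]
      ring
    · refine integral_congr_ae (Eventually.of_forall fun p => ?_)
      simp only [Pi.add_apply, he, zero_mul, Complex.ofReal_zero, mul_zero, Complex.exp_zero,
        mul_one, propagatorApprox_loc, hF₁, hF₂, hF₀]
      ring
  have hbox : Tendsto (fun ε => ∫ p, (Real.sign (recoil m j p 0) : ℂ) *
      boxDelta ε (mink (recoil m j p) (recoil m j p) - m ^ 2) * f (onShellCfg m j p) *
        shellDensity m p) (𝓝[>] 0) (𝓝 (S₁ - S₂)) := by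
    refine (hS₁.sub hS₂).congr' (hev.mono fun ε hε => ?_)
    have h := integral_sub
      (hI ε hε.1 _ (hem 1 0) (he1 _ _) F₁ _ hd₁.continuous hb₁).2
      (hI ε hε.1 _ (hem 1 0) (he1 _ _) F₂ _ hd₂.continuous hb₂).2
    refine h.symm.trans (integral_congr_ae (Eventually.of_forall fun p => ?_))
    have h0 : boxDelta ε (mink (recoil m j p) (recoil m j p) - m ^ 2) * F₀ p = 0 := by
      by_cases h : F₀ p = 0
      · rw [h, mul_zero]
      · rw [boxDelta, if_neg (not_lt.2 (hε.2.le.trans (hFs₀ p h))), zero_mul]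
    have h1 : (Real.sign (recoil m j p 0) : ℂ) * F₁ p = F₁ p := by
      by_cases h : F₁ p = 0
      · rw [h, mul_zero]
      · rw [Real.sign_of_pos (by linarith [hFs₁ p h]), Complex.ofReal_one, one_mul]
    have h2 : (Real.sign (recoil m j p 0) : ℂ) * F₂ p = -F₂ p := by
      by_cases h : F₂ p = 0
      · rw [h, mul_zero, neg_zero]
      · rw [Real.sign_of_neg (by linarith [hFs₂ p h]), Complex.ofReal_neg, Complex.ofReal_one,
          neg_one_mul]
    have h3 : f (onShellCfg m j p) = F₁ p + F₂ p + F₀ p := by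
      simp only [hF₁, hF₂, hF₀]
      ring
    simp only [h3]
    linear_combination (-(Real.sign (recoil m j p 0) : ℂ) * shellDensity m p) * h0 -
      (boxDelta ε (mink (recoil m j p) (recoil m j p) - m ^ 2) * shellDensity m p) * (h1 + h2)
  -- the three kinds of propagators
  have hinn : Tendsto (shellIntegral m j .inn f) (𝓝[>] 0)
      (𝓝 (-Complex.I * Real.pi * (S₁ - S₂))) := by
    refine (hbox.const_mul _).congr fun ε => ?_
    rw [shellIntegral, ← integral_const_mul]
    refine integral_congr_ae (Eventually.of_forall fun p => ?_)
    simp only [propagatorApprox_inn]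
    ring
  have hout : Tendsto (shellIntegral m j .out f) (𝓝[>] 0)
      (𝓝 (Complex.I * Real.pi * (S₁ - S₂))) := by
    refine (hbox.const_mul _).congr fun ε => ?_
    rw [shellIntegral, ← integral_const_mul]
    refine integral_congr_ae (Eventually.of_forall fun p => ?_)
    simp only [propagatorApprox_out]
    ring
  have hpinn : ∀ t, Tendsto (shellIntegral m j .loc fun k => chi m φ t .inn (slot k j) * f k)
      (𝓝[>] 0) (𝓝 (P₁ t + P₂ (-t))) := fun t => by
    refine (hphase t (-t)).congr fun ε => ?_
    refine integral_congr_ae (Eventually.of_forall fun p => ?_)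
    simp only [propagatorApprox_loc, chi, chiPlus_eq, chiMinus_eq, slot_onShellCfg_self, hF₁, hF₂,
      he]
    rw [show t * (1 * recoil m j p 0 - omega m (spatial (recoil m j p))) =
        (recoil m j p 0 - omega m (spatial (recoil m j p))) * t by ring,
      show -t * (-1 * recoil m j p 0 - omega m (spatial (recoil m j p))) =
        (recoil m j p 0 + omega m (spatial (recoil m j p))) * t by ring]
    ring
  have hpout : ∀ t, Tendsto (shellIntegral m j .loc fun k => chi m φ t .out (slot k j) * f k)
      (𝓝[>] 0) (𝓝 (P₁ (-t) + P₂ t)) := fun t => by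
    refine (hphase (-t) t).congr fun ε => ?_
    refine integral_congr_ae (Eventually.of_forall fun p => ?_)
    simp only [propagatorApprox_loc, chi, chiPlus_eq, chiMinus_eq, slot_onShellCfg_self, hF₁, hF₂,
      he]
    rw [show -Complex.I * ((-t * (1 * recoil m j p 0 - omega m (spatial (recoil m j p))) : ℝ) : ℂ) =
        Complex.I * (((recoil m j p 0 - omega m (spatial (recoil m j p))) * t : ℝ) : ℂ) by
          push_cast; ring,
      show -Complex.I * ((t * (-1 * recoil m j p 0 - omega m (spatial (recoil m j p))) : ℝ) : ℂ) =
        Complex.I * (((recoil m j p 0 + omega m (spatial (recoil m j p))) * t : ℝ) : ℂ) by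
          push_cast; ring]
    ring
  have hτ0 : 0 < τ := by
    have := norm_nonneg (shellCfgMap s j)
    linarith
  have hx₁ : 0 ≤ D₁ * (τ * (2 * C₁ * A)) := (norm_nonneg _).trans hS₁n
  have hx₂ : 0 ≤ D₂ * (τ * (2 * C₂ * A)) := (norm_nonneg _).trans hS₂n
  have hx₀ : 0 ≤ E * (τ * (A + 2 * C₁ * A + 2 * C₂ * A)) := (norm_nonneg _).trans hRn
  have hSS : ‖S₁ - S₂‖ ≤ D₁ * (τ * (2 * C₁ * A)) + D₂ * (τ * (2 * C₂ * A)) :=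
    (norm_sub_le _ _).trans (add_le_add hS₁n hS₂n)
  have hC : (Real.pi * (D₁ * (τ * (2 * C₁)) + D₂ * (τ * (2 * C₂))) +
    (D₁ * (τ * (2 * C₁)) + D₂ * (τ * (2 * C₂)) + E * (τ * (1 + 2 * C₁ + 2 * C₂)))) * A =
    Real.pi * (D₁ * (τ * (2 * C₁ * A)) + D₂ * (τ * (2 * C₂ * A))) +
    (D₁ * (τ * (2 * C₁ * A)) + D₂ * (τ * (2 * C₂ * A)) +
      E * (τ * (A + 2 * C₁ * A + 2 * C₂ * A))) := by ring
  have hpi := mul_le_mul_of_nonneg_left hSS Real.pi_pos.le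
  have hpi0 := mul_nonneg Real.pi_pos.le (add_nonneg hx₁ hx₂)
  refine ⟨fun a => match a with
    | .inn => -Complex.I * Real.pi * (S₁ - S₂)
    | .loc => P₁ 0 + P₂ 0 + R
    | .out => Complex.I * Real.pi * (S₁ - S₂),
    fun a t => match a with
    | .inn => P₁ t + P₂ (-t)
    | .loc => P₁ 0 + P₂ 0 + R
    | .out => P₁ (-t) + P₂ t, fun a => ?_, fun a => ?_, fun a t => ?_, fun a => ?_⟩
  · cases a
    exacts [hinn, hloc, hout]
  · rw [hC]
    cases a
    · simp only [norm_mul, norm_neg, Complex.norm_I, Complex.norm_real, Real.norm_eq_abs,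
        abs_of_pos Real.pi_pos, one_mul]
      linarith
    · refine (norm_add_le _ _).trans ((add_le_add_left (norm_add_le _ _) _).trans ?_)
      linarith
    · simp only [norm_mul, Complex.norm_I, Complex.norm_real, Real.norm_eq_abs,
        abs_of_pos Real.pi_pos, one_mul]
      linarith
  · cases a
    · exact hpinn t
    · simpa only [chi, one_mul] using hloc
    · exact hpout t
  · cases a
    · have h := hT₁.add (hB₂.comp tendsto_neg_atTop_atBot)
      rw [show -Complex.I * Real.pi * S₁ + Complex.I * Real.pi * S₂ =
        -Complex.I * Real.pi * (S₁ - S₂) by ring] at h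
      exact h
    · exact tendsto_const_nhds
    · have h := (hB₁.comp tendsto_neg_atTop_atBot).add hT₂
      rw [show Complex.I * Real.pi * S₁ + -Complex.I * Real.pi * S₂ =
        Complex.I * Real.pi * (S₁ - S₂) by ring] at h
      exact h

end ShellProductLimits

section ShellDistribution

variable {s n : ℕ} {m : ℝ} {φ : ℝ → ℝ}

theorem weight_le_one_add_norm_pow (L : ℕ) (k : Cfg s n) : weight L k ≤ (1 + ‖k‖) ^ (n * L) := by
  have h : ∀ l : Fin n, (1 + ∑ μ, k (l, μ) ^ 2) ^ ((L : ℝ) / 2) ≤ (1 + ‖k‖) ^ L := fun l => by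
    have h1 : ‖slotProj s n l k‖ ≤ ‖k‖ := by
      have := (slotProj s n l).le_of_opNorm_le (norm_slotProj_le l) k
      rwa [one_mul] at this
    have h0 := norm_nonneg (slotProj s n l k)
    rw [← norm_slotProj_apply_sq]
    calc (1 + ‖slotProj s n l k‖ ^ 2) ^ ((L : ℝ) / 2) ≤ ((1 + ‖k‖) ^ 2) ^ ((L : ℝ) / 2) := by
          refine Real.rpow_le_rpow (by positivity) (by nlinarith) (by positivity)
      _ = (1 + ‖k‖) ^ L := by
          rw [← Real.rpow_natCast, ← Real.rpow_natCast, ← Real.rpow_mul (by positivity)]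
          congr 1
          push_cast
          ring
  calc weight L k ≤ ∏ _l : Fin n, (1 + ‖k‖) ^ L := Finset.prod_le_prod
        (fun l _ => Real.rpow_nonneg (add_nonneg zero_le_one
          (Finset.sum_nonneg fun _ _ => sq_nonneg _)) _) fun l _ => h l
    _ = _ := by rw [Finset.prod_const, Finset.card_univ, Fintype.card_fin, ← pow_mul, mul_comm]

theorem schwartz_hasDecay (L : ℕ) (f : 𝓢(Cfg s n, ℂ)) :
    HasDecay L (2 ^ (n * L) *
      ((Finset.Iic (n * L, 1)).sup (schwartzSeminormFamily ℂ (Cfg s n) ℂ)) f) f := by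
  have h : ∀ r ≤ 1, ∀ k, weight L k * ‖iteratedFDeriv ℝ r f k‖ ≤ 2 ^ (n * L) *
      ((Finset.Iic (n * L, 1)).sup (schwartzSeminormFamily ℂ (Cfg s n) ℂ)) f := fun r hr k =>
    (mul_le_mul_of_nonneg_right (weight_le_one_add_norm_pow L k) (norm_nonneg _)).trans
      (SchwartzMap.one_add_le_sup_seminorm_apply (𝕜 := ℂ) (m := (n * L, 1)) le_rfl hr f k)
  refine ⟨f.differentiable, fun k => ?_, fun k => ?_⟩
  · have := h 0 (by norm_num) k
    rwa [norm_iteratedFDeriv_zero] at this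
  · have := h 1 le_rfl k
    rwa [norm_iteratedFDeriv_one] at this

/-- A linear functional which is bounded by weighted suprema of a test function and of its
derivative is a tempered distribution. -/
theorem exists_distribution (V : 𝓢(Cfg s n, ℂ) → ℂ) (hadd : ∀ f g, V (f + g) = V f + V g)
    (hsmul : ∀ (c : ℂ) f, V (c • f) = c * V f) {L : ℕ} {C : ℝ}
    (hV : ∀ (f : 𝓢(Cfg s n, ℂ)) (A : ℝ), HasDecay L A f → ‖V f‖ ≤ C * A) :
    ∃ T : 𝓢'(Cfg s n, ℂ), ∀ f, T f = V f := by
  let T : 𝓢(Cfg s n, ℂ) →L[ℂ] ℂ := SchwartzMap.mkCLMtoNormedSpace V hadd hsmul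
    ⟨Finset.Iic (n * L, 1), |C| * 2 ^ (n * L), by positivity, fun f => by
      have h := hV f _ (schwartz_hasDecay L f)
      refine h.trans ?_
      rw [← mul_assoc]
      gcongr
      exact le_abs_self C⟩
  exact ⟨ContinuousLinearMap.toPointwiseConvergenceCLM _ _ _ _ T, fun f => rfl⟩

theorem exists_isShellCutoff (hm : 0 < m) : ∃ φ : ℝ → ℝ, IsShellCutoff m φ := by
  have hm2 : 0 < m ^ 2 := by positivity
  let φ : ContDiffBump (0 : ℝ) := ⟨3 / 8 * m ^ 2, 1 / 2 * m ^ 2, by positivity, by linarith⟩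
  refine ⟨φ, φ.contDiff, 3 / 4 * m ^ 2, by positivity, by linarith, ?_, fun x hx => ?_⟩
  · rw [φ.tsupport_eq, Real.closedBall_eq_Icc]
    intro x hx
    have h1 : φ.rOut = 1 / 2 * m ^ 2 := rfl
    rw [h1] at hx
    exact ⟨by linarith [hx.1], by linarith [hx.2]⟩
  · refine φ.one_of_mem_closedBall ?_
    have h1 : φ.rIn = 3 / 8 * m ^ 2 := rfl
    rw [h1, Real.closedBall_eq_Icc]
    exact ⟨by linarith [hx.1], by linarith [hx.2]⟩

theorem integrable_shellIntegral (hm : 0 < m) (j : Fin n) (a : Label) {ε : ℝ} (hε : 0 < ε)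
    (f : 𝓢(Cfg s n, ℂ)) :
    Integrable fun p : {l : Fin n // l ≠ j} → EuclideanSpace ℝ (Fin s) =>
      propagatorApprox m ε a (recoil m j p) * f (onShellCfg m j p) * shellDensity m p := by
  have hu : Measurable fun p : {l : Fin n // l ≠ j} → EuclideanSpace ℝ (Fin s) =>
      mink (recoil m j p) (recoil m j p) - m ^ 2 :=
    ((continuous_mink_self.comp (continuous_recoil j)).sub continuous_const).measurable
  have hk0 : Measurable fun p : {l : Fin n // l ≠ j} → EuclideanSpace ℝ (Fin s) =>
      recoil m j p 0 := ((continuous_apply 0).comp (continuous_recoil j)).measurable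
  have hsg : Measurable Real.sign := by
    have e : Real.sign = fun r : ℝ => if r < 0 then -1 else if 0 < r then 1 else 0 := rfl
    rw [e]
    exact Measurable.ite measurableSet_Iio measurable_const
      (Measurable.ite measurableSet_Ioi measurable_const measurable_const)
  have hsm : Measurable fun p : {l : Fin n // l ≠ j} → EuclideanSpace ℝ (Fin s) =>
      (Real.sign (recoil m j p 0) : ℂ) * boxDelta ε (mink (recoil m j p) (recoil m j p) - m ^ 2) :=
    (Complex.measurable_ofReal.comp (hsg.comp hk0)).mul ((measurable_boxDelta ε).comp hu)
  have hsb : ∀ p : {l : Fin n // l ≠ j} → EuclideanSpace ℝ (Fin s),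
      ‖(Real.sign (recoil m j p 0) : ℂ) *
        boxDelta ε (mink (recoil m j p) (recoil m j p) - m ^ 2)‖ ≤ ε⁻¹ := fun p => by
    rw [norm_mul]
    refine (mul_le_of_le_one_left (norm_nonneg _) ?_).trans (norm_boxDelta_le hε _)
    rw [Complex.norm_real]
    rcases Real.sign_apply_eq (recoil m j p 0) with h | h | h <;> simp [h]
  obtain ⟨hd, hb, -⟩ := (schwartz_hasDecay (s + 1 + 9) f).onShell_bound hm j
  cases a
  · simp only [propagatorApprox_inn]
    refine (integrable_shell hm (hsm.const_mul _).aestronglyMeasurable (B := Real.pi * ε⁻¹)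
      (fun p => ?_) hd.continuous hb).1
    rw [norm_mul, norm_mul, norm_neg, Complex.norm_I, one_mul, Complex.norm_real,
      Real.norm_of_nonneg Real.pi_pos.le]
    exact mul_le_mul_of_nonneg_left (hsb p) Real.pi_pos.le
  · simp only [propagatorApprox_loc]
    exact (integrable_shell hm ((measurable_truncInv ε).comp hu).aestronglyMeasurable
      (fun p => norm_truncInv_le hε _) hd.continuous hb).1
  · simp only [propagatorApprox_out]
    refine (integrable_shell hm (hsm.const_mul _).aestronglyMeasurable (B := Real.pi * ε⁻¹)
      (fun p => ?_) hd.continuous hb).1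
    rw [norm_mul, norm_mul, Complex.norm_I, one_mul, Complex.norm_real,
      Real.norm_of_nonneg Real.pi_pos.le]
    exact mul_le_mul_of_nonneg_left (hsb p) Real.pi_pos.le

/-- Products of mass shells with one propagator exist as tempered distributions, with bounds of a
fixed order in each argument. -/
theorem exists_isShellProduct (hs : 2 ≤ s) (hm : 0 < m) :
    ∃ L : ℕ, ∀ (n : ℕ) (_ : 3 ≤ n) (j : Fin n), ∃ (T : Label → 𝓢'(Cfg s n, ℂ)) (C : ℝ),
      (∀ a, IsShellProduct m j a (T a)) ∧
      ∀ a (f : 𝓢(Cfg s n, ℂ)) (A : ℝ), HasDecay L A f → ‖T a f‖ ≤ C * A := by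
  obtain ⟨φ, hφ⟩ := exists_isShellCutoff hm
  obtain ⟨L, hL⟩ := exists_shellIntegral_limits hs hm hφ
  refine ⟨L, fun n hn j => ?_⟩
  obtain ⟨C, hC⟩ := hL n hn j
  have hlim : ∀ (f : 𝓢(Cfg s n, ℂ)) a, ∃ V : ℂ, Tendsto (shellIntegral m j a f) (𝓝[>] 0) (𝓝 V) :=
    fun f a => by
      obtain ⟨V, -, hV, -⟩ := hC f _ (schwartz_hasDecay L f)
      exact ⟨V a, hV a⟩
  choose V hV using hlim
  have hbound : ∀ (f : 𝓢(Cfg s n, ℂ)) a (A : ℝ), HasDecay L A f → ‖V f a‖ ≤ C * A :=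
    fun f a A hf => by
      obtain ⟨V', -, hV', hb, -⟩ := hC f A hf
      rw [tendsto_nhds_unique (hV f a) (hV' a)]
      exact hb a
  have hpos : ∀ᶠ ε : ℝ in 𝓝[>] 0, 0 < ε := self_mem_nhdsWithin
  have hT : ∀ a, ∃ T : 𝓢'(Cfg s n, ℂ), ∀ f, T f = V f a := fun a => by
    refine exists_distribution (fun f => V f a) (fun f g => ?_) (fun c f => ?_)
      fun f A hf => hbound f a A hf
    · refine tendsto_nhds_unique (hV (f + g) a) (((hV f a).add (hV g a)).congr'
        (hpos.mono fun ε hε => ?_))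
      have h := integral_add (integrable_shellIntegral hm j a hε f)
        (integrable_shellIntegral hm j a hε g)
      refine h.symm.trans (integral_congr_ae (Eventually.of_forall fun p => ?_))
      simp only [add_apply]
      ring
    · refine tendsto_nhds_unique (hV (c • f) a) (((hV f a).const_mul c).congr fun ε => ?_)
      rw [shellIntegral, ← integral_const_mul]
      refine integral_congr_ae (Eventually.of_forall fun p => ?_)
      simp only [smul_apply, smul_eq_mul]
      ring
  choose T hT using hT
  refine ⟨T, C, fun a f => ?_, fun a f A hf => ?_⟩
  · rw [hT]
    exact hV f a
  · rw [hT]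
    exact hbound f a A hf

/-- For large times the principal value turns into the in- or outgoing propagator. -/
theorem IsShellProduct.tendsto_chi (hs : 2 ≤ s) (hm : 0 < m) (hφ : IsShellCutoff m φ) (hn : 3 ≤ n)
    {j : Fin n} {a : Label} {T T' : 𝓢'(Cfg s n, ℂ)} (hT : IsShellProduct m j .loc T)
    (hT' : IsShellProduct m j a T') (f : 𝓢(Cfg s n, ℂ)) (g : ℝ → 𝓢(Cfg s n, ℂ))
    (hg : ∀ t p, g t (onShellCfg m j p) =
      chi m φ t a (recoil m j p) * f (onShellCfg m j p)) :
    Tendsto (fun t => T (g t)) atTop (𝓝 (T' f)) := by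
  obtain ⟨L, hL⟩ := exists_shellIntegral_limits hs hm hφ
  obtain ⟨C, hC⟩ := hL n hn j
  obtain ⟨V, P, hV, -, hP, hPV⟩ := hC f _ (schwartz_hasDecay L f)
  rw [tendsto_nhds_unique (hT' f) (hV a)]
  refine (hPV a).congr fun t => tendsto_nhds_unique (hP a t) ((hT (g t)).congr fun ε => ?_)
  refine integral_congr_ae (Eventually.of_forall fun p => ?_)
  simp only [hg, slot_onShellCfg_self, shellDensity]

end ShellDistribution

/-! ### The two-point functionals -/

section TwoPoint

variable {s : ℕ} {m m₀ : ℝ} {ρ : ℝ → ℝ}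

/-- The pair `(k, -k)` with `k = (-ω_μ(𝐩), 𝐩)`. -/
def pairCfg (z : ℝ × EuclideanSpace ℝ (Fin s)) : Cfg s 2 :=
  ofSlots ![shellPoint z.1 (-1) z.2, -shellPoint z.1 (-1) z.2]

theorem continuous_omega_uncurry :
    Continuous fun z : ℝ × EuclideanSpace ℝ (Fin s) => omega z.1 z.2 := by
  unfold omega
  fun_prop

theorem continuous_shellPoint (ς : ℝ) :
    Continuous fun z : ℝ × EuclideanSpace ℝ (Fin s) => shellPoint z.1 ς z.2 := by
  refine continuous_pi fun μ => ?_
  refine Fin.cases ?_ (fun i => ?_) μ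
  · exact continuous_const.mul continuous_omega_uncurry
  · simp only [shellPoint, Fin.cons_succ]
    fun_prop

theorem continuous_pairCfg : Continuous (pairCfg (s := s)) := by
  refine (PiLp.continuous_toLp 2 _).comp (continuous_pi fun q => ?_)
  obtain ⟨l, μ⟩ := q
  have h := (continuous_apply μ).comp (continuous_shellPoint (s := s) (-1))
  fin_cases l
  · exact h
  · exact h.neg

theorem sum_sq_shellPoint (μ : ℝ) (p : EuclideanSpace ℝ (Fin s)) :
    ∑ i, shellPoint μ (-1) p i ^ 2 = μ ^ 2 + 2 * ‖p‖ ^ 2 := by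
  have h := omega_sq μ p
  rw [Fin.sum_univ_succ]
  have h2 : ‖p‖ ^ 2 = ∑ i, p i ^ 2 := by
    rw [EuclideanSpace.norm_sq_eq]
    simp
  simp only [shellPoint, Fin.cons_zero, Fin.cons_succ]
  rw [← h2]
  linear_combination h

theorem weight_pairCfg (L : ℕ) (z : ℝ × EuclideanSpace ℝ (Fin s)) :
    weight L (pairCfg z) = (1 + (z.1 ^ 2 + 2 * ‖z.2‖ ^ 2)) ^ L := by
  have h0 : ∑ i, pairCfg z (0, i) ^ 2 = z.1 ^ 2 + 2 * ‖z.2‖ ^ 2 := sum_sq_shellPoint z.1 z.2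
  have h1 : ∑ i, pairCfg z (1, i) ^ 2 = z.1 ^ 2 + 2 * ‖z.2‖ ^ 2 := by
    rw [← sum_sq_shellPoint z.1 z.2]
    refine Finset.sum_congr rfl fun i _ => ?_
    exact neg_sq (shellPoint z.1 (-1) z.2 i)
  rw [weight, Fin.prod_univ_two, h0, h1, ← Real.rpow_add (by positivity), add_halves,
    Real.rpow_natCast]

/-- The integrand of the two-point functionals. -/
def pairKernel (f : Cfg s 2 → ℂ) (z : ℝ × EuclideanSpace ℝ (Fin s)) : ℂ :=
  f (pairCfg z) / (2 * omega z.1 z.2 : ℝ)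

theorem twoPoint_eq (μ : ℝ) (f : 𝓢(Cfg s 2, ℂ)) : twoPoint μ f = ∫ p, pairKernel f (μ, p) := rfl

theorem norm_pairKernel_le {N : ℕ} {A : ℝ} {f : Cfg s 2 → ℂ} (hf : HasDecay (N + (s + 1)) A f)
    {μ₀ μ : ℝ} (hμ₀ : 0 < μ₀) (hμ : μ₀ ≤ μ) (p : EuclideanSpace ℝ (Fin s)) :
    ‖pairKernel f (μ, p)‖ ≤
      A * μ₀⁻¹ * 2 ^ N * ((1 + |μ|) ^ N)⁻¹ * (omega 1 p ^ (2 * (s + 1)))⁻¹ := by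
  have hμ0 : 0 < μ := hμ₀.trans_le hμ
  have hA := hf.nonneg
  have hω : μ₀ ≤ omega μ p := hμ.trans (le_omega μ p)
  have h1 : (1 + μ ^ 2) ^ N * (1 + ‖p‖ ^ 2) ^ (s + 1) ≤ weight (N + (s + 1)) (pairCfg (μ, p)) := by
    rw [weight_pairCfg, pow_add _ N (s + 1)]
    have h0 := sq_nonneg ‖p‖
    exact mul_le_mul (pow_le_pow_left₀ (by positivity) (by simp only; linarith) N)
      (pow_le_pow_left₀ (by positivity) (by simp only; nlinarith [sq_nonneg μ]) (s + 1))
      (by positivity) (by positivity)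
  have h2 : ‖f (pairCfg (μ, p))‖ ≤ A * (((1 + μ ^ 2) ^ N)⁻¹ * ((1 + ‖p‖ ^ 2) ^ (s + 1))⁻¹) := by
    rw [← mul_inv, ← div_eq_mul_inv, le_div_iff₀ (by positivity), mul_comm]
    exact (mul_le_mul_of_nonneg_right h1 (norm_nonneg _)).trans (hf.le _)
  have h3 : (omega 1 p ^ (2 * (s + 1))) = (1 + ‖p‖ ^ 2) ^ (s + 1) := by
    rw [pow_mul, omega_sq]
    congr 1
    ring
  have h4 : ((1 + μ ^ 2) ^ N)⁻¹ ≤ 2 ^ N * ((1 + |μ|) ^ N)⁻¹ := by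
    rw [abs_of_pos hμ0, ← div_eq_mul_inv, ← div_pow, ← inv_pow]
    refine pow_le_pow_left₀ (by positivity) ?_ N
    rw [inv_le_comm₀ (by positivity) (by positivity), inv_div, div_le_iff₀ (by positivity)]
    nlinarith [sq_nonneg (μ - 1)]
  rw [pairKernel, norm_div, Complex.norm_real, Real.norm_of_nonneg (by linarith), h3]
  calc ‖f (pairCfg (μ, p))‖ / (2 * omega μ p)
      ≤ (A * (((1 + μ ^ 2) ^ N)⁻¹ * ((1 + ‖p‖ ^ 2) ^ (s + 1))⁻¹)) / μ₀ := by
        gcongr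
        linarith
    _ ≤ (A * ((2 ^ N * ((1 + |μ|) ^ N)⁻¹) * ((1 + ‖p‖ ^ 2) ^ (s + 1))⁻¹)) / μ₀ := by gcongr
    _ = _ := by
        rw [div_eq_mul_inv]
        ring

theorem measurable_pairKernel {f : Cfg s 2 → ℂ} (hf : Continuous f) :
    Measurable (pairKernel f) := by
  have h1 : Measurable fun z : ℝ × EuclideanSpace ℝ (Fin s) => f (pairCfg z) :=
    (hf.comp continuous_pairCfg).measurable
  have h2 := (continuous_omega_uncurry (s := s)).measurable
  exact h1.div (Complex.measurable_ofReal.comp (h2.const_mul 2))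

theorem integrable_pairKernel {f : Cfg s 2 → ℂ} {A : ℝ} {N : ℕ}
    (hf : HasDecay (N + (s + 1)) A f) {μ : ℝ} (hμ : 0 < μ) :
    Integrable fun p => pairKernel f (μ, p) :=
  ((integrable_omega_pow_inv one_pos (by omega : s < 2 * (s + 1))).const_mul
    (A * μ⁻¹ * 2 ^ N * ((1 + |μ|) ^ N)⁻¹)).mono'
    ((measurable_pairKernel hf.differentiable.continuous).comp
      measurable_prodMk_left).aestronglyMeasurable
    (Eventually.of_forall fun p => norm_pairKernel_le hf hμ le_rfl p)

/-- The order of decay at which the spectral integral converges. -/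
theorem exists_integrable_spectral (hm₀ : 0 < m₀) (hρ : IsSpectralDensity m₀ ρ) :
    ∃ (N : ℕ) (C : ℝ), ∀ (f : Cfg s 2 → ℂ) (A : ℝ), HasDecay (N + (s + 1)) A f →
      Integrable (fun z : ℝ × EuclideanSpace ℝ (Fin s) => (ρ z.1 : ℂ) * pairKernel f z)
        ((volume.restrict (Set.Ioi m₀)).prod volume) ∧
      ‖∫ z, (ρ z.1 : ℂ) * pairKernel f z ∂((volume.restrict (Set.Ioi m₀)).prod volume)‖ ≤
        C * A := by
  obtain ⟨hρ0, N, hN⟩ := hρ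
  let w : ℝ × EuclideanSpace ℝ (Fin s) → ℝ := fun z =>
    (ρ z.1 * ((1 + |z.1|) ^ N)⁻¹) * (omega 1 z.2 ^ (2 * (s + 1)))⁻¹
  have hw : Integrable w ((volume.restrict (Set.Ioi m₀)).prod volume) :=
    Integrable.mul_prod hN (integrable_omega_pow_inv one_pos (by omega : s < 2 * (s + 1)))
  have hρm : AEStronglyMeasurable ρ (volume.restrict (Set.Ioi m₀)) := by
    have h1 : AEStronglyMeasurable (fun μ : ℝ => (1 + |μ|) ^ N) (volume.restrict (Set.Ioi m₀)) :=
      Measurable.aestronglyMeasurable (by fun_prop)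
    refine (hN.aestronglyMeasurable.mul h1).congr (Eventually.of_forall fun μ => ?_)
    have h2 : 0 < 1 + |μ| := by positivity
    simp only [Pi.mul_apply]
    field_simp
  have hae : ∀ᵐ z : ℝ × EuclideanSpace ℝ (Fin s) ∂((volume.restrict (Set.Ioi m₀)).prod volume),
      m₀ < z.1 :=
    Measure.quasiMeasurePreserving_fst.ae (ae_restrict_mem measurableSet_Ioi)
  refine ⟨N, m₀⁻¹ * 2 ^ N * ∫ z, w z ∂((volume.restrict (Set.Ioi m₀)).prod volume),
    fun f A hf => ?_⟩
  have hb : ∀ᵐ z : ℝ × EuclideanSpace ℝ (Fin s) ∂((volume.restrict (Set.Ioi m₀)).prod volume),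
      ‖(ρ z.1 : ℂ) * pairKernel f z‖ ≤ A * m₀⁻¹ * 2 ^ N * w z := hae.mono fun z hz => by
    rw [norm_mul, Complex.norm_real, Real.norm_of_nonneg (hρ0 _ hz)]
    refine (mul_le_mul_of_nonneg_left (norm_pairKernel_le hf hm₀ hz.le z.2)
      (hρ0 _ hz)).trans (le_of_eq ?_)
    simp only [w]
    ring
  have hsm : AEStronglyMeasurable (fun z : ℝ × EuclideanSpace ℝ (Fin s) =>
      (ρ z.1 : ℂ) * pairKernel f z) ((volume.restrict (Set.Ioi m₀)).prod volume) :=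
    (Complex.continuous_ofReal.comp_aestronglyMeasurable hρm.comp_fst).mul
      (measurable_pairKernel hf.differentiable.continuous).aestronglyMeasurable
  refine ⟨(hw.const_mul _).mono' hsm hb,
    (norm_integral_le_of_norm_le (hw.const_mul _) hb).trans (le_of_eq ?_)⟩
  rw [integral_const_mul]
  ring

/-- Substitution `v = ω_μ(𝐩)` in the spectral parameter, and the Riemann–Lebesgue lemma. -/
theorem tendsto_spectral_phase_fiber (hm₀ : 0 < m₀) (F : ℝ → ℂ) (p : EuclideanSpace ℝ (Fin s))
    (ω₀ : ℝ) :
    Tendsto (fun θ : ℝ => ∫ μ in Set.Ioi m₀,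
      F μ * Complex.exp (Complex.I * (θ * (omega μ p - ω₀) : ℝ))) (cocompact ℝ) (𝓝 0) := by
  let G : ℝ → ℂ := fun v => F (√(v ^ 2 - ‖p‖ ^ 2)) * ((v / √(v ^ 2 - ‖p‖ ^ 2) : ℝ) : ℂ)
  let g : ℝ → ℝ := fun μ => omega μ p
  have hg : ∀ μ ∈ Set.Ioi m₀, HasDerivWithinAt g (μ / omega μ p) (Set.Ioi m₀) μ := fun μ hμ => by
    have hμ0 : 0 < μ := hm₀.trans hμ
    have h0 : ‖p‖ ^ 2 + μ ^ 2 ≠ 0 := by positivity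
    have h := (((hasDerivAt_pow 2 μ).const_add (‖p‖ ^ 2)).sqrt h0).hasDerivWithinAt
      (s := Set.Ioi m₀)
    refine h.congr_deriv ?_
    have : √(‖p‖ ^ 2 + μ ^ 2) = omega μ p := rfl
    rw [this]
    have := omega_pos hμ0 p
    field_simp
    norm_num
  have hinj : Set.InjOn g (Set.Ioi m₀) := fun x hx y hy hxy => by
    have h1 : omega x p ^ 2 = omega y p ^ 2 := congrArg (· ^ 2) hxy
    rw [omega_sq, omega_sq, add_right_inj] at h1
    exact (pow_left_inj₀ (hm₀.trans hx).le (hm₀.trans hy).le two_ne_zero).1 h1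
  have hsub : ∀ θ : ℝ, ∫ μ in Set.Ioi m₀,
      F μ * Complex.exp (Complex.I * (θ * (omega μ p - ω₀) : ℝ)) =
      Complex.exp (Complex.I * (-(θ * ω₀) : ℝ)) * ∫ v,
        (g '' Set.Ioi m₀).indicator G v * Complex.exp (Complex.I * (θ * v : ℝ)) := fun θ => by
    have himg : MeasurableSet (g '' Set.Ioi m₀) :=
      measurableSet_Ioi.image_of_continuousOn_injOn
        (fun μ hμ => (hg μ hμ).continuousWithinAt) hinj
    have e1 : ∫ v, (g '' Set.Ioi m₀).indicator G v * Complex.exp (Complex.I * (θ * v : ℝ)) =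
        ∫ v in g '' Set.Ioi m₀, G v * Complex.exp (Complex.I * (θ * v : ℝ)) := by
      rw [← integral_indicator himg]
      refine integral_congr_ae (Eventually.of_forall fun v => ?_)
      by_cases hv : v ∈ g '' Set.Ioi m₀ <;> simp [hv]
    rw [e1, integral_image_eq_integral_abs_deriv_smul measurableSet_Ioi hg hinj,
      ← integral_const_mul]
    refine setIntegral_congr_fun measurableSet_Ioi fun μ hμ => ?_
    have hμ0 : 0 < μ := hm₀.trans hμ
    have hω := omega_pos hμ0 p
    have h1 : √(g μ ^ 2 - ‖p‖ ^ 2) = μ := by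
      simp only [g]
      rw [omega_sq, add_sub_cancel_left, Real.sqrt_sq hμ0.le]
    have h2 : ((|μ / omega μ p| : ℝ) : ℂ) * ((omega μ p / μ : ℝ) : ℂ) = 1 := by
      rw [abs_of_pos (by positivity), ← Complex.ofReal_mul]
      norm_cast
      field_simp
    have h3 : Complex.exp (Complex.I * (θ * (omega μ p - ω₀) : ℝ)) =
        Complex.exp (Complex.I * (-(θ * ω₀) : ℝ)) * Complex.exp (Complex.I * (θ * g μ : ℝ)) := by
      rw [← Complex.exp_add]
      congr 1
      simp only [g]
      push_cast
      ring
    simp only [G, h1, Complex.real_smul]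
    rw [h3]
    linear_combination (-F μ * Complex.exp (Complex.I * (-(θ * ω₀) : ℝ)) *
      Complex.exp (Complex.I * (θ * g μ : ℝ))) * h2
  have h := tendsto_integral_mul_cexp (F := (g '' Set.Ioi m₀).indicator G)
  refine squeeze_zero_norm (fun θ => le_of_eq ?_) (tendsto_norm_zero.comp h)
  rw [hsub, norm_mul, mul_comm Complex.I, Complex.norm_exp_ofReal_mul_I, one_mul]
  rfl

/-- Contributions of masses `μ ≠ m` to two-point functions drop out for large times. -/
theorem tendsto_spectral_phase (m : ℝ) (hm₀ : 0 < m₀)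
    {F : ℝ × EuclideanSpace ℝ (Fin s) → ℂ}
    (hF : Integrable F ((volume.restrict (Set.Ioi m₀)).prod volume)) {l : Filter ℝ}
    [l.IsCountablyGenerated] (hl : l ≤ cocompact ℝ) :
    Tendsto (fun θ : ℝ => ∫ z, F z * Complex.exp (Complex.I *
      (θ * (omega z.1 z.2 - omega m z.2) : ℝ)) ∂((volume.restrict (Set.Ioi m₀)).prod volume)) l
      (𝓝 0) := by
  have hom := (continuous_omega_uncurry (s := s)).measurable
  have hom' := (continuous_omega (s := s) m).measurable
  have hexp : ∀ x : ℝ, ‖Complex.exp (Complex.I * (x : ℂ))‖ = 1 := fun x => by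
    rw [mul_comm, Complex.norm_exp_ofReal_mul_I]
  have hi : ∀ θ : ℝ, Integrable (fun z => F z * Complex.exp (Complex.I *
      (θ * (omega z.1 z.2 - omega m z.2) : ℝ))) ((volume.restrict (Set.Ioi m₀)).prod volume) :=
    fun θ => by
    refine hF.mono (hF.aestronglyMeasurable.mul (Measurable.aestronglyMeasurable (by fun_prop)))
      (Eventually.of_forall fun z => ?_)
    rw [norm_mul, hexp, mul_one]
  simp only [fun θ => integral_prod_symm _ (hi θ)]
  have h0 : (0 : ℂ) = ∫ _p : EuclideanSpace ℝ (Fin s), (0 : ℂ) := by simp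
  rw [h0]
  refine tendsto_integral_filter_of_dominated_convergence
    (fun p => ∫ μ in Set.Ioi m₀, ‖F (μ, p)‖) (Eventually.of_forall fun θ => ?_)
    (Eventually.of_forall fun θ => Eventually.of_forall fun p => ?_)
    hF.norm.integral_prod_right (Eventually.of_forall fun p => ?_)
  · exact (hi θ).integral_prod_right.aestronglyMeasurable
  · refine (norm_integral_le_integral_norm _).trans (le_of_eq ?_)
    refine integral_congr_ae (Eventually.of_forall fun μ => ?_)
    simp only
    rw [norm_mul, hexp, mul_one]
  · exact (tendsto_spectral_phase_fiber hm₀ (fun μ => F (μ, p)) p (omega m p)).mono_left hl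

end TwoPoint

section TwoPointDistribution

variable {s : ℕ} {m m₀ : ℝ} {ρ φ : ℝ → ℝ}

theorem pairKernel_add (f g : 𝓢(Cfg s 2, ℂ)) (z : ℝ × EuclideanSpace ℝ (Fin s)) :
    pairKernel (f + g : 𝓢(Cfg s 2, ℂ)) z = pairKernel f z + pairKernel g z := by
  simp only [pairKernel, add_apply, add_div]

theorem pairKernel_smul (c : ℂ) (f : 𝓢(Cfg s 2, ℂ)) (z : ℝ × EuclideanSpace ℝ (Fin s)) :
    pairKernel (c • f : 𝓢(Cfg s 2, ℂ)) z = c * pairKernel f z := by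
  simp only [pairKernel, smul_apply, smul_eq_mul, mul_div_assoc]

/-- The mass shell delta as a tempered distribution. -/
theorem exists_twoPoint (s : ℕ) (hm : 0 < m) :
    ∃ (T : 𝓢'(Cfg s 2, ℂ)) (L : ℕ) (C : ℝ), (∀ f, T f = twoPoint m f) ∧
      ∀ (f : 𝓢(Cfg s 2, ℂ)) (A : ℝ), HasDecay L A f → ‖T f‖ ≤ C * A := by
  have hint : ∀ f : 𝓢(Cfg s 2, ℂ), Integrable fun p => pairKernel f (m, p) := fun f =>
    integrable_pairKernel (N := 0) (schwartz_hasDecay _ f) hm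
  have hb : ∀ (f : 𝓢(Cfg s 2, ℂ)) (A : ℝ), HasDecay (0 + (s + 1)) A f → ‖twoPoint m f‖ ≤
      (m⁻¹ * 2 ^ 0 * ((1 + |m|) ^ 0)⁻¹ *
        ∫ p : EuclideanSpace ℝ (Fin s), (omega 1 p ^ (2 * (s + 1)))⁻¹) * A := fun f A hf => by
    have h := (integrable_omega_pow_inv one_pos (by omega : s < 2 * (s + 1))).const_mul
      (A * m⁻¹ * 2 ^ 0 * ((1 + |m|) ^ 0)⁻¹)
    refine (norm_integral_le_of_norm_le h (Eventually.of_forall fun p =>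
      norm_pairKernel_le hf hm le_rfl p)).trans (le_of_eq ?_)
    rw [integral_const_mul]
    ring
  obtain ⟨T, hT⟩ := exists_distribution (fun f => twoPoint m f) (fun f g => by
      simp only [twoPoint_eq, pairKernel_add]
      exact integral_add (hint f) (hint g))
    (fun c f => by
      simp only [twoPoint_eq, pairKernel_smul]
      exact integral_const_mul _ _) hb
  exact ⟨T, _, _, hT, fun f A hf => by rw [hT]; exact hb f A hf⟩

theorem spectral_eq {f : Cfg s 2 → ℂ}
    (hi : Integrable (fun z : ℝ × EuclideanSpace ℝ (Fin s) => (ρ z.1 : ℂ) * pairKernel f z)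
        ((volume.restrict (Set.Ioi m₀)).prod volume)) :
    ∫ μ in Set.Ioi m₀, (ρ μ : ℂ) * (∫ p, pairKernel f (μ, p)) =
      ∫ z, (ρ z.1 : ℂ) * pairKernel f z ∂((volume.restrict (Set.Ioi m₀)).prod volume) := by
  rw [integral_prod _ hi]
  simp only [integral_const_mul]

theorem exists_fullTwoPoint (s : ℕ) (hm : 0 < m) (hm₀ : 0 < m₀) (hρ : IsSpectralDensity m₀ ρ) :
    ∃ (T : 𝓢'(Cfg s 2, ℂ)) (L : ℕ) (C : ℝ), (∀ f, T f = fullTwoPoint m m₀ ρ f) ∧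
      ∀ (f : 𝓢(Cfg s 2, ℂ)) (A : ℝ), HasDecay L A f → ‖T f‖ ≤ C * A := by
  obtain ⟨T₁, L₁, C₁, hT₁, hb₁⟩ := exists_twoPoint s hm
  obtain ⟨N, C, hC⟩ := exists_integrable_spectral (s := s) hm₀ hρ
  have hint := fun f : 𝓢(Cfg s 2, ℂ) => (hC f _ (schwartz_hasDecay _ f)).1
  have hb : ∀ (f : 𝓢(Cfg s 2, ℂ)) (A : ℝ), HasDecay (N + (s + 1)) A f →
      ‖∫ μ in Set.Ioi m₀, (ρ μ : ℂ) * twoPoint μ f‖ ≤ C * A := fun f A hf => by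
    simp only [twoPoint_eq]
    rw [spectral_eq (hint f)]
    exact (hC f A hf).2
  obtain ⟨T₂, hT₂⟩ := exists_distribution
    (fun f : 𝓢(Cfg s 2, ℂ) => ∫ μ in Set.Ioi m₀, (ρ μ : ℂ) * twoPoint μ f) (fun f g => by
      simp only [twoPoint_eq]
      rw [spectral_eq (hint f), spectral_eq (hint g), spectral_eq (hint (f + g)),
        ← integral_add (hint f) (hint g)]
      refine integral_congr_ae (Eventually.of_forall fun z => ?_)
      simp only [pairKernel_add]
      ring)
    (fun c f => by
      simp only [twoPoint_eq]
      rw [spectral_eq (hint f), spectral_eq (hint (c • f)), ← integral_const_mul]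
      refine integral_congr_ae (Eventually.of_forall fun z => ?_)
      simp only [pairKernel_smul]
      ring) hb
  refine ⟨T₁ + T₂, max L₁ (N + (s + 1)), C₁ + C, fun f => ?_, fun f A hf => ?_⟩
  · rw [fullTwoPoint, ← hT₁, ← hT₂]
    rfl
  · have h1 := hb₁ f A (hf.mono (le_max_left _ _))
    have h2 := hb f A (hf.mono (le_max_right _ _))
    rw [← hT₂] at h2
    have h3 : (T₁ + T₂) f = T₁ f + T₂ f := rfl
    rw [h3, add_mul]
    exact (norm_add_le _ _).trans (add_le_add h1 h2)

/-- Oscillating factors remove the contributions of all masses but `m`. -/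
theorem tendsto_fullTwoPoint (hm : 0 < m) (hm₀ : 0 < m₀) (hρ : IsSpectralDensity m₀ ρ) {σ : ℝ}
    (hσ : σ ≠ 0) (f : 𝓢(Cfg s 2, ℂ)) (g : ℝ → 𝓢(Cfg s 2, ℂ))
    (hg : ∀ u (z : ℝ × EuclideanSpace ℝ (Fin s)), 0 < z.1 → g u (pairCfg z) = f (pairCfg z) *
      Complex.exp (Complex.I * ((σ * u) * (omega z.1 z.2 - omega m z.2) : ℝ))) :
    Tendsto (fun u => fullTwoPoint m m₀ ρ (g u)) atTop (𝓝 (twoPoint m f)) := by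
  obtain ⟨N, C, hC⟩ := exists_integrable_spectral (s := s) hm₀ hρ
  have hint := fun f : 𝓢(Cfg s 2, ℂ) => (hC f _ (schwartz_hasDecay _ f)).1
  have hae : ∀ᵐ z : ℝ × EuclideanSpace ℝ (Fin s) ∂((volume.restrict (Set.Ioi m₀)).prod volume),
      m₀ < z.1 :=
    Measure.quasiMeasurePreserving_fst.ae (ae_restrict_mem measurableSet_Ioi)
  have h1 : ∀ u, twoPoint m (g u) = twoPoint m f := fun u => by
    simp only [twoPoint_eq]
    refine integral_congr_ae (Eventually.of_forall fun p => ?_)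
    simp only [pairKernel, hg u (m, p) hm, sub_self, mul_zero, Complex.ofReal_zero,
      Complex.exp_zero, mul_one]
  have hl : Tendsto (fun u : ℝ => σ * u) atTop (cocompact ℝ) :=
    ((Homeomorph.mulLeft₀ σ hσ).isClosedEmbedding.tendsto_cocompact).mono_left
      atTop_le_cocompact
  have hm' : Filter.map (fun u : ℝ => σ * u) atTop ≤ cocompact ℝ := hl
  have h2 := (tendsto_spectral_phase m hm₀ (hint f) hm').comp tendsto_map
  have h3 : ∀ u, ∫ μ in Set.Ioi m₀, (ρ μ : ℂ) * twoPoint μ (g u) =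
      ∫ z, (ρ z.1 : ℂ) * pairKernel f z * Complex.exp (Complex.I *
        ((σ * u) * (omega z.1 z.2 - omega m z.2) : ℝ))
        ∂((volume.restrict (Set.Ioi m₀)).prod volume) := fun u => by
    simp only [twoPoint_eq]
    rw [spectral_eq (hint (g u))]
    refine integral_congr_ae (hae.mono fun z hz => ?_)
    simp only [pairKernel, hg u z (hm₀.trans hz)]
    ring
  have h4 := h2.const_add (twoPoint m f)
  rw [add_zero] at h4
  refine h4.congr fun u => ?_
  rw [fullTwoPoint, h1, h3]
  rfl

theorem slot_pairCfg_zero (z : ℝ × EuclideanSpace ℝ (Fin s)) :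
    slot (pairCfg z) 0 = shellPoint z.1 (-1) z.2 := rfl

theorem slot_pairCfg_one (z : ℝ × EuclideanSpace ℝ (Fin s)) :
    slot (pairCfg z) 1 = -shellPoint z.1 (-1) z.2 := rfl

theorem spatial_shellPoint (μ ς : ℝ) (p : EuclideanSpace ℝ (Fin s)) :
    spatial (shellPoint μ ς p) = p := by
  ext i
  simp [spatial, shellPoint]

theorem shellPoint_zero (μ ς : ℝ) (p : EuclideanSpace ℝ (Fin s)) :
    shellPoint μ ς p 0 = ς * omega μ p := rfl

theorem mink_shellPoint (μ : ℝ) {ς : ℝ} (hς : ς ^ 2 = 1) (p : EuclideanSpace ℝ (Fin s)) :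
    mink (shellPoint μ ς p) (shellPoint μ ς p) = μ ^ 2 := by
  have h := mink_self_sub (m := μ) (shellPoint μ ς p)
  rw [spatial_shellPoint, shellPoint_zero] at h
  linear_combination h + omega μ p ^ 2 * hς

theorem neg_shellPoint (μ ς : ℝ) (p : EuclideanSpace ℝ (Fin s)) :
    -shellPoint μ ς p = shellPoint μ (-ς) (-p) := by
  funext i
  refine Fin.cases ?_ (fun i => ?_) i
  · simp [shellPoint, omega]
  · simp [shellPoint]

theorem chi_shellPoint_neg {μ : ℝ} (hμ : 0 < μ) (t : ℝ) (a : Label)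
    (p : EuclideanSpace ℝ (Fin s)) : chi m φ t a (shellPoint μ (-1) p) = match a with
    | .inn => φ (μ ^ 2 - m ^ 2) * Complex.exp (Complex.I * (t * (omega μ p - omega m p) : ℝ))
    | .loc => 1
    | .out => φ (μ ^ 2 - m ^ 2) *
        Complex.exp (Complex.I * (-t * (omega μ p - omega m p) : ℝ)) := by
  have hω := omega_pos hμ p
  have h1 : chiPlus m φ (shellPoint μ (-1) p) = 0 := by
    rw [chiPlus, if_neg]
    rw [shellPoint_zero]
    linarith
  have h2 : chiMinus m φ (shellPoint μ (-1) p) = φ (μ ^ 2 - m ^ 2) := by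
    rw [chiMinus, if_pos, mink_shellPoint μ (by norm_num)]
    rw [shellPoint_zero]
    linarith
  cases a <;> simp only [chi, h1, h2, shellPoint_zero, spatial_shellPoint, Complex.ofReal_zero,
    zero_mul, zero_add]
  · congr 2
    push_cast
    ring
  · congr 2
    push_cast
    ring

theorem chi_shellPoint_pos {μ : ℝ} (hμ : 0 < μ) (t : ℝ) (a : Label)
    (p : EuclideanSpace ℝ (Fin s)) : chi m φ t a (shellPoint μ 1 p) = match a with
    | .inn => φ (μ ^ 2 - m ^ 2) * Complex.exp (Complex.I * (-t * (omega μ p - omega m p) : ℝ))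
    | .loc => 1
    | .out => φ (μ ^ 2 - m ^ 2) *
        Complex.exp (Complex.I * (t * (omega μ p - omega m p) : ℝ)) := by
  have hω := omega_pos hμ p
  have h1 : chiPlus m φ (shellPoint μ 1 p) = φ (μ ^ 2 - m ^ 2) := by
    rw [chiPlus, if_pos, mink_shellPoint μ (by norm_num)]
    rw [shellPoint_zero]
    linarith
  have h2 : chiMinus m φ (shellPoint μ 1 p) = 0 := by
    rw [chiMinus, if_neg]
    rw [shellPoint_zero]
    linarith
  cases a <;> simp only [chi, h1, h2, shellPoint_zero, spatial_shellPoint, Complex.ofReal_zero,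
    zero_mul, add_zero]
  · congr 2
    push_cast
    ring
  · congr 2
    push_cast
    ring

theorem IsShellCutoff.apply_zero (hφ : IsShellCutoff m φ) : φ 0 = 1 := by
  obtain ⟨-, ε, hε, -, -, h⟩ := hφ
  exact h 0 ⟨by linarith, by linarith⟩

/-- The multipliers are one on the mass shell. -/
theorem chi_shellPoint (hm : 0 < m) (hφ : IsShellCutoff m φ) (t : ℝ) (a : Label) {ς : ℝ}
    (hς : ς = 1 ∨ ς = -1) (p : EuclideanSpace ℝ (Fin s)) :
    chi m φ t a (shellPoint m ς p) = 1 := by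
  rcases hς with rfl | rfl
  · rw [chi_shellPoint_pos hm]
    cases a <;> simp [hφ.apply_zero]
  · rw [chi_shellPoint_neg hm]
    cases a <;> simp [hφ.apply_zero]

/-- On pairs of mass `μ`, a non-local leg contributes a phase. -/
theorem exists_chi_pairCfg (m : ℝ) (φ : ℝ → ℝ) (i : Fin 2) {a : Label} (ha : a ≠ .loc) :
    ∃ σ : ℝ, σ ≠ 0 ∧ ∀ z : ℝ × EuclideanSpace ℝ (Fin s), 0 < z.1 → ∀ t,
      chi m φ t a (slot (pairCfg z) i) = chi m φ 0 a (slot (pairCfg z) i) *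
        Complex.exp (Complex.I * ((σ * t) * (omega z.1 z.2 - omega m z.2) : ℝ)) := by
  fin_cases i
  · cases a
    · refine ⟨1, one_ne_zero, fun z hz t => ?_⟩
      simp [slot_pairCfg_zero, chi_shellPoint_neg hz]
    · exact (ha rfl).elim
    · refine ⟨-1, by norm_num, fun z hz t => ?_⟩
      simp [slot_pairCfg_zero, chi_shellPoint_neg hz]
  · cases a
    · refine ⟨-1, by norm_num, fun z hz t => ?_⟩
      simp [slot_pairCfg_one, neg_shellPoint, chi_shellPoint_pos hz, omega_neg]
    · exact (ha rfl).elim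
    · refine ⟨1, one_ne_zero, fun z hz t => ?_⟩
      simp [slot_pairCfg_one, neg_shellPoint, chi_shellPoint_pos hz, omega_neg]

end TwoPointDistribution

/-! ### Lorentz invariance of the measure on the mass shell -/

section Lorentz

variable {s : ℕ} {m : ℝ} {Λ : (Fin (s + 1) → ℝ) ≃ₗ[ℝ] (Fin (s + 1) → ℝ)}

theorem mink_single_zero (k : Fin (s + 1) → ℝ) : mink (Pi.single 0 1) k = k 0 := by
  simp [mink]

theorem mink_neg_neg (k : Fin (s + 1) → ℝ) : mink (-k) (-k) = mink k k := by simp [mink]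

theorem mink_smul_smul (c : ℝ) (k : Fin (s + 1) → ℝ) : mink (c • k) (c • k) = c ^ 2 * mink k k := by
  simp only [mink, Pi.smul_apply, smul_eq_mul, mul_sub, Finset.mul_sum]
  congr 1
  · ring
  · exact Finset.sum_congr rfl fun i _ => by ring

/-- Two timelike vectors with positive product have energies of the same sign. -/
theorem pos_of_mink_pos {a b : Fin (s + 1) → ℝ} (ha : 0 < mink a a) (ha0 : 0 < a 0)
    (hb : 0 < mink b b) (hab : 0 < mink a b) : 0 < b 0 := by
  by_contra hb0
  rw [not_lt] at hb0
  have hcs := Finset.sum_mul_sq_le_sq_mul_sq Finset.univ (fun i : Fin s => a i.succ)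
    fun i => b i.succ
  simp only [mink, ← sq] at ha hb hab
  have h0 : 0 ≤ ∑ i : Fin s, a i.succ ^ 2 := Finset.sum_nonneg fun i _ => sq_nonneg _
  have h0' : 0 ≤ ∑ i : Fin s, b i.succ ^ 2 := Finset.sum_nonneg fun i _ => sq_nonneg _
  have h1 : (∑ i : Fin s, a i.succ ^ 2) * ∑ i : Fin s, b i.succ ^ 2 ≤ a 0 ^ 2 * b 0 ^ 2 :=
    mul_le_mul (by linarith) (by linarith) h0' (sq_nonneg _)
  have h2 : a 0 * b 0 ≤ 0 := mul_nonpos_of_nonneg_of_nonpos ha0.le hb0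
  nlinarith

theorem IsProperOrthochronous.pos (hΛ : IsProperOrthochronous Λ) {k : Fin (s + 1) → ℝ}
    (hk : 0 < mink k k) (hk0 : 0 < k 0) : 0 < Λ k 0 := by
  refine pos_of_mink_pos (a := Λ (Pi.single 0 1)) ?_ hΛ.2.2 ?_ ?_
  · rw [hΛ.1, mink_single_zero]
    simp
  · rwa [hΛ.1]
  · rwa [hΛ.1, mink_single_zero]

theorem IsProperOrthochronous.neg (hΛ : IsProperOrthochronous Λ) {k : Fin (s + 1) → ℝ}
    (hk : 0 < mink k k) (hk0 : k 0 < 0) : Λ k 0 < 0 := by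
  have h := hΛ.pos (k := -k) (by rwa [mink_neg_neg]) (by simpa using hk0)
  rw [map_neg, Pi.neg_apply] at h
  linarith

theorem ne_zero_of_mink_pos {k : Fin (s + 1) → ℝ} (hk : 0 < mink k k) : k 0 ≠ 0 := by
  intro h
  have h0 : 0 ≤ ∑ i : Fin s, k i.succ * k i.succ := Finset.sum_nonneg fun i _ => mul_self_nonneg _
  simp only [mink, h] at hk
  linarith

theorem IsProperOrthochronous.pos_iff (hΛ : IsProperOrthochronous Λ) {k : Fin (s + 1) → ℝ}
    (hk : 0 < mink k k) : 0 < Λ k 0 ↔ 0 < k 0 := by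
  refine ⟨fun h => ?_, hΛ.pos hk⟩
  rcases lt_or_gt_of_ne (ne_zero_of_mink_pos hk) with h0 | h0
  · exact absurd h (hΛ.neg hk h0).not_gt
  · exact h0

theorem shellPoint_spatial {ς : ℝ} (hς : ς = 1 ∨ ς = -1) {k : Fin (s + 1) → ℝ}
    (hk : mink k k = m ^ 2) (hk0 : 0 < ς * k 0) : shellPoint m ς (spatial k) = k := by
  have h1 := mink_self_sub (m := m) k
  rw [hk, sub_self] at h1
  have h2 : 0 ≤ omega m (spatial k) := Real.sqrt_nonneg _
  have hς2 : ς * ς = 1 := by rcases hς with h | h <;> simp [h]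
  have h3 : omega m (spatial k) = ς * k 0 := by
    rcases hς with rfl | rfl <;> rcases mul_eq_zero.1 h1.symm with h | h <;> linarith
  funext i
  refine Fin.cases ?_ (fun i => ?_) i
  · rw [shellPoint_zero, h3, ← mul_assoc, hς2, one_mul]
  · simp [shellPoint, spatial]

/-- The action of a Lorentz transformation on the spatial momenta of the shell of sign `ς`. -/
def shellAction (m : ℝ) (Λ : (Fin (s + 1) → ℝ) ≃ₗ[ℝ] (Fin (s + 1) → ℝ)) (ς : ℝ)
    (p : EuclideanSpace ℝ (Fin s)) : EuclideanSpace ℝ (Fin s) :=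
  spatial (Λ (shellPoint m ς p))

theorem shellPoint_shellAction (hm : 0 < m) (hΛ : IsProperOrthochronous Λ) {ς : ℝ}
    (hς : ς = 1 ∨ ς = -1) (p : EuclideanSpace ℝ (Fin s)) :
    shellPoint m ς (shellAction m Λ ς p) = Λ (shellPoint m ς p) := by
  have hς2 : ς ^ 2 = 1 := by rcases hς with h | h <;> simp [h]
  have h1 : mink (shellPoint m ς p) (shellPoint m ς p) = m ^ 2 := mink_shellPoint m hς2 p
  have h2 : 0 < mink (shellPoint m ς p) (shellPoint m ς p) := by
    rw [h1]
    positivity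
  have hω := omega_pos hm p
  refine shellPoint_spatial hς (by rw [hΛ.1, h1]) ?_
  rcases hς with rfl | rfl
  · rw [one_mul]
    refine hΛ.pos h2 ?_
    rw [shellPoint_zero]
    linarith
  · have := hΛ.neg h2 (by rw [shellPoint_zero]; linarith)
    linarith

theorem continuous_linearEquiv (Λ : (Fin (s + 1) → ℝ) ≃ₗ[ℝ] (Fin (s + 1) → ℝ)) : Continuous Λ :=
  Λ.toLinearMap.continuous_of_finiteDimensional

theorem continuous_shellPoint_right (m ς : ℝ) : Continuous (shellPoint (s := s) m ς) := by
  refine continuous_pi fun μ => ?_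
  refine Fin.cases ?_ (fun i => ?_) μ
  · exact continuous_const.mul (continuous_omega m)
  · simp only [shellPoint, Fin.cons_succ]
    fun_prop

theorem continuous_shellAction (ς : ℝ) : Continuous (shellAction m Λ ς) :=
  continuous_spatial.comp ((continuous_linearEquiv Λ).comp (continuous_shellPoint_right m ς))

theorem measurePreserving_lorentz (hΛ : IsProperOrthochronous Λ) : MeasurePreserving Λ := by
  refine ⟨(continuous_linearEquiv Λ).measurable, ?_⟩
  have h := Measure.map_linearMap_addHaar_eq_smul_addHaar
    (volume : Measure (Fin (s + 1) → ℝ)) (f := Λ.toLinearMap) (by rw [hΛ.2.1]; exact one_ne_zero)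
  rw [hΛ.2.1] at h
  simpa using h

/-- Energy and momentum as coordinates. -/
theorem measurePreserving_cons : MeasurePreserving
    (fun z : ℝ × EuclideanSpace ℝ (Fin s) => (Fin.cons z.1 fun i => z.2 i : Fin (s + 1) → ℝ))
    (volume.prod volume) volume := by
  have h := (volume_preserving_piFinSuccAbove (fun _ : Fin (s + 1) => ℝ) 0).symm.comp
    ((MeasurePreserving.id (volume : Measure ℝ)).prod (PiLp.volume_preserving_ofLp (Fin s)))
  have e : (fun z : ℝ × EuclideanSpace ℝ (Fin s) =>
      (Fin.cons z.1 fun i => z.2 i : Fin (s + 1) → ℝ)) =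
      ⇑(MeasurableEquiv.piFinSuccAbove (fun _ : Fin (s + 1) => ℝ) 0).symm ∘
        Prod.map id WithLp.ofLp := by
    funext z
    exact (Fin.insertNth_zero _ _).symm
  rw [e]
  exact h

/-- The positive-energy vectors `k` with `1 < k² < 4`. -/
def shellLayer (s : ℕ) : Set (Fin (s + 1) → ℝ) := {k | 0 < k 0 ∧ 1 < mink k k ∧ mink k k < 4}

theorem measurableSet_shellLayer : MeasurableSet (shellLayer s) := by
  have h := (continuous_mink_self (s := s)).measurable
  have h1 : MeasurableSet {k : Fin (s + 1) → ℝ | 0 < k 0} :=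
    measurableSet_lt measurable_const (measurable_pi_apply 0)
  exact h1.inter ((measurableSet_lt measurable_const h).inter (measurableSet_lt h measurable_const))

theorem omega_smul {r : ℝ} (hr : 0 < r) (p : EuclideanSpace ℝ (Fin s)) :
    omega (r * m) (r • p) = r * omega m p := by
  rw [omega, omega, norm_smul, Real.norm_of_nonneg hr.le, mul_pow, mul_pow, ← mul_add,
    Real.sqrt_mul (sq_nonneg r), Real.sqrt_sq hr.le]

theorem lintegral_comp_smul_eq {r : ℝ} (hr : 0 < r) {h : EuclideanSpace ℝ (Fin s) → ENNReal}
    (hh : Measurable h) : ∫⁻ p, h p = ENNReal.ofReal (r ^ s) * ∫⁻ q, h (r • q) := by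
  have h1 := Measure.map_addHaar_smul (volume : Measure (EuclideanSpace ℝ (Fin s))) hr.ne'
  have h2 : ∫⁻ q, h (r • q) = ∫⁻ p, h p ∂(Measure.map (r • ·) volume) :=
    (lintegral_map hh (measurable_const_smul r)).symm
  rw [h2, h1, lintegral_smul_measure, finrank_euclideanSpace_fin, abs_of_pos (by positivity),
    smul_eq_mul, ← mul_assoc, ← ENNReal.ofReal_mul (by positivity),
    mul_inv_cancel₀ (by positivity), ENNReal.ofReal_one, one_mul]

/-- Integration over energies at fixed momentum, in terms of the mass. -/
theorem lintegral_shellLayer_fiber (F : EuclideanSpace ℝ (Fin s) → ENNReal)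
    (p : EuclideanSpace ℝ (Fin s)) :
    ∫⁻ x : ℝ, (shellLayer s).indicator (fun k => F ((m / √(mink k k)) • spatial k))
      (Fin.cons x fun i => p i) =
    ∫⁻ M in Set.Ioo (1 : ℝ) 2, ENNReal.ofReal (M / omega M p) * F ((m / M) • p) := by
  have hsp : ∀ x : ℝ, spatial (Fin.cons x fun i => p i : Fin (s + 1) → ℝ) = p := fun x => by
    ext i
    simp [spatial]
  have hmk : ∀ x : ℝ, mink (Fin.cons x fun i => p i : Fin (s + 1) → ℝ) (Fin.cons x fun i => p i) =
      x ^ 2 - ‖p‖ ^ 2 := fun x => by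
    have h := mink_self_sub (m := 0) (Fin.cons x fun i => p i : Fin (s + 1) → ℝ)
    have h2 := omega_sq 0 p
    rw [hsp, Fin.cons_zero] at h
    linear_combination h - h2
  have hg : ∀ M ∈ Set.Ioo (1 : ℝ) 2,
      HasDerivWithinAt (fun M => omega M p) (M / omega M p) (Set.Ioo 1 2) M := fun M hM => by
    have hM0 : 0 < M := one_pos.trans hM.1
    have h0 : ‖p‖ ^ 2 + M ^ 2 ≠ 0 := by positivity
    have h := (((hasDerivAt_pow 2 M).const_add (‖p‖ ^ 2)).sqrt h0).hasDerivWithinAt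
      (s := Set.Ioo 1 2)
    refine h.congr_deriv ?_
    have : √(‖p‖ ^ 2 + M ^ 2) = omega M p := rfl
    rw [this]
    have := omega_pos hM0 p
    field_simp
    norm_num
  have hinj : Set.InjOn (fun M => omega M p) (Set.Ioo 1 2) := fun x hx y hy hxy => by
    have h1 : omega x p ^ 2 = omega y p ^ 2 := congrArg (· ^ 2) hxy
    rw [omega_sq, omega_sq, add_right_inj] at h1
    exact (pow_left_inj₀ (one_pos.trans hx.1).le (one_pos.trans hy.1).le two_ne_zero).1 h1
  have himg : ∀ x : ℝ, (Fin.cons x fun i => p i : Fin (s + 1) → ℝ) ∈ shellLayer s ↔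
      x ∈ (fun M => omega M p) '' Set.Ioo 1 2 := fun x => by
    simp only [shellLayer, Set.mem_ofPred_eq, hmk, Fin.cons_zero]
    constructor
    · rintro ⟨h0, h1, h2⟩
      refine ⟨√(x ^ 2 - ‖p‖ ^ 2), ⟨?_, ?_⟩, ?_⟩
      · rw [Real.lt_sqrt (by norm_num)]
        linarith
      · rw [Real.sqrt_lt' (by norm_num)]
        linarith
      · simp only [omega]
        rw [Real.sq_sqrt (by linarith), add_sub_cancel, Real.sqrt_sq h0.le]
    · rintro ⟨M, hM, rfl⟩
      have hM0 : 0 < M := one_pos.trans hM.1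
      have h1 := omega_sq M p
      refine ⟨omega_pos hM0 p, ?_, ?_⟩ <;> rw [h1] <;> nlinarith [hM.1, hM.2]
  have hms : MeasurableSet ((fun M => omega M p) '' Set.Ioo 1 2) :=
    measurableSet_Ioo.image_of_continuousOn_injOn (fun M hM => (hg M hM).continuousWithinAt) hinj
  have e1 : ∀ x : ℝ, (shellLayer s).indicator (fun k => F ((m / √(mink k k)) • spatial k))
      (Fin.cons x fun i => p i) = ((fun M => omega M p) '' Set.Ioo 1 2).indicator
        (fun x => F ((m / √(x ^ 2 - ‖p‖ ^ 2)) • p)) x := fun x => by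
    by_cases hx : x ∈ (fun M => omega M p) '' Set.Ioo 1 2
    · rw [Set.indicator_of_mem hx, Set.indicator_of_mem ((himg x).2 hx), hmk, hsp]
    · rw [Set.indicator_of_notMem hx, Set.indicator_of_notMem fun h => hx ((himg x).1 h)]
  simp only [e1]
  rw [lintegral_indicator hms, lintegral_image_eq_lintegral_abs_deriv_mul measurableSet_Ioo hg hinj]
  refine setLIntegral_congr_fun measurableSet_Ioo fun M hM => ?_
  have hM0 : 0 < M := one_pos.trans hM.1
  have hω := omega_pos hM0 p
  beta_reduce
  rw [abs_of_pos (by positivity), omega_sq, add_sub_cancel_left, Real.sqrt_sq hM0.le]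

/-- Up to a constant, the invariant measure on the mass shell is the image of the Lebesgue measure
on a layer of timelike vectors under the projection along the rays. -/
theorem exists_lintegral_shellLayer (s : ℕ) (hm : 0 < m) : ∃ κ : ENNReal, κ ≠ 0 ∧ κ ≠ ⊤ ∧
    ∀ F : EuclideanSpace ℝ (Fin s) → ENNReal, Measurable F →
      ∫⁻ k in shellLayer s, F ((m / √(mink k k)) • spatial k) =
        κ * ∫⁻ p, ENNReal.ofReal (m / omega m p) * F p := by
  have hint : IntegrableOn (fun M : ℝ => (M / m) ^ s) (Set.Ioo 1 2) :=
    (Continuous.integrableOn_Icc (by fun_prop)).mono_set Set.Ioo_subset_Icc_self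
  refine ⟨∫⁻ M in Set.Ioo (1 : ℝ) 2, ENNReal.ofReal ((M / m) ^ s), ?_, ?_, fun F hF => ?_⟩
  · have hle : ENNReal.ofReal ((1 / m) ^ s) ≤
        ∫⁻ M in Set.Ioo (1 : ℝ) 2, ENNReal.ofReal ((M / m) ^ s) := by
      calc ENNReal.ofReal ((1 / m) ^ s)
          = ∫⁻ _ in Set.Ioo (1 : ℝ) 2, ENNReal.ofReal ((1 / m) ^ s) := by
            rw [setLIntegral_const, Real.volume_Ioo]
            norm_num
        _ ≤ _ := setLIntegral_mono (by fun_prop) fun M hM => by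
            have := hM.1.le
            gcongr
    exact (lt_of_lt_of_le (ENNReal.ofReal_pos.2 (by positivity)) hle).ne'
  · exact hint.lintegral_lt_top.ne
  have hmeas : Measurable fun k : Fin (s + 1) → ℝ => F ((m / √(mink k k)) • spatial k) := by
    have h1 := (continuous_mink_self (s := s)).measurable
    have h2 := (continuous_spatial (s := s)).measurable
    fun_prop
  have hom := (continuous_omega_uncurry (s := s)).measurable
  have hom' := (continuous_omega (s := s) m).measurable
  rw [← lintegral_indicator measurableSet_shellLayer,
    ← measurePreserving_cons.lintegral_comp (hmeas.indicator measurableSet_shellLayer),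
    lintegral_prod_symm (μ := volume) (ν := volume) (fun a : ℝ × EuclideanSpace ℝ (Fin s) =>
      (shellLayer s).indicator (fun k => F ((m / √(mink k k)) • spatial k))
        (Fin.cons a.1 fun i => a.2.ofLp i)) ((hmeas.indicator measurableSet_shellLayer).comp
      measurePreserving_cons.measurable).aemeasurable]
  simp only [lintegral_shellLayer_fiber]
  rw [lintegral_lintegral_swap (Measurable.aemeasurable (by fun_prop)),
    ← lintegral_mul_const _ (by fun_prop)]
  refine setLIntegral_congr_fun measurableSet_Ioo fun M hM => ?_
  have hM0 : 0 < M := one_pos.trans hM.1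
  have hr : 0 < M / m := by positivity
  have hf : Measurable fun p : EuclideanSpace ℝ (Fin s) =>
      ENNReal.ofReal (M / omega M p) * F ((m / M) • p) := by
    have := (continuous_omega (s := s) M).measurable
    fun_prop
  rw [lintegral_comp_smul_eq hr hf]
  congr 1
  refine lintegral_congr fun q => ?_
  have h1 : omega M ((M / m) • q) = M / m * omega m q := by
    rw [← omega_smul hr, div_mul_cancel₀ _ hm.ne']
  have hω := omega_pos hm q
  rw [h1, smul_smul, div_mul_div_cancel₀ hM0.ne', div_self hm.ne', one_smul]
  congr 2
  field_simp

theorem lintegral_shellAction_one (hm : 0 < m) (hΛ : IsProperOrthochronous Λ)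
    {F : EuclideanSpace ℝ (Fin s) → ENNReal} (hF : Measurable F) :
    ∫⁻ p, ENNReal.ofReal (m / omega m p) * F (shellAction m Λ 1 p) =
      ∫⁻ p, ENNReal.ofReal (m / omega m p) * F p := by
  obtain ⟨κ, hκ0, hκ, h⟩ := exists_lintegral_shellLayer s hm
  have hS : Measurable fun p => F (shellAction m Λ 1 p) :=
    hF.comp (continuous_shellAction 1).measurable
  rw [← ENNReal.mul_right_inj hκ0 hκ, ← h F hF, ← h _ hS]
  have hmeas : Measurable fun k : Fin (s + 1) → ℝ => F ((m / √(mink k k)) • spatial k) := by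
    have h1 := (continuous_mink_self (s := s)).measurable
    have h2 := (continuous_spatial (s := s)).measurable
    fun_prop
  rw [← lintegral_indicator measurableSet_shellLayer,
    ← lintegral_indicator measurableSet_shellLayer,
    ← (measurePreserving_lorentz hΛ).lintegral_comp (hmeas.indicator measurableSet_shellLayer)]
  refine lintegral_congr fun k => ?_
  have hiff : Λ k ∈ shellLayer s ↔ k ∈ shellLayer s := by
    simp only [shellLayer, Set.mem_ofPred_eq, hΛ.1 k k]
    constructor
    · rintro ⟨h0, h1⟩
      exact ⟨(hΛ.pos_iff (one_pos.trans h1.1)).1 h0, h1⟩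
    · rintro ⟨h0, h1⟩
      exact ⟨(hΛ.pos_iff (one_pos.trans h1.1)).2 h0, h1⟩
  by_cases hk : k ∈ shellLayer s
  · rw [Set.indicator_of_mem hk, Set.indicator_of_mem (hiff.2 hk), hΛ.1 k k]
    have h0 : 0 < mink k k := one_pos.trans hk.2.1
    have h1 : 0 < √(mink k k) := Real.sqrt_pos.2 h0
    have h2 : (m / √(mink k k)) • spatial k = spatial ((m / √(mink k k)) • k) := rfl
    have h3 : shellPoint m 1 (spatial ((m / √(mink k k)) • k)) = (m / √(mink k k)) • k := by
      refine shellPoint_spatial (Or.inl rfl) ?_ ?_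
      · rw [mink_smul_smul, div_pow, Real.sq_sqrt h0.le, div_mul_cancel₀ _ h0.ne']
      · rw [one_mul, Pi.smul_apply, smul_eq_mul]
        exact mul_pos (by positivity) hk.1
    rw [h2, shellAction, h3, map_smul]
    rfl
  · rw [Set.indicator_of_notMem hk, Set.indicator_of_notMem fun h => hk (hiff.1 h)]

/-- Invariance of `d𝐩 / 2ω` on both mass shells. -/
theorem lintegral_shellAction (hm : 0 < m) (hΛ : IsProperOrthochronous Λ) {ς : ℝ}
    (hς : ς = 1 ∨ ς = -1) {F : EuclideanSpace ℝ (Fin s) → ENNReal} (hF : Measurable F) :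
    ∫⁻ p, ENNReal.ofReal (2 * omega m p)⁻¹ * F (shellAction m Λ ς p) =
      ∫⁻ p, ENNReal.ofReal (2 * omega m p)⁻¹ * F p := by
  have hom := (continuous_omega (s := s) m).measurable
  have hc : ∀ G : EuclideanSpace ℝ (Fin s) → ENNReal, Measurable G →
      ∫⁻ p, ENNReal.ofReal (2 * omega m p)⁻¹ * G p =
      ENNReal.ofReal (2 * m)⁻¹ * ∫⁻ p, ENNReal.ofReal (m / omega m p) * G p := fun G hG => by
    rw [← lintegral_const_mul _ (by fun_prop)]
    refine lintegral_congr fun p => ?_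
    rw [← mul_assoc, ← ENNReal.ofReal_mul (by positivity)]
    congr 2
    have := omega_pos hm p
    field_simp
  have h1 : ∀ G : EuclideanSpace ℝ (Fin s) → ENNReal, Measurable G →
      ∫⁻ p, ENNReal.ofReal (2 * omega m p)⁻¹ * G (shellAction m Λ 1 p) =
      ∫⁻ p, ENNReal.ofReal (2 * omega m p)⁻¹ * G p := fun G hG => by
    rw [hc G hG, hc (fun p => G (shellAction m Λ 1 p)) (hG.comp (continuous_shellAction 1).measurable),
      lintegral_shellAction_one hm hΛ hG]
  rcases hς with rfl | rfl
  · exact h1 F hF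
  · have e : ∀ p, shellAction m Λ (-1) p = -shellAction m Λ 1 (-p) := fun p => by
      have h := neg_shellPoint (s := s) m 1 (-p)
      rw [neg_neg] at h
      rw [shellAction, ← h, map_neg]
      rfl
    have h2 := h1 (fun p => F (-p)) (hF.comp measurable_neg)
    rw [← lintegral_neg_eq_self] at h2
    rw [← lintegral_neg_eq_self (f := fun p => ENNReal.ofReal (2 * omega m p)⁻¹ * F p)]
    simpa only [e, omega_neg] using h2

end Lorentz

/-! ### Lorentz invariance of the limits -/

section LorentzProduct

variable {s n : ℕ} {m : ℝ} {Λ : (Fin (s + 1) → ℝ) ≃ₗ[ℝ] (Fin (s + 1) → ℝ)}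

theorem integral_comp_eq_of_lintegral {α : Type*} [MeasurableSpace α] {μ : Measure α}
    {w : α → ENNReal} (hw : Measurable w) (hw' : ∀ x, w x < ⊤) {S : α → α} (hS : Measurable S)
    (h : ∀ G : α → ENNReal, Measurable G → ∫⁻ x, w x * G (S x) ∂μ = ∫⁻ x, w x * G x ∂μ)
    {F : α → ℂ} (hF : Measurable F) :
    ∫ x, F (S x) * ((w x).toReal : ℂ) ∂μ = ∫ x, F x * ((w x).toReal : ℂ) ∂μ := by
  have hmap : (μ.withDensity w).map S = μ.withDensity w := Measure.ext fun A hA => by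
    have h1 := h (A.indicator 1) (measurable_one.indicator hA)
    rw [Measure.map_apply hS hA, withDensity_apply _ (hS hA), withDensity_apply _ hA,
      ← lintegral_indicator hA, ← lintegral_indicator (hS hA)]
    refine Eq.trans (lintegral_congr fun x => ?_) (h1.trans (lintegral_congr fun x => ?_))
    · by_cases hx : S x ∈ A
      · rw [Set.indicator_of_mem (show x ∈ S ⁻¹' A from hx), Set.indicator_of_mem hx, Pi.one_apply,
          mul_one]
      · rw [Set.indicator_of_notMem (show x ∉ S ⁻¹' A from hx), Set.indicator_of_notMem hx,
          mul_zero]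
    · by_cases hx : x ∈ A
      · rw [Set.indicator_of_mem hx, Set.indicator_of_mem hx, Pi.one_apply, mul_one]
      · rw [Set.indicator_of_notMem hx, Set.indicator_of_notMem hx, mul_zero]
  have hi := fun g : α → ℂ =>
    integral_withDensity_eq_integral_toReal_smul (μ := μ) hw (Eventually.of_forall hw') g
  have h2 := integral_map (μ := μ.withDensity w) hS.aemeasurable (f := F)
    hF.aestronglyMeasurable
  rw [hmap, hi, hi] at h2
  simp only [Complex.real_smul] at h2
  simp only [mul_comm (F _)]
  exact h2.symm

/-- Lorentz transformations in several momenta leave the product of the invariant measures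
unchanged. -/
theorem lintegral_pi_shellAction {ι : Type*} [Fintype ι] [DecidableEq ι] (hm : 0 < m)
    (hΛ : IsProperOrthochronous Λ) {ς : ι → ℝ} (hς : ∀ l, ς l = 1 ∨ ς l = -1) (S : Finset ι)
    {G : (ι → EuclideanSpace ℝ (Fin s)) → ENNReal} (hG : Measurable G) :
    ∫⁻ p : ι → EuclideanSpace ℝ (Fin s), (∏ l, ENNReal.ofReal (2 * omega m (p l))⁻¹) *
        G (fun l => if l ∈ S then shellAction m Λ (ς l) (p l) else p l) =
      ∫⁻ p : ι → EuclideanSpace ℝ (Fin s), (∏ l, ENNReal.ofReal (2 * omega m (p l))⁻¹) * G p := by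
  have hom := (continuous_omega (s := s) m).measurable
  have hS : ∀ ς, Measurable (shellAction (s := s) m Λ ς) :=
    fun ς => (continuous_shellAction ς).measurable
  have hw : Measurable fun p : ι → EuclideanSpace ℝ (Fin s) =>
      ∏ l, ENNReal.ofReal (2 * omega m (p l))⁻¹ :=
    Finset.measurable_fun_prod _ fun l _ => by fun_prop
  induction S using Finset.induction_on generalizing G with
  | empty => simp
  | insert l S hl ih =>
    have hT : Measurable fun p : ι → EuclideanSpace ℝ (Fin s) =>
        fun i => if i ∈ S then shellAction m Λ (ς i) (p i) else p i := by
      refine measurable_pi_lambda _ fun i => ?_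
      split_ifs
      · exact (hS _).comp (measurable_pi_apply i)
      · exact measurable_pi_apply i
    have hU : Measurable fun p : ι → EuclideanSpace ℝ (Fin s) =>
        Function.update p l (shellAction m Λ (ς l) (p l)) := by
      refine measurable_pi_lambda _ fun i => ?_
      by_cases hi : i = l
      · subst hi
        simp only [Function.update_self]
        exact (hS _).comp (measurable_pi_apply i)
      · simp only [Function.update_of_ne hi]
        exact measurable_pi_apply i
    have hstep : ∀ H : (ι → EuclideanSpace ℝ (Fin s)) → ENNReal, Measurable H →
        ∫⁻ p : ι → EuclideanSpace ℝ (Fin s), (∏ l, ENNReal.ofReal (2 * omega m (p l))⁻¹) *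
          H (Function.update p l (shellAction m Λ (ς l) (p l))) =
        ∫⁻ p : ι → EuclideanSpace ℝ (Fin s),
          (∏ l, ENNReal.ofReal (2 * omega m (p l))⁻¹) * H p := fun H hH => by
      refine lintegral_eq_of_lmarginal_eq {l} (hw.mul (hH.comp hU)) (hw.mul hH) ?_
      rw [lmarginal_singleton, lmarginal_singleton]
      funext x
      have hprod : ∀ y, ∏ i, ENNReal.ofReal (2 * omega m (Function.update x l y i))⁻¹ =
          (∏ i ∈ Finset.univ.erase l, ENNReal.ofReal (2 * omega m (x i))⁻¹) *
            ENNReal.ofReal (2 * omega m y)⁻¹ := fun y => by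
        rw [← Finset.prod_erase_mul _ _ (Finset.mem_univ l), Function.update_self]
        congr 1
        exact Finset.prod_congr rfl fun i hi => by
          rw [Function.update_of_ne (Finset.ne_of_mem_erase hi)]
      have hHx : Measurable fun y => H (Function.update x l y) := hH.comp (measurable_update x)
      simp only [hprod, Function.update_self, Function.update_idem, mul_assoc]
      have hHS : Measurable fun y => H (Function.update x l (shellAction m Λ (ς l) y)) :=
        hHx.comp (hS _)
      rw [lintegral_const_mul _ (by fun_prop), lintegral_const_mul _ (by fun_prop),
        lintegral_shellAction hm hΛ (hς l) hHx]
    rw [← ih hG, ← hstep (fun p => G fun i => if i ∈ S then shellAction m Λ (ς i) (p i) else p i)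
      (hG.comp hT)]
    refine lintegral_congr fun p => ?_
    congr 2
    funext i
    by_cases hi : i = l
    · subst hi
      simp [hl]
    · simp [hi]

theorem integral_pi_shellAction {ι : Type*} [Fintype ι] (hm : 0 < m)
    (hΛ : IsProperOrthochronous Λ) {ς : ι → ℝ} (hς : ∀ l, ς l = 1 ∨ ς l = -1)
    {F : (ι → EuclideanSpace ℝ (Fin s)) → ℂ} (hF : Measurable F) :
    ∫ p : ι → EuclideanSpace ℝ (Fin s),
        F (fun l => shellAction m Λ (ς l) (p l)) * shellDensity m p =
      ∫ p : ι → EuclideanSpace ℝ (Fin s), F p * shellDensity m p := by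
  classical
  have hom := (continuous_omega (s := s) m).measurable
  have hw : Measurable fun p : ι → EuclideanSpace ℝ (Fin s) =>
      ∏ l, ENNReal.ofReal (2 * omega m (p l))⁻¹ :=
    Finset.measurable_fun_prod _ fun l _ => by fun_prop
  have h := integral_comp_eq_of_lintegral (μ := volume) hw
    (fun p => ENNReal.prod_lt_top fun l _ => ENNReal.ofReal_lt_top)
    (S := fun p l => shellAction m Λ (ς l) (p l))
    (measurable_pi_lambda _ fun l => (continuous_shellAction (ς l)).measurable.comp
      (measurable_pi_apply l))
    (fun G hG => by simpa using lintegral_pi_shellAction hm hΛ hς Finset.univ hG) hF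
  have hd : ∀ p : ι → EuclideanSpace ℝ (Fin s),
      ((∏ l, ENNReal.ofReal (2 * omega m (p l))⁻¹ : ENNReal).toReal : ℂ) = shellDensity m p :=
    fun p => by
      rw [ENNReal.toReal_prod, shellDensity, Complex.ofReal_prod]
      refine Finset.prod_congr rfl fun l _ => ?_
      have := omega_pos hm (p l)
      rw [ENNReal.toReal_ofReal (by positivity)]
  simpa only [hd] using h

theorem onShellCfg_shellAction (hm : 0 < m) (hΛ : IsProperOrthochronous Λ) (j : Fin n)
    (p : {l : Fin n // l ≠ j} → EuclideanSpace ℝ (Fin s)) :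
    recoil m j (fun l => shellAction m Λ (shellSign j l) (p l)) = Λ (recoil m j p) ∧
    onShellCfg m j (fun l => shellAction m Λ (shellSign j l) (p l)) =
      diagEquiv n Λ (onShellCfg m j p) := by
  have h1 : ∀ l, onShell m j (fun l => shellAction m Λ (shellSign j l) (p l)) l =
      Λ (onShell m j p l) := fun l =>
    shellPoint_shellAction hm hΛ (shellSign_eq j l) (p l)
  have h2 : recoil m j (fun l => shellAction m Λ (shellSign j l) (p l)) = Λ (recoil m j p) := by
    simp only [recoil, h1, map_neg, map_sum]
  refine ⟨h2, ?_⟩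
  ext ⟨l, μ⟩
  change (if h : l = j then _ else _ : Fin (s + 1) → ℝ) μ = Λ (slot (onShellCfg m j p) l) μ
  split_ifs with h
  · subst h
    rw [h2, slot_onShellCfg_self]
  · rw [h1, ← slot_onShellCfg_ne]

theorem IsProperOrthochronous.sign_eq (hΛ : IsProperOrthochronous Λ) {k : Fin (s + 1) → ℝ}
    (hk : 0 < mink k k) : Real.sign (Λ k 0) = Real.sign (k 0) := by
  rcases lt_or_gt_of_ne (ne_zero_of_mink_pos hk) with h0 | h0
  · rw [Real.sign_of_neg h0, Real.sign_of_neg (hΛ.neg hk h0)]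
  · rw [Real.sign_of_pos h0, Real.sign_of_pos (hΛ.pos hk h0)]

theorem propagatorApprox_lorentz (hΛ : IsProperOrthochronous Λ) {ε : ℝ}
    (hεm : ε < m ^ 2) (a : Label) (k : Fin (s + 1) → ℝ) :
    propagatorApprox m ε a (Λ k) = propagatorApprox m ε a k := by
  have h : (if |mink k k - m ^ 2| < ε then Real.sign (Λ k 0) / (2 * ε) else 0) =
      if |mink k k - m ^ 2| < ε then Real.sign (k 0) / (2 * ε) else 0 := by
    split_ifs with h
    · rw [hΛ.sign_eq (by linarith [(abs_lt.1 h).1])]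
    · rfl
  cases a <;> simp only [propagatorApprox, hΛ.1 k k, h]

theorem measurable_propagatorApprox (ε : ℝ) (a : Label) :
    Measurable (propagatorApprox (s := s) m ε a) := by
  have h := (continuous_mink_self (s := s)).measurable.sub_const (m ^ 2)
  have h0 : Measurable fun k : Fin (s + 1) → ℝ => ((Real.sign (k 0) : ℝ) : ℂ) := by
    refine Complex.measurable_ofReal.comp ?_
    unfold Real.sign
    exact Measurable.ite (measurableSet_lt (measurable_pi_apply 0) measurable_const)
      measurable_const (Measurable.ite (measurableSet_lt measurable_const (measurable_pi_apply 0))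
        measurable_const measurable_const)
  cases a
  · simp only [funext (propagatorApprox_inn ε)]
    exact (h0.mul ((measurable_boxDelta ε).comp h)).const_mul _
  · simp only [funext (propagatorApprox_loc ε)]
    exact (measurable_truncInv ε).comp h
  · simp only [funext (propagatorApprox_out ε)]
    exact (h0.mul ((measurable_boxDelta ε).comp h)).const_mul _

theorem continuous_onShellCfg (j : Fin n) : Continuous (onShellCfg (s := s) m j) := by
  refine (PiLp.continuous_toLp 2 _).comp (continuous_pi fun q => ?_)
  by_cases h : q.1 = j
  · simp only [h, dite_true]
    exact (continuous_apply q.2).comp (continuous_recoil j)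
  · simp only [h, dite_false]
    exact (continuous_apply q.2).comp ((continuous_shellPoint_right m _).comp (continuous_apply _))

/-- The integrals are invariant already for a fixed width `ε < m²`. For larger `ε` the averages
could reach spacelike vectors, on which the sign of the energy is not invariant. -/
theorem IsShellProduct.lorentz (hm : 0 < m) (hΛ : IsProperOrthochronous Λ) {j : Fin n} {a : Label}
    {T : 𝓢'(Cfg s n, ℂ)} (hT : IsShellProduct m j a T) {f g : 𝓢(Cfg s n, ℂ)}
    (hfg : ∀ p, g (onShellCfg m j p) = f (diagEquiv n Λ (onShellCfg m j p))) : T g = T f := by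
  refine tendsto_nhds_unique (hT g) ((hT f).congr' ?_)
  have hm2 : (0 : ℝ) < m ^ 2 := by positivity
  filter_upwards [Ioo_mem_nhdsGT hm2] with ε hε
  have h := integral_pi_shellAction (ι := {l : Fin n // l ≠ j}) (s := s) hm hΛ (shellSign_eq j)
    (F := fun p => propagatorApprox m ε a (recoil m j p) * f (onShellCfg m j p))
    (((measurable_propagatorApprox ε a).comp (continuous_recoil j).measurable).mul
      (f.continuous.comp (continuous_onShellCfg j)).measurable)
  refine h.symm.trans (integral_congr_ae (Eventually.of_forall fun p => ?_))
  obtain ⟨h1, h2⟩ := onShellCfg_shellAction hm hΛ j p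
  simp only [h1, h2, propagatorApprox_lorentz hΛ hε.2, hfg]
  rfl

theorem pairCfg_shellAction {μ : ℝ} (hμ : 0 < μ) (hΛ : IsProperOrthochronous Λ)
    (p : EuclideanSpace ℝ (Fin s)) :
    pairCfg (μ, shellAction μ Λ (-1) p) = diagEquiv 2 Λ (pairCfg (μ, p)) := by
  have h := shellPoint_shellAction hμ hΛ (Or.inr rfl) p
  ext ⟨l, i⟩
  change (![_, _] : Fin 2 → Fin (s + 1) → ℝ) l i = Λ (slot (pairCfg (μ, p)) l) i
  fin_cases l
  · exact congrFun (h.trans (congrArg Λ (slot_pairCfg_zero (μ, p)).symm)) i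
  · refine congrFun (Eq.trans ?_ (congrArg Λ (slot_pairCfg_one (μ, p)).symm)) i
    rw [map_neg]
    exact congrArg Neg.neg h

theorem twoPoint_lorentz {μ : ℝ} (hμ : 0 < μ) (hΛ : IsProperOrthochronous Λ)
    {f g : 𝓢(Cfg s 2, ℂ)}
    (hfg : ∀ p, g (pairCfg (μ, p)) = f (diagEquiv 2 Λ (pairCfg (μ, p)))) :
    twoPoint μ g = twoPoint μ f := by
  have hom := (continuous_omega (s := s) μ).measurable
  have h := integral_comp_eq_of_lintegral (μ := (volume : Measure (EuclideanSpace ℝ (Fin s))))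
    (w := fun p => ENNReal.ofReal (2 * omega μ p)⁻¹) (by fun_prop)
    (fun p => ENNReal.ofReal_lt_top) (continuous_shellAction (-1)).measurable
    (fun G hG => lintegral_shellAction hμ hΛ (Or.inr rfl) hG)
    (F := fun p => f (pairCfg (μ, p)))
    (f.continuous.comp (continuous_pairCfg.comp (Continuous.prodMk_right μ))).measurable
  simp only [pairCfg_shellAction hμ hΛ, ← hfg] at h
  have e : ∀ (F : 𝓢(Cfg s 2, ℂ)) (p : EuclideanSpace ℝ (Fin s)), F (pairCfg (μ, p)) *
      ((ENNReal.ofReal (2 * omega μ p)⁻¹).toReal : ℂ) = pairKernel F (μ, p) := fun F p => by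
    have := omega_pos hμ p
    rw [ENNReal.toReal_ofReal (by positivity), Complex.ofReal_inv]
    rfl
  simp only [e] at h
  exact h

theorem fullTwoPoint_lorentz {m₀ : ℝ} {ρ : ℝ → ℝ} (hm : 0 < m) (hm₀ : 0 < m₀)
    (hΛ : IsProperOrthochronous Λ) {f g : 𝓢(Cfg s 2, ℂ)}
    (hfg : ∀ z, g (pairCfg z) = f (diagEquiv 2 Λ (pairCfg z))) :
    fullTwoPoint m m₀ ρ g = fullTwoPoint m m₀ ρ f := by
  rw [fullTwoPoint, fullTwoPoint, twoPoint_lorentz hm hΛ fun p => hfg (m, p)]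
  congr 1
  refine setIntegral_congr_fun measurableSet_Ioi fun μ hμ => ?_
  simp only [twoPoint_lorentz (hm₀.trans hμ) hΛ fun p => hfg (μ, p)]

end LorentzProduct

/-! ### The Poincaré group and the Fourier transform -/

section Poincare

variable {s n : ℕ} {m : ℝ} {Λ : (Fin (s + 1) → ℝ) ≃ₗ[ℝ] (Fin (s + 1) → ℝ)}

/-- Tuples of vectors as elements of a Euclidean space. -/
def slotsEquiv (s n : ℕ) : (Fin n → Fin (s + 1) → ℝ) ≃ₗ[ℝ] Cfg s n where
  toFun x := ofSlots x
  invFun x := slot x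
  map_add' _ _ := rfl
  map_smul' _ _ := rfl
  left_inv _ := rfl
  right_inv _ := rfl

theorem det_diagEquiv (n : ℕ) (Λ : (Fin (s + 1) → ℝ) ≃ₗ[ℝ] (Fin (s + 1) → ℝ)) :
    LinearMap.det ((diagEquiv n Λ).toLinearEquiv : Cfg s n →ₗ[ℝ] Cfg s n) =
      LinearMap.det Λ.toLinearMap ^ n := by
  have h := LinearMap.det_pi (ι := Fin n) fun _ => Λ.toLinearMap
  rw [← LinearMap.det_conj _ (slotsEquiv s n), Finset.prod_const, Finset.card_univ,
    Fintype.card_fin] at h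
  rw [← h]
  rfl

theorem measurePreserving_diagEquiv (n : ℕ) (hΛ : IsProperOrthochronous Λ) :
    MeasurePreserving (diagEquiv n Λ) := by
  refine ⟨(diagEquiv n Λ).continuous.measurable, ?_⟩
  have hd := det_diagEquiv n Λ
  rw [hΛ.2.1, one_pow] at hd
  have h := Measure.map_linearMap_addHaar_eq_smul_addHaar (volume : Measure (Cfg s n))
    (f := ((diagEquiv n Λ).toLinearEquiv : Cfg s n →ₗ[ℝ] Cfg s n)) (by rw [hd]; exact one_ne_zero)
  rw [hd] at h
  simpa using h

theorem mink_add_left (x y k : Fin (s + 1) → ℝ) : mink (x + y) k = mink x k + mink y k := by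
  simp only [mink, Pi.add_apply, add_mul, Finset.sum_add_distrib]
  ring

theorem mink_sum_right {ι : Type*} (S : Finset ι) (x : Fin (s + 1) → ℝ)
    (k : ι → Fin (s + 1) → ℝ) : mink x (∑ l ∈ S, k l) = ∑ l ∈ S, mink x (k l) := by
  simp only [mink, Finset.sum_apply, Finset.mul_sum, Finset.sum_sub_distrib]
  rw [Finset.sum_comm]

/-- Poincaré transformations in energy-momentum space: the translations act by phases which are
trivial where the momenta add up to zero. -/
theorem minkFourier_poincare (hΛ : IsProperOrthochronous Λ) (v : Fin (s + 1) → ℝ)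
    (f : 𝓢(Cfg s n, ℂ)) (k : Cfg s n) :
    minkFourier s n (poincare n Λ v f) k =
      Complex.exp (-Complex.I * ((mink v (∑ l, slot k l) : ℝ) : ℂ)) *
        minkFourier s n f (diagEquiv n Λ.symm k) := by
  rw [minkFourier_apply, minkFourier_apply, mul_left_comm]
  congr 1
  rw [← integral_add_right_eq_self _ (ofSlots fun _ => v : Cfg s n),
    ← (measurePreserving_diagEquiv n hΛ).integral_comp
      (diagEquiv n Λ).toHomeomorph.measurableEmbedding, ← integral_const_mul]
  refine integral_congr_ae (Eventually.of_forall fun y => ?_)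
  have h1 : ∀ l, slot (diagEquiv n Λ y + ofSlots fun _ => v) l = Λ (slot y l) + v := fun l => rfl
  have h2 : ∀ l, mink (Λ (slot y l)) (slot k l) =
      mink (slot y l) (slot (diagEquiv n Λ.symm k) l) := fun l => by
    have h := hΛ.1 (slot y l) (Λ.symm (slot k l))
    rw [Λ.apply_symm_apply] at h
    exact h
  beta_reduce
  rw [poincare_apply]
  simp only [h1, mink_add_left, h2, Finset.sum_add_distrib, add_sub_cancel_right,
    Λ.symm_apply_apply, ← mink_sum_right]
  rw [Complex.ofReal_add, mul_add, add_comm, Complex.exp_add, mul_assoc]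
  rfl

theorem sum_slot_onShellCfg (j : Fin n) (p : {l : Fin n // l ≠ j} → EuclideanSpace ℝ (Fin s)) :
    ∑ l, slot (onShellCfg m j p) l = 0 := by
  rw [← Finset.add_sum_erase _ _ (Finset.mem_univ j), slot_onShellCfg_self, recoil,
    Finset.sum_subtype (p := fun l => l ≠ j) (F := inferInstance) (Finset.univ.erase j) (by simp)
      (fun l => slot (onShellCfg m j p) l)]
  simp only [slot_onShellCfg_ne, neg_add_cancel]

theorem sum_slot_pairCfg (z : ℝ × EuclideanSpace ℝ (Fin s)) : ∑ l, slot (pairCfg z) l = 0 := by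
  rw [Fin.sum_univ_two, slot_pairCfg_zero, slot_pairCfg_one, add_neg_cancel]

theorem minkFourier_poincare_of_sum_eq_zero (hΛ : IsProperOrthochronous Λ) (v : Fin (s + 1) → ℝ)
    (f : 𝓢(Cfg s n, ℂ)) {k : Cfg s n} (hk : ∑ l, slot k l = 0) :
    minkFourier s n (poincare n Λ v f) (diagEquiv n Λ k) = minkFourier s n f k := by
  have h : ∑ l, slot (diagEquiv n Λ k) l = 0 := by
    have h' := congrArg Λ hk
    rw [map_sum, map_zero] at h'
    exact h'
  have h2 : diagEquiv n Λ.symm (diagEquiv n Λ k) = k := by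
    ext q
    exact congrFun (Λ.symm_apply_apply (slot k q.1)) q.2
  have h0 : mink v 0 = 0 := by simp [mink]
  rw [minkFourier_poincare hΛ, h, h0, h2]
  simp

end Poincare

/-! ### Decay of Fourier transforms in terms of the Schwartz norms -/

section Decay

variable {s n : ℕ}

/-- The partial derivative in the coordinate `q`. -/
def coordDeriv (q : Fin n × Fin (s + 1)) (f : 𝓢(Cfg s n, ℂ)) : 𝓢(Cfg s n, ℂ) :=
  ∂_{(EuclideanSpace.single q (1 : ℝ) : Cfg s n)} f

/-- Multiplication by the coordinate `q`. -/
def coordMul (q : Fin n × Fin (s + 1)) : 𝓢(Cfg s n, ℂ) →L[ℝ] 𝓢(Cfg s n, ℂ) :=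
  SchwartzMap.smulLeftCLM ℂ fun x : Cfg s n => x q

theorem coordMul_apply (q : Fin n × Fin (s + 1)) (f : 𝓢(Cfg s n, ℂ)) (x : Cfg s n) :
    coordMul q f x = (x q : ℂ) * f x := by
  rw [coordMul, SchwartzMap.smulLeftCLM_apply_apply (coord_hasTemperateGrowth q),
    Complex.real_smul]

theorem coordDeriv_coordMul (q r : Fin n × Fin (s + 1)) (f : 𝓢(Cfg s n, ℂ)) :
    coordDeriv r (coordMul q f) = coordMul q (coordDeriv r f) + if r = q then f else 0 := by
  ext x
  have h1 : HasFDerivAt (fun x : Cfg s n => ((x q : ℝ) : ℂ))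
      (Complex.ofRealCLM ∘L (EuclideanSpace.proj (𝕜 := ℝ) q : Cfg s n →L[ℝ] ℝ)) x :=
    (Complex.ofRealCLM ∘L (EuclideanSpace.proj (𝕜 := ℝ) q : Cfg s n →L[ℝ] ℝ)).hasFDerivAt
  have h2 : HasFDerivAt (fun x : Cfg s n => ((x q : ℝ) : ℂ) * f x) _ x :=
    h1.mul (f.differentiable x).hasFDerivAt
  have h3 : ⇑(coordMul q f) = fun x => ((x q : ℝ) : ℂ) * f x := funext (coordMul_apply q f)
  rw [coordDeriv, SchwartzMap.lineDerivOp_apply_eq_fderiv, h3, HasFDerivAt.fderiv h2, add_apply, add_apply,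
    coordMul_apply, coordDeriv, SchwartzMap.lineDerivOp_apply_eq_fderiv]
  by_cases h : r = q
  · subst h
    simp
  · simp [h, Ne.symm h]

theorem diagEquiv_dualScale_single (q : Fin n × Fin (s + 1)) :
    diagEquiv n dualScale (EuclideanSpace.single q (1 : ℝ)) =
      ((if q.2 = 0 then 1 else -1) * (2 * Real.pi)⁻¹) • EuclideanSpace.single q (1 : ℝ) := by
  ext ⟨l, μ⟩
  change (if μ = 0 then (2 * Real.pi)⁻¹ * (EuclideanSpace.single q (1 : ℝ) : Cfg s n) (l, μ) else
    -((2 * Real.pi)⁻¹ * (EuclideanSpace.single q (1 : ℝ) : Cfg s n) (l, μ))) = _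
  rw [PiLp.smul_apply, smul_eq_mul]
  by_cases h : (l, μ) = q
  · subst h
    split_ifs <;> simp
  · simp [h]

theorem inner_single_one (x : Cfg s n) (q : Fin n × Fin (s + 1)) :
    inner ℝ x (EuclideanSpace.single q (1 : ℝ)) = x q := by
  rw [EuclideanSpace.inner_single_right]
  simp

/-- The sign of the coordinate `q` in the Minkowski product. -/
def minkSign (q : Fin n × Fin (s + 1)) : ℝ := if q.2 = 0 then 1 else -1

theorem minkSign_mul_self (q : Fin n × Fin (s + 1)) : minkSign q * minkSign q = 1 := by
  rw [minkSign]
  split_ifs <;> norm_num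

theorem minkFourier_coordDeriv (q : Fin n × Fin (s + 1)) (f : 𝓢(Cfg s n, ℂ)) (k : Cfg s n) :
    minkFourier s n (coordDeriv q f) k =
      Complex.I * minkSign q * k q * minkFourier s n f k := by
  have h : ∀ g : 𝓢(Cfg s n, ℂ), minkFourier s n g k =
      (((2 * Real.pi) ^ (-(((s + 1) * n : ℕ) : ℝ) / 2) : ℝ) : ℂ) *
        (𝓕 g : 𝓢(Cfg s n, ℂ)) (diagEquiv n dualScale k) := fun g => rfl
  have hk : (diagEquiv n dualScale k) q = minkSign q * (2 * Real.pi)⁻¹ * k q := by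
    change (if q.2 = 0 then (2 * Real.pi)⁻¹ * k q else -((2 * Real.pi)⁻¹ * k q)) = _
    rw [minkSign]
    split_ifs <;> ring
  have hg : (inner ℝ · (EuclideanSpace.single q (1 : ℝ)) : Cfg s n → ℝ).HasTemperateGrowth := by
    fun_prop
  rw [h, h, coordDeriv, SchwartzMap.fourier_lineDerivOp_eq, smul_apply,
    SchwartzMap.smulLeftCLM_apply_apply hg, inner_single_one, hk, smul_eq_mul, Complex.real_smul]
  have hpi : (Real.pi : ℂ) ≠ 0 := Complex.ofReal_ne_zero.2 Real.pi_ne_zero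
  push_cast
  field_simp

theorem coordDeriv_minkFourier (q : Fin n × Fin (s + 1)) (f : 𝓢(Cfg s n, ℂ)) (k : Cfg s n) :
    coordDeriv q (minkFourier s n f) k =
      -(Complex.I * minkSign q) * minkFourier s n (coordMul q f) k := by
  have h0 : ∀ g : 𝓢(Cfg s n, ℂ), minkFourier s n g =
      (((2 * Real.pi) ^ (-(((s + 1) * n : ℕ) : ℝ) / 2) : ℝ) : ℂ) •
        SchwartzMap.compCLMOfContinuousLinearEquiv ℂ (diagEquiv n dualScale) (𝓕 g) := fun g => rfl
  have hpi : (Real.pi : ℂ) ≠ 0 := Complex.ofReal_ne_zero.2 Real.pi_ne_zero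
  have hmul : SchwartzMap.smulLeftCLM ℂ
      (inner ℝ · (EuclideanSpace.single q (1 : ℝ)) : Cfg s n → ℝ) f = coordMul q f := by
    simp only [inner_single_one]
    rfl
  rw [coordDeriv, h0, h0, LineDeriv.lineDerivOp_smul,
    SchwartzMap.lineDerivOp_compCLMOfContinuousLinearEquiv, diagEquiv_dualScale_single,
    LineDeriv.lineDerivOp_left_smul, SchwartzMap.lineDerivOp_fourier_eq, hmul]
  simp only [smul_apply, SchwartzMap.compCLMOfContinuousLinearEquiv_apply, Function.comp_apply,
    FourierTransform.fourier_smul, smul_eq_mul, Complex.real_smul, minkSign]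
  push_cast
  field_simp
  
/-- The Fourier transform turns `1 - Δ` in the `l`-th argument into `1 + |k_l|²`. -/
theorem one_add_sum_sq_mul_minkFourier (l : Fin n) (f : 𝓢(Cfg s n, ℂ)) (k : Cfg s n) :
    ((1 + ∑ μ, k (l, μ) ^ 2 : ℝ) : ℂ) * minkFourier s n f k =
      minkFourier s n f k - ∑ μ, minkFourier s n (coordDeriv (l, μ) (coordDeriv (l, μ) f)) k := by
  have h : ∀ μ, minkFourier s n (coordDeriv (l, μ) (coordDeriv (l, μ) f)) k =
      -((k (l, μ) ^ 2 : ℝ) : ℂ) * minkFourier s n f k := fun μ => by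
    rw [minkFourier_coordDeriv, minkFourier_coordDeriv]
    have h1 : ((minkSign (l, μ) : ℝ) : ℂ) * minkSign (s := s) (l, μ) = 1 := by
      rw [← Complex.ofReal_mul, minkSign_mul_self, Complex.ofReal_one]
    push_cast
    linear_combination ((k (l, μ)) ^ 2 * minkFourier s n f k * Complex.I * Complex.I) * h1 +
      ((k (l, μ)) ^ 2 * minkFourier s n f k) * Complex.I_mul_I
  simp only [h]
  rw [← Finset.sum_mul, Finset.sum_neg_distrib]
  push_cast
  ring

/-- The iterated partial derivative in the coordinates `c 0, c 1, …`. -/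
def coordDerivs {r : ℕ} (c : Fin r → Fin n × Fin (s + 1)) (f : 𝓢(Cfg s n, ℂ)) : 𝓢(Cfg s n, ℂ) :=
  ∂^{fun i => (EuclideanSpace.single (c i) (1 : ℝ) : Cfg s n)} f

theorem coordDeriv_coordDerivs {r : ℕ} (q : Fin n × Fin (s + 1))
    (c : Fin r → Fin n × Fin (s + 1)) (f : 𝓢(Cfg s n, ℂ)) :
    coordDeriv q (coordDerivs c f) = coordDerivs (Fin.cons q c : Fin (r + 1) → _) f := by
  rw [coordDerivs, coordDerivs, LineDeriv.iteratedLineDerivOp_succ_left]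
  rfl

/-- The order of the derivative `c` in the `l`-th argument. -/
def derivOrder {r : ℕ} (c : Fin r → Fin n × Fin (s + 1)) (l : Fin n) : ℕ :=
  (Finset.univ.filter fun i => (c i).1 = l).card

theorem derivOrder_cons {r : ℕ} (q : Fin n × Fin (s + 1)) (c : Fin r → Fin n × Fin (s + 1))
    (l : Fin n) : derivOrder (Fin.cons q c : Fin (r + 1) → _) l =
      derivOrder c l + if q.1 = l then 1 else 0 := by
  rw [derivOrder, Fin.card_filter_univ_succ, derivOrder]
  simp only [Fin.cons_zero, Fin.cons_succ]
  split_ifs <;> rfl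

theorem le_of_derivOrder_le {r K : ℕ} {c : Fin r → Fin n × Fin (s + 1)}
    (h : ∀ l, derivOrder c l ≤ K) : r ≤ n * K := by
  have h1 := Finset.card_eq_sum_card_fiberwise (s := (Finset.univ : Finset (Fin r)))
    (t := (Finset.univ : Finset (Fin n))) (f := fun i => (c i).1) fun _ _ => Finset.mem_univ _
  rw [Finset.card_univ, Fintype.card_fin] at h1
  rw [h1]
  refine (Finset.sum_le_card_nsmul _ _ K fun l _ => h l).trans ?_
  simp

theorem weight_mul_coordDerivs_le {r K : ℕ} (L : ℕ) {c : Fin r → Fin n × Fin (s + 1)}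
    (h : ∀ l, derivOrder c l ≤ K) (f : 𝓢(Cfg s n, ℂ)) (x : Cfg s n) :
    weight L x * ‖coordDerivs c f x‖ ≤ schwartzNorm s n K L f := by
  have hr : r < n * K + 1 := Nat.lt_succ_of_le (le_of_derivOrder_le h)
  have hmem : (⟨⟨r, hr⟩, c⟩ : Σ r : Fin (n * K + 1), Fin r → Fin n × Fin (s + 1)) ∈
      derivIndices s n K := Finset.mem_filter.2 ⟨Finset.mem_univ _, h⟩
  refine le_trans ?_ (Seminorm.le_finset_sup_apply
    (p := fun c : Σ r : Fin (n * K + 1), Fin r → Fin n × Fin (s + 1) =>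
      derivSeminorm s n L c.2) hmem)
  have h1 := BoundedContinuousFunction.norm_coe_le_norm
    (SchwartzMap.toBoundedContinuousFunctionCLM ℂ (Cfg s n) ℂ
      (SchwartzMap.smulLeftCLM ℂ (fun x : Cfg s n => (weight L x : ℂ)) (coordDerivs c f))) x
  refine le_trans (le_of_eq ?_) h1
  rw [SchwartzMap.toBoundedContinuousFunctionCLM_apply,
    SchwartzMap.smulLeftCLM_apply_apply (weight_hasTemperateGrowth L), smul_eq_mul, norm_mul,
    Complex.norm_real, Real.norm_of_nonneg (weight_pos L x).le]

theorem prod_one_add_sq_le_weight (x : Cfg s n) :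
    ∏ q, (1 + x q ^ 2) ≤ weight (2 * (s + 1)) x := by
  rw [Fintype.prod_prod_type, weight]
  refine Finset.prod_le_prod (fun l _ => Finset.prod_nonneg fun μ _ => by positivity)
    fun l _ => ?_
  have h : (((2 * (s + 1) : ℕ) : ℝ) / 2) = ((s + 1 : ℕ) : ℝ) := by
    push_cast
    ring
  rw [h, Real.rpow_natCast]
  calc ∏ μ, (1 + x (l, μ) ^ 2) ≤ ∏ _μ : Fin (s + 1), (1 + ∑ ν, x (l, ν) ^ 2) := by
        refine Finset.prod_le_prod (fun μ _ => by positivity) fun μ _ => ?_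
        have := Finset.single_le_sum (f := fun ν => x (l, ν) ^ 2) (fun ν _ => sq_nonneg _)
          (Finset.mem_univ μ)
        linarith
    _ = _ := by simp

theorem integrable_prod_one_add_sq_inv (s n : ℕ) :
    Integrable fun x : Cfg s n => (∏ q, (1 + x q ^ 2))⁻¹ := by
  have h := Integrable.fintype_prod (ι := Fin n × Fin (s + 1)) (μ := fun _ => (volume : Measure ℝ))
    (f := fun _ x => (1 + x ^ 2)⁻¹) fun _ => integrable_inv_one_add_sq
  have h2 := ((PiLp.volume_preserving_ofLp (Fin n × Fin (s + 1))).integrable_comp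
    h.aestronglyMeasurable).2 h
  refine h2.congr (Eventually.of_forall fun x => ?_)
  simp

/-- A bound for the supremum of the Fourier transform. -/
theorem exists_norm_minkFourier_le (s n : ℕ) : ∃ C : ℝ, 0 ≤ C ∧ ∀ (g : 𝓢(Cfg s n, ℂ)) (B : ℝ),
    (∀ x, weight (2 * (s + 1)) x * ‖g x‖ ≤ B) → ∀ k, ‖minkFourier s n g k‖ ≤ C * B := by
  refine ⟨(2 * Real.pi) ^ (-(((s + 1) * n : ℕ) : ℝ) / 2) * ∫ x : Cfg s n,
    (∏ q, (1 + x q ^ 2))⁻¹, ?_, fun g B hB k => ?_⟩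
  · refine mul_nonneg (by positivity) (integral_nonneg fun x => ?_)
    exact inv_nonneg.2 (Finset.prod_nonneg fun q _ => by positivity)
  · have hpi : (0 : ℝ) ≤ (2 * Real.pi) ^ (-(((s + 1) * n : ℕ) : ℝ) / 2) := by positivity
    rw [minkFourier_apply, norm_mul, Complex.norm_real, Real.norm_of_nonneg hpi, mul_assoc,
      ← integral_mul_const]
    refine mul_le_mul_of_nonneg_left ?_ hpi
    refine norm_integral_le_of_norm_le ((integrable_prod_one_add_sq_inv s n).mul_const B)
      (Eventually.of_forall fun x => ?_)
    have h1 : ‖Complex.exp (-Complex.I * ((∑ l, mink (slot x l) (slot k l) : ℝ) : ℂ))‖ = 1 := by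
      rw [Complex.norm_exp]
      simp
    have h0 : 0 < ∏ q, (1 + x q ^ 2) := Finset.prod_pos fun q _ => by positivity
    rw [norm_mul, h1, one_mul, le_inv_mul_iff₀ h0]
    exact (mul_le_mul_of_nonneg_right (prod_one_add_sq_le_weight x) (norm_nonneg _)).trans (hB x)

end Decay

section DecayFourier

variable {s n : ℕ}

theorem norm_coord_le_sqrt (x : Cfg s n) (q : Fin n × Fin (s + 1)) :
    |x q| ≤ √(1 + ∑ μ, x (q.1, μ) ^ 2) := by
  refine Real.le_sqrt_of_sq_le ?_
  rw [sq_abs]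
  have h := Finset.single_le_sum (f := fun μ => x (q.1, μ) ^ 2) (fun _ _ => sq_nonneg _)
    (Finset.mem_univ q.2)
  have : x q ^ 2 = x (q.1, q.2) ^ 2 := rfl
  linarith

theorem norm_coord_le_weight_one (x : Cfg s n) (q : Fin n × Fin (s + 1)) :
    |x q| ≤ weight 1 x := by
  refine (norm_coord_le_sqrt x q).trans ?_
  have h := rpow_le_weight 1 x q.1
  rwa [Nat.cast_one, ← Real.sqrt_eq_rpow] at h

/-- The polynomial `∏ (1 + |k_l|²)` over a multiset of arguments. -/
def multiWeight (S : Multiset (Fin n)) (k : Cfg s n) : ℝ :=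
  (S.map fun l => 1 + ∑ μ, k (l, μ) ^ 2).prod

theorem multiWeight_cons (l : Fin n) (S : Multiset (Fin n)) (k : Cfg s n) :
    multiWeight (l ::ₘ S) k = (1 + ∑ μ, k (l, μ) ^ 2) * multiWeight S k := by
  rw [multiWeight, Multiset.map_cons, Multiset.prod_cons, multiWeight]

theorem multiWeight_nonneg (S : Multiset (Fin n)) (k : Cfg s n) : 0 ≤ multiWeight S k := by
  induction S using Multiset.induction_on with
  | empty => simp [multiWeight]
  | cons l S ih =>
    rw [multiWeight_cons]
    have h : 0 ≤ ∑ μ, k (l, μ) ^ 2 := Finset.sum_nonneg fun _ _ => sq_nonneg _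
    exact mul_nonneg (by linarith) ih

theorem multiWeight_nsmul_univ (N : ℕ) (k : Cfg s n) :
    multiWeight (N • (Finset.univ : Finset (Fin n)).val) k = weight (2 * N) k := by
  rw [multiWeight, Multiset.map_nsmul, Multiset.prod_nsmul, weight, ← Finset.prod_eq_multiset_prod,
    ← Finset.prod_pow]
  refine Finset.prod_congr rfl fun l _ => ?_
  have h : (((2 * N : ℕ) : ℝ) / 2) = (N : ℝ) := by
    push_cast
    ring
  rw [h, Real.rpow_natCast]

theorem multiWeight_cons_mul_norm (l : Fin n) (S : Multiset (Fin n)) (g : 𝓢(Cfg s n, ℂ))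
    (k : Cfg s n) : multiWeight (l ::ₘ S) k * ‖minkFourier s n g k‖ ≤
      multiWeight S k * ‖minkFourier s n g k‖ +
        ∑ μ, multiWeight S k * ‖minkFourier s n (coordDeriv (l, μ) (coordDeriv (l, μ) g)) k‖ := by
  have h0 : 0 ≤ ∑ μ, k (l, μ) ^ 2 := Finset.sum_nonneg fun _ _ => sq_nonneg _
  have h1 := congrArg norm (one_add_sum_sq_mul_minkFourier l g k)
  rw [norm_mul, Complex.norm_real, Real.norm_of_nonneg (by linarith)] at h1
  rw [multiWeight_cons, mul_comm (1 + _), mul_assoc, h1, ← Finset.mul_sum, ← mul_add]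
  exact mul_le_mul_of_nonneg_left ((norm_sub_le _ _).trans
    (add_le_add_right (norm_sum_le _ _) _)) (multiWeight_nonneg S k)

theorem derivOrder_double_add {r K : ℕ} {c : Fin r → Fin n × Fin (s + 1)} {l : Fin n}
    {S : Multiset (Fin n)} (h : ∀ i, derivOrder c i + 2 * (l ::ₘ S).count i ≤ K) :
    (∀ i, derivOrder c i + 2 * S.count i ≤ K) ∧
    (∀ μ i, derivOrder (Fin.cons (l, μ) c : Fin (r + 1) → Fin n × Fin (s + 1)) i +
      2 * S.count i ≤ K) ∧
    (∀ μ i, derivOrder (Fin.cons (l, μ) (Fin.cons (l, μ) c : Fin (r + 1) → Fin n × Fin (s + 1)) :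
      Fin (r + 2) → Fin n × Fin (s + 1)) i + 2 * S.count i ≤ K) := by
  have h' : ∀ i, derivOrder c i + 2 * (S.count i + if l = i then 1 else 0) ≤ K := fun i => by
    have := h i
    rw [Multiset.count_cons] at this
    simp only [@eq_comm _ i l] at this
    exact this
  simp only [derivOrder_cons]
  refine ⟨fun i => ?_, fun μ i => ?_, fun μ i => ?_⟩ <;> have h2 := h' i <;>
    split_ifs at h2 ⊢ <;> omega

/-- Weighted bounds for Fourier transforms and for their first derivatives, by induction on the
number of factors `1 + |k_l|²`. -/
theorem exists_multiWeight_bound (s n : ℕ) : ∃ C : ℝ, 0 ≤ C ∧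
    ∀ (f : 𝓢(Cfg s n, ℂ)) (K : ℕ) (B : ℝ), (∀ (r : ℕ) (c : Fin r → Fin n × Fin (s + 1)),
      (∀ l, derivOrder c l ≤ K) →
        ∀ x, weight (2 * (s + 1) + 1) x * ‖coordDerivs c f x‖ ≤ B) →
    ∀ (S : Multiset (Fin n)) (r : ℕ) (c : Fin r → Fin n × Fin (s + 1)),
      (∀ l, derivOrder c l + 2 * S.count l ≤ K) → ∀ k,
        multiWeight S k * ‖minkFourier s n (coordDerivs c f) k‖ ≤
          C * B * (3 * (s + 1) + 1) ^ S.card ∧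
        ∀ q, multiWeight S k * ‖minkFourier s n (coordMul q (coordDerivs c f)) k‖ ≤
          C * B * (3 * (s + 1) + 1) ^ S.card := by
  obtain ⟨C, hC0, hC⟩ := exists_norm_minkFourier_le s n
  refine ⟨C, hC0, fun f K B hB S => ?_⟩
  induction S using Multiset.induction_on with
  | empty =>
    intro r c hc k
    have hb : ∀ x, weight (2 * (s + 1) + 1) x * ‖coordDerivs c f x‖ ≤ B :=
      hB r c fun l => by simpa using hc l
    have h1 : multiWeight (0 : Multiset (Fin n)) k = 1 := by simp [multiWeight]
    rw [h1, one_mul, Multiset.card_zero, pow_zero, mul_one]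
    refine ⟨hC _ _ (fun x => ?_) k, fun q => ?_⟩
    · exact (mul_le_mul_of_nonneg_right (weight_mono (by omega) x) (norm_nonneg _)).trans (hb x)
    · rw [one_mul]
      refine hC _ _ (fun x => ?_) k
      refine le_trans ?_ (hb x)
      rw [coordMul_apply, norm_mul, Complex.norm_real, Real.norm_eq_abs, weight_add, mul_assoc]
      exact mul_le_mul_of_nonneg_left (mul_le_mul_of_nonneg_right (norm_coord_le_weight_one x q)
        (norm_nonneg _)) (weight_pos _ x).le
  | cons l S ih =>
    intro r c hc k
    obtain ⟨h0, h1, h2⟩ := derivOrder_double_add hc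
    set D : ℝ := C * B * (3 * (s + 1) + 1) ^ S.card with hD
    have hb0 := ih r c h0 k
    have hb1 := fun μ => (ih _ _ (h1 μ) k).1
    have hb2 := fun μ => ih _ _ (h2 μ) k
    simp only [← coordDeriv_coordDerivs] at hb1 hb2
    have hD0 : 0 ≤ D := (mul_nonneg (multiWeight_nonneg S k) (norm_nonneg _)).trans hb0.1
    have hcard : C * B * (3 * (s + 1) + 1) ^ (l ::ₘ S).card = D * (3 * (s + 1) + 1) := by
      rw [Multiset.card_cons, pow_succ, hD]
      ring
    rw [hcard]
    constructor
    · refine (multiWeight_cons_mul_norm l S _ k).trans ?_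
      have h3 := Finset.sum_le_card_nsmul Finset.univ _ D fun μ _ => (hb2 μ).1
      rw [Finset.card_univ, Fintype.card_fin, nsmul_eq_mul] at h3
      push_cast at h3
      have : 0 ≤ D * (2 * (s + 1)) := by positivity
      linarith [hb0.1]
    · intro q
      refine (multiWeight_cons_mul_norm l S _ k).trans ?_
      have h4 : ∀ μ, multiWeight S k * ‖minkFourier s n (coordDeriv (l, μ) (coordDeriv (l, μ)
          (coordMul q (coordDerivs c f)))) k‖ ≤ 3 * D := fun μ => by
        have e : minkFourier s n (coordDeriv (l, μ) (coordDeriv (l, μ)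
            (coordMul q (coordDerivs c f)))) k =
            minkFourier s n (coordMul q (coordDeriv (l, μ) (coordDeriv (l, μ)
              (coordDerivs c f)))) k +
            (if (l, μ) = q then 2 else 0) *
              minkFourier s n (coordDeriv (l, μ) (coordDerivs c f)) k := by
          have hadd : ∀ g h : 𝓢(Cfg s n, ℂ), coordDeriv (l, μ) (g + h) =
              coordDeriv (l, μ) g + coordDeriv (l, μ) h := fun g h =>
            LineDeriv.lineDerivOp_add _ g h
          rw [coordDeriv_coordMul, hadd, coordDeriv_coordMul]
          split_ifs
          · rw [map_add, map_add, add_apply, add_apply]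
            ring
          · have hz : coordDeriv (l, μ) (0 : 𝓢(Cfg s n, ℂ)) = 0 := LineDeriv.lineDerivOp_zero _
            rw [hz, add_zero, add_zero, zero_mul, add_zero]
        have h5 : ‖(if (l, μ) = q then 2 else 0 : ℂ)‖ ≤ 2 := by split_ifs <;> simp
        rw [e]
        calc _ ≤ multiWeight S k * (‖minkFourier s n (coordMul q (coordDeriv (l, μ)
              (coordDeriv (l, μ) (coordDerivs c f)))) k‖ +
              2 * ‖minkFourier s n (coordDeriv (l, μ) (coordDerivs c f)) k‖) := by
              refine mul_le_mul_of_nonneg_left ?_ (multiWeight_nonneg S k)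
              refine (norm_add_le _ _).trans (add_le_add_right ?_ _)
              rw [norm_mul]
              exact mul_le_mul_of_nonneg_right h5 (norm_nonneg _)
          _ ≤ _ := by linarith [(hb2 μ).2 q, hb1 μ]
      have h3 := Finset.sum_le_card_nsmul Finset.univ _ (3 * D) fun μ _ => h4 μ
      rw [Finset.card_univ, Fintype.card_fin, nsmul_eq_mul] at h3
      push_cast at h3
      linarith [hb0.2 q]

theorem norm_fderiv_le_sum (F : Cfg s n → ℂ) (k : Cfg s n) :
    ‖fderiv ℝ F k‖ ≤ ∑ q, ‖fderiv ℝ F k (EuclideanSpace.single q (1 : ℝ))‖ := by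
  refine ContinuousLinearMap.opNorm_le_bound _ (Finset.sum_nonneg fun _ _ => norm_nonneg _)
    fun v => ?_
  have hv : v = ∑ q, v q • (EuclideanSpace.single q (1 : ℝ) : Cfg s n) := by
    ext q
    simp [Finset.sum_apply, Pi.single_apply]
  conv_lhs => rw [hv]
  rw [map_sum, Finset.sum_mul]
  refine (norm_sum_le _ _).trans (Finset.sum_le_sum fun q _ => ?_)
  rw [map_smul, norm_smul, mul_comm]
  exact mul_le_mul_of_nonneg_left (PiLp.norm_apply_le v q) (norm_nonneg _)

/-- The orders of the Schwartz norms which control the Fourier transform with a given weight do not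
depend on the number of arguments. -/
theorem exists_hasDecay_minkFourier (s n N : ℕ) : ∃ C : ℝ, 0 ≤ C ∧ ∀ f : 𝓢(Cfg s n, ℂ),
    HasDecay (2 * N) (C * schwartzNorm s n (2 * N) (2 * (s + 1) + 1) f) (minkFourier s n f) := by
  obtain ⟨C, hC0, hC⟩ := exists_multiWeight_bound s n
  set S : Multiset (Fin n) := N • (Finset.univ : Finset (Fin n)).val with hS
  set D : ℝ := C * (3 * (s + 1) + 1) ^ S.card with hD
  have hD0 : 0 ≤ D := by positivity
  have hcard : ((n * (s + 1) : ℕ) : ℝ) * D ≥ 0 := by positivity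
  refine ⟨((n * (s + 1) : ℕ) + 1) * D, by positivity, fun f => ?_⟩
  set B := schwartzNorm s n (2 * N) (2 * (s + 1) + 1) f with hB
  have hB0 : 0 ≤ B := apply_nonneg _ _
  have h := fun k => hC f (2 * N) B
    (fun r c hc x => weight_mul_coordDerivs_le (2 * (s + 1) + 1) hc f x) S 0 Fin.elim0
    (fun l => by
      rw [hS, Multiset.count_nsmul, Multiset.count_univ]
      simp [derivOrder]) k
  have h0 : coordDerivs Fin.elim0 f = f := LineDeriv.iteratedLineDerivOp_fin_zero _ _
  simp only [h0, hS, multiWeight_nsmul_univ] at h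
  simp only [← hS] at h
  have hDB : C * B * (3 * (s + 1) + 1) ^ S.card = D * B := by
    rw [hD]
    ring
  rw [hDB] at h
  have hcB : 0 ≤ ((n * (s + 1) : ℕ) : ℝ) * D * B := mul_nonneg hcard hB0
  have hDB0 : 0 ≤ D * B := mul_nonneg hD0 hB0
  refine ⟨(minkFourier s n f).differentiable, fun k => ?_, fun k => ?_⟩
  · linarith [(h k).1]
  · have h1 := mul_le_mul_of_nonneg_left (norm_fderiv_le_sum (minkFourier s n f) k)
      (weight_pos (2 * N) k).le
    refine h1.trans ?_
    rw [Finset.mul_sum]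
    refine (Finset.sum_le_card_nsmul _ _ (D * B) fun q _ => ?_).trans ?_
    · have h2 : fderiv ℝ (minkFourier s n f) k (EuclideanSpace.single q (1 : ℝ)) =
          coordDeriv q (minkFourier s n f) k := rfl
      rw [h2, coordDeriv_minkFourier, norm_mul]
      have h3 : ‖-(Complex.I * minkSign q)‖ = 1 := by
        rw [norm_neg, norm_mul, Complex.norm_I, one_mul, Complex.norm_real, minkSign]
        split_ifs <;> simp
      rw [h3, one_mul]
      exact (h k).2 q
    · rw [Finset.card_univ, Fintype.card_prod, Fintype.card_fin, Fintype.card_fin, nsmul_eq_mul]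
      linarith

end DecayFourier

/-! ### Transfer functions -/

section Transfer

variable {s n : ℕ}

theorem prod_pow_le_weight {D : ℕ} {e : Fin n × Fin (s + 1) →₀ ℕ}
    (he : ∀ l, ∑ μ, e (l, μ) ≤ D) (k : Cfg s n) : ∏ q, |k q| ^ e q ≤ weight D k := by
  rw [Fintype.prod_prod_type, weight]
  refine Finset.prod_le_prod (fun l _ => Finset.prod_nonneg fun μ _ => by positivity)
    fun l _ => ?_
  have h0 : 0 ≤ ∑ μ, k (l, μ) ^ 2 := Finset.sum_nonneg fun _ _ => sq_nonneg _
  have h1 : 1 ≤ √(1 + ∑ μ, k (l, μ) ^ 2) := Real.one_le_sqrt.2 (by linarith)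
  have h2 : (1 + ∑ μ, k (l, μ) ^ 2) ^ ((D : ℝ) / 2) = √(1 + ∑ μ, k (l, μ) ^ 2) ^ D := by
    rw [Real.sqrt_eq_rpow, ← Real.rpow_natCast, ← Real.rpow_mul (by linarith)]
    congr 1
    ring
  rw [h2]
  calc ∏ μ, |k (l, μ)| ^ e (l, μ) ≤ ∏ μ, √(1 + ∑ μ, k (l, μ) ^ 2) ^ e (l, μ) :=
        Finset.prod_le_prod (fun μ _ => by positivity) fun μ _ =>
          pow_le_pow_left₀ (abs_nonneg _) (norm_coord_le_sqrt k (l, μ)) _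
    _ = √(1 + ∑ μ, k (l, μ) ^ 2) ^ ∑ μ, e (l, μ) := Finset.prod_pow_eq_pow_sum _ _ _
    _ ≤ _ := pow_le_pow_right₀ h1 (he l)

theorem norm_polyFun_monomial_le {D : ℕ} {e : Fin n × Fin (s + 1) →₀ ℕ}
    (he : ∀ l, ∑ μ, e (l, μ) ≤ D) (a : ℝ) (k : Cfg s n) :
    ‖polyFun (MvPolynomial.monomial e a) k‖ ≤ |a| * weight D k := by
  rw [polyFun, MvPolynomial.eval_monomial, Complex.norm_real, norm_mul, Real.norm_eq_abs,
    Finsupp.prod_fintype _ _ (fun _ => pow_zero _), Real.norm_eq_abs, Finset.abs_prod]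
  simp only [abs_pow]
  exact mul_le_mul_of_nonneg_left (prod_pow_le_weight he k) (abs_nonneg a)

theorem polyFun_sum {ι : Type*} (S : Finset ι) (P : ι → MvPolynomial (Fin n × Fin (s + 1)) ℝ)
    (k : Cfg s n) : polyFun (∑ i ∈ S, P i) k = ∑ i ∈ S, polyFun (P i) k := by
  simp only [polyFun, map_sum, Complex.ofReal_sum]

theorem fderiv_polyFun (P : MvPolynomial (Fin n × Fin (s + 1)) ℝ) (k : Cfg s n)
    (q : Fin n × Fin (s + 1)) :
    fderiv ℝ (polyFun P) k (EuclideanSpace.single q (1 : ℝ)) =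
      polyFun (MvPolynomial.pderiv q P) k := by
  have hd : ∀ P : MvPolynomial (Fin n × Fin (s + 1)) ℝ, DifferentiableAt ℝ (polyFun P) k :=
    fun P => (polyFun_hasTemperateGrowth P).1.differentiable (by simp) k
  induction P using MvPolynomial.induction_on with
  | C a =>
    have h : polyFun (s := s) (n := n) (MvPolynomial.C a) = fun _ => (a : ℂ) := by
      funext k
      rw [polyFun, MvPolynomial.eval_C]
    rw [h, MvPolynomial.pderiv_C, polyFun]
    simp
  | add P Q hP hQ =>
    have h : polyFun (P + Q) = fun k : Cfg s n => polyFun P k + polyFun Q k := by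
      funext k
      simp only [polyFun, map_add, Complex.ofReal_add]
    have h2 := congrFun h
    rw [h, fderiv_fun_add (hd P) (hd Q), add_apply, hP, hQ, map_add]
    simp only [polyFun, map_add, Complex.ofReal_add]
  | mul_X P r hP =>
    have h : polyFun (P * MvPolynomial.X r) = fun k : Cfg s n => polyFun P k * ((k r : ℝ) : ℂ) := by
      funext k
      simp only [polyFun, map_mul, MvPolynomial.eval_X, Complex.ofReal_mul]
    have h1 : HasFDerivAt (fun x : Cfg s n => ((x r : ℝ) : ℂ))
        (Complex.ofRealCLM ∘L (EuclideanSpace.proj (𝕜 := ℝ) r : Cfg s n →L[ℝ] ℝ)) k :=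
      (Complex.ofRealCLM ∘L (EuclideanSpace.proj (𝕜 := ℝ) r : Cfg s n →L[ℝ] ℝ)).hasFDerivAt
    have h2 : HasFDerivAt (fun k : Cfg s n => polyFun P k * ((k r : ℝ) : ℂ)) _ k :=
      (hd P).hasFDerivAt.mul h1
    rw [h, HasFDerivAt.fderiv h2, add_apply, smul_apply, smul_apply, hP, MvPolynomial.pderiv_mul,
      MvPolynomial.pderiv_X]
    simp only [polyFun, map_add, map_mul, MvPolynomial.eval_X]
    by_cases hq : q = r
    · subst hq
      simp
      ring
    · simp [Ne.symm hq]
      ring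

/-- Polynomials of bounded degree in each argument are multipliers between weighted spaces. -/
theorem exists_polyFun_bound {D : ℕ} {P : MvPolynomial (Fin n × Fin (s + 1)) ℝ}
    (hP : ∀ l, ∀ e ∈ P.support, ∑ μ, e (l, μ) ≤ D) : ∃ C : ℝ, ∀ k : Cfg s n,
      ‖polyFun P k‖ ≤ C * weight D k ∧ ‖fderiv ℝ (polyFun P) k‖ ≤ C * weight D k := by
  have hsum := P.support_sum_monomial_coeff
  have h1 : ∀ k : Cfg s n, ‖polyFun P k‖ ≤ (∑ e ∈ P.support, |P.coeff e|) * weight D k := fun k => by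
    conv_lhs => rw [← hsum]
    rw [polyFun_sum, Finset.sum_mul]
    exact (norm_sum_le _ _).trans (Finset.sum_le_sum fun e he =>
      norm_polyFun_monomial_le (fun l => hP l e he) _ k)
  have h2 : ∀ (k : Cfg s n) q, ‖polyFun (MvPolynomial.pderiv q P) k‖ ≤
      (∑ e ∈ P.support, |P.coeff e * e q|) * weight D k := fun k q => by
    conv_lhs => rw [← hsum]
    rw [map_sum, polyFun_sum, Finset.sum_mul]
    refine (norm_sum_le _ _).trans (Finset.sum_le_sum fun e he => ?_)
    rw [MvPolynomial.pderiv_monomial]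
    refine norm_polyFun_monomial_le (fun l => le_trans (Finset.sum_le_sum fun μ _ => ?_)
      (hP l e he)) _ k
    rw [Finsupp.tsub_apply]
    exact Nat.sub_le _ _
  have hC1 : 0 ≤ ∑ e ∈ P.support, |P.coeff e| := Finset.sum_nonneg fun _ _ => abs_nonneg _
  have hC2 : 0 ≤ ∑ q, ∑ e ∈ P.support, |P.coeff e * e q| :=
    Finset.sum_nonneg fun _ _ => Finset.sum_nonneg fun _ _ => abs_nonneg _
  refine ⟨(∑ e ∈ P.support, |P.coeff e|) + ∑ q, ∑ e ∈ P.support, |P.coeff e * e q|,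
    fun k => ⟨(h1 k).trans ?_, (norm_fderiv_le_sum _ k).trans ?_⟩⟩
  · exact mul_le_mul_of_nonneg_right (by linarith) (weight_pos D k).le
  · simp only [fderiv_polyFun]
    refine (Finset.sum_le_sum fun q _ => h2 k q).trans ?_
    rw [← Finset.sum_mul]
    exact mul_le_mul_of_nonneg_right (by linarith) (weight_pos D k).le

/-- Multiplication by a transfer function on the energy-momentum side. -/
def transfer (P : MvPolynomial (Fin n × Fin (s + 1)) ℝ) (f : 𝓢(Cfg s n, ℂ)) : 𝓢(Cfg s n, ℂ) :=
  SchwartzMap.smulLeftCLM ℂ (polyFun P) (minkFourier s n f)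

theorem transfer_apply (P : MvPolynomial (Fin n × Fin (s + 1)) ℝ) (f : 𝓢(Cfg s n, ℂ))
    (k : Cfg s n) : transfer P f k = polyFun P k * minkFourier s n f k := by
  rw [transfer, SchwartzMap.smulLeftCLM_apply_apply (polyFun_hasTemperateGrowth P), smul_eq_mul]

theorem exists_hasDecay_transfer (L : ℕ) {D : ℕ} {P : MvPolynomial (Fin n × Fin (s + 1)) ℝ}
    (hP : ∀ l, ∀ e ∈ P.support, ∑ μ, e (l, μ) ≤ D) : ∃ C : ℝ, 0 ≤ C ∧ ∀ f : 𝓢(Cfg s n, ℂ),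
      HasDecay L (C * schwartzNorm s n (2 * (L + D)) (2 * (s + 1) + 1) f) (transfer P f) := by
  obtain ⟨C₁, hC₁⟩ := exists_polyFun_bound hP
  obtain ⟨C₂, hC₂, h⟩ := exists_hasDecay_minkFourier s n (L + D)
  have hC₁0 : 0 ≤ C₁ :=
    nonneg_of_mul_nonneg_left ((norm_nonneg _).trans (hC₁ 0).1) (weight_pos D 0)
  refine ⟨2 * C₁ * C₂, by positivity, fun f => ?_⟩
  have h1 := ((h f).mono (by omega : L + D ≤ 2 * (L + D))).mul
    ((polyFun_hasTemperateGrowth P).1.differentiable (by simp))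
    (fun k => (hC₁ k).1) fun k => (hC₁ k).2
  rw [mul_assoc (2 * C₁)]
  convert h1 using 1
  funext k
  exact transfer_apply P f k

end Transfer

/-! ### Continuity in the topology `γ` -/

section Gamma

variable {s : ℕ}

theorem ExtFunctional.eval_lof (F : ExtFunctional s) (n : ℕ)
    (g : (Fin n → Label) → 𝓢(Cfg s n, ℂ)) :
    F.eval (DirectSum.lof ℂ ℕ (fun n => (Fin n → Label) → 𝓢(Cfg s n, ℂ)) n g) =
      ∑ a, F n a (g a) := by
  rw [ExtFunctional.eval, DirectSum.toModule_lof, LinearMap.sum_apply]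
  rfl

/-- Bounds of a fixed order, with constants that may depend on the number of arguments, imply
continuity in the topology `γ`: the topology induced by the functional belongs to the family which
defines the direct sum topology. -/
theorem ExtFunctional.isGammaContinuous_of_bound {F : ExtFunctional s} (K L : ℕ)
    (h : ∀ n, ∃ C : ℝ, 0 ≤ C ∧ ∀ a f, ‖F n a f‖ ≤ C * schwartzNorm s n K L f) :
    F.IsGammaContinuous := by
  have hle : gamma s ≤ TopologicalSpace.induced F.eval inferInstance := by
    refine (iInf₂_le K L).trans (sInf_le ⟨topologicalAddGroup_induced F.eval,
      continuousSMul_induced F.eval, LocallyConvexSpace.induced (F.eval.restrictScalars ℝ),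
      fun n => ?_⟩)
    refine continuous_induced_rng.2 ?_
    obtain ⟨C, hC0, hC⟩ := h n
    let p := extSchwartzNorm s n K L
    let _ : SeminormedAddCommGroup ((Fin n → Label) → 𝓢(Cfg s n, ℂ)) := p.toSeminormedAddCommGroup
    let T : ((Fin n → Label) → 𝓢(Cfg s n, ℂ)) →+ ℂ :=
      (F.eval ∘ₗ DirectSum.lof ℂ ℕ (fun n => (Fin n → Label) → 𝓢(Cfg s n, ℂ)) n).toAddMonoidHom
    refine AddMonoidHomClass.continuous_of_bound T (Fintype.card (Fin n → Label) * C) fun g => ?_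
    have hT : T g = ∑ a, F n a (g a) := F.eval_lof n g
    have hn : ‖g‖ = p g := rfl
    rw [hT, hn]
    refine (norm_sum_le _ _).trans ?_
    have h1 := Finset.sum_le_card_nsmul (Finset.univ : Finset (Fin n → Label))
      (fun a => ‖F n a (g a)‖) (C * p g) fun a _ => by
        refine (hC a (g a)).trans (mul_le_mul_of_nonneg_left ?_ hC0)
        exact Seminorm.le_finset_sup_apply
          (p := fun a : Fin n → Label => (schwartzNorm s n K L).comp (LinearMap.proj a))
          (Finset.mem_univ a)
    rw [nsmul_eq_mul, Finset.card_univ, ← mul_assoc] at h1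
    exact h1
  exact continuous_le_dom hle continuous_induced_dom

end Gamma

/-! ### Existence and invariance of the functionals -/

section Functionals

variable {s : ℕ} {m m₀ : ℝ} {ρ : ℝ → ℝ}

/-- The functional `F^G` exists, with bounds whose order does not depend on the number of
arguments. -/
theorem exists_structureFormFactor (hs : 2 ≤ s) (hm : 0 < m) (hm₀ : 0 < m₀)
    (hρ : IsSpectralDensity m₀ ρ) :
    ∃ F : ExtFunctional s, IsStructureFormFactor m m₀ ρ F ∧ ∃ L : ℕ, ∀ n, ∃ C : ℝ, 0 ≤ C ∧
      ∀ a (f : 𝓢(Cfg s n, ℂ)) (A : ℝ), HasDecay L A f → ‖F n a f‖ ≤ C * A := by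
  obtain ⟨T₂, L₂, C₂, hT₂, hb₂⟩ := exists_twoPoint s hm
  obtain ⟨T₂', L₂', C₂', hT₂', hb₂'⟩ := exists_fullTwoPoint s hm hm₀ hρ
  obtain ⟨L₃, h₃⟩ := exists_isShellProduct (s := s) hs hm
  choose T C hT hb using h₃
  let F : ExtFunctional s := fun n => match n with
    | 0 => fun _ => 0
    | 1 => fun _ => 0
    | 2 => fun a => if a 0 = .loc ∧ a 1 = .loc then T₂' else T₂
    | n + 3 => fun a => ∑ j, T (n + 3) (by omega) j (a j)
  refine ⟨F, ⟨fun _ => rfl, fun _ => rfl, fun a ha f => ?_, fun a ha f => ?_, fun n hn a => ?_⟩,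
    max L₂ (max L₂' L₃), fun n => ?_⟩
  · have h : F 2 a = T₂' := if_pos ha
    rw [h, hT₂']
  · have h : F 2 a = T₂ := if_neg ha
    rw [h, hT₂]
  · obtain ⟨n, rfl⟩ := Nat.exists_eq_add_of_le' hn
    exact ⟨fun j => T (n + 3) (by omega) j (a j), fun j => hT _ _ j (a j), rfl⟩
  · rcases n with - | - | - | n
    · exact ⟨0, le_rfl, fun a f A _ => by simp [F]⟩
    · exact ⟨0, le_rfl, fun a f A _ => by simp [F]⟩
    · refine ⟨|C₂| + |C₂'|, by positivity, fun a f A hf => ?_⟩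
      have hA := hf.nonneg
      have h1 := (hb₂ f A (hf.mono (le_max_left _ _))).trans
        (mul_le_mul_of_nonneg_right (le_abs_self C₂) hA)
      have h2 := (hb₂' f A (hf.mono ((le_max_left _ _).trans (le_max_right _ _)))).trans
        (mul_le_mul_of_nonneg_right (le_abs_self C₂') hA)
      have h3 := mul_nonneg (abs_nonneg C₂) hA
      have h4 := mul_nonneg (abs_nonneg C₂') hA
      rw [add_mul]
      by_cases ha : a 0 = .loc ∧ a 1 = .loc
      · have h : F 2 a = T₂' := if_pos ha
        rw [h]
        linarith
      · have h : F 2 a = T₂ := if_neg ha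
        rw [h]
        linarith
    · refine ⟨∑ j, |C (n + 3) (by omega) j|, Finset.sum_nonneg fun _ _ => abs_nonneg _,
        fun a f A hf => ?_⟩
      have hA := hf.nonneg
      have h : F (n + 3) a f = ∑ j, T (n + 3) (by omega) j (a j) f := by
        change (∑ j, T (n + 3) (by omega) j (a j) : 𝓢'(Cfg s (n + 3), ℂ)) f = _
        simp
      rw [h, Finset.sum_mul]
      refine (norm_sum_le _ _).trans (Finset.sum_le_sum fun j _ => ?_)
      exact (hb _ _ j (a j) f A (hf.mono ((le_max_right _ _).trans (le_max_right _ _)))).trans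
        (mul_le_mul_of_nonneg_right (le_abs_self _) hA)

theorem IsStructureFormFactor.isStructureFunctional {F : ExtFunctional s}
    (hF : IsStructureFormFactor m m₀ ρ F) :
    IsStructureFunctional m m₀ ρ fun n => F n fun _ => .loc :=
  ⟨hF.zero _, hF.one _, hF.two_loc _ ⟨rfl, rfl⟩, fun n hn => hF.three_le n hn _⟩

theorem transfer_poincare {n : ℕ} {P : MvPolynomial (Fin n × Fin (s + 1)) ℝ}
    {Λ : (Fin (s + 1) → ℝ) ≃ₗ[ℝ] (Fin (s + 1) → ℝ)}
    (hP : ∀ k : Cfg s n, polyFun P (ofSlots fun l => Λ (slot k l)) = polyFun P k)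
    (hΛ : IsProperOrthochronous Λ) (v : Fin (s + 1) → ℝ) (f : 𝓢(Cfg s n, ℂ)) {k : Cfg s n}
    (hk : ∑ l, slot k l = 0) :
    transfer P (poincare n Λ v f) (diagEquiv n Λ k) = transfer P f k := by
  rw [transfer_apply, transfer_apply, minkFourier_poincare_of_sum_eq_zero hΛ v f hk]
  congr 1
  exact hP k

theorem IsStructureFormFactor.isPoincareInvariant (hm : 0 < m) (hm₀ : 0 < m₀)
    {F : ExtFunctional s} (hF : IsStructureFormFactor m m₀ ρ F)
    {M : ∀ n : ℕ, MvPolynomial (Fin n × Fin (s + 1)) ℝ} (hM : IsTransferSequence M) :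
    ExtFunctional.IsPoincareInvariant fun n a => invFourier (dotExt M F n a) := by
  intro Λ v hΛ n a f
  change F n a (transfer (M n) (poincare n Λ v f)) = F n a (transfer (M n) f)
  have h := fun {k} => transfer_poincare (k := k) (hM.lorentz n Λ hΛ.1) hΛ v f
  rcases n with - | - | - | n
  · simp [hF.zero a]
  · simp [hF.one a]
  · have h2 := fun z => (h (sum_slot_pairCfg z)).symm
    by_cases ha : a 0 = .loc ∧ a 1 = .loc
    · rw [hF.two_loc a ha, hF.two_loc a ha]
      exact (fullTwoPoint_lorentz hm hm₀ hΛ h2).symm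
    · rw [hF.two_other a ha, hF.two_other a ha]
      exact (twoPoint_lorentz hm hΛ fun p => h2 (m, p)).symm
  · obtain ⟨T, hT, hFT⟩ := hF.three_le (n + 3) (by omega) a
    have hsum : ∀ g, F (n + 3) a g = ∑ j, T j g := fun g => by
      rw [hFT]
      simp
    rw [hsum, hsum]
    exact Finset.sum_congr rfl fun j _ =>
      ((hT j).lorentz hm hΛ fun p => (h (sum_slot_onShellCfg j p)).symm).symm

/-- The essential hypotheses are that `L` does not depend on `n` and that the degrees of the transfer
functions are bounded in each argument. -/
theorem isGammaContinuous_invFourier_dotExt {F : ExtFunctional s} {L : ℕ}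
    (hF : ∀ n, ∃ C : ℝ, 0 ≤ C ∧
      ∀ a (f : 𝓢(Cfg s n, ℂ)) (A : ℝ), HasDecay L A f → ‖F n a f‖ ≤ C * A)
    {M : ∀ n : ℕ, MvPolynomial (Fin n × Fin (s + 1)) ℝ} (hM : IsTransferSequence M) :
    ExtFunctional.IsGammaContinuous fun n a => invFourier (dotExt M F n a) := by
  obtain ⟨D, hD⟩ := hM.degree
  refine ExtFunctional.isGammaContinuous_of_bound (2 * (L + D)) (2 * (s + 1) + 1) fun n => ?_
  obtain ⟨C₁, hC₁, h₁⟩ := hF n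
  obtain ⟨C₂, hC₂, h₂⟩ := exists_hasDecay_transfer (s := s) L (hD n)
  refine ⟨C₁ * C₂, by positivity, fun a f => ?_⟩
  rw [mul_assoc]
  exact h₁ a _ _ (h₂ f)

end Functionals

/-! ### The iterated limits -/

section FormFactors

variable {s n : ℕ} {m m₀ : ℝ} {ρ φ : ℝ → ℝ}

/-- Iterated limits from limits in one parameter at a time: `Φ S` is the function which is left
after the parameters in `S` have tended to infinity. -/
theorem hasIteratedLimit_of_family {X : Type*} [TopologicalSpace X]
    {Φ : Finset (Fin n) → (Fin n → ℝ) → X} {x : X}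
    (hΦ : ∀ S, ∀ i ∉ S, ∀ t,
      Tendsto (fun u => Φ S (Function.update t i u)) atTop (𝓝 (Φ (insert i S) t)))
    (hx : ∀ t, Φ Finset.univ t = x) (σ : Equiv.Perm (Fin n)) :
    HasIteratedLimit (List.ofFn σ) (Φ ∅) x := by
  have h : ∀ (is : List (Fin n)) (S : Finset (Fin n)), is.Nodup → (∀ i, i ∈ is ↔ i ∉ S) →
      HasIteratedLimit is (Φ S) x := fun is => by
    induction is with
    | nil =>
      intro S _ hS t
      have : S = Finset.univ := Finset.eq_univ_iff_forall.2 fun i => by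
        by_contra hi
        exact List.not_mem_nil ((hS i).2 hi)
      rw [this, hx]
    | cons i is ih =>
      intro S hnd hS
      rw [List.nodup_cons] at hnd
      refine ⟨Φ (insert i S), hΦ S i ((hS i).1 List.mem_cons_self), ih _ hnd.2 fun j => ?_⟩
      have hj := hS j
      rw [List.mem_cons] at hj
      rw [Finset.mem_insert, not_or, ← hj]
      constructor
      · intro h
        exact ⟨fun e => hnd.1 (e ▸ h), Or.inr h⟩
      · rintro ⟨h1, h2 | h2⟩
        · exact absurd h2 h1
        · exact h2
  exact h _ ∅ (List.nodup_ofFn.2 σ.injective) fun i =>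
    ⟨fun _ => Finset.notMem_empty i, fun _ => (List.mem_ofFn' _ _).2 ⟨σ.symm i, by simp⟩⟩

theorem transfer_waveOperator (hm : 0 < m) (hφ : IsShellCutoff m φ)
    (P : MvPolynomial (Fin n × Fin (s + 1)) ℝ) (a : Fin n → Label) (t : Fin n → ℝ)
    (f : 𝓢(Cfg s n, ℂ)) (k : Cfg s n) : transfer P (waveOperator m φ a t f) k =
      (∏ l, chi m φ (t l) (a l) (slot k l)) * transfer P f k := by
  rw [transfer_apply, transfer_apply, minkFourier_waveOperator hm hφ]
  ring

/-- On the mass shells the wave operators act in the recoil momentum only. -/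
theorem transfer_waveOperator_onShellCfg (hm : 0 < m) (hφ : IsShellCutoff m φ)
    (P : MvPolynomial (Fin n × Fin (s + 1)) ℝ) (a : Fin n → Label) (t : Fin n → ℝ)
    (f : 𝓢(Cfg s n, ℂ)) (j : Fin n) (p : {l : Fin n // l ≠ j} → EuclideanSpace ℝ (Fin s)) :
    transfer P (waveOperator m φ a t f) (onShellCfg m j p) =
      chi m φ (t j) (a j) (recoil m j p) * transfer P f (onShellCfg m j p) := by
  rw [transfer_waveOperator hm hφ, ← Finset.mul_prod_erase _ _ (Finset.mem_univ j),
    slot_onShellCfg_self, Finset.prod_eq_one fun l hl => ?_, mul_one]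
  have hlj := Finset.ne_of_mem_erase hl
  rw [slot_onShellCfg_ne j p ⟨l, hlj⟩]
  exact chi_shellPoint hm hφ _ _ (shellSign_eq j ⟨l, hlj⟩) _

theorem IsShellProduct.congr {j : Fin n} {a : Label} {T : 𝓢'(Cfg s n, ℂ)}
    (hT : IsShellProduct m j a T) {f g : 𝓢(Cfg s n, ℂ)}
    (hfg : ∀ p, f (onShellCfg m j p) = g (onShellCfg m j p)) : T f = T g := by
  refine tendsto_nhds_unique (hT f) ((hT g).congr fun ε => ?_)
  simp only [hfg]

theorem hasIteratedLimit_shellProduct (hs : 2 ≤ s) (hm : 0 < m) (hφ : IsShellCutoff m φ)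
    (hn : 3 ≤ n) (P : MvPolynomial (Fin n × Fin (s + 1)) ℝ) (a : Fin n → Label)
    {T T' : Fin n → 𝓢'(Cfg s n, ℂ)} (hT : ∀ j, IsShellProduct m j .loc (T j))
    (hT' : ∀ j, IsShellProduct m j (a j) (T' j)) (σ : Equiv.Perm (Fin n)) :
    HasIteratedLimit (List.ofFn σ)
      (fun t => PointwiseConvergenceCLM.precomp ℂ (waveOperator m φ a t)
        (invFourier (TemperedDistribution.smulLeftCLM ℂ (polyFun P) (∑ j, T j))))
      (invFourier (TemperedDistribution.smulLeftCLM ℂ (polyFun P) (∑ j, T' j))) := by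
  have hsum : ∀ (Q : Fin n → 𝓢'(Cfg s n, ℂ)) f, (∑ j, Q j) f = ∑ j, Q j f := fun Q f => by simp
  have h := hasIteratedLimit_of_family (n := n)
    (Φ := fun S t => ∑ j, if j ∈ S then
        invFourier (TemperedDistribution.smulLeftCLM ℂ (polyFun P) (T' j)) else
        PointwiseConvergenceCLM.precomp ℂ (waveOperator m φ a t)
          (invFourier (TemperedDistribution.smulLeftCLM ℂ (polyFun P) (T j))))
    (x := invFourier (TemperedDistribution.smulLeftCLM ℂ (polyFun P) (∑ j, T' j)))
    (fun S i hi t => ?_) (fun t => ?_) σ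
  · convert h using 2 with t
    ext f
    change (∑ j, T j) (transfer P (waveOperator m φ a t f)) = _
    simp only [Finset.notMem_empty, if_false, hsum]
    rfl
  · refine tendsto_finsetSum _ fun j _ => ?_
    by_cases hj : j ∈ S
    · simp only [hj, if_true, Finset.mem_insert_of_mem hj]
      exact tendsto_const_nhds
    · simp only [hj, if_false]
      rw [PointwiseConvergenceCLM.tendsto_iff_forall_tendsto]
      intro f
      change Tendsto (fun u => T j (transfer P (waveOperator m φ a (Function.update t i u) f)))
        atTop _
      by_cases hij : j = i
      · subst hij
        rw [if_pos (Finset.mem_insert_self _ _)]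
        refine (hT j).tendsto_chi hs hm hφ hn (hT' j) (transfer P f) _ fun u p => ?_
        rw [transfer_waveOperator_onShellCfg hm hφ, Function.update_self]
      · rw [if_neg (by rw [Finset.mem_insert, not_or]; exact ⟨hij, hj⟩)]
        refine tendsto_const_nhds.congr fun u => (hT j).congr
          (f := transfer P (waveOperator m φ a t f)) fun p => ?_
        rw [transfer_waveOperator_onShellCfg hm hφ, transfer_waveOperator_onShellCfg hm hφ,
          Function.update_of_ne hij]
  · ext f
    change _ = (∑ j, T' j) (transfer P f)
    simp only [Finset.mem_univ, if_true, hsum]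
    rfl

theorem transfer_one (f : 𝓢(Cfg s n, ℂ)) : transfer 1 f = minkFourier s n f := by
  ext k
  rw [transfer_apply, polyFun, map_one, Complex.ofReal_one, one_mul]

/-- The label `loc` carries no wave operator. -/
theorem waveOperator_update_of_loc (a : Fin n → Label) {i : Fin n} (hi : a i = .loc)
    (t : Fin n → ℝ) (u : ℝ) :
    waveOperator (s := s) m φ a (Function.update t i u) = waveOperator m φ a t := by
  have h : (fun k : Cfg s n => ∏ l, chi m φ (Function.update t i u l) (a l) (slot k l)) =
      fun k : Cfg s n => ∏ l, chi m φ (t l) (a l) (slot k l) := by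
    funext k
    refine Finset.prod_congr rfl fun l _ => ?_
    by_cases hl : l = i
    · subst hl
      rw [hi]
      rfl
    · rw [Function.update_of_ne hl]
  rw [waveOperator, h, waveOperator]

/-- One step of the limit of the two-point functional: the first time parameter of an in- or
outgoing argument which tends to infinity removes the spectral part. -/
theorem tendsto_fullTwoPoint_waveOperator (hm : 0 < m) (hm₀ : 0 < m₀)
    (hρ : IsSpectralDensity m₀ ρ) (hφ : IsShellCutoff m φ) (a : Fin 2 → Label) {i : Fin 2}
    (hi : a i ≠ .loc) (t : Fin 2 → ℝ) (f : 𝓢(Cfg s 2, ℂ)) :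
    Tendsto (fun u => fullTwoPoint m m₀ ρ
      (minkFourier s 2 (waveOperator m φ a (Function.update t i u) f))) atTop
      (𝓝 (twoPoint m (minkFourier s 2 f))) := by
  obtain ⟨σ, hσ, hchi⟩ := exists_chi_pairCfg (s := s) m φ i hi
  have h := tendsto_fullTwoPoint hm hm₀ hρ hσ
    (minkFourier s 2 (waveOperator m φ a (Function.update t i 0) f))
    (fun u => minkFourier s 2 (waveOperator m φ a (Function.update t i u) f)) fun u z hz => by
      have e : ∀ u, ∏ l, chi m φ (Function.update t i u l) (a l) (slot (pairCfg z) l) =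
          chi m φ u (a i) (slot (pairCfg z) i) *
            ∏ l ∈ Finset.univ.erase i, chi m φ (t l) (a l) (slot (pairCfg z) l) := fun u => by
        rw [← Finset.mul_prod_erase _ _ (Finset.mem_univ i), Function.update_self]
        congr 1
        exact Finset.prod_congr rfl fun l hl => by
          rw [Function.update_of_ne (Finset.ne_of_mem_erase hl)]
      rw [minkFourier_waveOperator hm hφ, minkFourier_waveOperator hm hφ, e, e, hchi z hz u]
      ring
  have h2 : twoPoint m (minkFourier s 2 (waveOperator m φ a (Function.update t i 0) f)) =
      twoPoint m (minkFourier s 2 f) := by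
    rw [twoPoint_eq, twoPoint_eq]
    refine integral_congr_ae (Eventually.of_forall fun p => ?_)
    have h0 : ∀ l, chi m φ (Function.update t i 0 l) (a l) (slot (pairCfg (m, p)) l) = 1 :=
      fun l => by
        fin_cases l
        · rw [Fin.zero_eta, slot_pairCfg_zero]
          exact chi_shellPoint hm hφ _ _ (Or.inr rfl) p
        · rw [Fin.mk_one, slot_pairCfg_one, neg_shellPoint]
          exact chi_shellPoint hm hφ _ _ (Or.inl (neg_neg 1)) (-p)
    simp only [pairKernel]
    rw [minkFourier_waveOperator hm hφ, Finset.prod_congr rfl fun l _ => h0 l,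
      Finset.prod_const_one, one_mul]
  rwa [h2] at h

theorem hasIteratedLimit_twoPoint (hm : 0 < m) (hm₀ : 0 < m₀)
    (hρ : IsSpectralDensity m₀ ρ) (hφ : IsShellCutoff m φ) (a : Fin 2 → Label)
    {T T' : 𝓢'(Cfg s 2, ℂ)} (hT : ∀ f, T f = fullTwoPoint m m₀ ρ f)
    (hloc : a 0 = .loc ∧ a 1 = .loc → ∀ f, T' f = fullTwoPoint m m₀ ρ f)
    (hother : ¬(a 0 = .loc ∧ a 1 = .loc) → ∀ f, T' f = twoPoint m f)
    (σ : Equiv.Perm (Fin 2)) :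
    HasIteratedLimit (List.ofFn σ)
      (fun t => PointwiseConvergenceCLM.precomp ℂ (waveOperator m φ a t)
        (invFourier (TemperedDistribution.smulLeftCLM ℂ (polyFun 1) T)))
      (invFourier (TemperedDistribution.smulLeftCLM ℂ (polyFun 1) T')) := by
  classical
  have h := hasIteratedLimit_of_family (n := 2)
    (Φ := fun S t => if ∃ i ∈ S, a i ≠ .loc then
        invFourier (TemperedDistribution.smulLeftCLM ℂ (polyFun 1) T') else
        PointwiseConvergenceCLM.precomp ℂ (waveOperator m φ a t)
          (invFourier (TemperedDistribution.smulLeftCLM ℂ (polyFun 1) T)))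
    (x := invFourier (TemperedDistribution.smulLeftCLM ℂ (polyFun 1) T'))
    (fun S i hi t => ?_) (fun t => ?_) σ
  · simpa using h
  · by_cases hS : ∃ i ∈ S, a i ≠ .loc
    · have hS' : ∃ j ∈ insert i S, a j ≠ .loc := by
        obtain ⟨j, hj, hja⟩ := hS
        exact ⟨j, Finset.mem_insert_of_mem hj, hja⟩
      simp only [if_pos hS, if_pos hS']
      exact tendsto_const_nhds
    · by_cases hai : a i = .loc
      · have hS' : ¬∃ j ∈ insert i S, a j ≠ .loc := by
          rintro ⟨j, hj, hja⟩
          rcases Finset.mem_insert.1 hj with rfl | hj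
          · exact hja hai
          · exact hS ⟨j, hj, hja⟩
        simp only [if_neg hS, if_neg hS', waveOperator_update_of_loc a hai]
        exact tendsto_const_nhds
      · have hS' : ∃ j ∈ insert i S, a j ≠ .loc := ⟨i, Finset.mem_insert_self _ _, hai⟩
        simp only [if_neg hS, if_pos hS']
        rw [PointwiseConvergenceCLM.tendsto_iff_forall_tendsto]
        intro f
        change Tendsto (fun u => T (transfer 1 (waveOperator m φ a (Function.update t i u) f)))
          atTop (𝓝 (T' (transfer 1 f)))
        have hne : ¬(a 0 = .loc ∧ a 1 = .loc) := fun h => hai (by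
          fin_cases i
          · exact h.1
          · exact h.2)
        simp only [transfer_one, hT, hother hne]
        exact tendsto_fullTwoPoint_waveOperator hm hm₀ hρ hφ a hai t f
  · by_cases hne : a 0 = .loc ∧ a 1 = .loc
    · have hS : ¬∃ i ∈ (Finset.univ : Finset (Fin 2)), a i ≠ .loc := by
        rintro ⟨i, -, hi⟩
        fin_cases i
        · exact hi hne.1
        · exact hi hne.2
      simp only [if_neg hS]
      ext f
      change T (transfer 1 (waveOperator m φ a t f)) = T' (transfer 1 f)
      rw [hT, hloc hne]
      congr 1
      ext k
      rw [transfer_waveOperator hm hφ, Fin.prod_univ_two, hne.1, hne.2]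
      simp [chi]
    · have hS : ∃ i ∈ (Finset.univ : Finset (Fin 2)), a i ≠ .loc := by
        by_contra hc
        push Not at hc
        exact hne ⟨hc 0 (Finset.mem_univ _), hc 1 (Finset.mem_univ _)⟩
      simp only [if_pos hS]

theorem hasIteratedLimit_const {X : Type*} [TopologicalSpace X] (x : X)
    (σ : Equiv.Perm (Fin n)) : HasIteratedLimit (List.ofFn σ) (fun _ => x) x :=
  hasIteratedLimit_of_family (Φ := fun _ _ => x) (fun _ _ _ _ => tendsto_const_nhds)
    (fun _ => rfl) σ

theorem IsStructureFormFactor.isFormFactor (hs : 2 ≤ s) (hm : 0 < m) (hm₀ : 0 < m₀)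
    (hρ : IsSpectralDensity m₀ ρ) (hφ : IsShellCutoff m φ)
    {F : ExtFunctional s} (hF : IsStructureFormFactor m m₀ ρ F) {G : Functional s}
    (hG : IsStructureFunctional m m₀ ρ G)
    {M : ∀ n : ℕ, MvPolynomial (Fin n × Fin (s + 1)) ℝ} (hM : IsTransferSequence M) :
    IsFormFactor m φ (fun n => invFourier (dot M G n))
      fun n a => invFourier (dotExt M F n a) := by
  intro n a σ
  rcases n with - | - | - | n
  · simp only [dot, dotExt, hF.zero a, hG.zero, invFourier, map_zero]
    exact hasIteratedLimit_const _ σ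
  · simp only [dot, dotExt, hF.one a, hG.one, invFourier, map_zero]
    exact hasIteratedLimit_const _ σ
  · have h2 : M 2 = 1 := hM.two
    simp only [dot, dotExt]
    change HasIteratedLimit _ (fun t => PointwiseConvergenceCLM.precomp ℂ (waveOperator m φ a t)
      (invFourier (TemperedDistribution.smulLeftCLM ℂ (polyFun (M 2)) (G 2))))
      (invFourier (TemperedDistribution.smulLeftCLM ℂ (polyFun (M 2)) (F 2 a)))
    rw [h2]
    exact hasIteratedLimit_twoPoint hm hm₀ hρ hφ a hG.two (hF.two_loc a) (hF.two_other a) σ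
  · obtain ⟨T, hT, hGT⟩ := hG.three_le (n + 3) (by omega)
    obtain ⟨T', hT', hFT⟩ := hF.three_le (n + 3) (by omega) a
    simp only [dot, dotExt, hGT, hFT]
    exact hasIteratedLimit_shellProduct hs hm hφ (by omega) _ a hT hT' σ

end FormFactors

end FormFactor

end

theorem corollary4p10 {s : ℕ} (hs : 2 ≤ s) {m m₀ : ℝ} (hm : 0 < m) (hm₀ : 0 < m₀)
    {ρ : ℝ → ℝ} (hρ : FormFactor.IsSpectralDensity m₀ ρ)
    {M : ∀ n : ℕ, MvPolynomial (Fin n × Fin (s + 1)) ℝ}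
    (hM : FormFactor.IsTransferSequence M) :
    ∃ (G : FormFactor.Functional s) (FG : FormFactor.ExtFunctional s),
      FormFactor.IsStructureFunctional m m₀ ρ G ∧
      FormFactor.IsStructureFormFactor m m₀ ρ FG ∧
      ∃ (WT : FormFactor.Functional s) (FT : FormFactor.ExtFunctional s),
        (∀ n, WT n = FormFactor.invFourier (FormFactor.dot M G n)) ∧
        (∀ n a, FT n a = FormFactor.invFourier (FormFactor.dotExt M FG n a)) ∧
        (∀ φ : ℝ → ℝ, FormFactor.IsShellCutoff m φ → FormFactor.IsFormFactor m φ WT FT) ∧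
        FT.IsPoincareInvariant ∧
        FT.IsGammaContinuous := by
  obtain ⟨F, hF, L, hL⟩ := FormFactor.exists_structureFormFactor (s := s) hs hm hm₀ hρ
  exact ⟨_, F, hF.isStructureFunctional, hF, _, _, fun _ => rfl, fun _ _ => rfl,
    fun φ hφ => hF.isFormFactor hs hm hm₀ hρ hφ hF.isStructureFunctional hM,
    hF.isPoincareInvariant hm hm₀ hM,
    FormFactor.isGammaContinuous_invFourier_dotExt hL hM⟩
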